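/- Let $q$ be a real-valued function on $(0,\infty)$ with $\int_0^\infty x|q(x)|\,dx<\infty$ (class $L_{1,1}$). For $\operatorname{Im}k\ge 0$ let $f(x,k)$, $x\ge 0$, be the Jost solution: $-f''+qf=k^2f$ on $(0,\infty)$ ($f$ differentiable, $f'$ locally absolutely continuous, equation a.e.), $f(\cdot,k)$ continuous on $[0,\infty)$, and $f(x,k)=e^{ikx}(1+o(1))$ as $x\to\infty$. Put $f(k)=f(0,k)$. The *scattering data* of $q$ are $\mathcal S=\{S(k),k_j,s_j,1\le j\le J\}$, where $S(k)=f(-k)/f(k)$ for real $k\neq0$ and $S(0)=\lim_{k\to0}S(k)$; $ik_1,\dots,ik_J$ with $0<k_1<\dots<k_J$ are the zeros of $f(k)$ in $\operatorname{Im}k>0$; and $s_j=\big(\int_0^\infty|f(x,ik_j)|^2dx\big)^{-1}>0$. Further let, for $x\ne 0$, $$F(x)=F_s(x)+F_d(x),\qquad F_s(x)=\lim_{R\to\infty}\frac1{2\pi}\int_{-R}^{R}[1-S(k)]e^{ikx}\,dk,\qquad F_d(x)=\sum_{j=1}^Js_je^{-k_jx}.$$ Let $\Delta=\{(x,y):0\le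 x\le y,\ y>0\}$. The *transformation kernel* of $q$ is the continuous function $A:\Delta\to\mathbb R$, extended by $0$ off $\Delta$, with $A(x,\cdot)\in L^1(x,\infty)$ for $x\ge0$ and $$f(x,k)=e^{ikx}+\int_x^\infty A(x,y)e^{iky}\,dy\qquad(x\ge0,\ \operatorname{Im}k\ge0).\tag{1}$$ **Theorem.** For every $q\in L_{1,1}$ the Jost solutions, the scattering data $\mathcal S$ (in particular with $J<\infty$) and the transformation kernel $A$ exist and are unique, and all steps of the scheme $\mathcal S\Rightarrow F\Rightarrow A\Rightarrow q$ are reversible, in the following sense. 1. *($\mathcal S\Leftrightarrow F$.)* The limit defining $F_s(x)$ exists and is real for every $x\neq0$. Conversely $\mathcal S$ is recovered from $F$: for $m=J,J-1,\dots,1$, with $R_m(x)=F(x)-\sum_{j>m}s_je^{-k_jx}$, $$k_m=\lim_{x\to-\infty}\frac{\log R_m(x)}{-x},\qquad s_m=\lim_{x\to-\infty}R_m(x)e^{k_mx};$$ moreover $F-F_d\to0$ as $x\to-\infty$, $F-F_d\in L^1(\mathbb R)$, and $1-S(k)=\int_{-\infty}^\infty (F(x)-F_d(x))e^{-ikx}\,dx$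 for all $k\in\mathbb R$. 2. *($F\Leftrightarrow A$.)* For all $(x,y)\in\Delta$, $$A(x,y)+F(x+y)+\int_x^\infty A(x,s)F(s+y)\,ds=0,\tag{2}$$ and for each $x\ge0$, $A(x,\cdot)$ is the only solution in $L^1(x,\infty)$ of (2) for a.e. $y>x$. Conversely $F$ is recovered from $A$: $F\in L^1(0,\infty)$, and $F|_{(0,\infty)}$ is the only function in $L^1(0,\infty)$ that satisfies (2), for every $x\ge0$ and a.e. $y>x$, with the given $A$ (a Volterra equation for $F$). Also, all of $\mathcal S$, hence $F$ on the whole line, is recovered from $A$: $\mathcal S$ is the only collection obtained by the definition of the scattering data from the functions given by the right-hand side of (1). 3. *($A\Leftrightarrow q$.)* $q(x)=-2\,\frac{d}{dx}A(x,x)$ for a.e. $x>0$. Conversely $A$ is recovered from $q$: among measurable kernels that vanish off $\Delta$ and are bounded on $\{y\ge\delta\}$ for each $\delta>0$, $A$ is the unique solution of $$B(x,y)=\frac12\int_{\frac{x+y}2}^\infty q(s)\,ds+\frac12\int_x^\infty q(s)\int_{y-s+x}^{y+s-x}B(s,u)\,du\,ds,\qquad (x,y)\in\Delta,$$ and the successive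 approximations of this equation, started from $0$, converge to $A$ uniformly on $\Delta\cap\{y\ge\delta\}$ for each $\delta>0$. Consequently each of the four objects determines the others: if $q,q'\in L_{1,1}$ have the data $(\mathcal S,F,A)$ and $(\mathcal S',F',A')$, then $\mathcal S=\mathcal S'$, $F=F'$ a.e. on $\mathbb R$, $A=A'$, and $q=q'$ a.e. on $(0,\infty)$ are equivalent. -/

import Mathlib

open MeasureTheory Set Filter Topology

/-- The class `L_{1,1}` of real potentials on the half-line: `q` is measurable on `(0, ∞)` and
`∫₀^∞ x |q x| dx < ∞`. (`q` need not be integrable at `0`.) -/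
def IsL11 (q : ℝ → ℝ) : Prop :=
  IntegrableOn (fun x => x * q x) (Ioi 0)

/-- `u` is the Jost solution at energy `k ^ 2`: `u` is continuous on `[0, ∞)`, it satisfies
`-u'' + q u = k ^ 2 u` on `(0, ∞)` (`u` is differentiable, `u'` is locally absolutely continuous and
the equation holds almost everywhere, here written in integrated form), and
`u x = e^{i k x} (1 + o(1))` as `x → ∞`. -/
structure IsJostSolution (q : ℝ → ℝ) (k : ℂ) (u : ℝ → ℂ) : Prop where
  continuousOn : ContinuousOn u (Ici 0)
  equation : ∃ v : ℝ → ℂ, (∀ x : ℝ, 0 < x → HasDerivAt u (v x) x) ∧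
    ∀ a b : ℝ, 0 < a → a ≤ b → v b - v a = ∫ t in a..b, ((q t : ℂ) - k ^ 2) * u t
  asymptotics : Tendsto (fun x : ℝ => Complex.exp (-(Complex.I * k * x)) * u x) atTop (𝓝 1)

/-- The Jost solution `f(x, k)` of the potential `q`, for `x ≥ 0` and `Im k ≥ 0`. -/
noncomputable def jost (q : ℝ → ℝ) (x : ℝ) (k : ℂ) : ℂ :=
  Classical.epsilon (IsJostSolution q k) x

/-- Collections `{S(k), k_j, s_j, 1 ≤ j ≤ J}`. -/
@[ext]
structure ScatteringData where
  S : ℝ → ℂ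
  J : ℕ
  k : Fin J → ℝ
  s : Fin J → ℝ

/-- `D` is the collection of scattering data read off from the solutions `f(x, k)`:
with `f(k) = f(0, k)`, `S(k) = f(-k) / f(k)` (at `k = 0` by continuity), the zeros of `f(k)` in the
open upper half-plane are `i k_1, …, i k_J` with `0 < k_1 < ⋯ < k_J`, and
`1 / s_j = ∫₀^∞ |f(x, i k_j)| ^ 2 dx` is finite and positive. -/
structure IsDataOf (f : ℝ → ℂ → ℂ) (D : ScatteringData) : Prop where
  S_eq : ∀ k : ℝ, k ≠ 0 → D.S k = f 0 (-(k : ℂ)) / f 0 (k : ℂ)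
  S_zero : Tendsto (fun k : ℝ => f 0 (-(k : ℂ)) / f 0 (k : ℂ)) (𝓝[≠] 0) (𝓝 (D.S 0))
  k_pos : ∀ j, 0 < D.k j
  k_strictMono : StrictMono D.k
  zeros_eq : {z : ℂ | 0 < z.im ∧ f 0 z = 0} = range (fun j => Complex.I * (D.k j : ℂ))
  s_pos : ∀ j, 0 < D.s j
  s_eq : ∀ j, D.s j = (∫ x in Ioi (0 : ℝ), ‖f x (Complex.I * (D.k j : ℂ))‖ ^ 2)⁻¹

namespace ScatteringData

/-- The truncated integral `(1 / 2π) ∫_{-R}^{R} (1 - S(k)) e^{i k x} dk`. -/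
noncomputable def truncatedFs (D : ScatteringData) (x R : ℝ) : ℂ :=
  (1 / (2 * (Real.pi : ℂ))) *
    ∫ k in (-R)..R, (1 - D.S k) * Complex.exp (Complex.I * (k : ℂ) * (x : ℂ))

/-- `F_s(x) = (1 / 2π) ∫_{-∞}^{∞} (1 - S(k)) e^{i k x} dk`, an improper integral (in general
`1 - S` is not absolutely integrable). -/
noncomputable def Fs (D : ScatteringData) (x : ℝ) : ℝ :=
  (limUnder atTop (D.truncatedFs x)).re

/-- `F_d(x) = ∑_j s_j e^{-k_j x}`. -/
noncomputable def Fd (D : ScatteringData) (x : ℝ) : ℝ :=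
  ∑ j, D.s j * Real.exp (-(D.k j * x))

/-- `F = F_s + F_d`. -/
noncomputable def F (D : ScatteringData) (x : ℝ) : ℝ :=
  D.Fs x + D.Fd x

/-- What is left of `F` after the terms of index greater than `m` have been subtracted. -/
noncomputable def remainder (D : ScatteringData) (m : Fin D.J) (x : ℝ) : ℝ :=
  D.F x - ∑ j ∈ Finset.Ioi m, D.s j * Real.exp (-(D.k j * x))

end ScatteringData

/-- The region `0 ≤ x ≤ y`, without the corner `(0, 0)` at which the kernels may be unbounded. -/
def kernelDomain : Set (ℝ × ℝ) :=
  {p | 0 ≤ p.1 ∧ p.1 ≤ p.2 ∧ 0 < p.2}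

/-- `e^{i k x} + ∫_x^∞ A(x, y) e^{i k y} dy`. -/
noncomputable def kernelJost (A : ℝ → ℝ → ℝ) (x : ℝ) (k : ℂ) : ℂ :=
  Complex.exp (Complex.I * k * x) +
    ∫ y in Ioi x, (A x y : ℂ) * Complex.exp (Complex.I * k * y)

/-- `A` is the transformation kernel of `q`: a kernel on `0 ≤ x ≤ y` (extended by zero) with
`f(x, k) = e^{i k x} + ∫_x^∞ A(x, y) e^{i k y} dy` for all `x ≥ 0` and `Im k ≥ 0`. -/
structure IsTransformationKernel (q : ℝ → ℝ) (A : ℝ → ℝ → ℝ) : Prop where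
  eq_zero : ∀ x y : ℝ, (x, y) ∉ kernelDomain → A x y = 0
  continuousOn : ContinuousOn (Function.uncurry A) kernelDomain
  integrableOn : ∀ x : ℝ, 0 ≤ x → IntegrableOn (A x) (Ioi x)
  jost_eq : ∀ (x : ℝ) (k : ℂ), 0 ≤ x → 0 ≤ k.im → jost q x k = kernelJost A x k

/-- The left-hand side `a(y) + F(x + y) + ∫_x^∞ a(s) F(s + y) ds` of Marchenko's equation. -/
noncomputable def marchenko (F : ℝ → ℝ) (x : ℝ) (a : ℝ → ℝ) (y : ℝ) : ℝ :=
  a y + F (x + y) + ∫ s in Ioi x, a s * F (s + y)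

open Classical in
/-- The right-hand side of the Volterra-type equation
`B(x, y) = 1/2 ∫_{(x+y)/2}^∞ q(s) ds + 1/2 ∫_x^∞ q(s) ∫_{y-s+x}^{y+s-x} B(s, u) du ds`
for kernels on `0 ≤ x ≤ y` extended by zero. -/
noncomputable def volterraStep (q : ℝ → ℝ) (B : ℝ → ℝ → ℝ) (x y : ℝ) : ℝ :=
  if (x, y) ∈ kernelDomain then
    (1 / 2) * (∫ s in Ioi ((x + y) / 2), q s) +
      (1 / 2) * ∫ s in Ioi x, q s * ∫ u in (y - s + x)..(y + s - x), B s u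
  else 0

/-! The kernel A is the centre of the proof. Its Volterra equation sees q only through the first
moment: the inner interval has length 2(s - x), so in the sup norm weighted by exp(2 ∫_x^∞ t|q(t)|
dt) the integral operator has norm at most 1/2. This gives the fixed point `kern`, the bound |A(x,
y)| ≤ C ∫_{(x+y)/2}^∞ |q|, and q itself from A(x, x) = (1/2) ∫_x^∞ q. Moreover I + A maps a
translate Φ(x + y) to a solution W of the integrated wave equation W_xx - q W = W_yy (`transm_eq`).
For exponentials Φ these are the Jost solutions.

Marchenko's equation is obtained without scattering theory. On the diagonal y = x it is a Volterra
equation for F, solved by `marF`. By `transm_eq` the defect of (2) for `marF` satisfies the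
homogeneous Volterra equation up to a function of x + y. On the diagonal the defect and its Volterra
integral vanish, so that function is zero, and then the defect is zero everywhere (`transm_marF`).
Uniqueness of A for given F needs no positivity: applying I + A to the homogeneous Marchenko
equation leaves a forward Volterra equation (`marchenko_homogeneous`). Uniqueness of F for given A
is a backward Gronwall argument (`marF_unique`).

It remains to see that `marF` is F_s + F_d on (0, ∞). First, 1 - S is the transform of an integrable
function. If f(0) ≠ 0 this is Wiener's lemma. If f(0) = 0, Marchenko's equation at x = 0 yields f(k)
= ik K^(k) with K integrable and ∫ K ≠ 0 (`exceptional`), and the zero cancels in f(-k)/f(k). All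
functions g of k that occur have the further property that k g'(k) is a transform (`IsScaled`),
which makes the improper integral defining F_s converge at every x ≠ 0 (`exists_inversion`).

The relation f(-k) = S(k) f(k) is Marchenko's equation at x = 0 for F_s, up to a null set, so the
difference F_s - `marF` solves a homogeneous equation with kernel A(0, ·). Hence its transform
continues to the upper half-plane as a quotient by f. The zeros of f there are imaginary, simple and
finite in number, by Wronskian identities and the behaviour of f at 0 and at infinity. Liouville's
theorem then leaves a sum of exponentials (`exists_sum_of_homogeneous`), and pairing with the
functions `overlap` shows that its coefficients are -s_j (`IsScattering.coeff_eq`). Finally F_s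
tends to 0 at -∞, so the exponentials can be peeled off one after the other, and the four objects
determine each other in the cycle S, F, A, q. -/

namespace HalfLine

/-- The weight `exp (2 ∫_x^∞ w)` that turns Volterra operators with density `w` into
contractions. -/
noncomputable def weight (w : ℝ → ℝ) (x : ℝ) : ℝ := Real.exp (2 * ∫ s in Ioi x, w s)

/-! ### Weighted norms for Volterra operators -/

section weight
variable {w : ℝ → ℝ} (hw : IntegrableOn w (Ioi 0)) (hw0 : ∀ s, 0 < s → 0 ≤ w s)

theorem tail_eq_sub {E : Type*} [NormedAddCommGroup E] [NormedSpace ℝ E] {f : ℝ → E}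
    (hf : IntegrableOn f (Ioi 0)) {x : ℝ} (hx : 0 ≤ x) :
    ∫ s in Ioi x, f s = (∫ s in Ioi 0, f s) - ∫ s in (0 : ℝ)..x, f s := by
  rw [← intervalIntegral.integral_interval_add_Ioi hf (hf.mono_set (Ioi_subset_Ioi hx))]
  exact (add_sub_cancel_left _ _).symm

theorem intervalIntegrable_of_Ioi {E : Type*} [NormedAddCommGroup E] {f : ℝ → E} {c a b : ℝ}
    (hf : IntegrableOn f (Ioi c)) (ha : c ≤ a) (hb : c ≤ b) :
    IntervalIntegrable f volume a b := by
  rw [intervalIntegrable_iff]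
  exact hf.mono_set fun t ht => lt_of_le_of_lt (le_min ha hb) ht.1

theorem continuousOn_tail {E : Type*} [NormedAddCommGroup E] [NormedSpace ℝ E] {f : ℝ → E} {c : ℝ}
    (hf : IntegrableOn f (Ioi c)) : ContinuousOn (fun x => ∫ s in Ioi x, f s) (Ici c) := by
  have h1 : ContinuousOn (fun x => (∫ s in Ioi c, f s) - ∫ s in c..x, f s) (Ici c) := by
    refine continuousOn_const.sub ?_
    intro x hx
    have h2 : ContinuousOn (fun x => ∫ s in c..x, f s) (uIcc c (x + 1)) :=
      intervalIntegral.continuousOn_primitive_interval'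
        (intervalIntegrable_of_Ioi hf le_rfl (by linarith [mem_Ici.1 hx])) left_mem_uIcc
    rw [uIcc_of_le (by linarith [mem_Ici.1 hx])] at h2
    refine (h2 x ⟨hx, by linarith⟩).mono_of_mem_nhdsWithin ?_
    have : Ici c ∩ Iio (x + 1) ∈ 𝓝[Ici c] x :=
      inter_mem self_mem_nhdsWithin (mem_nhdsWithin_of_mem_nhds (Iio_mem_nhds (by linarith)))
    exact mem_of_superset this fun t ht => ⟨ht.1, ht.2.le⟩
  refine h1.congr fun x hx => ?_
  rw [← intervalIntegral.integral_interval_add_Ioi hf (hf.mono_set (Ioi_subset_Ioi hx))]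
  exact (add_sub_cancel_left _ _).symm

include hw in
theorem continuousOn_weight : ContinuousOn (weight w) (Ici 0) :=
  Real.continuous_exp.comp_continuousOn (continuousOn_const.mul (continuousOn_tail hw))

include hw0 in
theorem one_le_weight {x : ℝ} (hx : 0 ≤ x) : 1 ≤ weight w x :=
  Real.one_le_exp (mul_nonneg zero_le_two
    (setIntegral_nonneg measurableSet_Ioi fun s hs => hw0 s (lt_of_le_of_lt hx hs)))

include hw hw0 in
theorem weight_antitone {x y : ℝ} (hx : 0 ≤ x) (hxy : x ≤ y) : weight w y ≤ weight w x := by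
  refine Real.exp_le_exp.2 (mul_le_mul_of_nonneg_left ?_ zero_le_two)
  refine setIntegral_mono_set (hw.mono_set (Ioi_subset_Ioi hx)) ?_
    (Ioi_subset_Ioi hxy).eventuallyLE
  filter_upwards [ae_restrict_mem measurableSet_Ioi] with s hs using hw0 s (lt_of_le_of_lt hx hs)

theorem weight_pos (x : ℝ) : 0 < weight w x := Real.exp_pos _

include hw hw0 in
theorem integrableOn_mul_weight : IntegrableOn (fun s => w s * weight w s) (Ioi 0) := by
  refine Integrable.mono' (hw.mul_const (weight w 0)) (hw.aestronglyMeasurable.mul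
    (((continuousOn_weight hw).mono Ioi_subset_Ici_self).aestronglyMeasurable
      measurableSet_Ioi)) ?_
  filter_upwards [ae_restrict_mem measurableSet_Ioi] with s hs
  rw [norm_mul, Real.norm_of_nonneg (hw0 s hs), Real.norm_of_nonneg (weight_pos s).le]
  exact mul_le_mul_of_nonneg_left (weight_antitone hw hw0 le_rfl (le_of_lt hs)) (hw0 s hs)

-- The weight W solves W' = -2 w W almost everywhere, so the integral telescopes. The 2 in the
-- exponent of W becomes the factor 1/2 that makes Volterra operators with density w contractions.
include hw hw0 in
theorem integral_mul_weight_le {x : ℝ} (hx : 0 ≤ x) :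
    ∫ s in Ioi x, w s * weight w s ≤ weight w x / 2 := by
  have hi := integrableOn_mul_weight hw hw0
  have key : ∀ b, x ≤ b → ∫ s in x..b, w s * weight w s ≤ weight w x / 2 := by
    intro b hb
    -- Monotonicity takes the place of absolute continuity: the integral of the derivative of a
    -- monotone function is at most its increment, which is all that is needed.
    have hmono : MonotoneOn (fun t => - weight w t) (uIcc x b) := by
      rw [uIcc_of_le hb]
      intro s hs t ht hst
      exact neg_le_neg (weight_antitone hw hw0 (hx.trans hs.1) hst)
    have h1 := hmono.intervalIntegral_deriv_mem_uIcc
    rw [uIcc_of_le (by linarith [weight_antitone hw hw0 hx hb])] at h1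
    have h2 : ∫ s in x..b, deriv (fun t => - weight w t) s
        = ∫ s in x..b, 2 * (w s * weight w s) := by
      refine intervalIntegral.integral_congr_ae ?_
      have hiw : IntervalIntegrable w volume 0 (b + 1) :=
        intervalIntegrable_of_Ioi hw le_rfl (by linarith)
      filter_upwards [hiw.ae_hasDerivAt_integral] with s hs hs'
      rw [uIoc_of_le hb] at hs'
      have hs0 : 0 < s := lt_of_le_of_lt hx hs'.1
      have hd := hs (by rw [uIcc_of_le (by linarith)]; exact ⟨hs0.le, by linarith [hs'.2]⟩) 0
        left_mem_uIcc
      have hd2 : HasDerivAt (weight w) (weight w s * (2 * (0 - w s))) s := by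
        have h3 := (((hasDerivAt_const s (∫ s in Ioi 0, w s)).sub hd).const_mul 2).exp
        have h4 : weight w =ᶠ[𝓝 s] fun x => Real.exp (2 * ((∫ s in Ioi 0, w s) -
            ∫ s in (0 : ℝ)..x, w s)) := by
          filter_upwards [Ioi_mem_nhds hs0] with t ht
          rw [weight, tail_eq_sub hw (le_of_lt ht)]
        have h5 := h3.congr_of_eventuallyEq h4
        exact h5.congr_deriv (by rw [h4.eq_of_nhds]; rfl)
      rw [hd2.fun_neg.deriv]
      ring
    rw [h2, intervalIntegral.integral_const_mul] at h1
    linarith [h1.2, weight_pos (w := w) b]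
  have ht := intervalIntegral_tendsto_integral_Ioi x (hi.mono_set (Ioi_subset_Ioi hx)) tendsto_id
  exact le_of_tendsto ht (eventually_atTop.2 ⟨x, key⟩)

end weight

/-! ### Fubini's theorem on triangles -/

section product
variable {E : Type*} [NormedAddCommGroup E]

/-- Tonelli's criterion, in the form used throughout: an integrable majorant replaces the exact
inner norm integrals. -/
theorem integrable_prod_of_bound {μ ν : Measure ℝ} [SFinite μ] [SFinite ν] {G : ℝ × ℝ → E}
    (hm : AEStronglyMeasurable G (μ.prod ν)) {b : ℝ → ℝ} (hb : Integrable b ν)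
    (h : ∀ᵐ s ∂ν, Integrable (fun t => G (t, s)) μ ∧ ∫ t, ‖G (t, s)‖ ∂μ ≤ b s) :
    Integrable G (μ.prod ν) := by
  rw [integrable_prod_iff' hm]
  refine ⟨h.mono fun s hs => hs.1, ?_⟩
  refine hb.mono' hm.norm.prod_swap.integral_prod_right' ?_
  filter_upwards [h] with s hs
  rw [Real.norm_of_nonneg (integral_nonneg fun _ => norm_nonneg _)]
  exact hs.2

variable [NormedSpace ℝ E]

/-- Interchange of the integrations over the region `a < t < s`. -/
theorem integral_triangle_swap {G : ℝ → ℝ → E} {a : ℝ}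
    (hm : AEStronglyMeasurable (Function.uncurry G)
      ((volume.restrict (Ioi a)).prod (volume.restrict (Ioi a)))) {b : ℝ → ℝ}
    (hb : IntegrableOn b (Ioi a))
    (h : ∀ᵐ s ∂(volume.restrict (Ioi a)), IntegrableOn (fun t => G t s) (Ioo a s) ∧
      ∫ t in Ioo a s, ‖G t s‖ ≤ b s) :
    ∫ t in Ioi a, ∫ s in Ioi t, G t s = ∫ s in Ioi a, ∫ t in Ioo a s, G t s := by
  have hset : MeasurableSet {p : ℝ × ℝ | a < p.1 ∧ p.1 < p.2} :=
    (measurableSet_lt measurable_const measurable_fst).inter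
      (measurableSet_lt measurable_fst measurable_snd)
  set H : ℝ × ℝ → E := indicator {p : ℝ × ℝ | a < p.1 ∧ p.1 < p.2} (Function.uncurry G) with hH
  have hHs : ∀ s, (fun t => H (t, s)) = indicator (Ioo a s) (fun t => G t s) := by
    intro s; ext t
    simp only [hH, indicator, mem_ofPred_eq, mem_Ioo]; split_ifs <;> rfl
  have hHt : ∀ t, a < t → (fun s => H (t, s)) = indicator (Ioi t) (fun s => G t s) := by
    intro t ht; ext s
    simp only [hH, indicator, mem_ofPred_eq, mem_Ioi, ht, true_and]; split_ifs <;> rfl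
  have hsub : ∀ s : ℝ, Ioo a s ⊆ Ioi a := fun s t ht => ht.1
  have hint : Integrable H ((volume.restrict (Ioi a)).prod (volume.restrict (Ioi a))) := by
    refine integrable_prod_of_bound ?_ hb ?_
    · exact AEStronglyMeasurable.indicator hm hset
    · filter_upwards [h] with s hs
      have e1 : (fun t => ‖H (t, s)‖) = indicator (Ioo a s) (fun t => ‖G t s‖) := by
        ext t
        rw [show H (t, s) = (Ioo a s).indicator (fun t => G t s) t from congrFun (hHs s) t,
          norm_indicator_eq_indicator_norm]
      rw [e1, hHs]
      constructor
      · rw [integrable_indicator_iff measurableSet_Ioo, IntegrableOn,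
          Measure.restrict_restrict measurableSet_Ioo, inter_eq_left.2 (hsub s)]
        exact hs.1
      · rw [setIntegral_indicator measurableSet_Ioo, inter_eq_right.2 (hsub s)]
        exact hs.2
  have := integral_integral_swap (f := fun t s => H (t, s)) hint
  calc ∫ t in Ioi a, ∫ s in Ioi t, G t s = ∫ t in Ioi a, ∫ s in Ioi a, H (t, s) := by
        refine setIntegral_congr_fun measurableSet_Ioi fun t ht => ?_
        rw [hHt t ht, setIntegral_indicator measurableSet_Ioi,
          inter_eq_right.2 (Ioi_subset_Ioi (le_of_lt ht))]
    _ = ∫ s in Ioi a, ∫ t in Ioi a, H (t, s) := this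
    _ = _ := by
        refine setIntegral_congr_fun measurableSet_Ioi fun s hs => ?_
        rw [hHs, setIntegral_indicator measurableSet_Ioo, inter_eq_right.2 (hsub s)]

end product

end HalfLine
-- The first moment of the potential and the Volterra operator
namespace HalfLine

/-- The density `s |q s|` of the first moment of `q`. -/
def moment (q : ℝ → ℝ) (s : ℝ) : ℝ := s * |q s|

/-- The tail `∫_x^∞ |q|`. -/
noncomputable def sig (q : ℝ → ℝ) (x : ℝ) : ℝ := ∫ s in Ioi x, |q s|

section basic
variable {q : ℝ → ℝ} (hq : IsL11 q)
include hq

theorem integrableOn_moment : IntegrableOn (moment q) (Ioi 0) := by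
  have h : IntegrableOn (fun x => |x * q x|) (Ioi 0) := hq.abs
  refine h.congr_fun (fun s hs => ?_) measurableSet_Ioi
  simp only [moment, abs_mul, abs_of_pos (mem_Ioi.1 hs)]

omit hq in
theorem moment_nonneg (s : ℝ) (hs : 0 < s) : 0 ≤ moment q s := mul_nonneg hs.le (abs_nonneg _)

theorem aestronglyMeasurable_q {x : ℝ} (hx : 0 ≤ x) :
    AEStronglyMeasurable q (volume.restrict (Ioi x)) := by
  have h : AEStronglyMeasurable q (volume.restrict (Ioi 0)) := by
    have h1 : AEStronglyMeasurable (fun s => s⁻¹ * (s * q s)) (volume.restrict (Ioi 0)) :=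
      measurable_inv.aestronglyMeasurable.mul hq.aestronglyMeasurable
    refine h1.congr ?_
    filter_upwards [ae_restrict_mem measurableSet_Ioi] with s hs
    rw [inv_mul_cancel_left₀ (ne_of_gt hs)]
  exact h.mono_set (Ioi_subset_Ioi hx)

theorem integrableOn_q {x : ℝ} (hx : 0 < x) : IntegrableOn q (Ioi x) := by
  have h1 := (integrableOn_moment hq).mono_set (Ioi_subset_Ioi hx.le)
  refine Integrable.mono' (h1.const_mul x⁻¹) (aestronglyMeasurable_q hq hx.le) ?_
  filter_upwards [ae_restrict_mem measurableSet_Ioi] with s hs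
  rw [Real.norm_eq_abs, moment, ← mul_assoc]
  refine le_mul_of_one_le_left (abs_nonneg _) ?_
  rw [inv_mul_eq_div, one_le_div hx]
  exact le_of_lt hs

omit hq in
theorem sig_nonneg (x : ℝ) : 0 ≤ sig q x := integral_nonneg fun _ => abs_nonneg _

theorem sig_anti {x y : ℝ} (hx : 0 < x) (hxy : x ≤ y) : sig q y ≤ sig q x :=
  setIntegral_mono_set (integrableOn_q hq hx).abs (Eventually.of_forall fun _ => abs_nonneg _)
    (Ioi_subset_Ioi hxy).eventuallyLE

/-- By Fubini the integral over (x, ∞) is that of (s - x)|q(s)|. Thus `sig q` is integrable up to 0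
even when q is not; this is the only way in which the behaviour of q at 0 enters the kernel
estimates. -/
theorem sig_tail {x : ℝ} (hx : 0 ≤ x) :
    IntegrableOn (sig q) (Ioi x) ∧ ∫ t in Ioi x, sig q t ≤ ∫ s in Ioi x, moment q s := by
  have hmeas : AEStronglyMeasurable (fun p : ℝ × ℝ => |q p.2|)
      ((volume.restrict (Ioi x)).prod (volume.restrict (Ioi x))) :=
    ((aestronglyMeasurable_q hq hx).norm).comp_snd
  have hb := (integrableOn_moment hq).mono_set (Ioi_subset_Ioi hx)
  have hbd : ∀ s ∈ Ioi x, ∫ _t in Ioo x s, ‖|q s|‖ ≤ moment q s := by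
    intro s hs
    rw [setIntegral_const, Real.norm_of_nonneg (abs_nonneg _), smul_eq_mul, moment]
    refine mul_le_mul_of_nonneg_right ?_ (abs_nonneg _)
    rw [Real.volume_real_Ioo_of_le (le_of_lt hs)]; linarith
  have hswap := integral_triangle_swap (G := fun _ s => |q s|) (a := x) hmeas hb (by
    filter_upwards [ae_restrict_mem measurableSet_Ioi] with s hs
    exact ⟨integrableOn_const (by simp), hbd s hs⟩)
  have hset : MeasurableSet {p : ℝ × ℝ | p.1 < p.2} := measurableSet_lt measurable_fst measurable_snd
  have hI : IntegrableOn (sig q) (Ioi x) := by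
    have hint : Integrable (indicator {p : ℝ × ℝ | p.1 < p.2} fun p => |q p.2|)
        ((volume.restrict (Ioi x)).prod (volume.restrict (Ioi x))) := by
      refine integrable_prod_of_bound (hmeas.indicator hset) hb ?_
      filter_upwards [ae_restrict_mem measurableSet_Ioi] with s hs
      have e : (fun t => indicator {p : ℝ × ℝ | p.1 < p.2} (fun p => |q p.2|) (t, s))
          = indicator (Iio s) (fun _ => |q s|) := by
        ext t; simp [indicator]
      have e2 : (fun t => ‖indicator {p : ℝ × ℝ | p.1 < p.2} (fun p => |q p.2|) (t, s)‖)
          = indicator (Iio s) (fun _ => ‖|q s|‖) := by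
        ext t
        rw [show indicator {p : ℝ × ℝ | p.1 < p.2} (fun p => |q p.2|) (t, s)
          = indicator (Iio s) (fun _ => |q s|) t from congrFun e t, norm_indicator_eq_indicator_norm]
      rw [e, e2, integrable_indicator_iff measurableSet_Iio, IntegrableOn,
        Measure.restrict_restrict measurableSet_Iio, setIntegral_indicator measurableSet_Iio,
        inter_comm (Iio s), Ioi_inter_Iio]
      exact ⟨integrableOn_const (by simp), hbd s hs⟩
    refine hint.integral_prod_left.congr ?_
    filter_upwards [ae_restrict_mem measurableSet_Ioi] with t ht
    have e : (fun s => indicator {p : ℝ × ℝ | p.1 < p.2} (fun p => |q p.2|) (t, s))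
        = indicator (Ioi t) (fun s => |q s|) := by
      ext s; simp [indicator]
    rw [e, setIntegral_indicator measurableSet_Ioi, Ioi_inter_Ioi, sup_eq_right.2 (le_of_lt ht)]
    rfl
  refine ⟨hI, ?_⟩
  change ∫ t in Ioi x, ∫ s in Ioi t, |q s| ≤ _
  rw [hswap]
  refine integral_mono_of_nonneg (Eventually.of_forall fun s => integral_nonneg fun _ =>
    abs_nonneg _) hb ?_
  filter_upwards [ae_restrict_mem measurableSet_Ioi] with s hs
  simpa using hbd s hs

theorem mul_sig_le {x : ℝ} (hx : 0 < x) : x * sig q x ≤ ∫ s in Ioi x, moment q s := by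
  rw [sig, ← integral_const_mul]
  refine setIntegral_mono_on ((integrableOn_q hq hx).abs.const_mul x)
    ((integrableOn_moment hq).mono_set (Ioi_subset_Ioi hx.le)) measurableSet_Ioi fun s hs => ?_
  exact mul_le_mul_of_nonneg_right (le_of_lt hs) (abs_nonneg _)

theorem moment_tail_le {x : ℝ} (hx : 0 ≤ x) :
    ∫ s in Ioi x, moment q s ≤ ∫ s in Ioi 0, moment q s :=
  setIntegral_mono_set (integrableOn_moment hq) (by
    filter_upwards [ae_restrict_mem measurableSet_Ioi] with s hs using moment_nonneg s hs)
    (Ioi_subset_Ioi hx).eventuallyLE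

end basic

section measurability
variable {α E : Type*} [MeasurableSpace α] [NormedAddCommGroup E] [NormedSpace ℝ E]

theorem stronglyMeasurable_integral_Ioc {B : α → ℝ → E}
    (hB : StronglyMeasurable (Function.uncurry B)) {a b : α → ℝ} (ha : Measurable a)
    (hb : Measurable b) : StronglyMeasurable fun p => ∫ u in Ioc (a p) (b p), B p u := by
  have hset : MeasurableSet {p : α × ℝ | a p.1 < p.2 ∧ p.2 ≤ b p.1} :=
    (measurableSet_lt (ha.comp measurable_fst) measurable_snd).inter
      (measurableSet_le measurable_snd (hb.comp measurable_fst))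
  have h := (hB.indicator hset).integral_prod_right' (ν := (volume : Measure ℝ))
  convert h using 2 with p
  rw [← integral_indicator measurableSet_Ioc]
  rfl

theorem stronglyMeasurable_intervalIntegral {B : α → ℝ → E}
    (hB : StronglyMeasurable (Function.uncurry B)) {a b : α → ℝ} (ha : Measurable a)
    (hb : Measurable b) : StronglyMeasurable fun p => ∫ u in a p..b p, B p u :=
  (stronglyMeasurable_integral_Ioc hB ha hb).sub (stronglyMeasurable_integral_Ioc hB hb ha)

theorem stronglyMeasurable_integral_Ioi {B : α → ℝ → E}
    (hB : StronglyMeasurable (Function.uncurry B)) {a : α → ℝ} (ha : Measurable a) :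
    StronglyMeasurable fun p => ∫ u in Ioi (a p), B p u := by
  have hset : MeasurableSet {p : α × ℝ | a p.1 < p.2} :=
    measurableSet_lt (ha.comp measurable_fst) measurable_snd
  have h := (hB.indicator hset).integral_prod_right' (ν := (volume : Measure ℝ))
  convert h using 2 with p
  rw [← integral_indicator measurableSet_Ioi]
  rfl

end measurability

theorem measurableSet_kernelDomain : MeasurableSet kernelDomain :=
  (measurableSet_le measurable_const measurable_fst).inter
    ((measurableSet_le measurable_fst measurable_snd).inter
      (measurableSet_lt measurable_const measurable_snd))

/-- Measurable kernels that vanish off `kernelDomain` and are bounded away from the corner. -/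
structure Admissible (B : ℝ → ℝ → ℝ) : Prop where
  meas : Measurable (Function.uncurry B)
  zero : ∀ x y, (x, y) ∉ kernelDomain → B x y = 0
  bdd : ∀ c, 0 < c → ∃ C, ∀ x y, c ≤ x + y → |B x y| ≤ C

theorem Admissible.sub {B B' : ℝ → ℝ → ℝ} (h : Admissible B) (h' : Admissible B') :
    Admissible fun x y => B x y - B' x y where
  meas := h.meas.sub h'.meas
  zero x y hxy := by rw [h.zero x y hxy, h'.zero x y hxy, sub_zero]
  bdd c hc := by
    obtain ⟨C, hC⟩ := h.bdd c hc
    obtain ⟨C', hC'⟩ := h'.bdd c hc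
    exact ⟨C + C', fun x y hxy => (abs_sub _ _).trans (add_le_add (hC x y hxy) (hC' x y hxy))⟩

theorem Admissible.bdd_right {B : ℝ → ℝ → ℝ} (h : Admissible B) {s : ℝ} (hs : 0 < s) :
    ∃ C, ∀ u, |B s u| ≤ C := by
  obtain ⟨C, hC⟩ := h.bdd (2 * s) (by linarith)
  refine ⟨max C 0, fun u => ?_⟩
  by_cases hu : s ≤ u
  · exact (hC s u (by linarith)).trans (le_max_left _ _)
  · rw [h.zero s u fun hm => hu hm.2.1, abs_zero]
    exact le_max_right _ _

theorem Admissible.intervalIntegrable {B : ℝ → ℝ → ℝ} (h : Admissible B) {s : ℝ} (hs : 0 < s)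
    (a b : ℝ) : IntervalIntegrable (B s) volume a b := by
  obtain ⟨C, hC⟩ := h.bdd_right hs
  refine (intervalIntegrable_const (c := C)).mono_fun
    (h.meas.of_uncurry_left.aestronglyMeasurable) (Eventually.of_forall fun u => ?_)
  exact (hC u).trans (le_abs_self C)

/-- The homogeneous part of the Volterra equation. -/
noncomputable def volt (q : ℝ → ℝ) (B : ℝ → ℝ → ℝ) (x y : ℝ) : ℝ :=
  (1 / 2) * ∫ s in Ioi x, q s * ∫ u in (y - s + x)..(y + s - x), B s u

/-- On the inner interval u ≥ y - s + x, that is s + u ≥ x + y: the half-planes c ≤ x + y are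
invariant under the Volterra operator, which is why `Admissible` measures boundedness by x + y. The
length 2(s - x) of the interval later supplies the factor s of the first moment. -/
theorem inner_bound {E : Type*} [NormedAddCommGroup E] [NormedSpace ℝ E] {B : ℝ → ℝ → E}
    {x y s C : ℝ} (hs : x < s) (h : ∀ u, x + y ≤ s + u → ‖B s u‖ ≤ C) :
    ‖∫ u in (y - s + x)..(y + s - x), B s u‖ ≤ C * (2 * (s - x)) := by
  have h1 := intervalIntegral.norm_integral_le_of_norm_le_const (a := y - s + x) (b := y + s - x)
    (f := B s) (C := C) fun u hu => h u (by
      rw [uIoc_of_le (by linarith)] at hu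
      linarith [hu.1])
  rwa [show y + s - x - (y - s + x) = 2 * (s - x) by ring, abs_of_pos (by linarith)] at h1

section volt
variable {q : ℝ → ℝ} (hq : IsL11 q) {B : ℝ → ℝ → ℝ}
include hq

/-- The contraction estimate. The factor 1/2 in front and the length 2(s - x) ≤ 2s combine to the
density s|q(s)|, and `integral_mul_weight_le` for this density gains the factor 1/2. -/
theorem volt_bound (hB : Admissible B) {c C : ℝ} (hC : 0 ≤ C)
    (h : ∀ x y, (x, y) ∈ kernelDomain → c ≤ x + y → |B x y| ≤ C * weight (moment q) x)
    {x y : ℝ} (hx : 0 ≤ x) (hxy : c ≤ x + y) :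
    |volt q B x y| ≤ C / 2 * weight (moment q) x := by
  have hi := (integrableOn_mul_weight (integrableOn_moment hq) moment_nonneg).mono_set
    (Ioi_subset_Ioi hx)
  have h1 : ‖∫ s in Ioi x, q s * ∫ u in (y - s + x)..(y + s - x), B s u‖
      ≤ ∫ s in Ioi x, (2 * C) * (moment q s * weight (moment q) s) := by
    refine norm_integral_le_of_norm_le (hi.const_mul _) ?_
    filter_upwards [ae_restrict_mem measurableSet_Ioi] with s hs
    have hs' : x < s := hs
    have h2 := inner_bound (B := B) (x := x) (y := y) (C := C * weight (moment q) s) hs'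
      (fun u hu => by
        by_cases hm : (s, u) ∈ kernelDomain
        · exact h s u hm (by linarith)
        · rw [hB.zero s u hm, norm_zero]
          exact mul_nonneg hC (weight_pos _).le)
    rw [norm_mul, Real.norm_eq_abs (q s), moment]
    calc |q s| * _ ≤ |q s| * (C * weight (moment q) s * (2 * (s - x))) := by gcongr
      _ ≤ |q s| * (C * weight (moment q) s * (2 * s)) := by
        have := (weight_pos (w := moment q) s).le
        gcongr; linarith
      _ = _ := by ring
  rw [integral_const_mul] at h1
  have h3 := integral_mul_weight_le (integrableOn_moment hq) moment_nonneg hx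
  rw [volt, abs_mul, abs_of_pos (by norm_num : (0 : ℝ) < 1 / 2)]
  rw [Real.norm_eq_abs] at h1
  nlinarith

theorem volt_integrableOn (hB : Admissible B) {x y : ℝ} (hx : 0 ≤ x) (hxy : 0 < x + y) :
    IntegrableOn (fun s => q s * ∫ u in (y - s + x)..(y + s - x), B s u) (Ioi x) := by
  obtain ⟨C, hC⟩ := hB.bdd (x + y) hxy
  have hC0 : 0 ≤ C := (abs_nonneg _).trans (hC x y le_rfl)
  refine Integrable.mono' (((integrableOn_moment hq).mono_set (Ioi_subset_Ioi hx)).const_mul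
    (2 * C)) ((aestronglyMeasurable_q hq hx).mul ?_) ?_
  · exact (stronglyMeasurable_intervalIntegral (B := B) hB.meas.stronglyMeasurable
      (by fun_prop) (by fun_prop)).aestronglyMeasurable
  · filter_upwards [ae_restrict_mem measurableSet_Ioi] with s hs
    have h2 := inner_bound (B := B) (x := x) (y := y) (C := C) hs fun u hu => hC s u hu
    rw [norm_mul, Real.norm_eq_abs (q s), moment]
    calc |q s| * _ ≤ |q s| * (C * (2 * (s - x))) := by gcongr
      _ ≤ |q s| * (C * (2 * s)) := by gcongr; linarith
      _ = _ := by ring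

theorem volt_sub {B' : ℝ → ℝ → ℝ} (hB : Admissible B) (hB' : Admissible B') {x y : ℝ}
    (hx : 0 ≤ x) (hxy : 0 < x + y) :
    volt q (fun x y => B x y - B' x y) x y = volt q B x y - volt q B' x y := by
  rw [volt, volt, volt, ← mul_sub, ← integral_sub (volt_integrableOn hq hB hx hxy)
    (volt_integrableOn hq hB' hx hxy)]
  congr 1
  refine setIntegral_congr_fun measurableSet_Ioi fun s hs => ?_
  have hs0 : 0 < s := lt_of_le_of_lt hx hs
  rw [intervalIntegral.integral_sub (hB.intervalIntegrable hs0 _ _)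
    (hB'.intervalIntegrable hs0 _ _), mul_sub]

/-- Iterating the contraction bounds B by a multiple of 2^(-n) for every n. This serves twice: for
the uniqueness of the kernel, and for the vanishing of the defect in Marchenko's equation. -/
theorem volt_eq_self (hB : Admissible B)
    (h : ∀ x y, (x, y) ∈ kernelDomain → B x y = volt q B x y) (x y : ℝ) : B x y = 0 := by
  by_cases hm : (x, y) ∈ kernelDomain
  swap
  · exact hB.zero x y hm
  have hxy : 0 < x + y := by linarith [hm.1, hm.2.2]
  obtain ⟨C, hC⟩ := hB.bdd (x + y) hxy
  have hC0 : 0 ≤ C := (abs_nonneg _).trans (hC x y le_rfl)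
  have key : ∀ n : ℕ, ∀ s u, (s, u) ∈ kernelDomain → x + y ≤ s + u →
      |B s u| ≤ C * (1 / 2) ^ n * weight (moment q) s := by
    intro n
    induction n with
    | zero =>
      intro s u hsu hle
      simpa using (hC s u hle).trans (le_mul_of_one_le_right hC0 (one_le_weight moment_nonneg hsu.1))
    | succ n ih =>
      intro s u hsu hle
      rw [h s u hsu]
      refine (volt_bound hq hB (by positivity) ih hsu.1 hle).trans (le_of_eq ?_)
      ring
  have hlim : Tendsto (fun n : ℕ => C * (1 / 2 : ℝ) ^ n * weight (moment q) x) atTop (𝓝 0) := by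
    have := ((tendsto_pow_atTop_nhds_zero_of_lt_one (r := (1 / 2 : ℝ)) (by norm_num)
      (by norm_num)).const_mul C).mul_const (weight (moment q) x)
    simpa using this
  have := ge_of_tendsto' hlim fun n => key n x y hm le_rfl
  exact abs_nonpos_iff.1 this

theorem continuousOn_volt (hB : Admissible B) :
    ContinuousOn (fun p : ℝ × ℝ => volt q B p.1 p.2) kernelDomain := by
  rintro ⟨x₀, y₀⟩ hm
  have hxy : 0 < x₀ + y₀ := by linarith [hm.1, hm.2.2]
  obtain ⟨C, hC⟩ := hB.bdd ((x₀ + y₀) / 2) (by linarith)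
  have hC0 : 0 ≤ C := (abs_nonneg _).trans (hC x₀ y₀ (by linarith))
  refine ContinuousWithinAt.mul continuousWithinAt_const ?_
  -- Moving the lower limit into an indicator puts all integrals on one half-line, so that dominated
  -- convergence applies; continuity of the integrand fails at most at the single point s = x₀.
  have heq : ∀ p ∈ kernelDomain, ∫ s in Ioi p.1, q s * ∫ u in (p.2 - s + p.1)..(p.2 + s - p.1), B s u
      = ∫ s in Ioi 0, indicator (Ioi p.1)
        (fun s => q s * ∫ u in (p.2 - s + p.1)..(p.2 + s - p.1), B s u) s := by
    intro p hp
    rw [setIntegral_indicator measurableSet_Ioi, Ioi_inter_Ioi, sup_eq_right.2 hp.1]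
  refine ContinuousWithinAt.congr ?_ heq (heq _ hm)
  have hnear : ∀ᶠ p : ℝ × ℝ in 𝓝[kernelDomain] (x₀, y₀), (x₀ + y₀) / 2 ≤ p.1 + p.2 ∧ p ∈ kernelDomain :=
    ((eventually_nhdsWithin_of_eventually_nhds (((continuous_fst.add continuous_snd).tendsto
      (x₀, y₀)).eventually_const_lt (show (x₀ + y₀) / 2 < x₀ + y₀ by linarith))).mono
      fun p hp => le_of_lt hp).and
      self_mem_nhdsWithin
  refine continuousWithinAt_of_dominated (bound := fun s => (2 * C) * moment q s) ?_ ?_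
    ((integrableOn_moment hq).const_mul _) ?_
  · filter_upwards [hnear] with p hp
    refine AEStronglyMeasurable.indicator ((aestronglyMeasurable_q hq le_rfl).mul ?_)
      measurableSet_Ioi
    exact (stronglyMeasurable_intervalIntegral (B := B) hB.meas.stronglyMeasurable
      (by fun_prop) (by fun_prop)).aestronglyMeasurable
  · filter_upwards [hnear] with p hp
    filter_upwards [ae_restrict_mem measurableSet_Ioi] with s hs
    rw [mem_Ioi] at hs
    by_cases hps : s ∈ Ioi p.1
    · rw [indicator_of_mem hps, norm_mul, Real.norm_eq_abs (q s), moment]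
      have h2 := inner_bound (B := B) (x := p.1) (y := p.2) (C := C) hps
        fun u hu => hC s u (by linarith [hp.1])
      calc |q s| * _ ≤ |q s| * (C * (2 * (s - p.1))) := by gcongr
        _ ≤ |q s| * (C * (2 * s)) := by gcongr; linarith [hp.2.1]
        _ = _ := by ring
    · rw [indicator_of_notMem hps, norm_zero]
      have := moment_nonneg (q := q) s hs
      positivity
  · have hne : ∀ᵐ s ∂(volume.restrict (Ioi (0 : ℝ))), s ≠ x₀ :=
      ae_restrict_of_ae (by simp [ae_iff, measure_singleton])
    filter_upwards [ae_restrict_mem measurableSet_Ioi, hne] with s hs hsx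
    refine ContinuousAt.continuousWithinAt ?_
    rcases lt_or_gt_of_ne hsx with h | h
    · refine (continuousAt_const (y := (0 : ℝ))).congr ?_
      filter_upwards [(continuous_fst.tendsto (x₀, y₀)).eventually_const_lt h] with p hp
      rw [indicator_of_notMem]
      exact not_lt.2 (le_of_lt hp)
    · have hprim : Continuous fun b => ∫ u in (0 : ℝ)..b, B s u :=
        intervalIntegral.continuous_primitive (fun a b => hB.intervalIntegrable hs a b) 0
      have hc : Continuous fun p : ℝ × ℝ => q s * ((∫ u in (0 : ℝ)..(p.2 + s - p.1), B s u)
          - ∫ u in (0 : ℝ)..(p.2 - s + p.1), B s u) :=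
        continuous_const.mul ((hprim.comp (by fun_prop)).sub (hprim.comp (by fun_prop)))
      refine hc.continuousAt.congr ?_
      filter_upwards [(continuous_fst.tendsto (x₀, y₀)).eventually_lt_const h] with p hp
      rw [indicator_of_mem (show s ∈ Ioi p.1 from hp), intervalIntegral.integral_interval_sub_left
        (hB.intervalIntegrable hs _ _) (hB.intervalIntegrable hs _ _)]

end volt
end HalfLine
-- The transformation kernel by successive approximation
namespace HalfLine

theorem volterraStep_of_mem {q : ℝ → ℝ} {B : ℝ → ℝ → ℝ} {x y : ℝ} (h : (x, y) ∈ kernelDomain) :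
    volterraStep q B x y = (1 / 2) * (∫ s in Ioi ((x + y) / 2), q s) + volt q B x y := by
  rw [volterraStep, if_pos h, volt]

theorem volterraStep_of_notMem {q : ℝ → ℝ} {B : ℝ → ℝ → ℝ} {x y : ℝ}
    (h : (x, y) ∉ kernelDomain) : volterraStep q B x y = 0 := by
  rw [volterraStep, if_neg h]

/-- The transformation kernel, as the limit of the successive approximations. -/
noncomputable def kern (q : ℝ → ℝ) (x y : ℝ) : ℝ :=
  limUnder atTop fun n : ℕ => (volterraStep q)^[n] (fun _ _ => 0) x y

theorem sum_pos_of_mem {x y : ℝ} (h : (x, y) ∈ kernelDomain) : 0 < (x + y) / 2 := by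
  linarith [h.1, h.2.2]

section kern
variable {q : ℝ → ℝ} (hq : IsL11 q)
include hq

omit hq in
theorem norm_tail_le (x : ℝ) : |∫ s in Ioi x, q s| ≤ sig q x :=
  norm_integral_le_integral_norm (f := q) (μ := volume.restrict (Ioi x))

theorem continuousOn_volterraStep {B : ℝ → ℝ → ℝ} (hB : Admissible B) :
    ContinuousOn (Function.uncurry (volterraStep q B)) kernelDomain := by
  have h1 : ContinuousOn (fun p : ℝ × ℝ => (1 / 2) * ∫ s in Ioi ((p.1 + p.2) / 2), q s)
      kernelDomain := by
    have h0 : ContinuousOn (fun x => ∫ s in Ioi x, q s) (Ioi 0) := by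
      intro x hx
      have hx2 : 0 < x / 2 := half_pos hx
      exact (continuousOn_tail (integrableOn_q hq hx2) x
        (by rw [mem_Ici]; linarith)).mono_of_mem_nhdsWithin
        (mem_nhdsWithin_of_mem_nhds (Ici_mem_nhds (by linarith)))
    exact continuousOn_const.mul (h0.comp (by fun_prop) fun p hp => sum_pos_of_mem hp)
  exact (h1.add (continuousOn_volt hq hB)).congr fun p hp => volterraStep_of_mem hp

theorem Admissible.volterraStep {B : ℝ → ℝ → ℝ} (hB : Admissible B) :
    Admissible (volterraStep q B) where
  meas := by
    classical
    have h := (continuousOn_volterraStep hq hB).measurable_piecewise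
      (g := fun _ => (0 : ℝ)) continuousOn_const measurableSet_kernelDomain
    convert h using 1
    ext p
    by_cases hp : p ∈ kernelDomain
    · rw [piecewise_eq_of_mem _ _ _ hp]
    · rw [piecewise_eq_of_notMem _ _ _ hp]
      exact volterraStep_of_notMem hp
  zero x y h := volterraStep_of_notMem h
  bdd c hc := by
    obtain ⟨C, hC⟩ := hB.bdd c hc
    have hC0 : 0 ≤ |C| := abs_nonneg C
    refine ⟨1 / 2 * sig q (c / 2) + |C| / 2 * weight (moment q) 0, fun x y hxy => ?_⟩
    by_cases hm : (x, y) ∈ kernelDomain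
    · rw [volterraStep_of_mem hm]
      refine (abs_add_le _ _).trans (add_le_add ?_ ?_)
      · rw [abs_mul, abs_of_pos (by norm_num : (0 : ℝ) < 1 / 2)]
        exact mul_le_mul_of_nonneg_left ((norm_tail_le _).trans
          (sig_anti hq (by linarith) (by linarith))) (by norm_num)
      · refine (volt_bound hq hB hC0 (fun s u hsu hle => ?_) hm.1 hxy).trans ?_
        · exact ((hC s u hle).trans (le_abs_self C)).trans
            (le_mul_of_one_le_right hC0 (one_le_weight moment_nonneg hsu.1))
        · exact mul_le_mul_of_nonneg_left (weight_antitone (integrableOn_moment hq) moment_nonneg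
            le_rfl hm.1) (by positivity)
    · rw [volterraStep_of_notMem hm, abs_zero]
      have := sig_nonneg (q := q) (c / 2)
      have := weight_pos (w := moment q) 0
      positivity

omit hq in
theorem admissible_zero : Admissible fun _ _ => 0 where
  meas := measurable_const
  zero _ _ _ := rfl
  bdd _ _ := ⟨0, fun _ _ _ => by simp⟩

theorem admissible_iterate (n : ℕ) : Admissible ((volterraStep q)^[n] fun _ _ => 0) := by
  induction n with
  | zero => exact admissible_zero
  | succ n ih => rw [Function.iterate_succ_apply']; exact ih.volterraStep hq

theorem volterraStep_sub {B B' : ℝ → ℝ → ℝ} (hB : Admissible B) (hB' : Admissible B') {x y : ℝ}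
    (h : (x, y) ∈ kernelDomain) :
    volterraStep q B x y - volterraStep q B' x y = volt q (fun x y => B x y - B' x y) x y := by
  rw [volterraStep_of_mem h, volterraStep_of_mem h,
    volt_sub hq hB hB' h.1 (by linarith [sum_pos_of_mem h])]
  ring

/-- The first difference is the inhomogeneous term, at most half of `sig q (c / 2)`; each later one
is `volt` of its predecessor and gains a factor 1/2. -/
theorem iterate_diff {c : ℝ} (hc : 0 < c) (n : ℕ) : ∀ x y, (x, y) ∈ kernelDomain → c ≤ x + y →
    |(volterraStep q)^[n + 1] (fun _ _ => 0) x y - (volterraStep q)^[n] (fun _ _ => 0) x y|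
      ≤ sig q (c / 2) / 2 * (1 / 2) ^ n * weight (moment q) x := by
  have hs := sig_nonneg (q := q) (c / 2)
  induction n with
  | zero =>
    intro x y h hle
    have hv : volt q (fun _ _ => 0) x y = 0 := by simp [volt]
    have : (volterraStep q)^[0 + 1] (fun _ _ => 0) x y = (1 / 2) * ∫ s in Ioi ((x + y) / 2), q s := by
      rw [zero_add, Function.iterate_one, volterraStep_of_mem h, hv, add_zero]
    rw [this, Function.iterate_zero, id, sub_zero, abs_mul,
      abs_of_pos (by norm_num : (0 : ℝ) < 1 / 2)]
    have h1 := (norm_tail_le ((x + y) / 2)).trans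
      (sig_anti hq (by linarith : 0 < c / 2) (by linarith))
    have h2 := one_le_weight (moment_nonneg (q := q)) h.1
    nlinarith
  | succ n ih =>
    intro x y h hle
    have h1 := admissible_iterate hq (n + 1)
    have h0 := admissible_iterate hq n
    have e : (volterraStep q)^[n + 1 + 1] (fun _ _ => 0) x y
        - (volterraStep q)^[n + 1] (fun _ _ => 0) x y
        = volterraStep q ((volterraStep q)^[n + 1] fun _ _ => 0) x y
        - volterraStep q ((volterraStep q)^[n] fun _ _ => 0) x y := by
      simp only [Function.iterate_succ_apply']
    rw [e, volterraStep_sub hq h1 h0 h]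
    exact (volt_bound hq (h1.sub h0) (by positivity) ih h.1 hle).trans (le_of_eq (by ring))

theorem tendsto_kern (x y : ℝ) :
    Tendsto (fun n : ℕ => (volterraStep q)^[n] (fun _ _ => 0) x y) atTop (𝓝 (kern q x y)) := by
  by_cases h : (x, y) ∈ kernelDomain
  · refine CauchySeq.tendsto_limUnder (cauchySeq_of_le_geometric (1 / 2)
      (sig q ((x + y) / 2) / 2 * weight (moment q) x) (by norm_num) fun n => ?_)
    rw [dist_comm, Real.dist_eq]
    refine (iterate_diff hq (by linarith [sum_pos_of_mem h]) n x y h le_rfl).trans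
      (le_of_eq (by ring))
  · have : (fun n : ℕ => (volterraStep q)^[n] (fun _ _ => 0) x y) = fun _ => 0 :=
      funext fun n => (admissible_iterate hq n).zero x y h
    rw [kern, this]
    exact CauchySeq.tendsto_limUnder (u := fun _ : ℕ => (0 : ℝ)) (cauchySeq_const (0 : ℝ))

theorem kern_zero {x y : ℝ} (h : (x, y) ∉ kernelDomain) : kern q x y = 0 :=
  tendsto_nhds_unique (tendsto_kern hq x y)
    (tendsto_const_nhds.congr fun n => ((admissible_iterate hq n).zero x y h).symm)

theorem iterate_dist {c : ℝ} (hc : 0 < c) (n : ℕ) {x y : ℝ} (h : (x, y) ∈ kernelDomain)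
    (hle : c ≤ x + y) : |(volterraStep q)^[n] (fun _ _ => 0) x y - kern q x y|
      ≤ sig q (c / 2) * (1 / 2) ^ n * weight (moment q) x := by
  have := dist_le_of_le_geometric_of_tendsto (1 / 2)
      (sig q (c / 2) / 2 * weight (moment q) x) (by norm_num) (fun n => by
        rw [dist_comm, Real.dist_eq]
        exact (iterate_diff hq hc n x y h hle).trans (le_of_eq (by ring)))
      (tendsto_kern hq x y) n
  rw [Real.dist_eq] at this
  exact this.trans (le_of_eq (by ring))

/-- The constant in the bound of the transformation kernel. -/
noncomputable def kernConst (q : ℝ → ℝ) : ℝ := weight (moment q) 0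

omit hq in
theorem kernConst_pos : 0 < kernConst q := weight_pos _

/-- The distance of the limit to the zeroth approximation, with the threshold c chosen as x + y
itself, so that the tail starts at (x + y) / 2. Since `sig q` is integrable on (0, ∞), this makes
A(x, ·) integrable uniformly in x ≥ 0. -/
theorem abs_kern_le {x y : ℝ} (h : (x, y) ∈ kernelDomain) :
    |kern q x y| ≤ kernConst q * sig q ((x + y) / 2) := by
  have h1 := iterate_dist hq (by linarith [sum_pos_of_mem h]) 0 h le_rfl
  rw [Function.iterate_zero, id, zero_sub, abs_neg, pow_zero, mul_one] at h1
  refine h1.trans ?_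
  rw [mul_comm]
  exact mul_le_mul_of_nonneg_right (weight_antitone (integrableOn_moment hq) moment_nonneg
    le_rfl h.1) (sig_nonneg _)

theorem admissible_kern : Admissible (kern q) where
  meas := measurable_of_tendsto_metrizable (fun n => (admissible_iterate hq n).meas)
    (tendsto_pi_nhds.2 fun p => tendsto_kern hq p.1 p.2)
  zero x y h := kern_zero hq h
  bdd c hc := by
    refine ⟨kernConst q * sig q (c / 2), fun x y hxy => ?_⟩
    by_cases hm : (x, y) ∈ kernelDomain
    · exact (abs_kern_le hq hm).trans (mul_le_mul_of_nonneg_left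
        (sig_anti hq (by linarith) (by linarith)) kernConst_pos.le)
    · rw [kern_zero hq hm, abs_zero]
      exact mul_nonneg kernConst_pos.le (sig_nonneg _)

theorem volterraStep_kern : volterraStep q (kern q) = kern q := by
  ext x y
  by_cases h : (x, y) ∈ kernelDomain
  swap
  · rw [volterraStep_of_notMem h, kern_zero hq h]
  refine tendsto_nhds_unique ?_ ((tendsto_add_atTop_iff_nat 1).2 (tendsto_kern hq x y))
  rw [tendsto_iff_dist_tendsto_zero]
  have hc : 0 < x + y := by linarith [sum_pos_of_mem h]
  have hs := sig_nonneg (q := q) ((x + y) / 2)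
  refine squeeze_zero (g := fun n : ℕ => sig q ((x + y) / 2) * (1 / 2 : ℝ) ^ n / 2 *
    weight (moment q) x) (fun _ => dist_nonneg) (fun n => ?_) ?_
  · rw [Function.iterate_succ_apply', Real.dist_eq,
      volterraStep_sub hq (admissible_iterate hq n) (admissible_kern hq) h]
    exact volt_bound hq ((admissible_iterate hq n).sub (admissible_kern hq)) (by positivity)
      (fun s u hsu hl => iterate_dist hq hc n hsu hl) h.1 le_rfl
  · have := (((tendsto_pow_atTop_nhds_zero_of_lt_one (r := (1 / 2 : ℝ)) (by norm_num)
      (by norm_num)).const_mul (sig q ((x + y) / 2))).div_const 2).mul_const (weight (moment q) x)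
    simpa using this

theorem continuousOn_kern : ContinuousOn (Function.uncurry (kern q)) kernelDomain := by
  rw [← volterraStep_kern hq]
  exact continuousOn_volterraStep hq (admissible_kern hq)

theorem kern_eq {x y : ℝ} (h : (x, y) ∈ kernelDomain) :
    kern q x y = (1 / 2) * (∫ s in Ioi ((x + y) / 2), q s) + volt q (kern q) x y := by
  rw [← volterraStep_of_mem h, volterraStep_kern hq]

theorem abs_kern_le_of_le {δ x y : ℝ} (hδ : 0 < δ) (hy : δ ≤ y) :
    |kern q x y| ≤ kernConst q * sig q (δ / 2) := by
  by_cases hm : (x, y) ∈ kernelDomain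
  · exact (abs_kern_le hq hm).trans (mul_le_mul_of_nonneg_left
      (sig_anti hq (by linarith) (by linarith [hm.1])) kernConst_pos.le)
  · rw [kern_zero hq hm, abs_zero]
    exact mul_nonneg kernConst_pos.le (sig_nonneg _)

theorem kern_unique {B : ℝ → ℝ → ℝ} (hm : Measurable (Function.uncurry B))
    (hb : ∀ δ : ℝ, 0 < δ → ∃ C : ℝ, ∀ x y : ℝ, δ ≤ y → |B x y| ≤ C)
    (h : volterraStep q B = B) : B = kern q := by
  have hB : Admissible B := by
    refine ⟨hm, fun x y hxy => ?_, fun c hc => ?_⟩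
    · rw [← h, volterraStep_of_notMem hxy]
    -- On the domain x ≤ y, so c ≤ x + y forces c / 2 ≤ y; off the domain a fixed point vanishes.
    · obtain ⟨C, hC⟩ := hb (c / 2) (by linarith)
      refine ⟨max C 0, fun x y hxy => ?_⟩
      by_cases hd : (x, y) ∈ kernelDomain
      · exact (hC x y (by linarith [hd.2.1])).trans (le_max_left _ _)
      · rw [← h, volterraStep_of_notMem hd, abs_zero]
        exact le_max_right _ _
  ext x y
  refine sub_eq_zero.1 (volt_eq_self hq (hB.sub (admissible_kern hq)) (fun x y hxy => ?_) x y)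
  rw [← volterraStep_sub hq hB (admissible_kern hq) hxy, h, volterraStep_kern hq]

theorem tendstoUniformlyOn_iterate {δ : ℝ} (hδ : 0 < δ) :
    TendstoUniformlyOn (fun (n : ℕ) (p : ℝ × ℝ) => ((volterraStep q)^[n] (fun _ _ => 0)) p.1 p.2)
        (Function.uncurry (kern q)) atTop {p : ℝ × ℝ | δ ≤ p.2} := by
  rw [Metric.tendstoUniformlyOn_iff]
  intro ε hε
  have hlim : Tendsto (fun n : ℕ => sig q (δ / 2) * (1 / 2 : ℝ) ^ n * kernConst q) atTop (𝓝 0) := by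
    have := ((tendsto_pow_atTop_nhds_zero_of_lt_one (r := (1 / 2 : ℝ)) (by norm_num)
      (by norm_num)).const_mul (sig q (δ / 2))).mul_const (kernConst q)
    simpa using this
  have hs := sig_nonneg (q := q) (δ / 2)
  filter_upwards [hlim.eventually_lt_const hε] with n hn p hp
  have hp' : δ ≤ p.2 := hp
  rw [dist_comm, Real.dist_eq]
  by_cases hm : (p.1, p.2) ∈ kernelDomain
  · refine ((iterate_dist hq hδ n hm (by linarith [hm.1])).trans ?_).trans_lt hn
    exact mul_le_mul_of_nonneg_left (weight_antitone (integrableOn_moment hq) moment_nonneg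
      le_rfl hm.1) (by positivity)
  · rw [(admissible_iterate hq n).zero _ _ hm, Function.uncurry, kern_zero hq hm]
    simpa using hε

theorem integrableOn_sig_half {x : ℝ} (hx : 0 ≤ x) :
    IntegrableOn (fun y => sig q ((x + y) / 2)) (Ioi x) ∧
      ∫ y in Ioi x, sig q ((x + y) / 2) = 2 * ∫ t in Ioi x, sig q t := by
  have h1 := (sig_tail hq hx).1
  have e : (fun y => sig q ((x + y) / 2)) = fun y => (fun z => sig q (1 / 2 * z)) (x + y) := by
    ext y; simp only []; congr 1; ring
  have h2 : IntegrableOn (fun z => sig q (1 / 2 * z)) (Ioi (x + x)) := by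
    rw [integrableOn_Ioi_comp_mul_left_iff _ _ (by norm_num : (0 : ℝ) < 1 / 2)]
    rwa [show 1 / 2 * (x + x) = x by ring]
  have h3 : ∫ z in Ioi (x + x), sig q (1 / 2 * z) = 2 * ∫ t in Ioi x, sig q t := by
    rw [integral_comp_mul_left_Ioi (sig q) _ (by norm_num : (0 : ℝ) < 1 / 2), smul_eq_mul,
      show 1 / 2 * (x + x) = x by ring, one_div, inv_inv]
  have hpre : (fun y => x + y) ⁻¹' Ioi (x + x) = Ioi x := by ext; simp
  have mp := (measurePreserving_add_left volume x)
  rw [e]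
  constructor
  · rw [← hpre]
    exact (mp.integrableOn_comp_preimage (measurableEmbedding_addLeft x)).2 h2
  · rw [← h3, ← mp.setIntegral_preimage_emb (measurableEmbedding_addLeft x) _ (Ioi (x + x)), hpre]

theorem integrableOn_kern {x : ℝ} (hx : 0 ≤ x) :
    IntegrableOn (kern q x) (Ioi x) ∧
      ∫ y in Ioi x, |kern q x y| ≤ 2 * kernConst q * ∫ t in Ioi x, sig q t := by
  have h1 := integrableOn_sig_half hq hx
  have hb : ∀ᵐ y ∂(volume.restrict (Ioi x)), ‖kern q x y‖ ≤ kernConst q * sig q ((x + y) / 2) := by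
    filter_upwards [ae_restrict_mem measurableSet_Ioi] with y hy
    exact abs_kern_le hq ⟨hx, le_of_lt hy, lt_of_le_of_lt hx hy⟩
  have hI : IntegrableOn (kern q x) (Ioi x) := Integrable.mono' (h1.1.const_mul _)
    ((admissible_kern hq).meas.of_uncurry_left.aestronglyMeasurable) hb
  refine ⟨hI, (integral_mono_ae hI.abs (h1.1.const_mul _) hb).trans (le_of_eq ?_)⟩
  rw [integral_const_mul, h1.2]; ring

/-- At y = x the inner interval is [2x - s, s], where A(s, u) = 0 except at the endpoint u = s; only
the inhomogeneous term is left. -/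
theorem kern_diag {x : ℝ} (hx : 0 < x) : kern q x x = (1 / 2) * ∫ s in Ioi x, q s := by
  have hv : ∫ s in Ioi x, q s * ∫ u in (x - s + x)..(x + s - x), kern q s u = 0 := by
    refine setIntegral_eq_zero_of_forall_eq_zero fun s hs => ?_
    rw [mem_Ioi] at hs
    rw [intervalIntegral.integral_of_le (by linarith), integral_Ioc_eq_integral_Ioo,
      setIntegral_eq_zero_of_forall_eq_zero, mul_zero]
    intro u hu
    refine kern_zero hq fun h => ?_
    have := h.2.1
    linarith [hu.2]
  rw [kern_eq hq ⟨hx.le, le_rfl, hx⟩, show (x + x) / 2 = x by ring, volt, hv, mul_zero, add_zero]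

end kern
end HalfLine
-- The transformation operator on translates
namespace HalfLine

section box
variable {E : Type*} [NormedAddCommGroup E] [NormedSpace ℝ E] [CompleteSpace E]

/-- Averaging over windows of half-width d is a symmetric operation, because |t - u| < d is
symmetric in t and u; the endpoints form a null set. -/
theorem box_swap {a : ℝ → ℝ} (ha : Integrable a) {ψ : ℝ → E} (hψ : StronglyMeasurable ψ)
    {C d : ℝ} (hC : ∀ t, ‖ψ t‖ ≤ C) (hd : 0 ≤ d) :
    Integrable (fun t => (∫ u in (t - d)..(t + d), a u) • ψ t) ∧
    ∫ t, ‖(∫ u in (t - d)..(t + d), a u) • ψ t‖ ≤ 2 * d * C * ∫ u, |a u| ∧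
    ∫ t, (∫ u in (t - d)..(t + d), a u) • ψ t
      = ∫ u, a u • ∫ t in (u - d)..(u + d), ψ t := by
  have hset : MeasurableSet {p : ℝ × ℝ | p.1 - d < p.2 ∧ p.2 ≤ p.1 + d} :=
    (measurableSet_lt (f := fun p : ℝ × ℝ => p.1 - d) (by fun_prop) measurable_snd).inter
      (measurableSet_le (g := fun p : ℝ × ℝ => p.1 + d) measurable_snd (by fun_prop))
  set K : ℝ × ℝ → E := indicator {p : ℝ × ℝ | p.1 - d < p.2 ∧ p.2 ≤ p.1 + d}
    fun p => a p.2 • ψ p.1 with hK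
  have hKu : ∀ u, (fun t => K (t, u)) = indicator (Ico (u - d) (u + d)) fun t => a u • ψ t := by
    intro u; ext t
    simp only [hK, indicator, mem_ofPred_eq, mem_Ico]
    have : (t - d < u ∧ u ≤ t + d) ↔ (u - d ≤ t ∧ t < u + d) := by constructor <;> intro h <;>
      constructor <;> linarith [h.1, h.2]
    simp only [this]
  have hKt : ∀ t, (fun u => K (t, u)) = indicator (Ioc (t - d) (t + d)) fun u => a u • ψ t := by
    intro t; ext u
    simp only [hK, indicator, mem_ofPred_eq, mem_Ioc]
  have hC0 : 0 ≤ C := (norm_nonneg _).trans (hC 0)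
  have hbnd : ∀ u, Integrable (fun t => K (t, u)) ∧ ∫ t, ‖K (t, u)‖ ≤ 2 * d * C * |a u| := by
    intro u
    constructor
    · rw [hKu, integrable_indicator_iff measurableSet_Ico]
      refine Integrable.mono' (g := fun _ => |a u| * C) (integrableOn_const (by simp))
        (hψ.aestronglyMeasurable.const_smul _) (Eventually.of_forall fun t => ?_)
      rw [norm_smul, Real.norm_eq_abs]
      exact mul_le_mul_of_nonneg_left (hC t) (abs_nonneg _)
    · have e : (fun t => ‖K (t, u)‖) = indicator (Ico (u - d) (u + d)) fun t => ‖a u • ψ t‖ := by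
        ext t
        rw [show K (t, u) = indicator (Ico (u - d) (u + d)) (fun t => a u • ψ t) t from
          congrFun (hKu u) t, norm_indicator_eq_indicator_norm]
      rw [e, integral_indicator measurableSet_Ico]
      have h1 := norm_setIntegral_le_of_norm_le_const (μ := volume) (s := Ico (u - d) (u + d))
        (f := fun t => ‖a u • ψ t‖) (C := |a u| * C) (by simp) (fun t _ => by
          rw [norm_norm, norm_smul, Real.norm_eq_abs]
          exact mul_le_mul_of_nonneg_left (hC t) (abs_nonneg _))
      rw [Real.volume_real_Ico_of_le (by linarith)] at h1
      refine (le_abs_self _).trans (h1.trans (le_of_eq ?_))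
      ring
  have hm : AEStronglyMeasurable K ((volume : Measure ℝ).prod volume) :=
    (ha.aestronglyMeasurable.comp_snd.smul hψ.aestronglyMeasurable.comp_fst).indicator hset
  have hint : Integrable K ((volume : Measure ℝ).prod volume) :=
    integrable_prod_of_bound hm (ha.abs.const_mul (2 * d * C)) (Eventually.of_forall hbnd)
  have e1 : ∀ t, ∫ u, K (t, u) = (∫ u in (t - d)..(t + d), a u) • ψ t := by
    intro t
    rw [hKt, integral_indicator measurableSet_Ioc, integral_smul_const,
      intervalIntegral.integral_of_le (by linarith)]
  have e2 : ∀ u, ∫ t, K (t, u) = a u • ∫ t in (u - d)..(u + d), ψ t := by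
    intro u
    rw [hKu, integral_indicator measurableSet_Ico, integral_smul,
      intervalIntegral.integral_of_le (by linarith), integral_Ico_eq_integral_Ioo,
      integral_Ioc_eq_integral_Ioo]
  refine ⟨?_, ?_, ?_⟩
  · simpa only [e1] using hint.integral_prod_left
  · have h1 : ∫ t, ‖∫ u, K (t, u)‖ ≤ ∫ t, ∫ u, ‖K (t, u)‖ :=
      integral_mono hint.integral_prod_left.norm hint.norm.integral_prod_left
        fun t => norm_integral_le_integral_norm _
    rw [integral_integral_swap (f := fun t u => ‖K (t, u)‖) hint.norm] at h1
    simp only [e1] at h1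
    refine h1.trans ?_
    rw [← integral_const_mul]
    exact integral_mono hint.norm.integral_prod_right (ha.abs.const_mul _) fun u => (hbnd u).2
  · have := integral_integral_swap (f := fun t u => K (t, u)) hint
    simpa only [e1, e2] using this

end box

/-- The image of `Φ(· + y)` under the transformation operator. -/
noncomputable def transm {E : Type*} [NormedAddCommGroup E] [NormedSpace ℝ E] (q : ℝ → ℝ)
    (Φ : ℝ → E) (x y : ℝ) : E :=
  Φ (x + y) + ∫ s in Ioi x, kern q x s • Φ (s + y)

section transm
variable {E : Type*} [NormedAddCommGroup E] [NormedSpace ℝ E]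
variable {q : ℝ → ℝ} (hq : IsL11 q)
include hq

/-- A bound for `∫ |A(x, y)| dy`. -/
noncomputable def mass (q : ℝ → ℝ) : ℝ :=
  2 * kernConst q * ∫ s in Ioi 0, moment q s

omit hq in
theorem mass_nonneg : 0 ≤ mass q :=
  mul_nonneg (mul_nonneg zero_le_two kernConst_pos.le)
    (setIntegral_nonneg measurableSet_Ioi fun s hs => moment_nonneg s hs)

theorem integral_kern_le_mass {x : ℝ} (hx : 0 ≤ x) : ∫ y in Ioi x, |kern q x y| ≤ mass q :=
  (integrableOn_kern hq hx).2.trans (mul_le_mul_of_nonneg_left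
    ((sig_tail hq hx).2.trans (moment_tail_le hq hx)) (by linarith [kernConst_pos (q := q)]))

theorem kern_eq_zero_of_lt {x y : ℝ} (h : y < x) : kern q x y = 0 :=
  kern_zero hq fun hm => absurd hm.2.1 (not_le.2 h)

theorem setIntegral_Ioi_kern {x : ℝ} (g : ℝ → E) :
    ∫ u, kern q x u • g u = ∫ u in Ioi x, kern q x u • g u := by
  rw [← integral_Ici_eq_integral_Ioi, setIntegral_eq_integral_of_forall_compl_eq_zero]
  intro u hu
  rw [kern_eq_zero_of_lt hq (not_le.1 hu), zero_smul]

theorem integrable_kern {x : ℝ} (hx : 0 ≤ x) : Integrable (kern q x) := by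
  refine IntegrableOn.integrable_of_forall_notMem_eq_zero (s := Ici x)
    ((integrableOn_Ici_iff_integrableOn_Ioi).2 (integrableOn_kern hq hx).1) fun u hu => ?_
  exact kern_eq_zero_of_lt hq (not_le.1 hu)

theorem integral_abs_kern_le_mass {x : ℝ} (hx : 0 ≤ x) : ∫ u, |kern q x u| ≤ mass q := by
  have : ∫ u in Ici x, |kern q x u| = ∫ u, |kern q x u| :=
    setIntegral_eq_integral_of_forall_compl_eq_zero fun u hu => by
      rw [kern_eq_zero_of_lt hq (not_le.1 hu), abs_zero]
  rw [← this, integral_Ici_eq_integral_Ioi]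
  exact integral_kern_le_mass hq hx

theorem integrableOn_kern_smul {Φ : ℝ → E} (hΦ : StronglyMeasurable Φ) {x y C : ℝ} (hx : 0 ≤ x)
    (hC : ∀ z, x + y ≤ z → ‖Φ z‖ ≤ C) :
    IntegrableOn (fun s => kern q x s • Φ (s + y)) (Ioi x) := by
  refine Integrable.mono' ((integrableOn_kern hq hx).1.norm.mul_const C)
    ((integrableOn_kern hq hx).1.aestronglyMeasurable.smul
      (hΦ.comp_measurable (measurable_id.add_const y)).aestronglyMeasurable) ?_
  filter_upwards [ae_restrict_mem measurableSet_Ioi] with s hs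
  rw [norm_smul]
  exact mul_le_mul_of_nonneg_left (hC _ (by linarith [mem_Ioi.1 hs])) (norm_nonneg _)

theorem norm_integral_kern_smul_le {Φ : ℝ → E} {x y C : ℝ} (hx : 0 ≤ x)
    (hC : ∀ z, x + y ≤ z → ‖Φ z‖ ≤ C) :
    ‖∫ s in Ioi x, kern q x s • Φ (s + y)‖ ≤ C * mass q := by
  have hC0 : 0 ≤ C := (norm_nonneg _).trans (hC _ le_rfl)
  have : ‖∫ s in Ioi x, kern q x s • Φ (s + y)‖ ≤ ∫ s in Ioi x, C * |kern q x s| := by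
    refine norm_integral_le_of_norm_le ((integrableOn_kern hq hx).1.abs.const_mul C) ?_
    filter_upwards [ae_restrict_mem measurableSet_Ioi] with s hs
    rw [norm_smul, mul_comm, Real.norm_eq_abs]
    exact mul_le_mul_of_nonneg_right (hC _ (by linarith [mem_Ioi.1 hs])) (abs_nonneg _)
  rw [integral_const_mul] at this
  exact this.trans (mul_le_mul_of_nonneg_left (integral_kern_le_mass hq hx) hC0)

theorem norm_transm_le {Φ : ℝ → E} {x y C : ℝ} (hx : 0 ≤ x)
    (hC : ∀ z, x + y ≤ z → ‖Φ z‖ ≤ C) : ‖transm q Φ x y‖ ≤ C * (1 + mass q) := by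
  refine (norm_add_le _ _).trans ?_
  have := norm_integral_kern_smul_le hq hx hC
  have := hC _ le_rfl
  linarith

theorem stronglyMeasurable_transm {Φ : ℝ → E} (hΦ : StronglyMeasurable Φ) :
    StronglyMeasurable (Function.uncurry (transm q Φ)) := by
  refine (hΦ.comp_measurable (measurable_fst.add measurable_snd)).add ?_
  refine stronglyMeasurable_integral_Ioi (α := ℝ × ℝ)
    (B := fun p s => kern q p.1 s • Φ (s + p.2)) ?_ measurable_fst
  refine StronglyMeasurable.smul ?_ ?_
  · exact ((admissible_kern hq).meas.comp
      ((measurable_fst.comp measurable_fst).prodMk measurable_snd)).stronglyMeasurable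
  · exact hΦ.comp_measurable (measurable_snd.add (measurable_snd.comp measurable_fst))

variable [CompleteSpace E]

/-- `box_swap` moves the average from A(s, ·) to the translates of Φ. The cut-off at x costs
nothing: A(s, t) lives on t ≥ s, and for t > s the window around t starts at t - s + x > x. -/
theorem kernel_box {Φ : ℝ → E} (hΦ : StronglyMeasurable Φ) {x y s C : ℝ} (hx : 0 ≤ x)
    (hs : x < s) (hC : ∀ z, x + y ≤ z → ‖Φ z‖ ≤ C) :
    ∫ t, (∫ u in (t - s + x)..(t + s - x), kern q s u) • indicator (Ioi x) (fun t => Φ (t + y)) t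
      = ∫ u in (y - s + x)..(y + s - x), ∫ t in Ioi s, kern q s t • Φ (t + u) := by
  have hs0 : 0 ≤ s := hx.trans hs.le
  have hC0 : 0 ≤ C := (norm_nonneg _).trans (hC _ le_rfl)
  have hψ : StronglyMeasurable (indicator (Ioi x) (fun t => Φ (t + y))) :=
    (hΦ.comp_measurable (measurable_id.add_const y)).indicator measurableSet_Ioi
  have hψC : ∀ t, ‖indicator (Ioi x) (fun t => Φ (t + y)) t‖ ≤ C := by
    intro t
    by_cases ht : t ∈ Ioi x
    · rw [indicator_of_mem ht]; exact hC _ (by linarith [mem_Ioi.1 ht])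
    · rw [indicator_of_notMem ht, norm_zero]; exact hC0
  have h1 := (box_swap (integrable_kern hq hs0) hψ hψC (d := s - x) (by linarith)).2.2
  have e1 : ∀ t : ℝ, t - (s - x) = t - s + x := fun t => by ring
  have e2 : ∀ t : ℝ, t + (s - x) = t + s - x := fun t => by ring
  simp only [e1, e2] at h1
  rw [h1, setIntegral_Ioi_kern hq]
  have hswap : ∫ u in (y - s + x)..(y + s - x), ∫ t in Ioi s, kern q s t • Φ (t + u)
      = ∫ t in Ioi s, ∫ u in (y - s + x)..(y + s - x), kern q s t • Φ (t + u) := by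
    rw [intervalIntegral.integral_of_le (by linarith)]
    simp only [intervalIntegral.integral_of_le (show y - s + x ≤ y + s - x by linarith)]
    refine integral_integral_swap (f := fun u t => kern q s t • Φ (t + u)) ?_
    have hb : Integrable (fun p : ℝ × ℝ => ‖kern q s p.2‖ * C)
        ((volume.restrict (Ioc (y - s + x) (y + s - x))).prod (volume.restrict (Ioi s))) :=
      ((integrableOn_kern hq hs0).1.norm.comp_snd _).mul_const C
    refine hb.mono' ?_ ?_
    · refine ((integrableOn_kern hq hs0).1.aestronglyMeasurable.comp_snd).smul ?_
      exact (hΦ.comp_measurable (measurable_snd.add measurable_fst)).aestronglyMeasurable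
    · rw [Measure.prod_restrict]
      filter_upwards [ae_restrict_mem (measurableSet_Ioc.prod measurableSet_Ioi)] with p hp
      rw [Function.uncurry, norm_smul]
      exact mul_le_mul_of_nonneg_left (hC _ (by linarith [hp.1.1, mem_Ioi.1 hp.2])) (norm_nonneg _)
  rw [hswap]
  refine setIntegral_congr_fun measurableSet_Ioi fun t ht => ?_
  rw [mem_Ioi] at ht
  rw [intervalIntegral.integral_smul]
  congr 1
  have e3 : ∫ u in (y - s + x)..(y + s - x), Φ (t + u)
      = ∫ u in (t - s + x)..(t + s - x), Φ (u + y) := by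
    rw [intervalIntegral.integral_comp_add_left, intervalIntegral.integral_comp_add_right]
    congr 1 <;> ring
  rw [e3]
  refine intervalIntegral.integral_congr_ae (Eventually.of_forall fun u hu => ?_)
  rw [uIoc_of_le (by linarith)] at hu
  rw [indicator_of_mem]
  rw [mem_Ioi]; linarith [hu.1]

/-- Fubini over x < t < 2s - x; the substitution t + y = s + u turns this range of t into the inner
interval of the Volterra operator. -/
theorem potential_box {Φ : ℝ → E} (hΦ : StronglyMeasurable Φ) {x y C : ℝ} (hx : 0 ≤ x)
    (hC : ∀ z, x + y ≤ z → ‖Φ z‖ ≤ C) :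
    IntegrableOn (fun s => q s • ∫ u in (y - s + x)..(y + s - x), Φ (s + u)) (Ioi x) ∧
    IntegrableOn (fun t => (∫ s in Ioi ((x + t) / 2), q s) • Φ (t + y)) (Ioi x) ∧
    ∫ t in Ioi x, (∫ s in Ioi ((x + t) / 2), q s) • Φ (t + y)
      = ∫ s in Ioi x, q s • ∫ u in (y - s + x)..(y + s - x), Φ (s + u) := by
  have hC0 : 0 ≤ C := (norm_nonneg _).trans (hC _ le_rfl)
  have hset : MeasurableSet {p : ℝ × ℝ | x + p.1 < 2 * p.2} :=
    measurableSet_lt (by fun_prop) (by fun_prop)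
  set K : ℝ × ℝ → E := indicator {p : ℝ × ℝ | x + p.1 < 2 * p.2}
    fun p => q p.2 • Φ (p.1 + y) with hK
  have hKs : ∀ s, (fun t => K (t, s)) = indicator (Iio (2 * s - x)) fun t => q s • Φ (t + y) := by
    intro s; ext t
    simp only [hK, indicator, mem_ofPred_eq, mem_Iio]
    have : (x + t < 2 * s) ↔ t < 2 * s - x := by constructor <;> intro h <;> linarith
    simp only [this]
  have hKt : ∀ t, (fun s => K (t, s)) = indicator (Ioi ((x + t) / 2)) fun s => q s • Φ (t + y) := by
    intro t; ext s
    simp only [hK, indicator, mem_ofPred_eq, mem_Ioi]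
    have : (x + t < 2 * s) ↔ (x + t) / 2 < s := by constructor <;> intro h <;> linarith
    simp only [this]
  have hm : AEStronglyMeasurable K ((volume.restrict (Ioi x)).prod (volume.restrict (Ioi x))) :=
    ((aestronglyMeasurable_q hq hx).comp_snd.smul
      (hΦ.comp_measurable (measurable_fst.add_const y)).aestronglyMeasurable).indicator hset
  have hint : Integrable K ((volume.restrict (Ioi x)).prod (volume.restrict (Ioi x))) := by
    refine integrable_prod_of_bound hm (((integrableOn_moment hq).mono_set
      (Ioi_subset_Ioi hx)).const_mul (2 * C)) ?_
    filter_upwards [ae_restrict_mem measurableSet_Ioi] with s hs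
    rw [mem_Ioi] at hs
    have hbd : ∀ t ∈ Ioo x (2 * s - x), ‖q s • Φ (t + y)‖ ≤ |q s| * C := by
      intro t ht
      rw [norm_smul, Real.norm_eq_abs]
      exact mul_le_mul_of_nonneg_left (hC _ (by linarith [ht.1])) (abs_nonneg _)
    constructor
    · rw [hKs, integrable_indicator_iff measurableSet_Iio, IntegrableOn,
        Measure.restrict_restrict measurableSet_Iio, inter_comm, Ioi_inter_Iio]
      refine Integrable.mono' (g := fun _ => |q s| * C) (integrableOn_const (by simp))
        ((hΦ.comp_measurable (measurable_id.add_const y)).aestronglyMeasurable.const_smul _) ?_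
      filter_upwards [ae_restrict_mem measurableSet_Ioo] with t ht using hbd t ht
    · have e : (fun t => ‖K (t, s)‖) = indicator (Iio (2 * s - x)) fun t => ‖q s • Φ (t + y)‖ := by
        ext t
        rw [show K (t, s) = indicator (Iio (2 * s - x)) (fun t => q s • Φ (t + y)) t from
          congrFun (hKs s) t, norm_indicator_eq_indicator_norm]
      rw [e, setIntegral_indicator measurableSet_Iio, Ioi_inter_Iio]
      have h1 := norm_setIntegral_le_of_norm_le_const (μ := volume) (s := Ioo x (2 * s - x))
        (f := fun t => ‖q s • Φ (t + y)‖) (C := |q s| * C) (by simp) (fun t ht => by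
          rw [norm_norm]; exact hbd t ht)
      rw [Real.volume_real_Ioo_of_le (by linarith)] at h1
      refine (le_abs_self _).trans (h1.trans ?_)
      rw [moment]
      nlinarith [mul_nonneg (abs_nonneg (q s)) hC0]
  have e1 : ∀ t ∈ Ioi x, ∫ s in Ioi x, K (t, s) = (∫ s in Ioi ((x + t) / 2), q s) • Φ (t + y) := by
    intro t ht
    rw [mem_Ioi] at ht
    rw [hKt, setIntegral_indicator measurableSet_Ioi, Ioi_inter_Ioi,
      sup_eq_right.2 (by linarith), integral_smul_const]
  have e2 : ∀ s ∈ Ioi x, ∫ t in Ioi x, K (t, s)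
      = q s • ∫ u in (y - s + x)..(y + s - x), Φ (s + u) := by
    intro s hs
    rw [mem_Ioi] at hs
    rw [hKs, setIntegral_indicator measurableSet_Iio, Ioi_inter_Iio, integral_smul,
      ← integral_Ioc_eq_integral_Ioo, ← intervalIntegral.integral_of_le (by linarith),
      intervalIntegral.integral_comp_add_right, intervalIntegral.integral_comp_add_left]
    congr 2 <;> ring
  refine ⟨?_, ?_, ?_⟩
  · exact hint.integral_prod_right.congr (by
      filter_upwards [ae_restrict_mem measurableSet_Ioi] with s hs using e2 s hs)
  · exact hint.integral_prod_left.congr (by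
      filter_upwards [ae_restrict_mem measurableSet_Ioi] with s hs using e1 s hs)
  · rw [← setIntegral_congr_fun measurableSet_Ioi e1, ← setIntegral_congr_fun measurableSet_Ioi e2]
    exact integral_integral_swap (f := fun t s => K (t, s)) hint

/-- The counterpart of `potential_box` for the second term of the equation for A. Absolute
convergence comes from the window length 2(s - x) ≤ 2s, which leaves the first moment of q. -/
theorem kernel_fubini {Φ : ℝ → E} (hΦ : StronglyMeasurable Φ) {x y C : ℝ} (hx : 0 ≤ x)
    (hC : ∀ z, x + y ≤ z → ‖Φ z‖ ≤ C) :
    IntegrableOn (fun s => q s • ∫ u in (y - s + x)..(y + s - x),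
      ∫ t in Ioi s, kern q s t • Φ (t + u)) (Ioi x) ∧
    ∫ t in Ioi x, (∫ s in Ioi x, q s * ∫ u in (t - s + x)..(t + s - x), kern q s u) • Φ (t + y)
      = ∫ s in Ioi x, q s • ∫ u in (y - s + x)..(y + s - x),
        ∫ t in Ioi s, kern q s t • Φ (t + u) := by
  have hC0 : 0 ≤ C := (norm_nonneg _).trans (hC _ le_rfl)
  set ψ : ℝ → E := indicator (Ioi x) (fun t => Φ (t + y)) with hψdef
  have hψ : StronglyMeasurable ψ :=
    (hΦ.comp_measurable (measurable_id.add_const y)).indicator measurableSet_Ioi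
  have hψC : ∀ t, ‖ψ t‖ ≤ C := by
    intro t
    by_cases ht : t ∈ Ioi x
    · rw [hψdef, indicator_of_mem ht]; exact hC _ (by linarith [mem_Ioi.1 ht])
    · rw [hψdef, indicator_of_notMem ht, norm_zero]; exact hC0
  set K : ℝ × ℝ → E := fun p => q p.2 •
    ((∫ u in (p.1 - p.2 + x)..(p.1 + p.2 - x), kern q p.2 u) • ψ p.1) with hK
  have e1 : ∀ t s : ℝ, t - (s - x) = t - s + x := fun t s => by ring
  have e2 : ∀ t s : ℝ, t + (s - x) = t + s - x := fun t s => by ring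
  have hm : AEStronglyMeasurable K ((volume : Measure ℝ).prod (volume.restrict (Ioi x))) := by
    refine (aestronglyMeasurable_q hq hx).comp_snd.smul
      (StronglyMeasurable.aestronglyMeasurable (StronglyMeasurable.smul ?_
        (hψ.comp_measurable measurable_fst)))
    exact stronglyMeasurable_intervalIntegral (α := ℝ × ℝ) (B := fun p u => kern q p.2 u)
      ((admissible_kern hq).meas.comp
        ((measurable_snd.comp measurable_fst).prodMk measurable_snd)).stronglyMeasurable
      (by fun_prop) (by fun_prop)
  have hint : Integrable K ((volume : Measure ℝ).prod (volume.restrict (Ioi x))) := by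
    refine integrable_prod_of_bound hm (((integrableOn_moment hq).mono_set
      (Ioi_subset_Ioi hx)).const_mul (2 * C * mass q)) ?_
    filter_upwards [ae_restrict_mem measurableSet_Ioi] with s hs
    rw [mem_Ioi] at hs
    have hs0 : 0 ≤ s := hx.trans hs.le
    obtain ⟨h1, h2, -⟩ := box_swap (integrable_kern hq hs0) hψ hψC (d := s - x) (by linarith)
    simp only [e1, e2] at h1 h2
    refine ⟨h1.smul (q s), ?_⟩
    simp only [hK, norm_smul (q s)]
    rw [integral_const_mul, Real.norm_eq_abs, moment]
    have h3 := integral_abs_kern_le_mass hq hs0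
    have hM := mass_nonneg (q := q)
    calc |q s| * _ ≤ |q s| * (2 * (s - x) * C * ∫ u, |kern q s u|) := by gcongr
      _ ≤ |q s| * (2 * (s - x) * C * mass q) := by
        have : 0 ≤ 2 * (s - x) * C := mul_nonneg (by linarith) hC0
        gcongr
      _ ≤ |q s| * (2 * s * C * mass q) := by gcongr; linarith
      _ = _ := by ring
  have e3 : ∀ s ∈ Ioi x, ∫ t, K (t, s) = q s • ∫ u in (y - s + x)..(y + s - x),
      ∫ t in Ioi s, kern q s t • Φ (t + u) := by
    intro s hs
    rw [← kernel_box hq hΦ hx hs hC, ← integral_smul]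
  constructor
  · exact hint.integral_prod_right.congr (by
      filter_upwards [ae_restrict_mem measurableSet_Ioi] with s hs using e3 s hs)
  · rw [← setIntegral_congr_fun measurableSet_Ioi e3,
      ← integral_integral_swap (f := fun t s => K (t, s)) hint, ← integral_indicator measurableSet_Ioi]
    refine integral_congr_ae (Eventually.of_forall fun t => ?_)
    by_cases ht : t ∈ Ioi x
    · simp only [hK, hψdef, indicator_of_mem ht, smul_smul]
      exact (integral_smul_const _ _).symm
    · simp only [hK, hψdef, indicator_of_notMem ht, smul_zero, integral_zero]

/-- The integral equation satisfied by the images of translates under the transformation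
operator. -/
theorem transm_eq {Φ : ℝ → E} (hΦ : StronglyMeasurable Φ) {x y C : ℝ} (hx : 0 ≤ x)
    (hC : ∀ z, x + y ≤ z → ‖Φ z‖ ≤ C) :
    IntegrableOn (fun s => q s • ∫ u in (y - s + x)..(y + s - x), transm q Φ s u) (Ioi x) ∧
    transm q Φ x y = Φ (x + y) +
      (1 / 2 : ℝ) • ∫ s in Ioi x, q s • ∫ u in (y - s + x)..(y + s - x), transm q Φ s u := by
  -- This is d'Alembert's formula for W_xx - q W = W_yy. The equation for A splits the integral of
  -- A(x, t) Φ(t + y) in two; the first half produces q against averages of Φ(s + u), the second q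
  -- against averages of the A-part, and together they form the averages of `transm`. No order
  -- between x and y is needed, only a bound for Φ beyond x + y.
  obtain ⟨p1, p2, p3⟩ := potential_box hq hΦ hx hC
  obtain ⟨k1, k2⟩ := kernel_fubini hq hΦ hx hC
  have hadd : ∀ s ∈ Ioi x, q s • (∫ u in (y - s + x)..(y + s - x), Φ (s + u)) +
      q s • (∫ u in (y - s + x)..(y + s - x), ∫ t in Ioi s, kern q s t • Φ (t + u))
      = q s • ∫ u in (y - s + x)..(y + s - x), transm q Φ s u := by
    intro s hs
    rw [mem_Ioi] at hs
    have hs0 : 0 ≤ s := hx.trans hs.le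
    rw [← smul_add, ← intervalIntegral.integral_add]
    · rfl
    · rw [intervalIntegrable_iff_integrableOn_Ioc_of_le (by linarith)]
      refine Integrable.mono' (g := fun _ => C) (integrableOn_const (by simp))
        (hΦ.comp_measurable (measurable_id.const_add s)).aestronglyMeasurable ?_
      filter_upwards [ae_restrict_mem measurableSet_Ioc] with u hu
      exact hC _ (by linarith [hu.1])
    · rw [intervalIntegrable_iff_integrableOn_Ioc_of_le (by linarith)]
      refine Integrable.mono' (g := fun _ => C * mass q) (integrableOn_const (by simp)) ?_ ?_
      · refine (stronglyMeasurable_integral_Ioi (α := ℝ) (B := fun u t => kern q s t • Φ (t + u))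
          (a := fun _ => s) ?_ measurable_const).aestronglyMeasurable
        exact (((admissible_kern hq).meas.of_uncurry_left.comp
          measurable_snd).stronglyMeasurable).smul
          (hΦ.comp_measurable (measurable_snd.add measurable_fst))
      · filter_upwards [ae_restrict_mem measurableSet_Ioc] with u hu
        exact norm_integral_kern_smul_le hq hs0 fun z hz => hC z (by linarith [hu.1])
  have hI := p1.add k1
  refine ⟨hI.congr_fun hadd measurableSet_Ioi, ?_⟩
  rw [transm]
  congr 1
  rw [← setIntegral_congr_fun measurableSet_Ioi hadd, integral_add p1 k1, ← p3, ← k2]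
  have hk := integrableOn_kern_smul hq hΦ hx hC
  have hsplit : ∀ t ∈ Ioi x, kern q x t • Φ (t + y)
      = (1 / 2 : ℝ) • ((∫ s in Ioi ((x + t) / 2), q s) • Φ (t + y)) +
        (1 / 2 : ℝ) • ((∫ s in Ioi x, q s * ∫ u in (t - s + x)..(t + s - x), kern q s u) •
          Φ (t + y)) := by
    intro t ht
    rw [kern_eq hq ⟨hx, le_of_lt ht, lt_of_le_of_lt hx ht⟩, volt, add_smul, mul_smul, mul_smul]
  have hk2 : IntegrableOn (fun t => (1 / 2 : ℝ) • ((∫ s in Ioi x, q s *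
      ∫ u in (t - s + x)..(t + s - x), kern q s u) • Φ (t + y))) (Ioi x) := by
    refine (hk.sub (p2.smul (1 / 2 : ℝ))).congr_fun (fun t ht => ?_) measurableSet_Ioi
    simp only [Pi.sub_apply, Pi.smul_apply]
    rw [hsplit t ht, add_sub_cancel_left]
  have hp2 : IntegrableOn (fun t => (1 / 2 : ℝ) • ((∫ s in Ioi ((x + t) / 2), q s) • Φ (t + y)))
    (Ioi x) := p2.smul (1 / 2 : ℝ)
  rw [setIntegral_congr_fun measurableSet_Ioi hsplit, integral_add hp2 hk2,
    integral_smul, integral_smul, smul_add]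

end transm
end HalfLine
-- Solutions of the equation and their Wronskians
namespace HalfLine

/-- The product rule for primitives of integrable functions. -/
theorem integral_product_rule {p r P R : ℝ → ℂ} {a b : ℝ} (hab : a ≤ b)
    (hp : IntervalIntegrable p volume a b) (hr : IntervalIntegrable r volume a b)
    (hP : ∀ x ∈ Icc a b, P x - P a = ∫ t in a..x, p t)
    (hR : ∀ x ∈ Icc a b, R x - R a = ∫ t in a..x, r t) :
    P b * R b - P a * R a = ∫ x in a..b, (p x * R x + P x * r x) := by
  have hp' := (intervalIntegrable_iff_integrableOn_Ioc_of_le hab).1 hp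
  have hr' := (intervalIntegrable_iff_integrableOn_Ioc_of_le hab).1 hr
  have hext : ∀ {f : ℝ → ℂ}, IntegrableOn f (Ioc a b) →
      IntegrableOn (indicator (Iic b) f) (Ioi a) := by
    intro f hf
    rw [IntegrableOn, integrable_indicator_iff measurableSet_Iic, IntegrableOn,
      Measure.restrict_restrict measurableSet_Iic, inter_comm, Ioi_inter_Iic]
    exact hf
  have hp0 := hext hp'
  have hr0 := hext hr'
  have hPc : ContinuousOn P (Icc a b) := by
    have h1 := intervalIntegral.continuousOn_primitive_interval' hp left_mem_uIcc
    rw [uIcc_of_le hab] at h1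
    exact (h1.add (continuousOn_const (c := P a))).congr fun x hx => by
      have := hP x hx
      simp only [Pi.add_apply]
      linear_combination this
  have hRc : ContinuousOn R (Icc a b) := by
    have h1 := intervalIntegral.continuousOn_primitive_interval' hr left_mem_uIcc
    rw [uIcc_of_le hab] at h1
    exact (h1.add (continuousOn_const (c := R a))).congr fun x hx => by
      have := hR x hx
      simp only [Pi.add_apply]
      linear_combination this
  have hpR : IntervalIntegrable (fun x => p x * R x) volume a b :=
    hp.mul_continuousOn (by rwa [uIcc_of_le hab])
  have hPr : IntervalIntegrable (fun x => P x * r x) volume a b :=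
    hr.continuousOn_mul (by rwa [uIcc_of_le hab])
  -- Both sides are the double integral of r(t) p(s) over a < t < s ≤ b; the indicators reduce the
  -- half-lines of the general swap to (a, b].
  have hswap := integral_triangle_swap
    (G := fun t s => indicator (Iic b) r t * indicator (Iic b) p s) (a := a)
    (hr0.aestronglyMeasurable.comp_fst.mul hp0.aestronglyMeasurable.comp_snd)
    (b := fun s => (∫ t in Ioi a, ‖indicator (Iic b) r t‖) * ‖indicator (Iic b) p s‖)
    (hp0.norm.const_mul _) (by
      refine Eventually.of_forall fun s => ⟨(hr0.mono_set fun t ht => ht.1).mul_const _, ?_⟩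
      simp only [norm_mul]
      rw [integral_mul_const]
      exact mul_le_mul_of_nonneg_right (setIntegral_mono_set hr0.norm
        (Eventually.of_forall fun _ => norm_nonneg _)
        Ioo_subset_Ioi_self.eventuallyLE) (norm_nonneg _))
  have hl : ∫ t in Ioi a, ∫ s in Ioi t, indicator (Iic b) r t * indicator (Iic b) p s
      = ∫ t in a..b, r t * (P b - P t) := by
    rw [intervalIntegral.integral_of_le hab, ← Ioi_inter_Iic, ← setIntegral_indicator
      measurableSet_Iic]
    refine setIntegral_congr_fun measurableSet_Ioi fun t ht => ?_
    rw [mem_Ioi] at ht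
    by_cases htb : t ∈ Iic b
    · rw [mem_Iic] at htb
      simp only [indicator_of_mem (show t ∈ Iic b from htb)]
      rw [integral_const_mul, setIntegral_indicator measurableSet_Iic, Ioi_inter_Iic,
        ← intervalIntegral.integral_of_le htb]
      congr 1
      rw [← intervalIntegral.integral_interval_sub_left hp
        (hp.mono_set (by rw [uIcc_of_le hab, uIcc_of_le ht.le]; exact Icc_subset_Icc le_rfl htb)),
        ← hP b ⟨hab, le_rfl⟩, ← hP t ⟨ht.le, htb⟩]
      ring
    · simp only [indicator_of_notMem htb, zero_mul, integral_zero]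
  have hrr : ∫ s in Ioi a, ∫ t in Ioo a s, indicator (Iic b) r t * indicator (Iic b) p s
      = ∫ s in a..b, p s * (R s - R a) := by
    rw [intervalIntegral.integral_of_le hab, ← Ioi_inter_Iic, ← setIntegral_indicator
      measurableSet_Iic]
    refine setIntegral_congr_fun measurableSet_Ioi fun s hs => ?_
    rw [mem_Ioi] at hs
    by_cases hsb : s ∈ Iic b
    · rw [mem_Iic] at hsb
      simp only [indicator_of_mem (show s ∈ Iic b from hsb)]
      rw [integral_mul_const, mul_comm, hR s ⟨hs.le, hsb⟩, intervalIntegral.integral_of_le hs.le,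
        integral_Ioc_eq_integral_Ioo]
      congr 1
      refine setIntegral_congr_fun measurableSet_Ioo fun t ht => ?_
      rw [indicator_of_mem (show t ∈ Iic b from ht.2.le.trans hsb)]
    · simp only [indicator_of_notMem hsb, mul_zero, integral_zero]
  rw [hl, hrr] at hswap
  have h1 : ∫ t in a..b, r t * (P b - P t) = P b * (R b - R a) - ∫ t in a..b, P t * r t := by
    rw [hR b ⟨hab, le_rfl⟩, ← intervalIntegral.integral_const_mul, ← intervalIntegral.integral_sub
      (hr.const_mul _) hPr]
    exact intervalIntegral.integral_congr fun t _ => by ring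
  have h2 : ∫ s in a..b, p s * (R s - R a) = (∫ s in a..b, p s * R s) - (P b - P a) * R a := by
    rw [hP b ⟨hab, le_rfl⟩, ← intervalIntegral.integral_mul_const, ← intervalIntegral.integral_sub
      hpR (hp.mul_const _)]
    exact intervalIntegral.integral_congr fun t _ => by ring
  rw [intervalIntegral.integral_add hpR hPr]
  rw [h1, h2] at hswap
  linear_combination hswap

/-- Solutions `u` of `-u'' + q u = E u` with derivative `v`. -/
structure Sol (q : ℝ → ℝ) (E : ℂ) (u v : ℝ → ℂ) : Prop where
  cont : ContinuousOn u (Ici 0)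
  deriv : ∀ x, 0 < x → HasDerivAt u (v x) x
  eq : ∀ a b, 0 < a → a ≤ b → v b - v a = ∫ t in a..b, ((q t : ℂ) - E) * u t

section Sol
variable {q : ℝ → ℝ} (hq : IsL11 q) {E : ℂ} {u v : ℝ → ℂ}
include hq

theorem integrableOn_q_complex {x : ℝ} (hx : 0 < x) :
    IntegrableOn (fun t => (q t : ℂ)) (Ioi x) := (integrableOn_q hq hx).ofReal

theorem Sol.intervalIntegrable (h : Sol q E u v) {a b : ℝ} (ha : 0 < a) (hb : 0 < b) :
    IntervalIntegrable (fun t => ((q t : ℂ) - E) * u t) volume a b := by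
  refine IntervalIntegrable.mul_continuousOn ?_ (h.cont.mono fun t ht =>
    le_trans (le_min ha.le hb.le) ht.1)
  refine IntervalIntegrable.sub ?_ intervalIntegrable_const
  exact intervalIntegrable_of_Ioi (integrableOn_q_complex hq (half_pos (lt_min ha hb)))
    (by linarith [min_le_left a b, lt_min ha hb]) (by linarith [min_le_right a b, lt_min ha hb])

theorem Sol.continuousOn (h : Sol q E u v) : ContinuousOn v (Ioi 0) := by
  intro x hx
  rw [mem_Ioi] at hx
  have h1 := intervalIntegral.continuousOn_primitive_interval'
    (h.intervalIntegrable hq (half_pos hx) (by linarith : 0 < x + 1)) left_mem_uIcc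
  rw [uIcc_of_le (by linarith)] at h1
  have h2 : ContinuousOn v (Icc (x / 2) (x + 1)) :=
    (h1.add (continuousOn_const (c := v (x / 2)))).congr fun t ht => by
      have := h.eq (x / 2) t (half_pos hx) ht.1
      simp only [Pi.add_apply]
      linear_combination this
  exact (h2.continuousAt (Icc_mem_nhds (by linarith) (by linarith))).continuousWithinAt

theorem Sol.intervalIntegrable_deriv (h : Sol q E u v) {a b : ℝ} (ha : 0 < a) (hb : 0 < b) :
    IntervalIntegrable v volume a b :=
  ((h.continuousOn hq).mono fun _ ht => lt_of_lt_of_le (lt_min ha hb) ht.1).intervalIntegrable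

theorem Sol.sub_eq (h : Sol q E u v) {a b : ℝ} (ha : 0 < a) (hab : a ≤ b) :
    u b - u a = ∫ t in a..b, v t :=
  (intervalIntegral.integral_eq_sub_of_hasDerivAt (fun t ht => h.deriv t (by
    rw [uIcc_of_le hab] at ht; exact lt_of_lt_of_le ha ht.1))
    (h.intervalIntegrable_deriv hq ha (ha.trans_le hab))).symm

/-- In the derivative of u v' - v u' the products v v' and the terms with q cancel; the difference
of the energies is left. -/
theorem Sol.wronskian {E' : ℂ} {u' v' : ℝ → ℂ} (h : Sol q E u v) (h' : Sol q E' u' v') {a b : ℝ}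
    (ha : 0 < a) (hab : a ≤ b) :
    (u b * v' b - v b * u' b) - (u a * v' a - v a * u' a) = (E - E') * ∫ x in a..b, u x * u' x := by
  have hb := ha.trans_le hab
  have hsub : uIcc a b ⊆ Ici 0 := fun t ht => by
    rw [uIcc_of_le hab] at ht; exact ha.le.trans ht.1
  have hsub' : uIcc a b ⊆ Ioi 0 := fun t ht => by
    rw [uIcc_of_le hab] at ht; exact ha.trans_le ht.1
  have h1 := integral_product_rule hab (h.intervalIntegrable_deriv hq ha hb)
    (h'.intervalIntegrable hq ha hb) (fun x hx => h.sub_eq hq ha hx.1)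
    (fun x hx => h'.eq a x ha hx.1)
  have h2 := integral_product_rule hab (h.intervalIntegrable hq ha hb)
    (h'.intervalIntegrable_deriv hq ha hb) (fun x hx => h.eq a x ha hx.1)
    (fun x hx => h'.sub_eq hq ha hx.1)
  have i1 : IntervalIntegrable (fun x => v x * v' x) volume a b :=
    (h.intervalIntegrable_deriv hq ha hb).mul_continuousOn ((h'.continuousOn hq).mono hsub')
  have i2 : IntervalIntegrable (fun x => u x * (((q x : ℂ) - E') * u' x)) volume a b :=
    (h'.intervalIntegrable hq ha hb).continuousOn_mul (h.cont.mono hsub)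
  have i3 : IntervalIntegrable (fun x => ((q x : ℂ) - E) * u x * u' x) volume a b :=
    (h.intervalIntegrable hq ha hb).mul_continuousOn (h'.cont.mono hsub)
  have h3 := intervalIntegral.integral_sub (i1.add i2) (i3.add i1)
  rw [show u b * v' b - v b * u' b - (u a * v' a - v a * u' a)
    = (u b * v' b - u a * v' a) - (v b * u' b - v a * u' a) by ring, h1, h2,
    ← intervalIntegral.integral_const_mul]
  refine h3.symm.trans (intervalIntegral.integral_congr fun x _ => ?_)
  ring

theorem Sol.sub {u' v' : ℝ → ℂ} (h : Sol q E u v) (h' : Sol q E u' v') :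
    Sol q E (fun x => u x - u' x) (fun x => v x - v' x) where
  cont := h.cont.sub h'.cont
  deriv x hx := (h.deriv x hx).sub (h'.deriv x hx)
  eq a b ha hab := by
    have := intervalIntegral.integral_sub (h.intervalIntegrable hq ha (ha.trans_le hab))
      (h'.intervalIntegrable hq ha (ha.trans_le hab))
    rw [← h.eq a b ha hab, ← h'.eq a b ha hab] at this
    rw [show v b - v' b - (v a - v' a) = v b - v a - (v' b - v' a) by ring, ← this]
    exact intervalIntegral.integral_congr fun x _ => by ring

end Sol
end HalfLine
-- Jost solutions from the kernel
namespace HalfLine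

theorem norm_cexp_I_mul (k : ℂ) (x : ℝ) :
    ‖Complex.exp (Complex.I * k * x)‖ = Real.exp (-(k.im * x)) := by
  rw [Complex.norm_exp]; congr 1; simp

theorem hasDerivAt_tail {f : ℝ → ℂ} {c x : ℝ} (hf : IntegrableOn f (Ioi c))
    (hc : ContinuousOn f (Ioi c)) (hx : c < x) :
    HasDerivAt (fun x => ∫ s in Ioi x, f s) (-f x) x := by
  have h1 : HasDerivAt (fun x => ∫ s in c..x, f s) (f x) x :=
    intervalIntegral.integral_hasDerivAt_right (intervalIntegrable_of_Ioi hf le_rfl hx.le)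
      (hc.stronglyMeasurableAtFilter isOpen_Ioi x hx) (hc.continuousAt (Ioi_mem_nhds hx))
  have h2 := (hasDerivAt_const x (∫ s in Ioi c, f s)).sub h1
  rw [zero_sub] at h2
  refine h2.congr_of_eventuallyEq ?_
  filter_upwards [Ioi_mem_nhds hx] with t ht
  simp only [Pi.sub_apply]
  rw [← intervalIntegral.integral_interval_add_Ioi hf (hf.mono_set (Ioi_subset_Ioi (le_of_lt ht)))]
  ring

theorem tendsto_tail {E : Type*} [NormedAddCommGroup E] [NormedSpace ℝ E] {f : ℝ → E} {c : ℝ}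
    (hf : IntegrableOn f (Ioi c)) : Tendsto (fun x => ∫ s in Ioi x, f s) atTop (𝓝 0) := by
  have h1 := (tendsto_const_nhds (x := ∫ s in Ioi c, f s)).sub
    (intervalIntegral_tendsto_integral_Ioi c hf tendsto_id)
  rw [sub_self] at h1
  refine h1.congr' ?_
  filter_upwards [eventually_ge_atTop c] with t ht
  rw [← intervalIntegral.integral_interval_add_Ioi hf (hf.mono_set (Ioi_subset_Ioi ht))]
  exact add_sub_cancel_left _ _

theorem hasDerivAt_cexp (c : ℂ) (x : ℝ) :
    HasDerivAt (fun x : ℝ => Complex.exp (c * x)) (c * Complex.exp (c * x)) x := by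
  have h := ((Complex.ofRealCLM.hasDerivAt (x := x)).const_mul c).cexp
  exact h.congr_deriv (by simp [mul_comm])

/-- The Jost solution without its exponential factor. -/
noncomputable def reduced (q : ℝ → ℝ) (k : ℂ) (x : ℝ) : ℂ :=
  Complex.exp (-(Complex.I * k * x)) * kernelJost (kern q) x k

section jost
variable {q : ℝ → ℝ} (hq : IsL11 q)

/-- For an exponential the translation by y is a scalar factor. Hence `transm_eq`, an equation in
two variables, becomes a Volterra equation in x for the candidate Jost solution. -/
theorem transm_exp (k : ℂ) (x y : ℝ) :
    transm q (fun z : ℝ => Complex.exp (Complex.I * k * z)) x y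
      = Complex.exp (Complex.I * k * y) * kernelJost (kern q) x k := by
  have h : ∀ s : ℝ, Complex.exp (Complex.I * k * ((s + y : ℝ) : ℂ))
      = Complex.exp (Complex.I * k * y) * Complex.exp (Complex.I * k * s) := by
    intro s; rw [← Complex.exp_add]; congr 1; push_cast; ring
  rw [transm, kernelJost, mul_add, h, ← integral_const_mul]
  congr 1
  refine setIntegral_congr_fun measurableSet_Ioi fun s _ => ?_
  simp only [h, Complex.real_smul]
  ring

theorem kernelJost_eq_exp_mul (k : ℂ) (x : ℝ) :
    kernelJost (kern q) x k = Complex.exp (Complex.I * k * x) * reduced q k x := by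
  rw [reduced, ← mul_assoc, ← Complex.exp_add, add_neg_cancel, Complex.exp_zero, one_mul]

include hq

theorem norm_reduced_le {k : ℂ} (hk : 0 ≤ k.im) {x : ℝ} (hx : 0 ≤ x) :
    ‖reduced q k x‖ ≤ 1 + mass q := by
  have h := norm_transm_le hq (Φ := fun z : ℝ => Complex.exp (Complex.I * k * z)) (x := x) (y := 0)
    (C := Real.exp (-(k.im * x))) hx fun z hz => by
      rw [norm_cexp_I_mul]
      refine Real.exp_le_exp.2 (neg_le_neg (mul_le_mul_of_nonneg_left ?_ hk))
      linarith
  rw [transm_exp, Complex.ofReal_zero, mul_zero, Complex.exp_zero, one_mul] at h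
  rw [reduced, norm_mul, show -(Complex.I * k * x) = Complex.I * k * ((-x : ℝ) : ℂ) by
    push_cast; ring, norm_cexp_I_mul]
  calc _ ≤ Real.exp (-(k.im * -x)) * (Real.exp (-(k.im * x)) * (1 + mass q)) := by gcongr
    _ = 1 + mass q := by rw [← mul_assoc, ← Real.exp_add]; simp

theorem norm_kernelJost_le {k : ℂ} (hk : 0 ≤ k.im) {x : ℝ} (hx : 0 ≤ x) :
    ‖kernelJost (kern q) x k‖ ≤ (1 + mass q) * Real.exp (-(k.im * x)) := by
  rw [kernelJost_eq_exp_mul, norm_mul, norm_cexp_I_mul, mul_comm]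
  exact mul_le_mul_of_nonneg_right (norm_reduced_le hq hk hx) (Real.exp_pos _).le

theorem stronglyMeasurable_kernelJost (k : ℂ) :
    StronglyMeasurable fun x => kernelJost (kern q) x k := by
  have h := (stronglyMeasurable_transm hq (Φ := fun z : ℝ => Complex.exp (Complex.I * k * z))
    (Continuous.stronglyMeasurable (by fun_prop))).comp_measurable
    (measurable_id.prodMk (measurable_const (a := (0 : ℝ))))
  convert h using 1
  ext x
  simp [Function.uncurry, transm_exp]

theorem stronglyMeasurable_reduced (k : ℂ) : StronglyMeasurable (reduced q k) :=
  (Continuous.stronglyMeasurable (by fun_prop)).mul (stronglyMeasurable_kernelJost hq k)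

/-- The derivative of `reduced`, up to sign and an exponential factor. -/
noncomputable def reducedAux (q : ℝ → ℝ) (k : ℂ) (t : ℝ) : ℂ :=
  ∫ s in Ioi t, (q s : ℂ) * reduced q k s * Complex.exp (2 * Complex.I * k * s)

omit hq in
theorem norm_cexp_two (k : ℂ) (x : ℝ) :
    ‖Complex.exp (2 * Complex.I * k * x)‖ = Real.exp (-(2 * k.im * x)) := by
  rw [Complex.norm_exp]; congr 1; simp

theorem integrableOn_reducedAux {k : ℂ} (hk : 0 ≤ k.im) {t : ℝ} (ht : 0 < t) :
    IntegrableOn (fun s : ℝ => (q s : ℂ) * reduced q k s * Complex.exp (2 * Complex.I * k * s))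
      (Ioi t) := by
  refine Integrable.mono' ((integrableOn_q hq ht).abs.mul_const (1 + mass q))
    (((integrableOn_q_complex hq ht).aestronglyMeasurable.mul
      (stronglyMeasurable_reduced hq k).aestronglyMeasurable).mul
      (Continuous.aestronglyMeasurable (by fun_prop))) ?_
  filter_upwards [ae_restrict_mem measurableSet_Ioi] with s hs
  have hs0 : 0 ≤ s := ht.le.trans (le_of_lt hs)
  rw [norm_mul, norm_mul, Complex.norm_real, norm_cexp_two, Real.norm_eq_abs]
  have h1 := norm_reduced_le hq hk hs0
  have h2 : Real.exp (-(2 * k.im * s)) ≤ 1 := Real.exp_le_one_iff.2 (by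
    have := mul_nonneg hk hs0; linarith)
  have hM := mass_nonneg (q := q)
  calc _ ≤ |q s| * (1 + mass q) * 1 := by gcongr
    _ = _ := mul_one _

theorem norm_mul_reducedAux_le {k : ℂ} (hk : 0 ≤ k.im) {t : ℝ} (ht : 0 < t) :
    ‖Complex.exp (-(2 * Complex.I * k * t)) * reducedAux q k t‖ ≤ (1 + mass q) * sig q t := by
  rw [reducedAux, ← integral_const_mul, sig, ← integral_const_mul]
  refine norm_integral_le_of_norm_le ((integrableOn_q hq ht).abs.const_mul _) ?_
  filter_upwards [ae_restrict_mem measurableSet_Ioi] with s hs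
  rw [mem_Ioi] at hs
  rw [show Complex.exp (-(2 * Complex.I * k * t)) * ((q s : ℂ) * reduced q k s *
    Complex.exp (2 * Complex.I * k * s)) = (q s : ℂ) * reduced q k s *
    Complex.exp (2 * Complex.I * k * ((s - t : ℝ) : ℂ)) by
      rw [mul_left_comm, ← Complex.exp_add]; congr 2; push_cast; ring,
    norm_mul, norm_mul, norm_cexp_two, Complex.norm_real, Real.norm_eq_abs]
  have h1 := norm_reduced_le hq hk (ht.le.trans hs.le)
  have h2 : Real.exp (-(2 * k.im * (s - t))) ≤ 1 := Real.exp_le_one_iff.2 (by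
    have := mul_nonneg hk (sub_nonneg.2 hs.le); linarith)
  have hM := mass_nonneg (q := q)
  calc _ ≤ |q s| * (1 + mass q) * 1 := by gcongr
    _ = _ := by ring

theorem continuousOn_reducedAux {k : ℂ} (hk : 0 ≤ k.im) : ContinuousOn (reducedAux q k) (Ioi 0) := by
  intro t ht
  have ht2 : 0 < t / 2 := half_pos ht
  exact (continuousOn_tail (integrableOn_reducedAux hq hk ht2) t
    (by rw [mem_Ici]; linarith)).mono_of_mem_nhdsWithin
    (mem_nhdsWithin_of_mem_nhds (Ici_mem_nhds (by linarith)))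

theorem continuousOn_mul_reducedAux {k : ℂ} (hk : 0 ≤ k.im) :
    ContinuousOn (fun t : ℝ => Complex.exp (-(2 * Complex.I * k * t)) * reducedAux q k t) (Ioi 0) :=
  (Continuous.continuousOn (by fun_prop)).mul (continuousOn_reducedAux hq hk)

theorem integrableOn_mul_reducedAux {k : ℂ} (hk : 0 ≤ k.im) :
    IntegrableOn (fun t : ℝ => Complex.exp (-(2 * Complex.I * k * t)) * reducedAux q k t)
      (Ioi 0) := by
  refine Integrable.mono' ((sig_tail hq le_rfl).1.const_mul (1 + mass q))
    ((continuousOn_mul_reducedAux hq hk).aestronglyMeasurable measurableSet_Ioi) ?_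
  filter_upwards [ae_restrict_mem measurableSet_Ioi] with t ht
  exact norm_mul_reducedAux_le hq hk ht

/-- `transm_eq` for the exponential at y = 0 gives f(x) = e^{ikx} + (1/2) ∫_x^∞ q(s) f(s) ∫ e^{iku}
du ds with |u| < s - x. Divided by e^{ikx} and with the order of integration changed, this presents
the reduced function as a tail. Its limit at infinity and its derivative can then be read off. -/
theorem reduced_eq {k : ℂ} (hk : 0 ≤ k.im) {x : ℝ} (hx : 0 ≤ x) :
    reduced q k x = 1 + ∫ t in Ioi x, Complex.exp (-(2 * Complex.I * k * t)) * reducedAux q k t := by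
  set Φ : ℝ → ℂ := fun z => Complex.exp (Complex.I * k * z) with hΦ
  have h := (transm_eq hq (Φ := Φ) (Continuous.stronglyMeasurable (by fun_prop)) (x := x) (y := 0)
    (C := 1) hx fun z hz => by
      rw [hΦ, norm_cexp_I_mul, Real.exp_le_one_iff]
      have := mul_nonneg hk (show 0 ≤ z by linarith)
      linarith).2
  have hswap := integral_triangle_swap
    (G := fun t s => (q s : ℂ) * reduced q k s * Complex.exp (2 * Complex.I * k * ((s - t : ℝ) : ℂ)))
    (a := x) (((Complex.continuous_ofReal.comp_aestronglyMeasurable (aestronglyMeasurable_q hq hx).comp_snd).mul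
      ((stronglyMeasurable_reduced hq k).comp_measurable measurable_snd).aestronglyMeasurable).mul
      (Continuous.aestronglyMeasurable (by fun_prop)))
    (b := fun s => (1 + mass q) * moment q s)
    (((integrableOn_moment hq).mono_set (Ioi_subset_Ioi hx)).const_mul _) (by
      filter_upwards [ae_restrict_mem measurableSet_Ioi] with s hs
      rw [mem_Ioi] at hs
      refine ⟨(Continuous.integrableOn_Icc (by fun_prop)).mono_set Ioo_subset_Icc_self, ?_⟩
      have hbd := norm_setIntegral_le_of_norm_le_const (μ := volume) (s := Ioo x s)
        (f := fun t : ℝ => ‖(q s : ℂ) * reduced q k s *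
          Complex.exp (2 * Complex.I * k * ((s - t : ℝ) : ℂ))‖) (C := |q s| * (1 + mass q))
        (by simp) (fun t ht => by
          rw [norm_norm, norm_mul, norm_mul, norm_cexp_two, Complex.norm_real, Real.norm_eq_abs]
          have h1 := norm_reduced_le hq hk (hx.trans hs.le)
          have h2 : Real.exp (-(2 * k.im * (s - t))) ≤ 1 := Real.exp_le_one_iff.2 (by
            have := mul_nonneg hk (sub_nonneg.2 ht.2.le); linarith)
          have hM := mass_nonneg (q := q)
          calc _ ≤ |q s| * (1 + mass q) * 1 := by gcongr
            _ = _ := mul_one _)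
      rw [Real.volume_real_Ioo_of_le hs.le] at hbd
      refine (le_abs_self _).trans (hbd.trans ?_)
      rw [moment]
      have hM := mass_nonneg (q := q)
      nlinarith [mul_nonneg (abs_nonneg (q s)) (show 0 ≤ 1 + mass q by linarith)])
  have hL : ∫ t in Ioi x, ∫ s in Ioi t, (q s : ℂ) * reduced q k s *
      Complex.exp (2 * Complex.I * k * ((s - t : ℝ) : ℂ))
      = ∫ t in Ioi x, Complex.exp (-(2 * Complex.I * k * t)) * reducedAux q k t := by
    refine setIntegral_congr_fun measurableSet_Ioi fun t _ => ?_
    rw [reducedAux, ← integral_const_mul]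
    refine setIntegral_congr_fun measurableSet_Ioi fun s _ => ?_
    rw [mul_left_comm, ← Complex.exp_add]
    congr 2; push_cast; ring
  rw [← hL, hswap]
  simp only [hΦ, transm_exp] at h
  rw [reduced, ← mul_one (kernelJost (kern q) x k), show (1 : ℂ) = Complex.exp
    (Complex.I * k * (0 : ℝ)) by simp, mul_comm (kernelJost _ _ _), h, mul_add, ← Complex.exp_add]
  congr 1
  · congr 1; push_cast; ring
  rw [Complex.real_smul, mul_left_comm, ← integral_const_mul, ← integral_const_mul]
  refine setIntegral_congr_fun measurableSet_Ioi fun s hs => ?_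
  rw [mem_Ioi] at hs
  rw [integral_const_mul, ← integral_Ioc_eq_integral_Ioo, ← intervalIntegral.integral_of_le hs.le,
    intervalIntegral.integral_mul_const, kernelJost_eq_exp_mul, Complex.real_smul]
  -- The kernel sin(k(s - x))/k is kept as an integral of exponentials, so no division by k occurs
  -- and k = 0 is not special.
  have h1 : ∫ t in x..s, Complex.exp (2 * Complex.I * k * ((s - t : ℝ) : ℂ))
      = ((1 / 2 : ℝ) : ℂ) * (Complex.exp (-(Complex.I * k * x)) * Complex.exp (Complex.I * k * s) *
        ∫ u in (0 - s + x)..(0 + s - x), Complex.exp (Complex.I * k * u)) := by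
    rw [intervalIntegral.integral_comp_sub_left (fun t : ℝ => Complex.exp (2 * Complex.I * k * t)),
      ← intervalIntegral.integral_const_mul, sub_self]
    have h2 := intervalIntegral.smul_integral_comp_mul_sub (a := 0) (b := s - x)
      (fun u : ℝ => Complex.exp (-(Complex.I * k * x)) * Complex.exp (Complex.I * k * s) *
        Complex.exp (Complex.I * k * u)) 2 (s - x)
    rw [show 0 - s + x = 2 * 0 - (s - x) by ring, show 0 + s - x = 2 * (s - x) - (s - x) by ring,
      ← h2, Complex.real_smul]
    push_cast
    rw [← mul_assoc, one_div, inv_mul_cancel₀ two_ne_zero, one_mul]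
    refine intervalIntegral.integral_congr fun t _ => ?_
    simp only [← Complex.exp_add]
    congr 1; ring
  rw [h1]
  ring

theorem tendsto_reduced {k : ℂ} (hk : 0 ≤ k.im) : Tendsto (reduced q k) atTop (𝓝 1) := by
  have h := (tendsto_const_nhds (x := (1 : ℂ))).add (tendsto_tail (integrableOn_mul_reducedAux hq hk))
  rw [add_zero] at h
  refine h.congr' ?_
  filter_upwards [eventually_ge_atTop 0] with x hx using (reduced_eq hq hk hx).symm

theorem continuousOn_reduced {k : ℂ} (hk : 0 ≤ k.im) : ContinuousOn (reduced q k) (Ici 0) :=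
  (continuousOn_const.add (continuousOn_tail (integrableOn_mul_reducedAux hq hk))).congr
    fun _ hx => reduced_eq hq hk hx

theorem hasDerivAt_reduced {k : ℂ} (hk : 0 ≤ k.im) {x : ℝ} (hx : 0 < x) :
    HasDerivAt (reduced q k) (-(Complex.exp (-(2 * Complex.I * k * x)) * reducedAux q k x)) x := by
  refine ((hasDerivAt_tail (integrableOn_mul_reducedAux hq hk)
    (continuousOn_mul_reducedAux hq hk) hx).const_add 1).congr_of_eventuallyEq ?_
  filter_upwards [Ioi_mem_nhds hx] with t ht using reduced_eq hq hk (le_of_lt ht)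

/-- The derivative of the Jost solution. -/
noncomputable def jostDeriv (q : ℝ → ℝ) (k : ℂ) (x : ℝ) : ℂ :=
  Complex.I * k * kernelJost (kern q) x k - Complex.exp (-(Complex.I * k * x)) * reducedAux q k x

/-- As q is merely measurable, the second derivative is verified in integrated form, by the product
rule for e^{-ikx} and the primitive `reducedAux`; the terms with k² come from the first-order part
of the derivative. -/
theorem sol_kernelJost {k : ℂ} (hk : 0 ≤ k.im) :
    Sol q (k ^ 2) (fun x => kernelJost (kern q) x k) (jostDeriv q k) := by
  have hcont : ContinuousOn (fun x => kernelJost (kern q) x k) (Ici 0) :=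
    ((Continuous.continuousOn (by fun_prop)).mul (continuousOn_reduced hq hk)).congr
      fun x _ => kernelJost_eq_exp_mul k x
  have hder : ∀ x, 0 < x → HasDerivAt (fun x => kernelJost (kern q) x k) (jostDeriv q k x) x := by
    intro x hx
    have h1 := (hasDerivAt_cexp (Complex.I * k) x).mul (hasDerivAt_reduced hq hk hx)
    have h2 : (fun x => kernelJost (kern q) x k)
        = (fun x : ℝ => Complex.exp (Complex.I * k * x)) * reduced q k :=
      funext fun x => kernelJost_eq_exp_mul k x
    rw [h2]
    refine h1.congr_deriv ?_
    rw [jostDeriv, kernelJost_eq_exp_mul, show -(Complex.I * k * x) = Complex.I * k * x +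
      -(2 * Complex.I * k * x) by ring, Complex.exp_add]
    ring
  have hdc : ContinuousOn (jostDeriv q k) (Ioi 0) :=
    (continuousOn_const.mul (hcont.mono Ioi_subset_Ici_self)).sub
      ((Continuous.continuousOn (by fun_prop)).mul (continuousOn_reducedAux hq hk))
  refine ⟨hcont, hder, fun a b ha hab => ?_⟩
  have hsub : uIcc a b ⊆ Ioi 0 := fun t ht => by
    rw [uIcc_of_le hab] at ht; exact ha.trans_le ht.1
  have hHi := intervalIntegrable_of_Ioi (integrableOn_reducedAux hq hk ha) le_rfl hab
  have hE : ∀ x : ℝ, HasDerivAt (fun x : ℝ => Complex.exp (-(Complex.I * k * x)))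
      (-(Complex.I * k) * Complex.exp (-(Complex.I * k * x))) x := by
    intro x
    have := hasDerivAt_cexp (-(Complex.I * k)) x
    simpa only [neg_mul] using this
  have hpr := integral_product_rule hab (p := fun x : ℝ => -(Complex.I * k) *
      Complex.exp (-(Complex.I * k * x))) (P := fun x : ℝ => Complex.exp (-(Complex.I * k * x)))
    (R := reducedAux q k) (Continuous.intervalIntegrable (by fun_prop) _ _) hHi.neg
    (fun x hx => (intervalIntegral.integral_eq_sub_of_hasDerivAt (fun t _ => hE t)
      (Continuous.intervalIntegrable (by fun_prop) _ _)).symm)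
    (fun x hx => by
      simp only [Pi.neg_apply]
      rw [intervalIntegral.integral_neg, reducedAux, reducedAux,
        ← intervalIntegral.integral_interval_add_Ioi (integrableOn_reducedAux hq hk ha)
        (integrableOn_reducedAux hq hk (ha.trans_le hx.1))]
      ring)
  have hf := (intervalIntegral.integral_eq_sub_of_hasDerivAt (fun t ht => hder t (hsub ht))
    ((hdc.mono hsub).intervalIntegrable)).symm
  have i1 : IntervalIntegrable (fun x : ℝ => -(Complex.I * k) * Complex.exp (-(Complex.I * k * x)) *
      reducedAux q k x) volume a b :=
    ((Continuous.continuousOn (by fun_prop)).mul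
      ((continuousOn_reducedAux hq hk).mono hsub)).intervalIntegrable
  have i2 : IntervalIntegrable (fun x : ℝ => Complex.exp (-(Complex.I * k * x)) *
      (-fun s : ℝ => (q s : ℂ) * reduced q k s * Complex.exp (2 * Complex.I * k * s)) x)
      volume a b :=
    hHi.neg.continuousOn_mul (Continuous.continuousOn (by fun_prop))
  have i3 := (hdc.mono hsub).intervalIntegrable (μ := volume)
  rw [show jostDeriv q k b - jostDeriv q k a = Complex.I * k * (kernelJost (kern q) b k -
    kernelJost (kern q) a k) - (Complex.exp (-(Complex.I * k * b)) * reducedAux q k b -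
    Complex.exp (-(Complex.I * k * a)) * reducedAux q k a) by rw [jostDeriv, jostDeriv]; ring,
    hf, hpr, ← intervalIntegral.integral_const_mul, ← intervalIntegral.integral_sub
    (i3.const_mul _) (i1.add i2)]
  refine intervalIntegral.integral_congr fun x _ => ?_
  simp only [jostDeriv, Pi.neg_apply, kernelJost_eq_exp_mul]
  rw [show Complex.exp (2 * Complex.I * k * x) = Complex.exp (Complex.I * k * x) *
    Complex.exp (Complex.I * k * x) by rw [← Complex.exp_add]; congr 1; ring]
  have h1 : Complex.exp (-(Complex.I * k * x)) * Complex.exp (Complex.I * k * x) = 1 := by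
    rw [← Complex.exp_add, neg_add_cancel, Complex.exp_zero]
  linear_combination (q x * reduced q k x * Complex.exp (Complex.I * k * x)) * h1
    + (k ^ 2 * reduced q k x * Complex.exp (Complex.I * k * x)) * Complex.I_sq

theorem isJostSolution_kernelJost {k : ℂ} (hk : 0 ≤ k.im) :
    IsJostSolution q k fun x => kernelJost (kern q) x k where
  continuousOn := (sol_kernelJost hq hk).cont
  equation := ⟨_, (sol_kernelJost hq hk).deriv, (sol_kernelJost hq hk).eq⟩
  asymptotics := tendsto_reduced hq hk

end jost
end HalfLine
-- Uniqueness of Jost solutions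
namespace HalfLine

/-- A backward Gronwall inequality. -/
theorem eq_zero_of_le_integral {w N : ℝ → ℝ} (hw : IntegrableOn w (Ioi 0))
    (hw0 : ∀ s ∈ Ioi (0 : ℝ), 0 ≤ w s) {C : ℝ} (hN0 : ∀ x, 0 < x → 0 ≤ N x)
    (hC : ∀ x, 0 < x → N x ≤ C)
    (h : ∀ x, 0 < x → N x ≤ ∫ t in Ioi x, w t * N t) {x : ℝ} (hx : 0 < x) : N x = 0 := by
  have hC0 : 0 ≤ C := (hN0 1 one_pos).trans (hC 1 one_pos)
  have key : ∀ n : ℕ, ∀ x, 0 < x → N x ≤ (1 / 2) ^ n * C * weight w x := by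
    intro n
    induction n with
    | zero =>
      intro x hx
      have h1 := one_le_weight hw0 hx.le
      rw [pow_zero, one_mul]
      exact (hC x hx).trans (le_mul_of_one_le_right hC0 h1)
    | succ n ih =>
      intro x hx
      refine (h x hx).trans ?_
      have hi := ((integrableOn_mul_weight hw hw0).mono_set
        (Ioi_subset_Ioi hx.le)).const_mul ((1 / 2) ^ n * C)
      calc ∫ t in Ioi x, w t * N t ≤ ∫ t in Ioi x, (1 / 2) ^ n * C * (w t * weight w t) := by
            refine integral_mono_of_nonneg ?_ hi ?_
            · filter_upwards [ae_restrict_mem measurableSet_Ioi] with t ht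
              exact mul_nonneg (hw0 t (hx.trans ht)) (hN0 t (hx.trans ht))
            · filter_upwards [ae_restrict_mem measurableSet_Ioi] with t ht
              calc w t * N t ≤ w t * ((1 / 2) ^ n * C * weight w t) :=
                    mul_le_mul_of_nonneg_left (ih t (hx.trans ht)) (hw0 t (hx.trans ht))
                _ = _ := by ring
        _ = (1 / 2) ^ n * C * ∫ t in Ioi x, w t * weight w t := integral_const_mul _ _
        _ ≤ (1 / 2) ^ n * C * (weight w x / 2) :=
            mul_le_mul_of_nonneg_left (integral_mul_weight_le hw hw0 hx.le) (by positivity)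
        _ = _ := by rw [pow_succ]; ring
  have hlim : Tendsto (fun n : ℕ => (1 / 2 : ℝ) ^ n * C * weight w x) atTop (𝓝 0) := by
    have := ((tendsto_pow_atTop_nhds_zero_of_lt_one (r := (1 / 2 : ℝ)) (by norm_num)
      (by norm_num)).mul_const C).mul_const (weight w x)
    simpa using this
  exact le_antisymm (ge_of_tendsto' hlim fun n => key n x hx) (hN0 x hx)

/-- If a function tends to zero and its derivative converges, the limit of the latter is zero. -/
theorem eq_zero_of_tendsto_deriv {G G' : ℝ → ℂ} {c : ℂ} (hG : Tendsto G atTop (𝓝 0))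
    (hd : ∀ x, 0 < x → HasDerivAt G (G' x) x) (hG' : Tendsto G' atTop (𝓝 c)) : c = 0 := by
  have h1 : Tendsto (fun x => G (x + 1) - G x) atTop (𝓝 0) := by
    simpa using (hG.comp (tendsto_atTop_add_const_right _ 1 tendsto_id)).sub hG
  have h2 : Tendsto (fun x => G (x + 1) - G x) atTop (𝓝 c) := by
    rw [Metric.tendsto_atTop]
    intro ε hε
    obtain ⟨X, hX⟩ := Metric.tendsto_atTop.1 hG' (ε / 2) (half_pos hε)
    refine ⟨max X 1, fun x hx => ?_⟩
    have hx1 : X ≤ x := (le_max_left _ _).trans hx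
    have hx2 : 1 ≤ x := (le_max_right _ _).trans hx
    have := norm_image_sub_le_of_norm_deriv_le_segment' (f := fun t => G t - c * t)
      (f' := fun t => G' t - c) (C := ε / 2) (a := x) (b := x + 1)
      (fun t ht => by
        have h := (hd t (by linarith [ht.1])).sub
          ((Complex.ofRealCLM.hasDerivAt (x := t)).const_mul c)
        exact (h.congr_deriv (by simp)).hasDerivWithinAt)
      (fun t ht => by
        have := hX t (hx1.trans ht.1)
        rw [dist_eq_norm] at this
        exact this.le) (x + 1) ⟨by linarith, le_rfl⟩
    rw [dist_eq_norm]
    calc ‖G (x + 1) - G x - c‖ = ‖G (x + 1) - c * ((x + 1 : ℝ) : ℂ) - (G x - c * x)‖ := by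
          congr 1; push_cast; ring
      _ ≤ ε / 2 * (x + 1 - x) := this
      _ < ε := by linarith
  exact tendsto_nhds_unique h2 h1

/-- A continuous function on a half-line with a limit at infinity is bounded. -/
theorem exists_bound_of_tendsto {g : ℝ → ℂ} {a : ℝ} {c : ℂ} (hg : ContinuousOn g (Ici a))
    (hlim : Tendsto g atTop (𝓝 c)) : ∃ M, 0 ≤ M ∧ ∀ x, a ≤ x → ‖g x‖ ≤ M := by
  obtain ⟨X, hX⟩ := eventually_atTop.1 (hlim.norm.eventually_le_const (lt_add_one ‖c‖))
  obtain ⟨M, hM⟩ := isCompact_Icc.exists_bound_of_continuousOn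
    (hg.mono (Icc_subset_Ici_self : Icc a X ⊆ Ici a))
  refine ⟨max M (‖c‖ + 1), (by positivity : 0 ≤ ‖c‖ + 1).trans (le_max_right _ _), fun x hx => ?_⟩
  rcases le_total x X with h | h
  · exact (hM x ⟨hx, h⟩).trans (le_max_left _ _)
  · exact (hX x h).trans (le_max_right _ _)

section uniqueness
variable {q : ℝ → ℝ} (hq : IsL11 q)
include hq

/-- A solution that is `o(e^{ikx})` at infinity vanishes. -/
theorem Sol.eq_zero {k : ℂ} (hk : 0 ≤ k.im) {d v : ℝ → ℂ} (hd : Sol q (k ^ 2) d v)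
    (hlim : Tendsto (fun x : ℝ => Complex.exp (-(Complex.I * k * x)) * d x) atTop (𝓝 0))
    {x : ℝ} (hx : 0 ≤ x) : d x = 0 := by
  set g : ℝ → ℂ := fun x : ℝ => Complex.exp (-(Complex.I * k * x)) * d x with hg
  have hgc : ContinuousOn g (Ici 0) := (Continuous.continuousOn (by fun_prop)).mul hd.cont
  have hdg : ∀ x : ℝ, d x = Complex.exp (Complex.I * k * x) * g x := fun x => by
    rw [hg, ← mul_assoc, ← Complex.exp_add, add_neg_cancel, Complex.exp_zero, one_mul]
  obtain ⟨M, hM0, hM⟩ := exists_bound_of_tendsto hgc hlim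
  set r : ℝ → ℂ := fun s => Complex.exp (Complex.I * k * s) * (q s * d s) with hr
  have hrb : ∀ s t : ℝ, 0 ≤ t → t ≤ s →
      ‖Complex.exp (-(2 * Complex.I * k * t)) * r s‖ ≤ |q s| * ‖g s‖ := by
    intro s t ht hts
    rw [hr, show Complex.exp (-(2 * Complex.I * k * t)) * (Complex.exp (Complex.I * k * s) *
      (q s * d s)) = Complex.exp (2 * Complex.I * k * ((s - t : ℝ) : ℂ)) * (q s * g s) by
        rw [hdg s, show Complex.exp (2 * Complex.I * k * ((s - t : ℝ) : ℂ)) =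
          Complex.exp (-(2 * Complex.I * k * t)) * (Complex.exp (Complex.I * k * s) *
          Complex.exp (Complex.I * k * s)) by
            rw [← Complex.exp_add, ← Complex.exp_add]; congr 1; push_cast; ring]
        ring, norm_mul, norm_mul, norm_cexp_two, Complex.norm_real, Real.norm_eq_abs]
    refine mul_le_of_le_one_left (by positivity) (Real.exp_le_one_iff.2 ?_)
    have := mul_nonneg hk (sub_nonneg.2 hts); linarith
  have hri : ∀ {a : ℝ}, 0 < a → IntegrableOn r (Ioi a) := by
    intro a ha
    refine Integrable.mono' ((integrableOn_q hq ha).abs.mul_const M)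
      ((Continuous.aestronglyMeasurable (by fun_prop)).mul
      ((integrableOn_q_complex hq ha).aestronglyMeasurable.mul
      ((hd.cont.mono fun t ht => (ha.trans ht).le).aestronglyMeasurable measurableSet_Ioi))) ?_
    filter_upwards [ae_restrict_mem measurableSet_Ioi] with s hs
    have hs' : 0 ≤ s := (ha.trans hs).le
    have := hrb s 0 le_rfl hs'
    simp only [Complex.ofReal_zero, mul_zero, neg_zero, Complex.exp_zero, one_mul] at this
    exact this.trans (mul_le_mul_of_nonneg_left (hM s hs') (abs_nonneg _))
  -- One factor of the operator d²/dx² + k² is split off: the derivative of p is e^{ikx} q d, in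
  -- which k² no longer occurs. It is integrable at infinity, so p converges.
  set p : ℝ → ℂ := fun x => Complex.exp (Complex.I * k * x) * (v x - Complex.I * k * d x) with hp
  have hpsub : ∀ a b, 0 < a → a ≤ b → p b - p a = ∫ s in a..b, r s := by
    intro a b ha hab
    have hb := ha.trans_le hab
    have hv := hd.intervalIntegrable_deriv hq ha hb
    have hpr := integral_product_rule hab (P := fun x : ℝ => Complex.exp (Complex.I * k * x))
      (p := fun x : ℝ => Complex.I * k * Complex.exp (Complex.I * k * x))
      (R := fun x => v x - Complex.I * k * d x)
      (r := fun x => ((q x : ℂ) - k ^ 2) * d x - Complex.I * k * v x)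
      (Continuous.intervalIntegrable (by fun_prop) _ _)
      ((hd.intervalIntegrable hq ha hb).sub (hv.const_mul _))
      (fun x _ => (intervalIntegral.integral_eq_sub_of_hasDerivAt
        (fun t _ => hasDerivAt_cexp _ t) (Continuous.intervalIntegrable (by fun_prop) _ _)).symm)
      (fun x hx => by
        have hx0 := ha.trans_le hx.1
        rw [intervalIntegral.integral_sub (hd.intervalIntegrable hq ha hx0)
          ((hd.intervalIntegrable_deriv hq ha hx0).const_mul _), ← hd.eq a x ha hx.1,
          intervalIntegral.integral_const_mul, ← hd.sub_eq hq ha hx.1]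
        ring)
    simp only [hp]
    rw [hpr]
    refine intervalIntegral.integral_congr fun s _ => ?_
    simp only [hr]
    linear_combination (-(k ^ 2) * Complex.exp (Complex.I * k * s) * d s) * Complex.I_sq
  set c : ℂ := p 1 + ∫ s in Ioi 1, r s with hc
  have hpt : ∀ x, 0 < x → p x = c - ∫ s in Ioi x, r s := by
    intro x hx
    rcases le_total x 1 with h | h
    · have h1 := hpsub x 1 hx h
      have h2 := intervalIntegral.integral_interval_add_Ioi (hri hx) (hri one_pos)
      rw [hc, ← h2, ← h1]; ring
    · have h1 := hpsub 1 x one_pos h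
      have h2 := intervalIntegral.integral_interval_add_Ioi (hri one_pos) (hri hx)
      rw [hc, ← h2, ← h1]; ring
  have hplim : Tendsto p atTop (𝓝 c) := by
    have h1 := (tendsto_const_nhds (x := c)).sub (tendsto_tail (hri one_pos))
    rw [sub_zero] at h1
    refine h1.congr' ?_
    filter_upwards [eventually_gt_atTop 0] with x hx using (hpt x hx).symm
  -- The function e^{ikx} d also tends to 0, being no larger than e^{-ikx} d in modulus, and its
  -- derivative 2ik e^{ikx} d + p tends to c; hence c = 0. This covers real k as well, where neither
  -- exponential decays.
  have hc0 : c = 0 := by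
    have hG : Tendsto (fun x : ℝ => Complex.exp (Complex.I * k * x) * d x) atTop (𝓝 0) := by
      refine squeeze_zero_norm' ?_ (tendsto_zero_iff_norm_tendsto_zero.1 hlim)
      filter_upwards [eventually_ge_atTop 0] with x hx
      rw [norm_mul, norm_mul]
      refine mul_le_mul_of_nonneg_right ?_ (norm_nonneg _)
      rw [norm_cexp_I_mul, show -(Complex.I * k * x) = Complex.I * (-k) * x by ring,
        norm_cexp_I_mul]
      refine Real.exp_le_exp.2 ?_
      have := mul_nonneg hk hx
      simp only [Complex.neg_im]; linarith
    refine eq_zero_of_tendsto_deriv (G' := fun x : ℝ => 2 * Complex.I * k *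
      (Complex.exp (Complex.I * k * x) * d x) + p x) hG (fun x hx => ?_) ?_
    · refine ((hasDerivAt_cexp (Complex.I * k) x).mul (hd.deriv x hx)).congr_deriv ?_
      simp only [hp]; ring
    · have := (hG.const_mul (2 * Complex.I * k)).add hplim
      rwa [mul_zero, zero_add] at this
  have hgd : ∀ x : ℝ, 0 < x → HasDerivAt g (Complex.exp (-(2 * Complex.I * k * x)) * p x) x := by
    intro x hx
    have h1 := (hasDerivAt_cexp (-(Complex.I * k)) x).mul (hd.deriv x hx)
    simp only [neg_mul (Complex.I * k)] at h1
    refine h1.congr_deriv ?_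
    simp only [hp]
    rw [← mul_assoc, ← Complex.exp_add, show -(2 * Complex.I * k * x) + Complex.I * k * x =
      -(Complex.I * k * x) by ring]
    ring
  -- Now |g'(t)| is at most a tail of |q g|. Applying `sig_tail` to the potential q|g| turns the
  -- resulting double integral into one with density s|q(s)|, to which the backward Gronwall
  -- inequality applies.
  set Q : ℝ → ℝ := fun s => q s * ‖g s‖ with hQ
  have hQm : IntegrableOn (fun s => s * Q s) (Ioi 0) := by
    refine Integrable.mono' ((integrableOn_moment hq).mul_const M)
      ((aestronglyMeasurable_id).mul ((aestronglyMeasurable_q hq le_rfl).mul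
      ((hgc.mono Ioi_subset_Ici_self).aestronglyMeasurable measurableSet_Ioi).norm)) ?_
    filter_upwards [ae_restrict_mem measurableSet_Ioi] with s hs
    rw [mem_Ioi] at hs
    rw [hQ, moment, norm_mul, norm_mul, norm_norm, Real.norm_of_nonneg hs.le, Real.norm_eq_abs,
      ← mul_assoc]
    exact mul_le_mul_of_nonneg_left (hM s hs.le) (by positivity)
  have hder : ∀ t : ℝ, 0 < t → ‖Complex.exp (-(2 * Complex.I * k * t)) * p t‖ ≤ sig Q t := by
    intro t ht
    rw [hpt t ht, hc0, zero_sub, mul_neg, norm_neg, ← integral_const_mul, sig]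
    refine norm_integral_le_of_norm_le (integrableOn_q (q := Q) hQm ht).abs ?_
    filter_upwards [ae_restrict_mem measurableSet_Ioi] with s hs
    refine (hrb s t ht.le (le_of_lt hs)).trans (le_of_eq ?_)
    rw [hQ, abs_mul, abs_norm]
  have hle : ∀ x, 0 < x → ‖g x‖ ≤ ∫ t in Ioi x, moment q t * ‖g t‖ := by
    intro x hx
    obtain ⟨hs1, hs2⟩ := sig_tail (q := Q) hQm hx.le
    have hcont : ContinuousOn (fun x : ℝ => Complex.exp (-(2 * Complex.I * k * x)) * p x)
        (Ioi 0) :=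
      (Continuous.continuousOn (by fun_prop)).mul ((Continuous.continuousOn (by fun_prop)).mul
        ((hd.continuousOn hq).sub (continuousOn_const.mul (hd.cont.mono Ioi_subset_Ici_self))))
    have hi : IntegrableOn (fun x : ℝ => Complex.exp (-(2 * Complex.I * k * x)) * p x) (Ioi x) := by
      refine Integrable.mono' hs1 ((hcont.mono (Ioi_subset_Ioi hx.le)).aestronglyMeasurable
        measurableSet_Ioi) ?_
      filter_upwards [ae_restrict_mem measurableSet_Ioi] with t ht using hder t (hx.trans ht)
    have hint := integral_Ioi_of_hasDerivAt_of_tendsto (hgc x hx.le |>.mono (Ici_subset_Ici.2 hx.le))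
      (fun t ht => hgd t (hx.trans ht)) hi hlim
    rw [zero_sub] at hint
    rw [← norm_neg, ← hint]
    calc _ ≤ ∫ t in Ioi x, sig Q t := by
          refine norm_integral_le_of_norm_le hs1 ?_
          filter_upwards [ae_restrict_mem measurableSet_Ioi] with t ht using hder t (hx.trans ht)
      _ ≤ ∫ s in Ioi x, moment Q s := hs2
      _ = _ := by
          refine setIntegral_congr_fun measurableSet_Ioi fun s _ => ?_
          simp only [moment, hQ, abs_mul, abs_norm, mul_assoc]
  have hz : ∀ x, 0 < x → d x = 0 := fun x hx => by
    rw [hdg x, norm_eq_zero.1 (eq_zero_of_le_integral (integrableOn_moment hq)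
      (fun s hs => moment_nonneg s hs) (N := fun x => ‖g x‖) (fun _ _ => norm_nonneg _)
      (fun x hx => hM x hx.le) hle hx), mul_zero]
  rcases hx.eq_or_lt with rfl | hx
  · have h1 : Tendsto d (𝓝[>] 0) (𝓝 (d 0)) :=
      (hd.cont 0 self_mem_Ici).mono_left (nhdsWithin_mono _ Ioi_subset_Ici_self)
    refine tendsto_nhds_unique h1 (tendsto_const_nhds.congr' ?_)
    filter_upwards [self_mem_nhdsWithin] with t ht using (hz t ht).symm
  · exact hz x hx

theorem isJostSolution_unique {k : ℂ} (hk : 0 ≤ k.im) {u u' : ℝ → ℂ} (hu : IsJostSolution q k u)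
    (hu' : IsJostSolution q k u') : EqOn u u' (Ici 0) := by
  intro x hx
  obtain ⟨v, hv, hv'⟩ := hu.equation
  obtain ⟨w, hw, hw'⟩ := hu'.equation
  have h1 : Sol q (k ^ 2) u v := ⟨hu.continuousOn, hv, hv'⟩
  have h2 : Sol q (k ^ 2) u' w := ⟨hu'.continuousOn, hw, hw'⟩
  refine sub_eq_zero.1 ((h1.sub hq h2).eq_zero hq hk ?_ hx)
  have := hu.asymptotics.sub hu'.asymptotics
  rw [sub_self] at this
  refine this.congr fun x => ?_
  ring

/-- The choice operator returns some Jost solution, since one exists, and any two agree on [0, ∞).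
-/
theorem jost_eq_kernelJost {k : ℂ} (hk : 0 ≤ k.im) {x : ℝ} (hx : 0 ≤ x) :
    jost q x k = kernelJost (kern q) x k := by
  have h := isJostSolution_kernelJost hq hk
  exact isJostSolution_unique hq hk (Classical.epsilon_spec ⟨_, h⟩) h hx

theorem isJostSolution_jost {k : ℂ} (hk : 0 ≤ k.im) : IsJostSolution q k fun x => jost q x k :=
  Classical.epsilon_spec ⟨_, isJostSolution_kernelJost hq hk⟩

theorem isTransformationKernel_kern : IsTransformationKernel q (kern q) where
  eq_zero _ _ h := kern_zero hq h
  continuousOn := continuousOn_kern hq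
  integrableOn _ hx := (integrableOn_kern hq hx).1
  jost_eq _ _ hx hk := jost_eq_kernelJost hq hk hx

end uniqueness
end HalfLine
-- Fourier transforms of integrable functions
namespace HalfLine

section fourier
open FourierTransform

/-- The Fourier transform `∫ f(x) e^{ikx} dx`. -/
noncomputable def ft (f : ℝ → ℂ) (k : ℝ) : ℂ :=
  ∫ x : ℝ, Complex.exp (Complex.I * k * x) * f x

theorem ft_eq_fourier (f : ℝ → ℂ) (k : ℝ) : ft f k = 𝓕 f (-(k / (2 * Real.pi))) := by
  rw [ft, Real.fourier_real_eq_integral_exp_smul]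
  refine integral_congr_ae (Eventually.of_forall fun x => ?_)
  simp only [smul_eq_mul]
  congr 2
  have : (Real.pi : ℂ) ≠ 0 := by exact_mod_cast Real.pi_ne_zero
  push_cast
  field_simp

theorem fourier_eq_ft (f : ℝ → ℂ) (ξ : ℝ) : 𝓕 f ξ = ft f (-(2 * Real.pi * ξ)) := by
  rw [ft_eq_fourier]; have := Real.pi_ne_zero; field_simp

theorem norm_cexp_I_mul_ofReal (k x : ℝ) : ‖Complex.exp (Complex.I * k * x)‖ = 1 := by
  rw [Complex.norm_exp]; simp

theorem integrable_cexp_mul {f : ℝ → ℂ} (hf : Integrable f) (k : ℝ) :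
    Integrable fun x : ℝ => Complex.exp (Complex.I * k * x) * f x := by
  refine Integrable.mono hf ((Continuous.aestronglyMeasurable (by fun_prop)).mul
    hf.aestronglyMeasurable) (Eventually.of_forall fun x => ?_)
  rw [norm_mul, norm_cexp_I_mul_ofReal, one_mul]

theorem ft_add {f g : ℝ → ℂ} (hf : Integrable f) (hg : Integrable g) (k : ℝ) :
    ft (fun x => f x + g x) k = ft f k + ft g k := by
  rw [ft, ft, ft, ← integral_add (integrable_cexp_mul hf k) (integrable_cexp_mul hg k)]
  simp only [mul_add]

theorem ft_const_mul (f : ℝ → ℂ) (c : ℂ) (k : ℝ) : ft (fun x => c * f x) k = c * ft f k := by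
  rw [ft, ft, ← integral_const_mul]
  simp only [mul_left_comm]

theorem ft_neg (f : ℝ → ℂ) (k : ℝ) : ft (fun x => -f x) k = -ft f k := by
  rw [ft, ft, ← integral_neg]
  simp only [mul_neg]

theorem ft_sub {f g : ℝ → ℂ} (hf : Integrable f) (hg : Integrable g) (k : ℝ) :
    ft (fun x => f x - g x) k = ft f k - ft g k := by
  simp only [sub_eq_add_neg]
  rw [ft_add hf hg.fun_neg, ft_neg]

theorem norm_ft_le (f : ℝ → ℂ) (k : ℝ) : ‖ft f k‖ ≤ ∫ x, ‖f x‖ := by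
  refine (norm_integral_le_integral_norm _).trans (le_of_eq ?_)
  simp only [norm_mul, norm_cexp_I_mul_ofReal, one_mul]

theorem ft_comp_neg (f : ℝ → ℂ) (k : ℝ) : ft (fun x => f (-x)) k = ft f (-k) := by
  rw [ft, ft, ← integral_neg_eq_self]
  simp only [neg_neg]
  refine integral_congr_ae (Eventually.of_forall fun x => ?_)
  simp

theorem continuous_ft {f : ℝ → ℂ} (hf : Integrable f) : Continuous (ft f) := by
  refine continuous_of_dominated (F := fun (k : ℝ) (x : ℝ) => Complex.exp (Complex.I * k * x) * f x)
    (bound := fun x => ‖f x‖)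
    (fun k => (integrable_cexp_mul hf k).aestronglyMeasurable)
    (fun k => Eventually.of_forall fun x => ?_) hf.norm (Eventually.of_forall fun x => by fun_prop)
  rw [norm_mul, norm_cexp_I_mul_ofReal, one_mul]

theorem tendsto_ft_cocompact (f : ℝ → ℂ) : Tendsto (ft f) (cocompact ℝ) (𝓝 0) := by
  have h1 : Tendsto (fun k : ℝ => -(k / (2 * Real.pi))) (cocompact ℝ) (cocompact ℝ) := by
    have h0 : (-(2 * Real.pi)⁻¹) ≠ 0 := neg_ne_zero.2 (inv_ne_zero (by positivity))
    refine ((Homeomorph.mulRight₀ _ h0).isClosedEmbedding.tendsto_cocompact).congr fun k => ?_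
    simp [div_eq_mul_inv]
  exact ((Real.zero_at_infty_fourier f).comp h1).congr fun k => (ft_eq_fourier f k).symm

/-- By the multiplication formula, the pairing of f with a test function equals the pairing of the
transform of f with the inverse transform of that test function. -/
theorem ae_eq_zero_of_ft_eq_zero {f : ℝ → ℂ} (hf : Integrable f) (h : ∀ k, ft f k = 0) :
    f =ᵐ[volume] 0 := by
  refine ae_eq_zero_of_integral_contDiff_smul_eq_zero hf.locallyIntegrable fun g hg hc => ?_
  have hg' : ContDiff ℝ (⊤ : ℕ∞) (fun x => (g x : ℂ)) := Complex.ofRealCLM.contDiff.comp hg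
  have hc' : HasCompactSupport (fun x => (g x : ℂ)) := hc.comp_left (g := fun t : ℝ => (t : ℂ)) rfl
  set G : SchwartzMap ℝ ℂ := hc'.toSchwartzMap hg' with hG
  have h1 := VectorFourier.integral_fourierIntegral_smul_eq_flip (L := innerₗ ℝ)
    Real.continuous_fourierChar continuous_inner (μ := volume) (ν := volume)
    hf (𝓕⁻ G : SchwartzMap ℝ ℂ).integrable
  have h2 : ∀ ξ, VectorFourier.fourierIntegral Real.fourierChar volume (innerₗ ℝ) f ξ = 0 :=
    fun ξ => (fourier_eq_ft f ξ).trans (h _)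
  have h3 : ∀ x, VectorFourier.fourierIntegral Real.fourierChar volume (innerₗ ℝ).flip
      (𝓕⁻ G : SchwartzMap ℝ ℂ) x = g x := by
    intro x
    have : 𝓕 (𝓕⁻ G : SchwartzMap ℝ ℂ) x = G x := by rw [FourierTransform.fourier_fourierInv_eq]
    rw [SchwartzMap.fourier_coe] at this
    rw [flip_innerₗ]
    exact this
  simp only [h2, h3, zero_smul, integral_zero] at h1
  rw [h1]
  refine integral_congr_ae (Eventually.of_forall fun x => ?_)
  simp only [smul_eq_mul, Complex.real_smul, mul_comm]

/-- `A` is the Fourier transform of an integrable function of norm at most `N`. -/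
def HasFourierBound (A : ℝ → ℂ) (N : ℝ) : Prop :=
  ∃ c : ℝ → ℂ, Integrable c ∧ (∀ ξ, A ξ = 𝓕 c ξ) ∧ ∫ x, ‖c x‖ ≤ N

theorem HasFourierBound.mono {A : ℝ → ℂ} {N M : ℝ} (h : HasFourierBound A N) (hNM : N ≤ M) :
    HasFourierBound A M := by
  obtain ⟨c, h1, h2, h3⟩ := h
  exact ⟨c, h1, h2, h3.trans hNM⟩

theorem HasFourierBound.add {A B : ℝ → ℂ} {N M : ℝ} (hA : HasFourierBound A N)
    (hB : HasFourierBound B M) : HasFourierBound (fun ξ => A ξ + B ξ) (N + M) := by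
  obtain ⟨a, ha1, ha2, ha3⟩ := hA
  obtain ⟨b, hb1, hb2, hb3⟩ := hB
  refine ⟨fun x => a x + b x, ha1.add hb1, fun ξ => ?_, ?_⟩
  · simp only [ha2, hb2]
    rw [fourier_eq_ft, fourier_eq_ft, fourier_eq_ft, ft_add ha1 hb1]
  · calc ∫ x, ‖a x + b x‖ ≤ ∫ x, (‖a x‖ + ‖b x‖) :=
          integral_mono (ha1.add hb1).norm (ha1.norm.add hb1.norm) fun x => norm_add_le _ _
      _ = (∫ x, ‖a x‖) + ∫ x, ‖b x‖ := integral_add ha1.norm hb1.norm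
      _ ≤ N + M := add_le_add ha3 hb3

theorem HasFourierBound.mul {A B : ℝ → ℂ} {N M : ℝ} (hA : HasFourierBound A N)
    (hB : HasFourierBound B M) : HasFourierBound (fun ξ => A ξ * B ξ) (N * M) := by
  obtain ⟨a, ha1, ha2, ha3⟩ := hA
  obtain ⟨b, hb1, hb2, hb3⟩ := hB
  refine ⟨convolution a b (ContinuousLinearMap.mul ℂ ℂ) volume, ha1.integrable_convolution _ hb1, fun ξ => ?_, ?_⟩
  · simp only [ha2, hb2]
    rw [Real.fourier_mul_convolution_eq ha1 hb1]
  · have hN : 0 ≤ N := (integral_nonneg fun _ => norm_nonneg _).trans ha3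
    have hi := (ha1.norm.convolution_integrand (ContinuousLinearMap.mul ℝ ℝ) hb1.norm)
    calc ∫ x, ‖convolution a b (ContinuousLinearMap.mul ℂ ℂ) volume x‖
        ≤ ∫ x, convolution (fun x => ‖a x‖) (fun x => ‖b x‖) (ContinuousLinearMap.mul ℝ ℝ) volume x := by
          refine integral_mono (ha1.integrable_convolution _ hb1).norm
            (ha1.norm.integrable_convolution _ hb1.norm) fun x => ?_
          refine (norm_integral_le_integral_norm _).trans (le_of_eq ?_)
          simp [convolution]
      _ = (∫ x, ‖a x‖) * ∫ x, ‖b x‖ := by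
          rw [integral_convolution (ContinuousLinearMap.mul ℝ ℝ) ha1.norm hb1.norm, ContinuousLinearMap.mul_apply']
      _ ≤ N * M := mul_le_mul ha3 hb3 (integral_nonneg fun _ => norm_nonneg _) hN

theorem HasFourierBound.pow_succ {A : ℝ → ℂ} {N : ℝ} (hA : HasFourierBound A N) (n : ℕ) :
    HasFourierBound (fun ξ => A ξ ^ (n + 1)) (N ^ (n + 1)) := by
  induction n with
  | zero => simpa using hA
  | succ n ih =>
    have := ih.mul hA
    simpa only [← _root_.pow_succ] using this

/-- The series converges in L¹ by completeness, and both the transform and the evaluation at ξ are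
continuous. -/
theorem HasFourierBound.tsum {A : ℕ → ℝ → ℂ} {N : ℕ → ℝ} (h : ∀ n, HasFourierBound (A n) (N n))
    (hN : Summable N) : HasFourierBound (fun ξ => ∑' n, A n ξ) (∑' n, N n) := by
  choose c h1 h2 h3 using h
  set C : ℕ → Lp ℂ 1 (volume : Measure ℝ) := fun n => (memLp_one_iff_integrable.2 (h1 n)).toLp with hC
  have hCn : ∀ n, ‖C n‖ ≤ N n := fun n => by
    rw [L1.norm_eq_integral_norm]
    refine (le_of_eq ?_).trans (h3 n)
    refine integral_congr_ae ?_
    filter_upwards [(memLp_one_iff_integrable.2 (h1 n)).coeFn_toLp] with x hx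
    rw [hC]; simp only [hx]
  have hs : Summable C := Summable.of_norm_bounded hN hCn
  refine ⟨((∑' n, C n : Lp ℂ 1 (volume : Measure ℝ)) : ℝ → ℂ), L1.integrable_coeFn _, fun ξ => ?_, ?_⟩
  · have h4 := (Real.Lp.fourierTransformCLM ℝ ℂ).hasSum hs.hasSum
    have h5 := (BoundedContinuousFunction.evalCLM ℂ ξ).hasSum h4
    simp only [BoundedContinuousFunction.evalCLM_apply, Real.Lp.fourierTransformCLM_apply,
      Real.Lp.fourierTransform_apply] at h5
    refine Eq.trans ?_ h5.tsum_eq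
    refine tsum_congr fun n => ?_
    rw [h2, hC]
    exact (Real.fourier_congr_ae (memLp_one_iff_integrable.2 (h1 n)).coeFn_toLp ξ).symm
  · rw [← L1.norm_eq_integral_norm]
    exact tsum_of_norm_bounded hN.hasSum hCn

/-- Twice differentiable functions with integrable derivatives are Fourier transforms. -/
theorem hasFourierBound_of_deriv {G G1 G2 : ℝ → ℂ} (h1 : ∀ x, HasDerivAt G (G1 x) x)
    (h2 : ∀ x, HasDerivAt G1 (G2 x) x) (hi : Integrable G) (hi1 : Integrable G1)
    (hi2 : Integrable G2) :
    HasFourierBound G (Real.pi * ((∫ x, ‖G x‖) + ∫ x, ‖G2 x‖)) := by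
  set M := (∫ x, ‖G x‖) + ∫ x, ‖G2 x‖ with hM
  have hd1 : deriv G = G1 := funext fun x => (h1 x).deriv
  have hd2 : deriv G1 = G2 := funext fun x => (h2 x).deriv
  have f1 := Real.fourier_deriv hi (fun x => (h1 x).differentiableAt) (by rwa [hd1])
  have f2 := Real.fourier_deriv hi1 (fun x => (h2 x).differentiableAt) (by rwa [hd2])
  rw [hd1] at f1
  rw [hd2] at f2
  -- The transform of G'' is -(2πξ)² times that of G, and (2π)² ≥ 1; the constant π in the statement
  -- is the integral of 1/(1 + ξ²).
  have hb : ∀ ξ, ‖𝓕 G ξ‖ ≤ M * (1 + ξ ^ 2)⁻¹ := by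
    intro ξ
    rw [← div_eq_mul_inv, le_div_iff₀ (by positivity)]
    have a1 : ‖𝓕 G ξ‖ ≤ ∫ x, ‖G x‖ := by rw [fourier_eq_ft]; exact norm_ft_le _ _
    have a2 : ‖𝓕 G2 ξ‖ ≤ ∫ x, ‖G2 x‖ := by rw [fourier_eq_ft]; exact norm_ft_le _ _
    have a3 : ‖𝓕 G2 ξ‖ = (2 * Real.pi) ^ 2 * ξ ^ 2 * ‖𝓕 G ξ‖ := by
      rw [f2]; simp only [f1, norm_smul, norm_mul, Complex.norm_I, Complex.norm_real,
        Real.norm_eq_abs, mul_one, Complex.norm_ofNat, abs_of_pos Real.pi_pos]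
      rw [← sq_abs ξ]; ring
    have a4 : 1 ≤ (2 * Real.pi) ^ 2 := by nlinarith [Real.pi_gt_three]
    have a5 : ξ ^ 2 * ‖𝓕 G ξ‖ ≤ (2 * Real.pi) ^ 2 * ξ ^ 2 * ‖𝓕 G ξ‖ := by
      rw [mul_assoc]; exact le_mul_of_one_le_left (by positivity) a4
    rw [hM]; linarith
  have hc : Continuous (𝓕 G) := by
    have : 𝓕 G = fun ξ => ft G (-(2 * Real.pi * ξ)) := funext (fourier_eq_ft G)
    rw [this]; exact (continuous_ft hi).comp (by fun_prop)
  have hFi : Integrable (𝓕 G) := (integrable_inv_one_add_sq.const_mul M).mono'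
    hc.aestronglyMeasurable (Eventually.of_forall hb)
  have hGc : Continuous G := continuous_iff_continuousAt.2 fun x => (h1 x).continuousAt
  have hneg : 𝓕⁻ G = fun x => 𝓕 G (-x) := funext fun x => Real.fourierInv_eq_fourier_neg G x
  refine ⟨𝓕⁻ G, by rw [hneg]; exact hFi.comp_neg, fun ξ => ?_, ?_⟩
  · rw [hGc.fourier_fourierInv_eq hi hFi]
  · rw [hneg]
    have := integral_neg_eq_self (fun x => ‖𝓕 G x‖) volume
    rw [this]
    calc ∫ x, ‖𝓕 G x‖ ≤ ∫ x : ℝ, M * (1 + x ^ 2)⁻¹ :=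
          integral_mono hFi.norm (integrable_inv_one_add_sq.const_mul M) hb
      _ = Real.pi * M := by rw [integral_const_mul, integral_univ_inv_one_add_sq, mul_comm]

end fourier
end HalfLine
-- Wiener's lemma
namespace HalfLine

section wiener
open FourierTransform

/-- The hypothesis on u and w says u = 1/(1 + w). The point is that powers of u are close to 1
wherever w is small, so they inherit integrability from w. -/
theorem norm_pow_sub_one_le {u w : ℂ} {r : ℝ} (hr : 1 ≤ r) (hu : ‖u‖ ≤ r)
    (hw : u - 1 = -(u * w)) (n : ℕ) : ‖u ^ n - 1‖ ≤ n * r ^ n * ‖w‖ := by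
  induction n with
  | zero => simp
  | succ n ih =>
    have h1 : u ^ (n + 1) - 1 = u * (u ^ n - 1) + -(u * w) := by rw [← hw]; ring
    rw [h1]
    have h0 : 0 ≤ r := zero_le_one.trans hr
    have hp : (1 : ℝ) ≤ r ^ n := one_le_pow₀ hr
    calc ‖u * (u ^ n - 1) + -(u * w)‖ ≤ ‖u‖ * ‖u ^ n - 1‖ + ‖u‖ * ‖w‖ := by
          refine (norm_add_le _ _).trans ?_
          rw [norm_neg, norm_mul, norm_mul]
      _ ≤ r * (n * r ^ n * ‖w‖) + r * ‖w‖ := by gcongr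
      _ ≤ r * (n * r ^ n * ‖w‖) + r * r ^ n * ‖w‖ := by
          gcongr; exact le_mul_of_one_le_right h0 hp
      _ = _ := by push_cast; ring

/-- The heart of Newman's argument. Two derivatives of u^(n+1) cost a factor (n+1)(n+2) and two
further powers of u; hence up to polynomial factors the Fourier norms grow like r^n, where r bounds
only the supremum of u. The constant 1 is subtracted because u tends to 1 at infinity. -/
theorem hasFourierBound_inv_pow (p : SchwartzMap ℝ ℂ) {r : ℝ} (hr : 1 ≤ r)
    (h0 : ∀ ξ, 1 + p ξ ≠ 0) (hp : ∀ ξ, ‖(1 + p ξ)⁻¹‖ ≤ r) :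
    ∃ K : ℝ, 0 ≤ K ∧ ∀ n : ℕ, HasFourierBound (fun ξ => (1 + p ξ)⁻¹ ^ (n + 1) - 1)
      (K * ((n + 1) * (n + 2)) * r ^ (n + 3)) := by
  have hr0 : 0 ≤ r := zero_le_one.trans hr
  set p1 : SchwartzMap ℝ ℂ := SchwartzMap.derivCLM ℝ ℂ p with hp1
  set p2 : SchwartzMap ℝ ℂ := SchwartzMap.derivCLM ℝ ℂ p1 with hp2
  have hd1 : ∀ x, HasDerivAt p (p1 x) x := fun x => by
    rw [hp1, SchwartzMap.derivCLM_apply]; exact (p.differentiableAt).hasDerivAt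
  have hd2 : ∀ x, HasDerivAt p1 (p2 x) x := fun x => by
    rw [hp2, SchwartzMap.derivCLM_apply]; exact (p1.differentiableAt).hasDerivAt
  obtain ⟨B, hB⟩ := p1.decay 0 0
  have hB' : ∀ x, ‖p1 x‖ ≤ B := fun x => by simpa using hB.2 x
  have hB0 : 0 ≤ B := (norm_nonneg _).trans (hB' 0)
  set K : ℝ := Real.pi * ((∫ x, ‖p x‖) + (B * (∫ x, ‖p1 x‖) + ∫ x, ‖p2 x‖)) with hK
  have I0 : 0 ≤ ∫ x, ‖p x‖ := integral_nonneg fun _ => norm_nonneg _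
  have I1 : 0 ≤ ∫ x, ‖p1 x‖ := integral_nonneg fun _ => norm_nonneg _
  have I2 : 0 ≤ ∫ x, ‖p2 x‖ := integral_nonneg fun _ => norm_nonneg _
  refine ⟨K, by positivity, fun n => ?_⟩
  set u : ℝ → ℂ := fun ξ => (1 + p ξ)⁻¹ with hu
  have hud : ∀ x, HasDerivAt u (-(u x ^ 2 * p1 x)) x := fun x => by
    refine (((hd1 x).const_add 1).inv (h0 x)).congr_deriv ?_
    simp only [hu]; field_simp
  have hg1 : ∀ x, HasDerivAt (fun ξ => u ξ ^ (n + 1) - 1)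
      (-((n + 1) * u x ^ (n + 2) * p1 x)) x := fun x => by
    refine (((hud x).pow (n + 1)).sub_const 1).congr_deriv ?_
    push_cast; ring
  have hg2 : ∀ x, HasDerivAt (fun x => -((n + 1) * u x ^ (n + 2) * p1 x))
      ((n + 1) * (n + 2) * u x ^ (n + 3) * p1 x ^ 2 - (n + 1) * u x ^ (n + 2) * p2 x) x :=
    fun x => by
    refine ((((hud x).pow (n + 2)).const_mul ((n : ℂ) + 1)).mul (hd2 x)).fun_neg.congr_deriv ?_
    simp only [Pi.pow_apply, show n + 2 - 1 = n + 1 from rfl]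
    push_cast; ring
  have huc : Continuous u := continuous_iff_continuousAt.2 fun x => (hud x).continuousAt
  have hb0 : ∀ x, ‖u x ^ (n + 1) - 1‖ ≤ (n + 1) * r ^ (n + 1) * ‖p x‖ := fun x => by
    have := norm_pow_sub_one_le hr (hp x) (w := p x) (by have := h0 x; field_simp; ring) (n + 1)
    exact_mod_cast this
  have hpow : ∀ m x, ‖u x ^ m‖ ≤ r ^ m := fun m x => by
    rw [norm_pow]; exact pow_le_pow_left₀ (norm_nonneg _) (hp x) m
  have nn : ∀ a : ℕ, ‖(n : ℂ) + a‖ = (n : ℝ) + a := fun a => by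
    rw [← Nat.cast_add, Complex.norm_natCast, Nat.cast_add]
  have nn1 : ‖(n : ℂ) + 1‖ = (n : ℝ) + 1 := by exact_mod_cast nn 1
  have nn2 : ‖(n : ℂ) + 2‖ = (n : ℝ) + 2 := by exact_mod_cast nn 2
  have hb1 : ∀ x, ‖-((n + 1) * u x ^ (n + 2) * p1 x)‖ ≤ (n + 1) * r ^ (n + 2) * ‖p1 x‖ := fun x => by
    rw [norm_neg, norm_mul, norm_mul, nn1]
    gcongr; exact hpow _ _
  have hb2 : ∀ x, ‖(n + 1) * (n + 2) * u x ^ (n + 3) * p1 x ^ 2 - (n + 1) * u x ^ (n + 2) * p2 x‖ ≤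
      ((n + 1) * (n + 2) * r ^ (n + 3)) * (B * ‖p1 x‖ + ‖p2 x‖) := fun x => by
    refine (norm_sub_le _ _).trans ?_
    rw [norm_mul, norm_mul, norm_mul, norm_mul, norm_mul, nn1, nn2, norm_pow (p1 x),
      mul_add (((n : ℝ) + 1) * (n + 2) * r ^ (n + 3)), sq]
    have e1 : (n + 1 : ℝ) * r ^ (n + 2) ≤ (n + 1) * (n + 2) * r ^ (n + 3) := by
      have : r ^ (n + 2) ≤ r ^ (n + 3) := pow_le_pow_right₀ hr (by omega)
      calc (n + 1 : ℝ) * r ^ (n + 2) ≤ (n + 1) * (1 * r ^ (n + 3)) := by rw [one_mul]; gcongr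
        _ ≤ (n + 1) * ((n + 2) * r ^ (n + 3)) := by gcongr; linarith [Nat.cast_nonneg (α := ℝ) n]
        _ = _ := by ring
    refine add_le_add ?_ ?_
    · gcongr
      · exact hpow _ _
      · exact hB' x
    · refine (mul_le_mul_of_nonneg_right (mul_le_mul_of_nonneg_left (hpow _ x) (by positivity))
        (norm_nonneg _)).trans ?_
      exact mul_le_mul_of_nonneg_right e1 (norm_nonneg _)
  have i0 : Integrable fun x => u x ^ (n + 1) - 1 := Integrable.mono' (p.integrable.norm.const_mul _)
    (by fun_prop) (Eventually.of_forall hb0)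
  have i1 : Integrable fun x => -((n + 1) * u x ^ (n + 2) * p1 x) :=
    Integrable.mono' (p1.integrable.norm.const_mul _)
    (Continuous.aestronglyMeasurable (by have := p1.continuous; fun_prop)) (Eventually.of_forall hb1)
  have ib2 := ((p1.integrable.norm (μ := volume)).const_mul B).add p2.integrable.norm
  have i2 : Integrable fun x => (n + 1) * (n + 2) * u x ^ (n + 3) * p1 x ^ 2 -
      (n + 1) * u x ^ (n + 2) * p2 x :=
    Integrable.mono' (ib2.const_mul _)
    (Continuous.aestronglyMeasurable (by have := p1.continuous; have := p2.continuous; fun_prop))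
    (Eventually.of_forall hb2)
  refine (hasFourierBound_of_deriv hg1 hg2 i0 i1 i2).mono ?_
  have j0 := integral_mono i0.norm (p.integrable.norm.const_mul _) hb0
  have j2 := integral_mono i2.norm (ib2.const_mul _) hb2
  simp only [Pi.add_apply] at j2
  rw [integral_const_mul] at j0 j2
  rw [integral_add (p1.integrable.norm.const_mul B) p2.integrable.norm, integral_const_mul] at j2
  have e0 : (n + 1 : ℝ) * r ^ (n + 1) ≤ (n + 1) * (n + 2) * r ^ (n + 3) := by
    have : r ^ (n + 1) ≤ r ^ (n + 3) := pow_le_pow_right₀ hr (by omega)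
    calc (n + 1 : ℝ) * r ^ (n + 1) ≤ (n + 1) * (1 * r ^ (n + 3)) := by rw [one_mul]; gcongr
      _ ≤ (n + 1) * ((n + 2) * r ^ (n + 3)) := by gcongr; linarith [Nat.cast_nonneg (α := ℝ) n]
      _ = _ := by ring
  have j0' := j0.trans (mul_le_mul_of_nonneg_right e0 I0)
  calc _ ≤ Real.pi * ((n + 1) * (n + 2) * r ^ (n + 3) * (∫ x, ‖p x‖) +
        (n + 1) * (n + 2) * r ^ (n + 3) * (B * (∫ x, ‖p1 x‖) + ∫ x, ‖p2 x‖)) :=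
        mul_le_mul_of_nonneg_left (add_le_add j0' j2) Real.pi_pos.le
    _ = _ := by rw [hK]; ring

/-- **Wiener's lemma** on the line. -/
theorem exists_fourier_inverse {l : ℝ → ℂ} (hl : Integrable l) {m : ℝ} (hm : 0 < m)
    (hlm : ∀ ξ, m ≤ ‖1 + 𝓕 l ξ‖) :
    ∃ c : ℝ → ℂ, Integrable c ∧ ∀ ξ, (1 + 𝓕 l ξ)⁻¹ = 1 + 𝓕 c ξ := by
  -- This makes r = 4/(3m) at least 1, so that lower powers of r are dominated by higher ones.
  wlog hm1 : m ≤ 1 generalizing m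
  · exact this one_pos (fun ξ => (not_le.1 hm1).le.trans (hlm ξ)) le_rfl
  -- With g a test function within m/4 of l in L¹ and p its transform, E = p - l^ has Fourier norm
  -- and supremum at most m/4, while |1 + p| ≥ 3m/4. Then 1/(1 + l^) = 1/(1 + p - E) is expanded in
  -- powers of E/(1 + p); by the previous lemma the series converges in Fourier norm because (m/4) ·
  -- 4/(3m) = 1/3.
  obtain ⟨g, hg1, hg2, hg3⟩ := MemLp.exist_eLpNorm_sub_le ENNReal.one_ne_top le_rfl
    (memLp_one_iff_integrable.2 hl) (show 0 < m / 4 by positivity)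
  set P : SchwartzMap ℝ ℂ := hg1.toSchwartzMap hg2 with hP
  have hPg : (P : ℝ → ℂ) = g := rfl
  have hPi : Integrable (P : ℝ → ℂ) := P.integrable
  have hgi : Integrable g := hPi
  have hnorm : ∫ x, ‖g x - l x‖ ≤ m / 4 := by
    have h1 : ∫ x, ‖g x - l x‖ = ∫ x, ‖(l - g) x‖ := by
      refine integral_congr_ae (Eventually.of_forall fun x => ?_)
      simp only [Pi.sub_apply]; rw [norm_sub_rev]
    rw [h1, integral_norm_eq_lintegral_enorm (hl.sub hgi).aestronglyMeasurable,
      ← eLpNorm_one_eq_lintegral_enorm]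
    exact ENNReal.toReal_le_of_le_ofReal (by positivity) hg3
  set p : SchwartzMap ℝ ℂ := 𝓕 P with hp
  have hpg : ∀ ξ, p ξ = 𝓕 g ξ := fun ξ => by rw [hp, SchwartzMap.fourier_coe, hPg]
  set E : ℝ → ℂ := 𝓕 (fun x => g x - l x) with hE
  have hEe : ∀ ξ, E ξ = p ξ - 𝓕 l ξ := fun ξ => by
    rw [hE, hpg, fourier_eq_ft, fourier_eq_ft, fourier_eq_ft, ft_sub hgi hl]
  have hEb : HasFourierBound E (m / 4) := ⟨_, hgi.sub hl, fun _ => rfl, hnorm⟩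
  have hEn : ∀ ξ, ‖E ξ‖ ≤ m / 4 := fun ξ => by
    rw [hE, fourier_eq_ft]; exact (norm_ft_le _ _).trans hnorm
  have hlow : ∀ ξ, 3 * m / 4 ≤ ‖1 + p ξ‖ := fun ξ => by
    have h1 : 1 + 𝓕 l ξ = (1 + p ξ) - E ξ := by rw [hEe]; ring
    have h2 := hlm ξ
    rw [h1] at h2
    have := norm_sub_le (1 + p ξ) (E ξ)
    linarith [hEn ξ]
  have hne : ∀ ξ, 1 + p ξ ≠ 0 := fun ξ h => by
    have := hlow ξ; rw [h, norm_zero] at this; linarith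
  set r : ℝ := 4 / (3 * m) with hr
  have hr1 : 1 ≤ r := by rw [hr, le_div_iff₀ (by positivity)]; linarith
  have hinv : ∀ ξ, ‖(1 + p ξ)⁻¹‖ ≤ r := fun ξ => by
    rw [norm_inv, hr, show 4 / (3 * m) = (3 * m / 4)⁻¹ by field_simp]
    exact inv_anti₀ (by positivity) (hlow ξ)
  obtain ⟨K, hK0, hK⟩ := hasFourierBound_inv_pow p hr1 hne hinv
  have hεr : m / 4 * r = 1 / 3 := by rw [hr]; field_simp
  -- The terms of the expansion from the first power of E on. Each power of 1/(1 + p) is 1 plus a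
  -- transform, which explains the two summands in the bound.
  set A : ℕ → ℝ → ℂ := fun n ξ => E ξ ^ (n + 1) * (1 + p ξ)⁻¹ ^ (n + 1 + 1) with hA
  have hAb : ∀ n, HasFourierBound (A n) ((m / 4) ^ (n + 1) + (m / 4) ^ (n + 1) *
      (K * (((n + 1 : ℕ) + 1) * ((n + 1 : ℕ) + 2)) * r ^ (n + 1 + 3))) := fun n => by
    have := (hEb.pow_succ n).add ((hEb.pow_succ n).mul (hK (n + 1)))
    refine (congrArg (HasFourierBound · _) ?_).mp this
    funext ξ; simp only [hA]; ring
  have hsum : Summable fun n : ℕ => (m / 4) ^ (n + 1) + (m / 4) ^ (n + 1) *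
      (K * (((n + 1 : ℕ) + 1) * ((n + 1 : ℕ) + 2)) * r ^ (n + 1 + 3)) := by
    refine Summable.add ?_ ?_
    · exact (summable_nat_add_iff 1).2 (summable_geometric_of_lt_one (by positivity) (by linarith))
    · have hs : ∀ k : ℕ, Summable fun n : ℕ => (n : ℝ) ^ k * (1 / 3 : ℝ) ^ n := fun k =>
        summable_pow_mul_geometric_of_norm_lt_one k (by norm_num)
      have := (((hs 2).add ((hs 1).mul_left 3)).add ((hs 0).mul_left 2)).mul_left (K * r ^ 3)
      refine ((summable_nat_add_iff 1).2 this).congr fun n => ?_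
      rw [← hεr, mul_pow]
      ring
  obtain ⟨c1, h1, h2, -⟩ := HasFourierBound.tsum hAb hsum
  obtain ⟨c0, h3, h4, -⟩ := hK 0
  refine ⟨fun x => c0 x + c1 x, h3.add h1, fun ξ => ?_⟩
  have hEp : ‖E ξ * (1 + p ξ)⁻¹‖ < 1 := by
    rw [norm_mul]
    calc _ ≤ m / 4 * r := mul_le_mul (hEn ξ) (hinv ξ) (norm_nonneg _) (by positivity)
      _ < 1 := by rw [hεr]; norm_num
  rw [fourier_eq_ft (fun x => c0 x + c1 x), ft_add h3 h1, ← fourier_eq_ft, ← fourier_eq_ft, ← h2,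
    ← h4]
  have hgeo := tsum_geometric_of_norm_lt_one hEp
  have hA' : ∑' n, A n ξ = E ξ * (1 + p ξ)⁻¹ ^ 2 * (1 - E ξ * (1 + p ξ)⁻¹)⁻¹ := by
    rw [← hgeo, ← tsum_mul_left]
    refine tsum_congr fun n => ?_
    simp only [hA]; ring
  beta_reduce
  rw [hA', show 1 + 𝓕 l ξ = (1 + p ξ) * (1 - E ξ * (1 + p ξ)⁻¹) by
    rw [hEe]; have := hne ξ; field_simp; ring]
  have hn1 : 1 - E ξ * (1 + p ξ)⁻¹ ≠ 0 := fun h => by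
    rw [← sub_eq_zero.1 h, norm_one] at hEp; exact lt_irrefl _ hEp
  rw [mul_inv]
  have := mul_inv_cancel₀ hn1
  have h5 := hne ξ
  generalize (1 - E ξ * (1 + p ξ)⁻¹)⁻¹ = z at *
  have : z = 1 + E ξ * (1 + p ξ)⁻¹ * z := by linear_combination this
  calc (1 + p ξ)⁻¹ * z = (1 + p ξ)⁻¹ * (1 + E ξ * (1 + p ξ)⁻¹ * z) := by rw [← this]
    _ = _ := by rw [zero_add, pow_one]; ring

end wiener

theorem exists_ft_inverse {l : ℝ → ℂ} (hl : Integrable l) {m : ℝ} (hm : 0 < m)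
    (hlm : ∀ k, m ≤ ‖1 + ft l k‖) :
    ∃ c : ℝ → ℂ, Integrable c ∧ ∀ k, (1 + ft l k)⁻¹ = 1 + ft c k := by
  obtain ⟨c, hc, h⟩ := exists_fourier_inverse hl hm fun ξ => by rw [fourier_eq_ft]; exact hlm _
  refine ⟨c, hc, fun k => ?_⟩
  rw [ft_eq_fourier, ft_eq_fourier]; exact h _

/-- The Fourier transform of a convolution, in existential form. -/
theorem exists_ft_mul {f g : ℝ → ℂ} (hf : Integrable f) (hg : Integrable g) :
    ∃ c : ℝ → ℂ, Integrable c ∧ ∀ k, ft c k = ft f k * ft g k := by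
  obtain ⟨c, hc, h, -⟩ := HasFourierBound.mul ⟨f, hf, fun _ => rfl, le_rfl⟩
    ⟨g, hg, fun _ => rfl, le_rfl⟩
  exact ⟨c, hc, fun k => by simp only [ft_eq_fourier]; exact (h _).symm⟩

end HalfLine
-- Marchenko's equation on the diagonal as a Volterra equation for F
namespace HalfLine

/-- The terms of the Neumann series of `u(x) = -A(x,x) - 2 ∫_x^∞ A(x, 2t - x) u(t) dt`. -/
noncomputable def diagTerm (q : ℝ → ℝ) : ℕ → ℝ → ℝ
  | 0 => indicator (Ioi 0) fun x => -kern q x x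
  | n + 1 => indicator (Ioi 0) fun x => ∫ t in Ioi x, -2 * kern q x (2 * t - x) * diagTerm q n t

/-- The solution of Marchenko's equation, regarded as an equation for `F` on the diagonal. -/
noncomputable def marF (q : ℝ → ℝ) (z : ℝ) : ℝ := ∑' n, diagTerm q n (z / 2)

/-- Translation of the variable in an integral over a half-line. -/
theorem setIntegral_Ioi_comp_add_right {E : Type*} [NormedAddCommGroup E] [NormedSpace ℝ E]
    (f : ℝ → E) (a b : ℝ) : ∫ y in Ioi (a + b), f y = ∫ s in Ioi a, f (s + b) := by
  have h := (measurePreserving_add_right volume b).setIntegral_preimage_emb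
    (measurableEmbedding_addRight b) f (Ioi (a + b))
  rw [← h, preimage_add_const_Ioi, add_sub_cancel_right]

section marF
variable {q : ℝ → ℝ} (hq : IsL11 q)

/-- The majorant `2 K sig`. -/
noncomputable def sigw (q : ℝ → ℝ) (t : ℝ) : ℝ := 2 * kernConst q * sig q t

theorem sigw_nonneg (t : ℝ) : 0 ≤ sigw q t :=
  mul_nonneg (mul_nonneg zero_le_two kernConst_pos.le) (sig_nonneg _)

include hq

theorem integrableOn_sigw : IntegrableOn (sigw q) (Ioi 0) :=
  (sig_tail hq le_rfl).1.const_mul _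

/-- The coordinates of (x, 2t - x) add up to 2t, so the kernel bound there depends on t alone: the
diagonal equation is of Volterra type with an integrable density, and its Neumann series converges.
-/
theorem abs_kern_reflect_le {x t : ℝ} (hx : 0 < x) (ht : x < t) :
    |-2 * kern q x (2 * t - x)| ≤ sigw q t := by
  have h := abs_kern_le hq (x := x) (y := 2 * t - x)
    ⟨hx.le, show x ≤ 2 * t - x by linarith, show 0 < 2 * t - x by linarith⟩
  rw [show (x + (2 * t - x)) / 2 = t by ring] at h
  rw [abs_mul, abs_neg, abs_two, sigw]
  linarith

theorem measurable_kern : Measurable (Function.uncurry (kern q)) := (admissible_kern hq).meas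

theorem stronglyMeasurable_diagTerm (n : ℕ) : StronglyMeasurable (diagTerm q n) := by
  induction n with
  | zero =>
    exact (((measurable_kern hq).comp
      (measurable_id.prodMk measurable_id)).neg.stronglyMeasurable).indicator measurableSet_Ioi
  | succ n ih =>
    refine (stronglyMeasurable_integral_Ioi (B := fun x t => -2 * kern q x (2 * t - x) *
      diagTerm q n t) ?_ measurable_id).indicator measurableSet_Ioi
    refine StronglyMeasurable.mul ?_ (ih.comp_measurable measurable_snd)
    exact (((measurable_kern hq).comp (measurable_fst.prodMk
      ((measurable_snd.const_mul 2).sub measurable_fst))).const_mul (-2)).stronglyMeasurable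

/-- The contraction argument again, with weight built from `sigw`. The decreasing factor sig q t ≤
sig q x is pulled out of the integral, so that the sum of the series still decays like `sig`. -/
theorem abs_diagTerm_le (n : ℕ) {x : ℝ} (hx : 0 < x) :
    |diagTerm q n x| ≤ kernConst q * sig q x * (1 / 2) ^ n * weight (sigw q) x := by
  have hw0 : ∀ s ∈ Ioi (0 : ℝ), 0 ≤ sigw q s := fun s _ => sigw_nonneg s
  induction n generalizing x with
  | zero =>
    have h := abs_kern_le hq (x := x) (y := x) ⟨hx.le, le_rfl, hx⟩
    rw [add_self_div_two] at h
    rw [diagTerm, indicator_of_mem (mem_Ioi.2 hx), abs_neg, pow_zero, mul_one]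
    exact h.trans (le_mul_of_one_le_right (mul_nonneg kernConst_pos.le (sig_nonneg _))
      (one_le_weight hw0 hx.le))
  | succ n ih =>
    rw [diagTerm, indicator_of_mem (mem_Ioi.2 hx)]
    have hi := ((integrableOn_mul_weight (integrableOn_sigw hq) hw0).mono_set
      (Ioi_subset_Ioi hx.le)).const_mul (kernConst q * sig q x * (1 / 2) ^ n)
    have hK := kernConst_pos (q := q)
    have hs := sig_nonneg (q := q) x
    refine (norm_integral_le_of_norm_le (f := fun t => -2 * kern q x (2 * t - x) * diagTerm q n t)
      hi ?_).trans ?_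
    · filter_upwards [ae_restrict_mem measurableSet_Ioi] with t ht
      have ht0 := hx.trans ht
      rw [norm_mul, Real.norm_eq_abs, Real.norm_eq_abs]
      calc _ ≤ sigw q t * (kernConst q * sig q t * (1 / 2) ^ n * weight (sigw q) t) :=
            mul_le_mul (abs_kern_reflect_le hq hx ht) (ih ht0) (abs_nonneg _) (sigw_nonneg t)
        _ ≤ sigw q t * (kernConst q * sig q x * (1 / 2) ^ n * weight (sigw q) t) := by
            have := sig_anti hq hx (le_of_lt ht)
            have h1 := sigw_nonneg (q := q) t
            have h2 := (weight_pos (w := sigw q) t).le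
            gcongr
        _ = _ := by ring
    · rw [integral_const_mul]
      calc _ ≤ kernConst q * sig q x * (1 / 2) ^ n * (weight (sigw q) x / 2) :=
            mul_le_mul_of_nonneg_left (integral_mul_weight_le (integrableOn_sigw hq) hw0 hx.le)
              (by positivity)
        _ = _ := by rw [pow_succ]; ring

/-- The constant in `|F(z)| ≤ C sig(z / 2)`. -/
noncomputable def marConst (q : ℝ → ℝ) : ℝ := 2 * kernConst q * weight (sigw q) 0

omit hq in
theorem marConst_pos : 0 < marConst q :=
  mul_pos (mul_pos zero_lt_two kernConst_pos) (weight_pos _)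

theorem abs_diagTerm_le' (n : ℕ) {x : ℝ} (hx : 0 < x) :
    |diagTerm q n x| ≤ kernConst q * sig q x * weight (sigw q) 0 * (1 / 2) ^ n := by
  refine (abs_diagTerm_le hq n hx).trans ?_
  have := weight_antitone (integrableOn_sigw hq) (fun s _ => sigw_nonneg s) le_rfl hx.le
  have hK := kernConst_pos (q := q)
  have hs := sig_nonneg (q := q) x
  calc _ ≤ kernConst q * sig q x * (1 / 2) ^ n * weight (sigw q) 0 := by gcongr
    _ = _ := by ring

theorem summable_diagTerm {x : ℝ} (hx : 0 < x) : Summable fun n => diagTerm q n x :=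
  Summable.of_norm_bounded ((summable_geometric_of_lt_one (by norm_num)
    (by norm_num : (1 / 2 : ℝ) < 1)).mul_left _) fun n => abs_diagTerm_le' hq n hx

theorem abs_marF_le {z : ℝ} (hz : 0 < z) : |marF q z| ≤ marConst q * sig q (z / 2) := by
  have hg := (hasSum_geometric_of_lt_one (by norm_num)
    (by norm_num : (1 / 2 : ℝ) < 1)).mul_left
    (kernConst q * sig q (z / 2) * weight (sigw q) 0)
  refine (tsum_of_norm_bounded (f := fun n => diagTerm q n (z / 2)) hg fun n => abs_diagTerm_le' hq n (half_pos hz)).trans (le_of_eq ?_)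
  rw [marConst]; ring

theorem abs_marF_le_of_le {c z : ℝ} (hc : 0 < c) (hz : c ≤ z) :
    ‖marF q z‖ ≤ marConst q * sig q (c / 2) :=
  (abs_marF_le hq (hc.trans_le hz)).trans (mul_le_mul_of_nonneg_left
    (sig_anti hq (half_pos hc) (by linarith)) marConst_pos.le)

theorem stronglyMeasurable_marF : StronglyMeasurable (marF q) := by
  refine Measurable.stronglyMeasurable (Measurable.tsum fun n => ?_)
  exact (stronglyMeasurable_diagTerm hq n).measurable.comp (measurable_id.div_const 2)

theorem marF_two_mul {x : ℝ} (hx : 0 < x) :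
    marF q (2 * x) = -kern q x x + ∫ t in Ioi x, -2 * kern q x (2 * t - x) * marF q (2 * t) := by
  have hs : ∀ t : ℝ, marF q (2 * t) = ∑' n, diagTerm q n t := fun t => by
    rw [marF, mul_div_cancel_left₀ _ two_ne_zero]
  have hw0 : ∀ s ∈ Ioi (0 : ℝ), 0 ≤ sigw q s := fun s _ => sigw_nonneg s
  rw [hs, (summable_diagTerm hq hx).tsum_eq_zero_add]
  congr 1
  · rw [diagTerm, indicator_of_mem (mem_Ioi.2 hx)]
  simp only [diagTerm, indicator_of_mem (mem_Ioi.2 hx), hs, ← tsum_mul_left]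
  have hbd : ∀ n : ℕ, ∀ t ∈ Ioi x, ‖-2 * kern q x (2 * t - x) * diagTerm q n t‖ ≤
      kernConst q * sig q x * weight (sigw q) 0 * (1 / 2) ^ n * sigw q t := by
    intro n t ht
    rw [mem_Ioi] at ht
    rw [norm_mul, Real.norm_eq_abs, Real.norm_eq_abs, mul_comm]
    have h1 := abs_diagTerm_le' hq n (hx.trans ht)
    have h2 := abs_kern_reflect_le hq hx ht
    have h3 := sig_anti hq hx ht.le
    have hK := kernConst_pos (q := q)
    have h4 := (weight_pos (w := sigw q) 0).le
    refine mul_le_mul (h1.trans ?_) h2 (abs_nonneg _) ?_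
    · gcongr
    · have := sig_nonneg (q := q) x; positivity
  have hsw := (integrableOn_sigw hq).mono_set (Ioi_subset_Ioi hx.le)
  have hint : ∀ n, IntegrableOn (fun t => -2 * kern q x (2 * t - x) * diagTerm q n t) (Ioi x) := by
    intro n
    refine Integrable.mono' (hsw.const_mul _) ?_ ((ae_restrict_mem measurableSet_Ioi).mono (hbd n))
    exact ((((measurable_kern hq).of_uncurry_left.comp
      ((measurable_id.const_mul 2).sub_const x)).const_mul (-2)).mul
      (stronglyMeasurable_diagTerm hq n).measurable).aestronglyMeasurable
  refine integral_tsum_of_summable_integral_norm hint ?_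
  refine Summable.of_nonneg_of_le (fun n => integral_nonneg fun _ => norm_nonneg _) (fun n => ?_)
    (((summable_geometric_of_lt_one (by norm_num) (by norm_num : (1 / 2 : ℝ) < 1)).mul_left
      (kernConst q * sig q x * weight (sigw q) 0)).mul_right (∫ t in Ioi x, sigw q t))
  calc _ ≤ ∫ t in Ioi x, kernConst q * sig q x * weight (sigw q) 0 * (1 / 2) ^ n * sigw q t :=
        setIntegral_mono_on (hint n).norm (hsw.const_mul _) measurableSet_Ioi (hbd n)
    _ = _ := integral_const_mul _ _

/-- Marchenko's equation on the diagonal. -/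
theorem transm_marF_diag {x : ℝ} (hx : 0 < x) : transm q (marF q) x x + kern q x x = 0 := by
  have h1 := marF_two_mul hq hx
  have h2 : ∫ t in Ioi x, -2 * kern q x (2 * t - x) * marF q (2 * t)
      = -∫ s in Ioi x, kern q x s • marF q (s + x) := by
    -- The substitution s = 2t - x, which is meant to make the argument s + x of F equal to 2t.
    have h3 := integral_comp_mul_left_Ioi (fun y => kern q x (y - x) * marF q y) x
      (b := 2) two_pos
    have h4 : ∫ s in Ioi x, kern q x s • marF q (s + x)
        = ∫ y in Ioi (2 * x), kern q x (y - x) * marF q y := by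
      rw [two_mul, setIntegral_Ioi_comp_add_right (fun y => kern q x (y - x) * marF q y)]
      simp only [add_sub_cancel_right, smul_eq_mul]
    rw [h4, ← neg_eq_iff_eq_neg, ← integral_neg]
    rw [smul_eq_mul, eq_inv_mul_iff_mul_eq₀ two_ne_zero, ← integral_const_mul] at h3
    rw [← h3]
    refine setIntegral_congr_fun measurableSet_Ioi fun t _ => ?_
    ring
  rw [transm, ← two_mul, h1, h2]
  ring

end marF
end HalfLine
-- Marchenko's equation off the diagonal
namespace HalfLine

theorem add_pos_of_mem {x y : ℝ} (h : (x, y) ∈ kernelDomain) : 0 < x + y :=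
  add_pos_of_nonneg_of_pos h.1 h.2.2

section marchenko
variable {q : ℝ → ℝ} (hq : IsL11 q)

open Classical in
/-- The left-hand side of Marchenko's equation, extended by zero. -/
noncomputable def marDefect (q : ℝ → ℝ) (x y : ℝ) : ℝ :=
  if (x, y) ∈ kernelDomain then transm q (marF q) x y + kern q x y else 0

theorem marDefect_of_mem {x y : ℝ} (h : (x, y) ∈ kernelDomain) :
    marDefect q x y = transm q (marF q) x y + kern q x y := if_pos h

theorem marDefect_of_notMem {x y : ℝ} (h : (x, y) ∉ kernelDomain) : marDefect q x y = 0 := if_neg h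

theorem marDefect_of_lt {x y : ℝ} (h : y < x) : marDefect q x y = 0 :=
  marDefect_of_notMem fun hm => absurd hm.2.1 (not_le.2 h)

include hq

theorem abs_transm_marF_le {c x y : ℝ} (hx : 0 ≤ x) (hc : 0 < c) (hxy : c ≤ x + y) :
    |transm q (marF q) x y| ≤ marConst q * sig q (c / 2) * (1 + mass q) :=
  norm_transm_le hq hx fun _ hz => abs_marF_le_of_le hq hc (hxy.trans hz)

theorem measurable_transm_marF : Measurable (Function.uncurry (transm q (marF q))) :=
  (stronglyMeasurable_transm hq (stronglyMeasurable_marF hq)).measurable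

theorem admissible_marDefect : Admissible (marDefect q) where
  meas := by
    have h := ((measurable_transm_marF hq).add (measurable_kern hq)).indicator
      measurableSet_kernelDomain
    refine (congrArg Measurable (funext fun p => ?_)).mp h
    by_cases hp : p ∈ kernelDomain
    · rw [indicator_of_mem hp]; exact (marDefect_of_mem hp).symm
    · rw [indicator_of_notMem hp]; exact (marDefect_of_notMem hp).symm
  zero x y h := marDefect_of_notMem h
  bdd c hc := by
    obtain ⟨C, hC⟩ := (admissible_kern hq).bdd c hc
    refine ⟨max (marConst q * sig q (c / 2) * (1 + mass q) + C) 0, fun x y hxy => ?_⟩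
    by_cases h : (x, y) ∈ kernelDomain
    · rw [marDefect_of_mem h]
      exact ((abs_add_le _ _).trans (add_le_add (abs_transm_marF_le hq h.1 hc hxy)
        (hC x y hxy))).trans (le_max_left _ _)
    · rw [marDefect_of_notMem h, abs_zero]; exact le_max_right _ _

theorem intervalIntegrable_transm_marF {s a b : ℝ} (hs : 0 ≤ s) (ha : 0 < s + a) (hb : 0 < s + b) :
    IntervalIntegrable (transm q (marF q) s) volume a b := by
  refine (intervalIntegrable_const (c := marConst q * sig q ((s + min a b) / 2) *
    (1 + mass q))).mono_fun (measurable_transm_marF hq).of_uncurry_left.aestronglyMeasurable ?_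
  have hm : 0 < s + min a b := by rcases min_choice a b with h | h <;> rwa [h]
  filter_upwards [ae_restrict_mem measurableSet_uIoc] with u hu
  refine (abs_transm_marF_le hq hs hm ?_).trans (le_abs_self _)
  have := hu.1
  linarith

/-- The inner interval is cut at u = s. Above s the integrand is the defect; below s both A and the
defect vanish and only `transm` remains, over (x + y - s, s). This piece depends on x and y only
through x + y, which is what makes the argument work. -/
theorem integral_transm_add_kern {x y s : ℝ} (h : (x, y) ∈ kernelDomain) (hs : x < s) :
    (∫ u in (y - s + x)..(y + s - x), transm q (marF q) s u) +
      ∫ u in (y - s + x)..(y + s - x), kern q s u =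
    (∫ u in (y - s + x)..(y + s - x), marDefect q s u) +
      indicator (Ioi ((x + y) / 2)) (fun s => ∫ u in (x + y - s)..s, transm q (marF q) s u) s := by
  have hs0 : 0 < s := h.1.trans_lt hs
  have hxy : 0 < x + y := add_pos_of_mem h
  have hle : x ≤ y := h.2.1
  have iA := fun a b => (admissible_kern hq).intervalIntegrable hs0 a b
  have iW := fun a b => (admissible_marDefect hq).intervalIntegrable hs0 a b
  have iw : ∀ {a b}, 0 < s + a → 0 < s + b → _ := fun {a b} ha hb =>
    intervalIntegrable_transm_marF hq hs0.le (a := a) (b := b) ha hb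
  have hge : ∀ a b, s ≤ a → a ≤ b → (∫ u in a..b, transm q (marF q) s u) + ∫ u in a..b, kern q s u
      = ∫ u in a..b, marDefect q s u := by
    intro a b ha hab
    rw [← intervalIntegral.integral_add (iw (by linarith) (by linarith)) (iA a b)]
    refine intervalIntegral.integral_congr fun u hu => ?_
    rw [uIcc_of_le hab] at hu
    exact (marDefect_of_mem ⟨hs0.le, ha.trans hu.1, hs0.trans_le (ha.trans hu.1)⟩).symm
  have hzero : ∀ (B : ℝ → ℝ → ℝ) a, a ≤ s → (∀ u, u < s → B s u = 0) → ∫ u in a..s, B s u = 0 := by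
    intro B a ha hB
    rw [intervalIntegral.integral_of_le ha, integral_Ioc_eq_integral_Ioo]
    exact setIntegral_eq_zero_of_forall_eq_zero fun u hu => hB u hu.2
  by_cases hm : s ∈ Ioi ((x + y) / 2)
  · rw [indicator_of_mem hm]
    rw [mem_Ioi] at hm
    have e : y - s + x = x + y - s := by ring
    rw [e, ← intervalIntegral.integral_add_adjacent_intervals (b := s)
      (iw (by linarith) (by linarith)) (iw (by linarith) (by linarith)),
      ← intervalIntegral.integral_add_adjacent_intervals (iA _ s) (iA s _),
      ← intervalIntegral.integral_add_adjacent_intervals (iW _ s) (iW s _),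
      ← hge s _ le_rfl (by linarith), hzero _ _ (by linarith) fun u hu => kern_eq_zero_of_lt hq hu,
      hzero _ _ (by linarith) fun u hu => marDefect_of_lt hu]
    ring
  · rw [indicator_of_notMem hm, add_zero]
    rw [mem_Ioi, not_lt] at hm
    exact hge _ _ (by linarith) (by linarith)

/-- The part of the iterated equation that only depends on `x + y`. -/
noncomputable def marRest (q : ℝ → ℝ) (z : ℝ) : ℝ :=
  marF q z + (1 / 2) * (∫ s in Ioi (z / 2), q s * ∫ u in (z - s)..s, transm q (marF q) s u) +
    (1 / 2) * ∫ s in Ioi (z / 2), q s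

/-- `transm_eq` for `marF` is added to the Volterra equation for A. By the preceding splitting, all
that is not reproduced as `volt` of the defect is a function of x + y. -/
theorem marDefect_eq {x y : ℝ} (h : (x, y) ∈ kernelDomain) :
    marDefect q x y = marRest q (x + y) + volt q (marDefect q) x y := by
  have hxy : 0 < x + y := add_pos_of_mem h
  have hle : x ≤ y := h.2.1
  obtain ⟨i1, e1⟩ := transm_eq hq (stronglyMeasurable_marF hq) (x := x) (y := y) h.1
    fun z hz => abs_marF_le_of_le hq hxy hz
  have hx : 0 ≤ x := h.1
  have i2 := volt_integrableOn hq (admissible_kern hq) hx hxy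
  have i3 := volt_integrableOn hq (admissible_marDefect hq) hx hxy
  have i12 : IntegrableOn (fun s => q s * (∫ u in (y - s + x)..(y + s - x), transm q (marF q) s u) +
    q s * (∫ u in (y - s + x)..(y + s - x), kern q s u)) (Ioi x) := Integrable.add i1 i2
  set R : ℝ → ℝ := indicator (Ioi ((x + y) / 2))
    (fun s => q s * ∫ u in (x + y - s)..s, transm q (marF q) s u) with hR
  simp only [smul_eq_mul] at i1 e1
  have hpt : ∀ s ∈ Ioi x, q s * (∫ u in (y - s + x)..(y + s - x), transm q (marF q) s u) +
      q s * (∫ u in (y - s + x)..(y + s - x), kern q s u) -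
      q s * (∫ u in (y - s + x)..(y + s - x), marDefect q s u) = R s := by
    intro s hs
    have := integral_transm_add_kern hq h hs
    rw [hR]
    by_cases hm : s ∈ Ioi ((x + y) / 2)
    · rw [indicator_of_mem hm] at this ⊢
      linear_combination q s * this
    · rw [indicator_of_notMem hm] at this ⊢
      linear_combination q s * this
  have hint : ∫ s in Ioi x, R s
      = ∫ s in Ioi ((x + y) / 2), q s * ∫ u in (x + y - s)..s, transm q (marF q) s u := by
    rw [hR, setIntegral_indicator measurableSet_Ioi, Ioi_inter_Ioi, sup_of_le_right (by linarith)]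
  rw [← setIntegral_congr_fun measurableSet_Ioi hpt, integral_sub i12 i3,
    integral_add i1 i2] at hint
  rw [marDefect_of_mem h, e1, kern_eq hq h, marRest, volt, volt, ← hint]
  ring

theorem marDefect_diag (x : ℝ) : marDefect q x x = 0 := by
  by_cases h : (x, x) ∈ kernelDomain
  · rw [marDefect_of_mem h]; exact transm_marF_diag hq h.2.2
  · exact marDefect_of_notMem h

/-- On the diagonal the defect vanishes by the construction of `marF`, and so does its `volt`, whose
inner integral stays below u = s. As the diagonal meets every value of x + y, the remainder vanishes
identically. -/
theorem marRest_eq_zero {z : ℝ} (hz : 0 < z) : marRest q z = 0 := by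
  have h := marDefect_eq hq (x := z / 2) (y := z / 2) ⟨(half_pos hz).le, le_rfl, half_pos hz⟩
  have hv : ∫ s in Ioi (z / 2), q s *
      ∫ u in (z / 2 - s + z / 2)..(z / 2 + s - z / 2), marDefect q s u = 0 := by
    refine setIntegral_eq_zero_of_forall_eq_zero fun s hs => ?_
    rw [mem_Ioi] at hs
    rw [intervalIntegral.integral_of_le (by linarith), integral_Ioc_eq_integral_Ioo,
      setIntegral_eq_zero_of_forall_eq_zero, mul_zero]
    intro u hu
    exact marDefect_of_lt (by linarith [hu.2])
  rw [marDefect_diag hq, volt, hv, mul_zero, add_zero, add_halves] at h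
  exact h.symm

/-- **Marchenko's equation** for the function `marF`. -/
theorem transm_marF {x y : ℝ} (h : (x, y) ∈ kernelDomain) :
    transm q (marF q) x y = -kern q x y := by
  -- Without the remainder the defect is a fixed point of a contraction.
  have h0 := volt_eq_self hq (admissible_marDefect hq) (fun x y hxy => by
    rw [marDefect_eq hq hxy, marRest_eq_zero hq (add_pos_of_mem hxy), zero_add]) x y
  rw [marDefect_of_mem h] at h0
  exact eq_neg_of_add_eq_zero_left h0

/-- `marF q (2 x) = -∫_x^∞ marDens`. -/
noncomputable def marDens (q : ℝ → ℝ) (r : ℝ) : ℝ :=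
  (1 / 2) * q r + ∫ s in Ioi r, q s * transm q (marF q) s (2 * r - s)

theorem abs_marDens_sub_le {r : ℝ} (hr : 0 < r) :
    |∫ s in Ioi r, q s * transm q (marF q) s (2 * r - s)| ≤
      marConst q * (1 + mass q) * sig q r ^ 2 := by
  have hi := (integrableOn_q hq hr).abs.mul_const (marConst q * sig q r * (1 + mass q))
  refine (norm_integral_le_of_norm_le (f := fun s => q s * transm q (marF q) s (2 * r - s))
    hi ?_).trans ?_
  · filter_upwards [ae_restrict_mem measurableSet_Ioi] with s hs
    rw [norm_mul, Real.norm_eq_abs, Real.norm_eq_abs]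
    refine mul_le_mul_of_nonneg_left ?_ (abs_nonneg _)
    have := abs_transm_marF_le hq (x := s) (y := 2 * r - s) (c := 2 * r) (hr.trans hs).le
      (by linarith) (by linarith)
    rwa [mul_div_cancel_left₀ _ two_ne_zero] at this
  · rw [integral_mul_const, ← sig]
    refine le_of_eq ?_; ring

theorem stronglyMeasurable_marDens_aux :
    AEStronglyMeasurable (fun p : ℝ × ℝ => q p.2 * transm q (marF q) p.2 (2 * p.1 - p.2))
      ((volume.restrict (Ioi 0)).prod (volume.restrict (Ioi 0))) :=
  (aestronglyMeasurable_q hq le_rfl).comp_snd.mul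
    ((measurable_transm_marF hq).comp (measurable_snd.prodMk
      ((measurable_fst.const_mul 2).sub measurable_snd))).aestronglyMeasurable

theorem aestronglyMeasurable_marDens_aux :
    AEStronglyMeasurable (fun r => ∫ s in Ioi r, q s * transm q (marF q) s (2 * r - s))
      (volume.restrict (Ioi 0)) := by
  obtain ⟨Q, hQ, hQq⟩ := aestronglyMeasurable_q hq (le_refl (0 : ℝ))
  have h : StronglyMeasurable fun r => ∫ s in Ioi r, Q s * transm q (marF q) s (2 * r - s) := by
    refine stronglyMeasurable_integral_Ioi (B := fun r s => Q s * transm q (marF q) s (2 * r - s))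
      ?_ measurable_id
    exact (hQ.comp_measurable measurable_snd).mul ((measurable_transm_marF hq).comp
      (measurable_snd.prodMk ((measurable_fst.const_mul 2).sub measurable_snd))).stronglyMeasurable
  refine h.aestronglyMeasurable.congr ?_
  filter_upwards [ae_restrict_mem measurableSet_Ioi] with r hr
  refine integral_congr_ae ?_
  filter_upwards [ae_restrict_of_ae_restrict_of_subset (Ioi_subset_Ioi (le_of_lt hr)) hQq] with s hs
  rw [hs]

/-- The density differs from q/2 by at most a constant times `sig q`², and r · sig q r is bounded by
the first moment, so the weighted difference is dominated by the integrable `sig q`. -/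
theorem isL11_marDens : IsL11 (marDens q) := by
  have h1 : IntegrableOn (fun x => x * ((1 / 2) * q x)) (Ioi 0) := by
    refine (Integrable.const_mul hq (1 / 2)).congr (Eventually.of_forall fun x => ?_)
    ring
  have h2 : IntegrableOn (fun r => r * ∫ s in Ioi r, q s * transm q (marF q) s (2 * r - s))
      (Ioi 0) := by
    refine Integrable.mono' ((sig_tail hq le_rfl).1.const_mul
      (marConst q * (1 + mass q) * ∫ s in Ioi 0, moment q s))
      (aestronglyMeasurable_id.mul (aestronglyMeasurable_marDens_aux hq)) ?_
    filter_upwards [ae_restrict_mem measurableSet_Ioi] with r hr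
    rw [mem_Ioi] at hr
    have b1 := abs_marDens_sub_le hq hr
    have b2 := (mul_sig_le hq hr).trans (moment_tail_le hq hr.le)
    have b3 := sig_nonneg (q := q) r
    have b4 : 0 ≤ marConst q * (1 + mass q) :=
      mul_nonneg marConst_pos.le (by linarith [mass_nonneg (q := q)])
    rw [norm_mul, Real.norm_of_nonneg hr.le, Real.norm_eq_abs]
    calc _ ≤ r * (marConst q * (1 + mass q) * sig q r ^ 2) := by gcongr
      _ = marConst q * (1 + mass q) * (r * sig q r) * sig q r := by ring
      _ ≤ _ := by gcongr
  refine (h1.add h2).congr (Eventually.of_forall fun x => ?_)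
  simp only [marDens, Pi.add_apply]; ring

/-- The vanishing of `marRest`, after the substitution u = 2r - s and a change of order. That F is
the tail of a function with finite first moment yields its continuity and integrability, and later
the regularity of the Jost function. -/
theorem marF_eq_tail {z : ℝ} (hz : 0 < z) : marF q z = -∫ r in Ioi (z / 2), marDens q r := by
  have hx : 0 < z / 2 := half_pos hz
  set C := marConst q * sig q (z / 2) * (1 + mass q) with hC
  have hsub : Ioi (z / 2) ⊆ Ioi (0 : ℝ) := Ioi_subset_Ioi hx.le
  have hbd : ∀ s u, z / 2 < s → z ≤ s + u → |transm q (marF q) s u| ≤ C := fun s u hs hu =>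
    abs_transm_marF_le hq (hx.trans hs).le hz hu
  have hswap := integral_triangle_swap (G := fun r s => q s * transm q (marF q) s (2 * r - s))
    (a := z / 2) ((stronglyMeasurable_marDens_aux hq).mono_measure
      (Measure.prod_mono (Measure.restrict_mono hsub le_rfl) (Measure.restrict_mono hsub le_rfl)))
    (b := fun s => C * moment q s) (((integrableOn_moment hq).mono_set hsub).const_mul C) (by
      filter_upwards [ae_restrict_mem measurableSet_Ioi] with s hs
      rw [mem_Ioi] at hs
      have hb : ∀ r ∈ Ioo (z / 2) s, ‖q s * transm q (marF q) s (2 * r - s)‖ ≤ |q s| * C := by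
        intro r hr
        rw [norm_mul, Real.norm_eq_abs, Real.norm_eq_abs]
        exact mul_le_mul_of_nonneg_left (hbd _ _ hs (by linarith [hr.1])) (abs_nonneg _)
      constructor
      · refine IntegrableOn.of_bound (C := |q s| * C) (by simp) ?_
          ((ae_restrict_mem measurableSet_Ioo).mono hb)
        exact (((measurable_transm_marF hq).of_uncurry_left.comp
          ((measurable_id.const_mul 2).sub_const s)).const_mul (q s)).aestronglyMeasurable
      · have hb' := norm_setIntegral_le_of_norm_le_const (μ := volume) (s := Ioo (z / 2) s)
          (f := fun r : ℝ => ‖q s * transm q (marF q) s (2 * r - s)‖) (C := |q s| * C) (by simp)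
          (fun r hr => by rw [norm_norm]; exact hb r hr)
        rw [Real.volume_real_Ioo_of_le hs.le] at hb'
        refine (le_abs_self _).trans (hb'.trans ?_)
        rw [moment]
        have h0 : 0 ≤ |q s| * C := mul_nonneg (abs_nonneg _) ((abs_nonneg _).trans (hbd s s hs (by linarith)))
        calc |q s| * C * (s - z / 2) ≤ |q s| * C * s := by gcongr; linarith
          _ = _ := by ring)
  have h3 : ∀ s ∈ Ioi (z / 2), ∫ r in Ioo (z / 2) s, q s * transm q (marF q) s (2 * r - s)
      = (1 / 2) * (q s * ∫ u in (z - s)..s, transm q (marF q) s u) := by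
    intro s hs
    rw [mem_Ioi] at hs
    rw [integral_const_mul, ← integral_Ioc_eq_integral_Ioo, ← intervalIntegral.integral_of_le hs.le,
      intervalIntegral.integral_comp_mul_sub _ two_ne_zero]
    rw [mul_div_cancel₀ _ two_ne_zero, show 2 * s - s = s by ring, smul_eq_mul]
    ring
  rw [setIntegral_congr_fun measurableSet_Ioi h3, integral_const_mul] at hswap
  have hi1 : IntegrableOn (fun r => (1 / 2) * q r) (Ioi (z / 2)) := (integrableOn_q hq hx).const_mul _
  have hi2 : IntegrableOn (fun r => ∫ s in Ioi r, q s * transm q (marF q) s (2 * r - s))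
      (Ioi (z / 2)) := by
    have := (integrableOn_q (isL11_marDens hq) hx).sub hi1
    refine this.congr (Eventually.of_forall fun r => ?_)
    simp only [marDens, Pi.sub_apply]; ring
  have h4 := marRest_eq_zero hq hz
  rw [marRest] at h4
  simp only [marDens]
  rw [integral_add hi1 hi2, hswap, integral_const_mul]
  linear_combination h4

theorem abs_marF_le_sig {z : ℝ} (hz : 0 < z) : |marF q z| ≤ sig (marDens q) (z / 2) := by
  rw [marF_eq_tail hq hz, abs_neg]; exact norm_tail_le _

theorem continuousOn_marF : ContinuousOn (marF q) (Ioi 0) := by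
  have h : ∀ z ∈ Ioi (0 : ℝ), marF q z = -∫ r in Ioi (z / 2), marDens q r :=
    fun z hz => marF_eq_tail hq hz
  refine ContinuousOn.congr ?_ h
  intro z hz
  rw [mem_Ioi] at hz
  have h1 := (continuousOn_tail (integrableOn_q (isL11_marDens hq) (half_pos (half_pos hz))))
    (z / 2) (by rw [mem_Ici]; linarith)
  have h2 := h1.continuousAt (Ici_mem_nhds (by linarith))
  exact (ContinuousAt.comp (f := fun z : ℝ => z / 2) (g := fun x => ∫ r in Ioi x, marDens q r)
    h2 (by fun_prop)).neg.continuousWithinAt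

theorem integrableOn_marF : IntegrableOn (marF q) (Ioi 0) := by
  have h : IntegrableOn (fun z => sig (marDens q) (z / 2)) (Ioi 0) := by
    have := (sig_tail (isL11_marDens hq) le_rfl).1
    have h2 := (integrableOn_Ioi_comp_mul_right_iff (sig (marDens q)) 0
      (a := 1 / 2) (by norm_num)).2 (by simpa using this)
    exact h2.congr_fun (fun z _ => by beta_reduce; rw [mul_one_div]) measurableSet_Ioi
  refine Integrable.mono' h (stronglyMeasurable_marF hq).aestronglyMeasurable ?_
  filter_upwards [ae_restrict_mem measurableSet_Ioi] with z hz using abs_marF_le_sig hq hz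

end marchenko
end HalfLine
-- Uniqueness in Marchenko's equation, for A and for F
namespace HalfLine

/-- A forward Gronwall lemma. -/
theorem ae_eq_zero_of_le_mul_integral {h b : ℝ → ℝ} {x₀ : ℝ} (hh : IntegrableOn h (Ioi x₀))
    (hb : IntegrableOn b (Ioi x₀)) (hb0 : ∀ x ∈ Ioi x₀, 0 ≤ b x)
    (H : ∀ᵐ x ∂(volume.restrict (Ioi x₀)), |h x| ≤ b x * ∫ s in x₀..x, |h s|) :
    h =ᵐ[volume.restrict (Ioi x₀)] 0 := by
  set N : ℝ → ℝ := fun x => ∫ s in x₀..x, |h s| with hN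
  have ih : ∀ {a c : ℝ}, x₀ ≤ a → a ≤ c → IntervalIntegrable (fun s => |h s|) volume a c :=
    fun ha hc => intervalIntegrable_of_Ioi hh.abs ha (ha.trans hc)
  have ib : ∀ {a c : ℝ}, x₀ ≤ a → a ≤ c → IntervalIntegrable b volume a c :=
    fun ha hc => intervalIntegrable_of_Ioi hb ha (ha.trans hc)
  have hadd : ∀ {a c : ℝ}, x₀ ≤ a → a ≤ c → N c = N a + ∫ s in a..c, |h s| := fun ha hc =>
    (intervalIntegral.integral_add_adjacent_intervals (ih le_rfl ha) (ih ha hc)).symm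
  have hmono : ∀ {a c : ℝ}, x₀ ≤ a → a ≤ c → N a ≤ N c := fun ha hc => by
    rw [hadd ha hc]
    exact le_add_of_nonneg_right (intervalIntegral.integral_nonneg hc fun _ _ => abs_nonneg _)
  have hN0 : N x₀ = 0 := intervalIntegral.integral_same
  have key : ∀ T, x₀ ≤ T → N T = 0 := by
    intro T hT
    have hcont : ContinuousOn N (Icc x₀ T) := by
      have := intervalIntegral.continuousOn_primitive_interval' (ih le_rfl hT) left_mem_uIcc
      rwa [uIcc_of_le hT] at this
    -- Continuous induction. The zero set of N is closed, and just to the right of a zero x one has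
    -- N(t) ≤ (∫_x^t b) N(t) with the integral at most 1/2, so N(t) = 0.
    have hsub : Icc x₀ T ⊆ {x | N x = 0} := by
      refine IsClosed.Icc_subset_of_forall_mem_nhdsWithin ?_ hN0 ?_
      · have := hcont.preimage_isClosed_of_isClosed isClosed_Icc (isClosed_singleton (x := (0 : ℝ)))
        rwa [inter_comm] at this
      · rintro x ⟨hx0, hx⟩
        rw [mem_ofPred_eq] at hx0
        have hbc := intervalIntegral.continuousOn_primitive_interval' (μ := volume)
          (ib hx.1 (by linarith : x ≤ x + 1)) left_mem_uIcc
        rw [uIcc_of_le (by linarith)] at hbc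
        have h1 : Tendsto (fun t => ∫ s in x..t, b s) (𝓝[>] x) (𝓝 0) := by
          have := hbc x ⟨le_rfl, by linarith⟩
          rw [ContinuousWithinAt, intervalIntegral.integral_same] at this
          refine this.mono_left (le_inf inf_le_left (le_principal_iff.2 ?_))
          filter_upwards [Ioo_mem_nhdsGT (by linarith : x < x + 1)] with t ht
            using ⟨ht.1.le, ht.2.le⟩
        filter_upwards [h1.eventually_le_const (show (0 : ℝ) < 1 / 2 by norm_num),
          self_mem_nhdsWithin] with t ht hxt
        rw [mem_Ioi] at hxt
        have h2 : N t ≤ (∫ s in x..t, b s) * N t := by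
          have h3 : N t = ∫ s in x..t, |h s| := by rw [hadd hx.1 hxt.le, hx0, zero_add]
          conv_lhs => rw [h3]
          rw [← intervalIntegral.integral_mul_const]
          refine intervalIntegral.integral_mono_ae_restrict hxt.le (ih hx.1 hxt.le)
            ((ib hx.1 hxt.le).mul_const _) ?_
          have hss : Icc x t ⊆ Ici x₀ := fun s hs => hx.1.trans hs.1
          have H' : ∀ᵐ x ∂(volume.restrict (Ici x₀)), |h x| ≤ b x * N x ∧ 0 ≤ b x := by
            rw [← restrict_Ioi_eq_restrict_Ici]
            filter_upwards [H, ae_restrict_mem measurableSet_Ioi] with s h1 h2 using ⟨h1, hb0 s h2⟩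
          filter_upwards [ae_restrict_of_ae_restrict_of_subset hss H',
            ae_restrict_mem measurableSet_Icc] with s hs hst
          exact hs.1.trans (mul_le_mul_of_nonneg_left (hmono (hx.1.trans hst.1) hst.2) hs.2)
        have h3 : 0 ≤ N t := hN0 ▸ hmono le_rfl (hx.1.trans hxt.le)
        show N t = 0
        nlinarith
    exact hsub ⟨hT, le_rfl⟩
  filter_upwards [H, ae_restrict_mem measurableSet_Ioi] with x hx hx0
  have : N x = 0 := key x (le_of_lt hx0)
  rw [show ∫ s in x₀..x, |h s| = 0 from this, mul_zero] at hx
  exact abs_nonpos_iff.1 hx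

section correlation
variable {𝕜 : Type*} [RCLike 𝕜]

theorem integrable_correlation {f g : ℝ → 𝕜} (hf : Integrable f) (hg : Integrable g) :
    Integrable (fun p : ℝ × ℝ => f p.2 * g (p.2 + p.1)) (volume.prod volume) := by
  have h := hf.comp_neg.convolution_integrand (ContinuousLinearMap.mul ℝ 𝕜) hg
  have hmp : MeasurePreserving (Prod.map id Neg.neg : ℝ × ℝ → ℝ × ℝ) (volume.prod volume)
      (volume.prod volume) := (MeasurePreserving.id _).prod (Measure.measurePreserving_neg _)
  refine (hmp.integrable_comp_of_integrable h).congr (Eventually.of_forall fun p => ?_)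
  simp [add_comm]

/-- Correlation over half-lines. -/
theorem integrable_correlation_Ioi {f g : ℝ → 𝕜} {a b c : ℝ} (hf : IntegrableOn f (Ioi a))
    (hg : IntegrableOn g (Ioi c)) (hc : c ≤ a + b) :
    Integrable (fun p : ℝ × ℝ => f p.2 * g (p.2 + p.1))
      ((volume.restrict (Ioi b)).prod (volume.restrict (Ioi a))) := by
  have h := integrable_correlation ((integrable_indicator_iff measurableSet_Ioi).2 hf)
    ((integrable_indicator_iff measurableSet_Ioi).2 hg)
  rw [Measure.prod_restrict]
  refine (h.integrableOn (s := Ioi b ×ˢ Ioi a)).congr_fun (fun p hp => ?_)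
    (measurableSet_Ioi.prod measurableSet_Ioi)
  have h1 : p.2 ∈ Ioi a := hp.2
  have h2 : p.2 + p.1 ∈ Ioi c := by
    have h3 : b < p.1 := hp.1
    rw [mem_Ioi] at h1 ⊢; linarith
  simp only [indicator_of_mem h1, indicator_of_mem h2]

end correlation

section uniqueness
variable {q : ℝ → ℝ} (hq : IsL11 q)
include hq

theorem integrableOn_mul_marF {h : ℝ → ℝ} {x₀ y : ℝ} (hx₀ : 0 ≤ x₀) (hh : IntegrableOn h (Ioi x₀))
    (hy : 0 < y) : IntegrableOn (fun s => h s * marF q (s + y)) (Ioi x₀) := by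
  refine Integrable.mul_bdd (c := marConst q * sig q (y / 2)) hh
    ((stronglyMeasurable_marF hq).comp_measurable (measurable_id.add_const y)).aestronglyMeasurable ?_
  filter_upwards [ae_restrict_mem measurableSet_Ioi] with s hs
  exact abs_marF_le_of_le hq hy (by linarith [hx₀.trans_lt hs])

/-- The homogeneous Marchenko equation has only the trivial integrable solution. -/
theorem marchenko_homogeneous {h : ℝ → ℝ} {x₀ : ℝ} (hx₀ : 0 ≤ x₀) (hh : IntegrableOn h (Ioi x₀))
    (H : ∀ᵐ y ∂(volume.restrict (Ioi x₀)), h y + ∫ s in Ioi x₀, h s * marF q (s + y) = 0) :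
    h =ᵐ[volume.restrict (Ioi x₀)] 0 := by
  set C := marConst q * (1 + mass q) with hC
  have hC0 : 0 ≤ C := mul_nonneg marConst_pos.le (by linarith [mass_nonneg (q := q)])
  have hb : IntegrableOn (fun x => C * sig q (x / 2)) (Ioi x₀) := by
    have h2 := (integrableOn_Ioi_comp_mul_right_iff (sig q) x₀ (a := 1 / 2) (by norm_num)).2
      (((sig_tail hq le_rfl).1).mono_set (Ioi_subset_Ioi (by positivity)))
    refine (h2.congr_fun (fun z _ => by rw [mul_one_div]) measurableSet_Ioi).const_mul C
  refine ae_eq_zero_of_le_mul_integral hh hb (fun x _ => mul_nonneg hC0 (sig_nonneg _)) ?_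
  filter_upwards [H, ae_restrict_mem measurableSet_Ioi] with x hx hx0
  rw [mem_Ioi] at hx0
  have hxp : 0 < x := hx₀.trans_lt hx0
  have hsub : Ioi x ⊆ Ioi x₀ := Ioi_subset_Ioi hx0.le
  have hA := (integrableOn_kern hq hxp.le).1
  obtain ⟨CA, hCA⟩ := (admissible_kern hq).bdd_right hxp
  have hAm : Measurable (kern q x) := (measurable_kern hq).of_uncurry_left
  have hAh : IntegrableOn (fun y => kern q x y * h y) (Ioi x) :=
    (hh.mono_set hsub).bdd_mul (c := CA) hAm.aestronglyMeasurable (Eventually.of_forall hCA)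
  -- The equation is tested with A(x, ·) over y > x and added to the equation at the point x; this
  -- amounts to applying I + A.
  have h1 : ∫ y in Ioi x, kern q x y * (h y + ∫ s in Ioi x₀, h s * marF q (s + y)) = 0 := by
    rw [integral_eq_zero_of_ae]
    filter_upwards [ae_restrict_of_ae_restrict_of_subset hsub H] with y hy
    rw [hy, mul_zero]; rfl
  have hprod : Integrable (Function.uncurry fun y s => kern q x y * (h s * marF q (s + y)))
      ((volume.restrict (Ioi x)).prod (volume.restrict (Ioi x₀))) := by
    have hm := hA.mul_prod hh
    have := hm.mul_bdd (c := marConst q * sig q (x / 2)) (g := fun p : ℝ × ℝ => marF q (p.2 + p.1))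
      ((stronglyMeasurable_marF hq).comp_measurable
        (measurable_snd.add measurable_fst)).aestronglyMeasurable (by
        rw [Measure.prod_restrict]
        filter_upwards [ae_restrict_mem (measurableSet_Ioi.prod measurableSet_Ioi)] with p hp
        have h3 : x < p.1 := hp.1
        have h4 : x₀ < p.2 := hp.2
        exact abs_marF_le_of_le hq hxp (by linarith))
    refine this.congr (Eventually.of_forall fun p => ?_)
    simp only [Function.uncurry]; ring
  have h2 : ∫ y in Ioi x, kern q x y * ∫ s in Ioi x₀, h s * marF q (s + y)
      = ∫ s in Ioi x₀, h s * ∫ y in Ioi x, kern q x y * marF q (y + s) := by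
    calc _ = ∫ y in Ioi x, ∫ s in Ioi x₀, kern q x y * (h s * marF q (s + y)) := by
          simp only [integral_const_mul]
      _ = ∫ s in Ioi x₀, ∫ y in Ioi x, kern q x y * (h s * marF q (s + y)) :=
          integral_integral_swap hprod
      _ = _ := by
          refine integral_congr_ae (Eventually.of_forall fun s => ?_)
          simp only [← integral_const_mul]
          refine integral_congr_ae (Eventually.of_forall fun y => ?_)
          simp only [add_comm y s]; ring
  have hi2 : IntegrableOn (fun y => kern q x y * ∫ s in Ioi x₀, h s * marF q (s + y)) (Ioi x) := by
    refine hprod.integral_prod_left.congr (Eventually.of_forall fun y => ?_)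
    simp only [Function.uncurry, integral_const_mul]
  simp only [mul_add] at h1
  rw [integral_add hAh hi2, h2] at h1
  have hi3 : IntegrableOn (fun s => h s * ∫ y in Ioi x, kern q x y * marF q (y + s)) (Ioi x₀) := by
    refine hprod.integral_prod_right.congr (Eventually.of_forall fun s => ?_)
    simp only [Function.uncurry, ← integral_const_mul]
    refine integral_congr_ae (Eventually.of_forall fun y => ?_)
    simp only [add_comm y s]; ring
  have h3 : ∫ s in Ioi x₀, h s * transm q (marF q) x s = -h x - ∫ y in Ioi x, kern q x y * h y := by
    have h4 : ∀ s, h s * transm q (marF q) x s = h s * marF q (s + x) +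
        h s * ∫ y in Ioi x, kern q x y * marF q (y + s) := fun s => by
      rw [transm, add_comm x s]; simp only [smul_eq_mul]; ring
    simp only [h4]
    rw [integral_add (integrableOn_mul_marF hq hx₀ hh hxp) hi3]
    linear_combination hx + h1
  have hi4 : IntegrableOn (fun s => h s * transm q (marF q) x s) (Ioi x₀) := by
    refine Integrable.mul_bdd (c := marConst q * sig q (x / 2) * (1 + mass q)) hh
      (measurable_transm_marF hq).of_uncurry_left.aestronglyMeasurable ?_
    filter_upwards [ae_restrict_mem measurableSet_Ioi] with s hs
    exact abs_transm_marF_le hq hxp.le hxp (by linarith [hx₀.trans_lt hs])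
  -- After Fubini the Hankel kernel F has become `transm (marF q)`. For s > x it equals -A(x, s) by
  -- Marchenko's equation and cancels the integral of A h. What survives is an integral over (x₀,
  -- x): a forward Volterra equation, covered by the Gronwall lemma.
  have h5 : ∫ s in Ioi x, h s * transm q (marF q) x s = -∫ y in Ioi x, kern q x y * h y := by
    rw [← integral_neg]
    refine setIntegral_congr_fun measurableSet_Ioi fun s hs => ?_
    rw [mem_Ioi] at hs
    rw [transm_marF hq ⟨hxp.le, le_of_lt hs, hxp.trans hs⟩]; ring
  rw [← intervalIntegral.integral_interval_add_Ioi hi4 (hi4.mono_set hsub), h5] at h3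
  have h6 : h x = -∫ s in x₀..x, h s * transm q (marF q) x s := by linear_combination h3
  rw [h6, abs_neg, ← intervalIntegral.integral_const_mul]
  refine intervalIntegral.norm_integral_le_of_norm_le
    (f := fun s => h s * transm q (marF q) x s) hx0.le
    (Eventually.of_forall fun s hs => ?_)
    ((intervalIntegrable_of_Ioi hh.abs le_rfl hx0.le).const_mul _)
  rw [norm_mul, Real.norm_eq_abs, Real.norm_eq_abs, mul_comm]
  refine mul_le_mul_of_nonneg_right ?_ (abs_nonneg _)
  have := abs_transm_marF_le hq (x := x) (y := s) hxp.le hxp (by linarith [hx₀.trans_lt hs.1])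
  rw [hC]; linarith

/-- A function is determined by Marchenko's equation with a given kernel. -/
theorem marF_unique {G : ℝ → ℝ} (hG : IntegrableOn G (Ioi 0))
    (H : ∀ x, 0 < x → ∀ᵐ y ∂(volume.restrict (Ioi x)), marchenko G x (kern q x) y = 0) :
    G =ᵐ[volume.restrict (Ioi 0)] marF q := by
  have hF := integrableOn_marF hq
  set D : ℝ → ℝ := fun z => G z - marF q z with hD
  have hDi : IntegrableOn D (Ioi 0) := hG.sub hF
  have hDa : IntegrableOn (fun z => |D z|) (Ioi 0) := hDi.abs
  -- G is determined only almost everywhere, so its values on the diagonal 2t carry no information;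
  -- the integrated quantity N takes their place.
  set N : ℝ → ℝ := fun t => ∫ z in Ioi (2 * t), |D z| with hN
  have hNn : ∀ t, 0 ≤ N t := fun t => integral_nonneg fun _ => abs_nonneg _
  have hNle : ∀ t, 0 < t → N t ≤ ∫ z in Ioi 0, |D z| := fun t ht =>
    setIntegral_mono_set hDa (Eventually.of_forall fun _ => abs_nonneg _)
      (Ioi_subset_Ioi (by linarith)).eventuallyLE
  have hle : ∀ x, 0 < x → N x ≤ ∫ t in Ioi x, sigw q t * N t := by
    intro x hx
    have hA := (integrableOn_kern hq hx.le).1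
    have hcor : ∀ {g : ℝ → ℝ}, IntegrableOn g (Ioi 0) →
        Integrable (fun p : ℝ × ℝ => kern q x p.2 * g (p.2 + p.1))
          ((volume.restrict (Ioi x)).prod (volume.restrict (Ioi x))) :=
      fun hg => integrable_correlation_Ioi hA hg (by linarith)
    have hpt : ∀ᵐ y ∂(volume.restrict (Ioi x)), |D (y + x)| ≤
        ∫ s in Ioi x, |kern q x s| * |D (s + y)| := by
      filter_upwards [H x hx, (hcor hG).prod_right_ae, (hcor hF).prod_right_ae,
        ae_restrict_mem measurableSet_Ioi] with y h1 h2 h3 hy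
      rw [mem_Ioi] at hy
      have h4 := transm_marF hq (x := x) (y := y) ⟨hx.le, hy.le, hx.trans hy⟩
      rw [transm] at h4
      rw [marchenko] at h1
      have h5 : D (y + x) = -∫ s in Ioi x, kern q x s * D (s + y) := by
        simp only [hD, mul_sub]
        rw [integral_sub h2 h3, add_comm y x]
        simp only [smul_eq_mul] at h4
        linear_combination h1 - h4
      rw [h5, abs_neg]
      refine (norm_integral_le_integral_norm (fun s => kern q x s * D (s + y))).trans (le_of_eq ?_)
      simp only [norm_mul, Real.norm_eq_abs]
    have hcorD := (hcor hDi).norm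
    simp only [norm_mul, Real.norm_eq_abs] at hcorD
    -- Integrating the pointwise inequality over y > x and substituting s = 2t - x gives N(x) ≤
    -- ∫_x^∞ 2|A(x, 2t - x)| N(t) dt, whose kernel is dominated by `sigw`.
    have hNx : N x = ∫ y in Ioi x, |D (y + x)| := by
      rw [hN]; simp only [two_mul]; exact setIntegral_Ioi_comp_add_right _ _ _
    have h6 : ∫ y in Ioi x, ∫ s in Ioi x, |kern q x s| * |D (s + y)|
        = ∫ s in Ioi x, |kern q x s| * N ((s + x) / 2) := by
      rw [integral_integral_swap hcorD]
      refine setIntegral_congr_fun measurableSet_Ioi fun s _ => ?_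
      simp only [integral_const_mul, hN]
      rw [mul_div_cancel₀ _ two_ne_zero, add_comm s x,
        setIntegral_Ioi_comp_add_right (fun z => |D z|) x s]
      simp only [add_comm s]
    have h7 : ∫ s in Ioi x, |kern q x s| * N ((s + x) / 2)
        = ∫ t in Ioi x, |-2 * kern q x (2 * t - x)| * N t := by
      have h3 := integral_comp_mul_left_Ioi (fun y => |kern q x (y - x)| * N (y / 2)) x
        (b := 2) two_pos
      rw [smul_eq_mul, eq_inv_mul_iff_mul_eq₀ two_ne_zero, ← integral_const_mul, two_mul x,
        setIntegral_Ioi_comp_add_right (fun y => |kern q x (y - x)| * N (y / 2))] at h3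
      simp only [add_sub_cancel_right] at h3
      rw [← h3]
      refine setIntegral_congr_fun measurableSet_Ioi fun t _ => ?_
      simp only [abs_mul, abs_neg, abs_two]
      rw [mul_div_cancel_left₀ _ two_ne_zero]; ring
    have hNm : AEMeasurable N (volume.restrict (Ioi x)) := by
      refine aemeasurable_restrict_of_antitoneOn measurableSet_Ioi fun s hs t _ hst => ?_
      have hs0 : 0 < s := hx.trans hs
      exact setIntegral_mono_set (hDa.mono_set (Ioi_subset_Ioi (by linarith)))
        (Eventually.of_forall fun _ => abs_nonneg _) (Ioi_subset_Ioi (by linarith)).eventuallyLE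
    rw [hNx]
    calc _ ≤ ∫ y in Ioi x, ∫ s in Ioi x, |kern q x s| * |D (s + y)| := by
          refine integral_mono_of_nonneg (Eventually.of_forall fun _ => abs_nonneg _)
            hcorD.integral_prod_left hpt
      _ = ∫ t in Ioi x, |-2 * kern q x (2 * t - x)| * N t := by rw [h6, h7]
      _ ≤ _ := by
          refine integral_mono_of_nonneg (Eventually.of_forall fun t =>
            mul_nonneg (abs_nonneg _) (hNn t)) ?_ ?_
          · refine Integrable.mul_bdd (c := ∫ z in Ioi 0, |D z|)
              ((integrableOn_sigw hq).mono_set (Ioi_subset_Ioi hx.le)) hNm.aestronglyMeasurable ?_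
            filter_upwards [ae_restrict_mem measurableSet_Ioi] with t ht
            rw [Real.norm_of_nonneg (hNn t)]
            exact hNle t (hx.trans ht)
          · filter_upwards [ae_restrict_mem measurableSet_Ioi] with t ht
            exact mul_le_mul_of_nonneg_right (abs_kern_reflect_le hq hx ht) (hNn t)
  have hz : ∀ x, 0 < x → N x = 0 := fun x hx => eq_zero_of_le_integral (integrableOn_sigw hq)
    (fun s _ => sigw_nonneg s) (fun x _ => hNn x) hNle hle hx
  have h8 : ∀ n : ℕ, ∀ᵐ z ∂(volume.restrict (Ioi (2 * (1 / ((n : ℝ) + 1))))), D z = 0 := by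
    intro n
    have := hz (1 / ((n : ℝ) + 1)) (by positivity)
    rw [hN, setIntegral_eq_zero_iff_of_nonneg_ae (Eventually.of_forall fun _ => abs_nonneg _)
      (hDa.mono_set (Ioi_subset_Ioi (by positivity)))] at this
    filter_upwards [this] with z hz using abs_eq_zero.1 hz
  have h9 : Ioi (0 : ℝ) = ⋃ n : ℕ, Ioi (2 * (1 / ((n : ℝ) + 1))) := by
    ext z
    simp only [mem_Ioi, mem_iUnion]
    constructor
    · intro hz
      obtain ⟨n, hn⟩ := exists_nat_one_div_lt (half_pos hz)
      exact ⟨n, by linarith⟩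
    · rintro ⟨n, hn⟩
      exact lt_trans (by positivity) hn
  have h10 : ∀ᵐ z ∂(volume.restrict (Ioi (0 : ℝ))), D z = 0 := by
    rw [h9, ae_restrict_iUnion_iff]; exact h8
  filter_upwards [h10] with z hz using sub_eq_zero.1 hz

end uniqueness
end HalfLine
-- Tails, correlations and the exceptional case f(0) = 0
namespace HalfLine

/-- The tail `∫_z^∞ φ`. -/
noncomputable def tail (φ : ℝ → ℝ) (z : ℝ) : ℝ := ∫ r in Ioi z, φ r

/-- The correlation `∫_0^∞ b(s) φ(s + t) ds`. -/
noncomputable def corr (b φ : ℝ → ℝ) (t : ℝ) : ℝ := ∫ s in Ioi 0, b s * φ (s + t)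

theorem abs_tail_le {φ : ℝ → ℝ} (hφ : IntegrableOn φ (Ioi 0)) {z : ℝ} (hz : 0 ≤ z) :
    |tail φ z| ≤ ∫ r in Ioi 0, |φ r| :=
  (norm_integral_le_integral_norm _).trans (setIntegral_mono_set hφ.norm
    (Eventually.of_forall fun _ => norm_nonneg _) (Ioi_subset_Ioi hz).eventuallyLE)

theorem measurable_tail_of_integrableOn {φ : ℝ → ℝ} (hφ : IntegrableOn φ (Ioi 0)) :
    AEStronglyMeasurable (tail φ) (volume.restrict (Ioi 0)) :=
  ((continuousOn_tail hφ).mono Ioi_subset_Ici_self).aestronglyMeasurable measurableSet_Ioi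

/-- Correlation commutes with taking tails: both sides integrate b(s) φ(s + r) over s > 0, r > y. -/
theorem corr_tail {b φ : ℝ → ℝ} (hb : IntegrableOn b (Ioi 0)) {y : ℝ}
    (hφ : IntegrableOn φ (Ioi y)) :
    IntegrableOn (corr b φ) (Ioi y) ∧ corr b (tail φ) y = tail (corr b φ) y := by
  have h := integrable_correlation_Ioi hb hφ (b := y) (by rw [zero_add])
  refine ⟨h.integral_prod_left, ?_⟩
  rw [tail]
  simp only [corr]
  rw [integral_integral_swap h]
  refine setIntegral_congr_fun measurableSet_Ioi fun s _ => ?_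
  simp only [integral_const_mul, tail]
  rw [add_comm s y, setIntegral_Ioi_comp_add_right φ y s]
  simp only [add_comm s]

/-- Since t ≤ s + t, the weight t can be moved onto φ(s + t), and b need only be integrable. -/
theorem isL11_corr {b φ : ℝ → ℝ} (hb : IntegrableOn b (Ioi 0)) (hφ : IsL11 φ) :
    IsL11 (corr b φ) := by
  have h := integrable_correlation_Ioi hb.norm (integrableOn_moment hφ) (b := 0) (c := 0)
    (by rw [zero_add])
  have hm : AEStronglyMeasurable (corr b φ) (volume.restrict (Ioi 0)) := by
    have hc : Ioi (0 : ℝ) = ⋃ n : ℕ, Ioi (1 / ((n : ℝ) + 1)) := by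
      ext z
      simp only [mem_Ioi, mem_iUnion]
      exact ⟨fun hz => exists_nat_one_div_lt hz, fun ⟨n, hn⟩ => lt_trans (by positivity) hn⟩
    rw [hc, aestronglyMeasurable_iUnion_iff]
    exact fun n => (corr_tail hb (integrableOn_q hφ (by positivity))).1.aestronglyMeasurable
  refine Integrable.mono' h.integral_prod_left (aestronglyMeasurable_id.mul hm) ?_
  filter_upwards [h.prod_right_ae, ae_restrict_mem measurableSet_Ioi] with t ht ht0
  rw [mem_Ioi] at ht0
  rw [corr, ← integral_const_mul]
  refine norm_integral_le_of_norm_le ht ?_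
  filter_upwards [ae_restrict_mem measurableSet_Ioi] with s hs
  rw [mem_Ioi] at hs
  rw [norm_mul, norm_mul, Real.norm_of_nonneg ht0.le, moment, Real.norm_eq_abs (φ _)]
  calc t * (‖b s‖ * |φ (s + t)|) = ‖b s‖ * (t * |φ (s + t)|) := by ring
    _ ≤ ‖b s‖ * ((s + t) * |φ (s + t)|) := by gcongr; linarith

/-- Integration by parts in a correlation. -/
theorem corr_tail_left {b φ : ℝ → ℝ} (hb : IntegrableOn b (Ioi 0)) {z : ℝ}
    (hφ : IntegrableOn φ (Ioi z)) :
    corr (tail b) φ z = tail b 0 * tail φ z - corr b (tail φ) z := by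
  have hφz : IntegrableOn (fun s => φ (s + z)) (Ioi 0) := by
    have := (measurePreserving_add_right volume z).integrableOn_comp_preimage
      (measurableEmbedding_addRight z) (f := φ) (s := Ioi z)
    rw [preimage_add_const_Ioi, sub_self] at this
    exact this.2 hφ
  have hm : AEStronglyMeasurable (Function.uncurry fun s t => b t * φ (s + z))
      ((volume.restrict (Ioi 0)).prod (volume.restrict (Ioi 0))) :=
    hb.aestronglyMeasurable.comp_snd.mul hφz.aestronglyMeasurable.comp_fst
  have hswap := integral_triangle_swap (G := fun s t => b t * φ (s + z)) hm
    (b := fun t => |b t| * ∫ s in Ioi 0, |φ (s + z)|) (hb.abs.mul_const _)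
    (Eventually.of_forall fun t => by
      refine ⟨(hφz.mono_set Ioo_subset_Ioi_self).const_mul _, ?_⟩
      simp only [norm_mul, Real.norm_eq_abs]
      rw [integral_const_mul]
      exact mul_le_mul_of_nonneg_left (setIntegral_mono_set hφz.abs
        (Eventually.of_forall fun _ => abs_nonneg _) Ioo_subset_Ioi_self.eventuallyLE)
        (abs_nonneg _))
  have hl : corr (tail b) φ z = ∫ s in Ioi 0, ∫ t in Ioi s, b t * φ (s + z) := by
    simp only [corr, tail, integral_mul_const]
  have hΦ : ∀ t, 0 < t → ∫ s in Ioo 0 t, φ (s + z) = tail φ z - tail φ (t + z) := by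
    intro t ht
    have h1 := intervalIntegral.integral_interval_add_Ioi hφz (hφz.mono_set (Ioi_subset_Ioi ht.le))
    rw [← setIntegral_Ioi_comp_add_right φ, ← setIntegral_Ioi_comp_add_right φ, zero_add] at h1
    rw [← integral_Ioc_eq_integral_Ioo, ← intervalIntegral.integral_of_le ht.le, tail, tail]
    linear_combination h1
  have hr : ∀ t ∈ Ioi (0 : ℝ), ∫ s in Ioo 0 t, b t * φ (s + z)
      = tail φ z * b t - b t * tail φ (t + z) := by
    intro t ht
    rw [integral_const_mul, hΦ t ht]; ring
  have hi : IntegrableOn (fun t => b t * tail φ (t + z)) (Ioi 0) := by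
    have h := (integrable_correlation_Ioi hb hφ (b := z) (by rw [zero_add])).integral_prod_right
    refine h.congr (Eventually.of_forall fun s => ?_)
    simp only [integral_const_mul, tail]
    rw [add_comm s z, setIntegral_Ioi_comp_add_right φ z s]
    simp only [add_comm s]
  rw [hl, hswap, setIntegral_congr_fun measurableSet_Ioi hr, integral_sub (hb.const_mul _) hi,
    integral_const_mul, mul_comm (tail φ z)]
  rfl

section scattering
variable {q : ℝ → ℝ} (hq : IsL11 q)

/-- A density of `marF`. -/
noncomputable def marPhi (q : ℝ → ℝ) (r : ℝ) : ℝ := -(1 / 2) * marDens q (r * (1 / 2))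

include hq

theorem isL11_marPhi : IsL11 (marPhi q) := by
  have h := isL11_marDens hq
  have h2 := ((integrableOn_Ioi_comp_mul_right_iff (fun x => x * marDens q x) 0
      (a := 1 / 2) (by norm_num)).2 (by rw [zero_mul]; exact h)).const_mul (-1)
  refine h2.congr (Eventually.of_forall fun r => ?_)
  simp only [marPhi]; ring

theorem marF_eq_tail_marPhi {z : ℝ} (hz : 0 < z) : marF q z = tail (marPhi q) z := by
  have h := integral_comp_mul_right_Ioi (marDens q) z (b := 1 / 2) (by norm_num)
  simp only [tail, marPhi]
  rw [integral_const_mul, h, marF_eq_tail hq hz, smul_eq_mul, mul_one_div]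
  ring

theorem kern_zero_eq {y : ℝ} (hy : 0 < y) : kern q 0 y = -marF q y - corr (kern q 0) (marF q) y := by
  have h := transm_marF hq (x := 0) (y := y) ⟨le_rfl, hy.le, hy⟩
  rw [transm, zero_add] at h
  simp only [smul_eq_mul] at h
  rw [corr]; linear_combination h

/-- Marchenko's equation at x = 0 expresses A(0, ·) by F and a correlation with F. F is a tail, and
correlations of tails are tails. The statement provides control of the derivative of the Jost
function on the real line. -/
theorem exists_tail_kern : ∃ α, IsL11 α ∧ ∀ y, 0 < y → kern q 0 y = tail α y := by
  have hA := (integrableOn_kern hq le_rfl).1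
  have hφ := isL11_marPhi hq
  refine ⟨fun t => -marPhi q t - corr (kern q 0) (marPhi q) t, ?_, fun y hy => ?_⟩
  · refine (Integrable.neg hφ |>.sub (isL11_corr hA hφ)).congr (Eventually.of_forall fun t => ?_)
    simp only [Pi.sub_apply, Pi.neg_apply]; ring
  · obtain ⟨h1, h2⟩ := corr_tail hA (integrableOn_q hφ hy)
    have h3 : corr (kern q 0) (marF q) y = corr (kern q 0) (tail (marPhi q)) y :=
      setIntegral_congr_fun measurableSet_Ioi fun s hs => by
        rw [mem_Ioi] at hs
        rw [marF_eq_tail_marPhi hq (by linarith)]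
    rw [kern_zero_eq hq hy, marF_eq_tail_marPhi hq hy, h3, h2, tail, tail, tail, integral_sub
      (integrableOn_q hφ hy).fun_neg h1, integral_neg]

/-- Bounded functions reproduced by the Hankel operator with kernel `marF` up to a sign are
integrable. -/
theorem integrableOn_of_fixed {K : ℝ → ℝ} {M c : ℝ} (hc : |c| ≤ 1)
    (hKm : AEStronglyMeasurable K (volume.restrict (Ioi 0))) (hM : ∀ z, 0 < z → |K z| ≤ M)
    (hK : ∀ z, 0 < z → K z = c * corr K (marF q) z) : IntegrableOn K (Ioi 0) := by
  set Φ : ℝ → ℝ := fun z => marConst q * sig q (z * (1 / 2)) with hΦ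
  have hΦ0 : ∀ z, 0 ≤ Φ z := fun z => mul_nonneg marConst_pos.le (sig_nonneg _)
  have hΦa : ∀ z w, 0 < z → z ≤ w → Φ w ≤ Φ z := fun z w hz hzw =>
    mul_le_mul_of_nonneg_left (sig_anti hq (by linarith) (by linarith)) marConst_pos.le
  have hΦi : IntegrableOn Φ (Ioi 0) :=
    ((integrableOn_Ioi_comp_mul_right_iff (sig q) 0 (a := 1 / 2) (by norm_num)).2
      (by simpa using (sig_tail hq le_rfl).1)).const_mul _
  have hF : ∀ z, 0 < z → |marF q z| ≤ Φ z := fun z hz => by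
    have := abs_marF_le hq hz
    simp only [hΦ]; rwa [mul_one_div]
  have hM0 : 0 ≤ M := (abs_nonneg _).trans (hM 1 one_pos)
  -- Beyond N the majorant has mass at most 1/2; on (0, N] only the bound M for K is used.
  obtain ⟨N, hN0, hN⟩ : ∃ N, 0 < N ∧ ∫ s in Ioi N, Φ s ≤ 1 / 2 := by
    have := (tendsto_tail hΦi).eventually_le_const (show (0 : ℝ) < 1 / 2 by norm_num)
    obtain ⟨N, h1, h2⟩ := (this.and (eventually_gt_atTop 0)).exists
    exact ⟨N, h2, h1⟩
  -- A bound A(Φ + η) improves to (MN + A/2)(Φ + η), an iteration converging to A = 2MN. The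
  -- auxiliary η > 0 is there because initially K is only bounded, and a constant is at most (M/η)(Φ
  -- + η); it tends to 0 at the end.
  have step : ∀ η A, 0 < η → 0 ≤ A → (∀ z, 0 < z → |K z| ≤ A * (Φ z + η)) →
      ∀ z, 0 < z → |K z| ≤ (M * N + A / 2) * (Φ z + η) := by
    intro η A hη hA h z hz
    have hA' : 0 ≤ A * (Φ z + η) := mul_nonneg hA (add_nonneg (hΦ0 z) hη.le)
    have hi1 : IntegrableOn (indicator (Iic N) fun _ => M * Φ z) (Ioi 0) := by
      rw [integrableOn_indicator_iff measurableSet_Iic, inter_comm, Ioi_inter_Iic]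
      exact integrableOn_const (by simp)
    have hi2 : IntegrableOn (indicator (Ioi N) fun s => A * (Φ z + η) * Φ s) (Ioi 0) :=
      (hΦi.const_mul _).indicator measurableSet_Ioi
    have hb : |corr K (marF q) z| ≤ ∫ s in Ioi 0, (indicator (Iic N) (fun _ => M * Φ z) s +
        indicator (Ioi N) (fun s => A * (Φ z + η) * Φ s) s) := by
      refine norm_integral_le_of_norm_le (f := fun s => K s * marF q (s + z)) (hi1.add hi2) ?_
      filter_upwards [ae_restrict_mem measurableSet_Ioi] with s hs
      rw [mem_Ioi] at hs
      have h1 := hF (s + z) (by linarith)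
      have h2 := hΦa z (s + z) hz (by linarith)
      have h3 := hΦa s (s + z) hs (by linarith)
      rw [norm_mul, Real.norm_eq_abs, Real.norm_eq_abs]
      rcases le_or_gt s N with hsN | hsN
      · rw [indicator_of_mem (mem_Iic.2 hsN), indicator_of_notMem (by simpa using hsN), add_zero]
        exact mul_le_mul (hM s hs) (h1.trans h2) (abs_nonneg _) hM0
      · rw [indicator_of_notMem (by simpa using hsN), indicator_of_mem (mem_Ioi.2 hsN), zero_add]
        calc |K s| * |marF q (s + z)| ≤ (A * (Φ s + η)) * Φ (s + z) :=
              mul_le_mul (h s hs) h1 (abs_nonneg _) (mul_nonneg hA (add_nonneg (hΦ0 s) hη.le))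
          _ = A * (Φ s * Φ (s + z) + η * Φ (s + z)) := by ring
          _ ≤ A * (Φ s * Φ z + η * Φ s) := by have := hΦ0 s; gcongr
          _ = _ := by ring
    rw [integral_add hi1 hi2, setIntegral_indicator measurableSet_Iic, Ioi_inter_Iic,
      setIntegral_indicator measurableSet_Ioi, Ioi_inter_Ioi, sup_of_le_right hN0.le,
      setIntegral_const, integral_const_mul, Real.volume_real_Ioc_of_le hN0.le, smul_eq_mul,
      sub_zero] at hb
    rw [hK z hz, abs_mul]
    calc |c| * |corr K (marF q) z| ≤ 1 * |corr K (marF q) z| :=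
          mul_le_mul_of_nonneg_right hc (abs_nonneg _)
      _ ≤ N * (M * Φ z) + A * (Φ z + η) * ∫ s in Ioi N, Φ s := by rw [one_mul]; exact hb
      _ ≤ N * (M * Φ z) + A * (Φ z + η) * (1 / 2) := by gcongr
      _ ≤ _ := by nlinarith [mul_nonneg (mul_nonneg hM0 hN0.le) hη.le]
  have hη : ∀ η, 0 < η → ∀ z, 0 < z → |K z| ≤ 2 * M * N * (Φ z + η) := by
    intro η hη z hz
    have hn : ∀ n : ℕ, ∀ z, 0 < z → |K z| ≤ (2 * M * N + M / η * (1 / 2) ^ n) * (Φ z + η) := by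
      intro n
      induction n with
      | zero =>
        intro z hz
        refine (hM z hz).trans ?_
        have h1 : M = M / η * η := by field_simp
        rw [pow_zero, mul_one]
        calc M = M / η * η := h1
          _ ≤ (2 * M * N + M / η) * (Φ z + η) := by
            have := hΦ0 z
            have h2 : 0 ≤ M / η := by positivity
            have h3 : 0 ≤ 2 * M * N := by positivity
            nlinarith [mul_nonneg h2 this, mul_nonneg h3 (add_nonneg this hη.le)]
      | succ n ih =>
        intro z hz
        have h2 : 0 ≤ M / η := by positivity
        refine (step η _ hη (by positivity) ih z hz).trans (le_of_eq ?_)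
        rw [pow_succ]; ring
    have hlim : Tendsto (fun n : ℕ => (2 * M * N + M / η * (1 / 2) ^ n) * (Φ z + η)) atTop
        (𝓝 ((2 * M * N + M / η * 0) * (Φ z + η))) :=
      ((tendsto_pow_atTop_nhds_zero_of_lt_one (by norm_num) (by norm_num)).const_mul _
        |>.const_add _).mul_const _
    rw [mul_zero, add_zero] at hlim
    exact ge_of_tendsto' hlim fun n => hn n z hz
  refine Integrable.mono' (hΦi.const_mul (2 * M * N)) hKm ?_
  filter_upwards [ae_restrict_mem measurableSet_Ioi] with z hz
  have hlim : Tendsto (fun η : ℝ => 2 * M * N * (Φ z + η)) (𝓝[>] 0) (𝓝 (2 * M * N * (Φ z + 0))) :=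
    (Continuous.tendsto (by fun_prop) _).mono_left nhdsWithin_le_nhds
  rw [add_zero] at hlim
  exact ge_of_tendsto hlim (by filter_upwards [self_mem_nhdsWithin] with η h using hη η h z hz)

/-- The exceptional case `f(0) = 0`: the tail `K` of `A(0, ·)` is integrable with nonzero integral,
and is itself the tail of a function of class `L11`. -/
theorem exceptional (h0 : tail (kern q 0) 0 = -1) :
    IntegrableOn (tail (kern q 0)) (Ioi 0) ∧ ∫ z in Ioi 0, tail (kern q 0) z ≠ 0 ∧
    ∃ α, IsL11 α ∧ ∀ y, 0 < y → tail (kern q 0) y = tail α y := by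
  have hA := (integrableOn_kern hq le_rfl).1
  have hF := integrableOn_marF hq
  have hφ := isL11_marPhi hq
  have hFz : ∀ {z : ℝ}, 0 < z → IntegrableOn (marF q) (Ioi z) := fun hz =>
    hF.mono_set (Ioi_subset_Ioi hz.le)
  set K := tail (kern q 0) with hK
  -- Marchenko's equation at x = 0 is integrated over (z, ∞), and the correlation is integrated by
  -- parts. The boundary term carries the factor K(0) = -1, which is what makes K a fixed point.
  have hKe : ∀ z, 0 < z → K z = 1 * corr K (marF q) z := by
    intro z hz
    obtain ⟨h1, h2⟩ := corr_tail hA (hFz hz)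
    have h3 := corr_tail_left hA (hFz hz)
    rw [← hK] at h3
    have h4 : K z = -tail (marF q) z - tail (corr (kern q 0) (marF q)) z := by
      rw [hK, tail, tail, tail, ← integral_neg, ← integral_sub (hFz hz).fun_neg h1]
      exact setIntegral_congr_fun measurableSet_Ioi fun y hy => kern_zero_eq hq (hz.trans hy)
    rw [one_mul, h3, h4, h0, h2]; ring
  have hKi : IntegrableOn K (Ioi 0) := integrableOn_of_fixed hq (c := 1) (by simp)
    (measurable_tail_of_integrableOn hA) (fun z hz => abs_tail_le hA hz.le) hKe
  have hKc : ContinuousOn K (Ici 0) := continuousOn_tail hA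
  refine ⟨hKi, fun hzero => ?_, corr K (marPhi q), isL11_corr hKi hφ, fun y hy => ?_⟩
  -- If the integral of K were 0, the same integration by parts would show L = -corr L F. So L would
  -- be an integrable solution of the homogeneous Marchenko equation at x = 0, hence zero, and K
  -- with it, against K(0) = -1.
  · set L := tail K with hL
    have hL0 : tail K 0 = 0 := hzero
    have hLe : ∀ z, 0 < z → L z = (-1) * corr L (marF q) z := by
      intro z hz
      obtain ⟨h1, h2⟩ := corr_tail hKi (hFz hz)
      have h3 := corr_tail_left hKi (hFz hz)
      rw [hL0, zero_mul, zero_sub, h2] at h3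
      rw [hL, h3, neg_one_mul, neg_neg]
      exact setIntegral_congr_fun measurableSet_Ioi fun y hy => by
        rw [hKe y (hz.trans hy), one_mul]
    have hLi : IntegrableOn L (Ioi 0) := integrableOn_of_fixed hq (c := -1) (by simp)
      (measurable_tail_of_integrableOn hKi) (fun z hz => abs_tail_le hKi hz.le) hLe
    have hLae := marchenko_homogeneous hq le_rfl hLi (by
      filter_upwards [ae_restrict_mem measurableSet_Ioi] with z hz
      have := hLe z hz
      rw [corr] at this
      linear_combination this)
    have hLc : ContinuousOn L (Ioi 0) := (continuousOn_tail hKi).mono Ioi_subset_Ici_self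
    have hLz : EqOn L (fun _ => 0) (Ioi 0) :=
      Measure.eqOn_open_of_ae_eq hLae isOpen_Ioi hLc continuousOn_const
    have hKz : ∀ z, 0 < z → K z = 0 := by
      intro z hz
      have hKz' : IntegrableOn (fun s => (K s : ℂ)) (Ioi 0) := hKi.ofReal
      have h1 := hasDerivAt_tail hKz' (Complex.continuous_ofReal.comp_continuousOn
        (hKc.mono Ioi_subset_Ici_self)) hz
      have h2 : (fun x => ∫ s in Ioi x, (K s : ℂ)) =ᶠ[𝓝 z] fun _ => 0 := by
        filter_upwards [Ioi_mem_nhds hz] with x hx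
        have := integral_ofReal (𝕜 := ℂ) (μ := volume.restrict (Ioi x)) (f := K)
        exact this.trans (by rw [show ∫ s in Ioi x, K s = 0 from hLz hx]; rfl)
      have h3 := h1.unique ((hasDerivAt_const z (0 : ℂ)).congr_of_eventuallyEq h2)
      exact_mod_cast neg_eq_zero.1 h3
    have h1 : Tendsto K (𝓝[>] 0) (𝓝 (K 0)) :=
      (hKc 0 self_mem_Ici).mono_left (nhdsWithin_mono _ Ioi_subset_Ici_self)
    have h2 : K 0 = 0 := tendsto_nhds_unique h1 (tendsto_const_nhds.congr' (by
      filter_upwards [self_mem_nhdsWithin] with t ht using (hKz t ht).symm))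
    rw [h0] at h2; norm_num at h2
  · obtain ⟨-, h2⟩ := corr_tail hKi (integrableOn_q hφ hy)
    rw [hKe y hy, one_mul, ← h2]
    refine setIntegral_congr_fun measurableSet_Ioi fun s hs => ?_
    rw [mem_Ioi] at hs
    rw [marF_eq_tail_marPhi hq (by linarith)]

end scattering
end HalfLine
-- Half-line Fourier transforms
namespace HalfLine

/-- The half-line Fourier transform `∫_0^∞ m(y) e^{iky} dy`. -/
noncomputable def lap (m : ℝ → ℂ) (k : ℂ) : ℂ :=
  ∫ y in Ioi (0 : ℝ), m y * Complex.exp (Complex.I * k * (y : ℂ))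

section lap
variable {m : ℝ → ℂ} (hm : IntegrableOn m (Ioi 0))

theorem norm_cexp_le_one {k : ℂ} (hk : 0 ≤ k.im) {y : ℝ} (hy : 0 ≤ y) :
    ‖Complex.exp (Complex.I * k * (y : ℂ))‖ ≤ 1 := by
  rw [norm_cexp_I_mul, Real.exp_le_one_iff]
  exact neg_nonpos.2 (mul_nonneg hk hy)

theorem continuous_cexp_I_mul (k : ℂ) :
    Continuous fun y : ℝ => Complex.exp (Complex.I * k * (y : ℂ)) := by fun_prop

include hm

theorem integrableOn_mul_cexp {k : ℂ} (hk : 0 ≤ k.im) :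
    IntegrableOn (fun y : ℝ => m y * Complex.exp (Complex.I * k * (y : ℂ))) (Ioi 0) :=
  Integrable.mul_bdd (c := 1) hm (continuous_cexp_I_mul k).aestronglyMeasurable
    ((ae_restrict_iff' measurableSet_Ioi).2 (ae_of_all _ fun _ hy =>
      norm_cexp_le_one hk (le_of_lt hy)))

theorem norm_lap_le {k : ℂ} (hk : 0 ≤ k.im) : ‖lap m k‖ ≤ ∫ y in Ioi (0 : ℝ), ‖m y‖ := by
  refine norm_integral_le_of_norm_le (f := fun y : ℝ => m y * Complex.exp (Complex.I * k * (y : ℂ)))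
    hm.norm ((ae_restrict_iff' measurableSet_Ioi).2 (ae_of_all _ fun y hy => ?_))
  rw [norm_mul]
  exact mul_le_of_le_one_right (norm_nonneg _) (norm_cexp_le_one hk (le_of_lt hy))

theorem continuousOn_lap : ContinuousOn (lap m) {k : ℂ | 0 ≤ k.im} := by
  refine continuousOn_of_dominated (bound := fun y => ‖m y‖)
    (fun k hk => (integrableOn_mul_cexp hm hk).aestronglyMeasurable) (fun k hk => ?_) hm.norm ?_
  · refine (ae_restrict_iff' measurableSet_Ioi).2 (ae_of_all _ fun y hy => ?_)
    rw [norm_mul]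
    exact mul_le_of_le_one_right (norm_nonneg _) (norm_cexp_le_one hk (le_of_lt hy))
  · exact ae_of_all _ fun y => Continuous.continuousOn (by fun_prop)

theorem differentiableAt_lap {k : ℂ} (hk : 0 < k.im) : DifferentiableAt ℂ (lap m) k := by
  have hs : {z : ℂ | k.im / 2 < z.im} ∈ 𝓝 k :=
    (isOpen_lt continuous_const Complex.continuous_im).mem_nhds (by
      change k.im / 2 < k.im; linarith)
  have hpos : ∀ z ∈ {z : ℂ | k.im / 2 < z.im}, k.im / 2 < z.im := fun z hz => hz
  refine (hasDerivAt_integral_of_dominated_loc_of_deriv_le (μ := volume.restrict (Ioi 0))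
    (F := fun (z : ℂ) (y : ℝ) => m y * Complex.exp (Complex.I * z * (y : ℂ)))
    (F' := fun (z : ℂ) (y : ℝ) => m y * (Complex.exp (Complex.I * z * (y : ℂ)) * (Complex.I * y)))
    (bound := fun y => ‖m y‖ * (2 / k.im)) hs ?_ (integrableOn_mul_cexp hm hk.le) ?_ ?_
    (hm.norm.mul_const _) ?_).2.differentiableAt
  · filter_upwards [hs] with z hz
    have := hpos z hz
    exact (integrableOn_mul_cexp hm (by linarith)).aestronglyMeasurable
  · exact hm.aestronglyMeasurable.mul (by fun_prop : Continuous fun y : ℝ =>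
      Complex.exp (Complex.I * k * (y : ℂ)) * (Complex.I * y)).aestronglyMeasurable
  · refine (ae_restrict_iff' measurableSet_Ioi).2 (ae_of_all _ fun y hy z hz => ?_)
    rw [mem_Ioi] at hy
    have hz := hpos z hz
    rw [norm_mul, norm_mul, norm_cexp_I_mul, norm_mul, Complex.norm_I, one_mul, Complex.norm_real,
      Real.norm_of_nonneg hy.le]
    gcongr
    have h1 : y * (k.im / 2) ≤ Real.exp (z.im * y) := by
      have h2 := Real.add_one_le_exp (z.im * y)
      nlinarith
    rw [Real.exp_neg, inv_mul_le_iff₀ (Real.exp_pos _)]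
    calc y = (y * (k.im / 2)) * (2 / k.im) := by field_simp
      _ ≤ _ := by gcongr
  · refine ae_of_all _ fun y z _ => HasDerivAt.const_mul _ ?_
    have := (((hasDerivAt_id z).const_mul Complex.I).mul_const (y : ℂ)).cexp
    simpa using this

omit hm in
theorem lap_ofReal (k : ℝ) : lap m k = ft (indicator (Ioi 0) m) k := by
  rw [lap, ft, ← integral_indicator measurableSet_Ioi]
  refine integral_congr_ae (ae_of_all _ fun y => ?_)
  by_cases hy : y ∈ Ioi (0 : ℝ)
  · simp only [indicator_of_mem hy]; ring
  · simp only [indicator_of_notMem hy]; ring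

/-- Riemann–Lebesgue in the closed upper half-plane. -/
theorem exists_norm_lap_le {ε : ℝ} (hε : 0 < ε) :
    ∃ R : ℝ, ∀ k : ℂ, 0 ≤ k.im → R ≤ ‖k‖ → ‖lap m k‖ ≤ ε := by
  have hf : Integrable (indicator (Ioi 0) m) := hm.integrable_indicator measurableSet_Ioi
  obtain ⟨g, hgs, hgc, hgε⟩ := (memLp_one_iff_integrable.2 hf).exist_eLpNorm_sub_le
    ENNReal.one_ne_top le_rfl (half_pos hε)
  have hgi : Integrable g := hgc.continuous.integrable_of_hasCompactSupport hgs
  have hd : Integrable (deriv g) :=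
    (hgc.continuous_deriv (by simp)).integrable_of_hasCompactSupport hgs.deriv
  have hdiff : Integrable (indicator (Ioi 0) m - g) := hf.sub hgi
  have hnorm : ∫ y, ‖indicator (Ioi 0) m y - g y‖ ≤ ε / 2 := by
    have h1 : ∫ y, ‖(indicator (Ioi 0) m - g) y‖ = _ :=
      integral_norm_eq_lintegral_enorm hdiff.aestronglyMeasurable
    rw [← eLpNorm_one_eq_lintegral_enorm] at h1
    rw [show (∫ y, ‖indicator (Ioi 0) m y - g y‖) = ∫ y, ‖(indicator (Ioi 0) m - g) y‖ from rfl, h1]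
    exact ENNReal.toReal_le_of_le_ofReal (half_pos hε).le hgε
  set C := ‖g 0‖ + ∫ y in Ioi (0 : ℝ), ‖deriv g y‖ with hC
  have hC0 : 0 ≤ C := add_nonneg (norm_nonneg _) (integral_nonneg fun _ => norm_nonneg _)
  refine ⟨2 * C / ε + 1, fun k hk hR => ?_⟩
  have hkpos : 0 < ‖k‖ := lt_of_lt_of_le (by positivity) hR
  have hk0 : k ≠ 0 := norm_pos_iff.1 hkpos
  have h1 : Complex.I * k * lap g k = -g 0 - lap (deriv g) k := by
    have h2 := integral_Ioi_of_hasDerivAt_of_tendsto (a := (0 : ℝ)) (m := (0 : ℂ))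
      (f := fun y : ℝ => g y * Complex.exp (Complex.I * k * (y : ℂ)))
      (f' := fun y : ℝ => deriv g y * Complex.exp (Complex.I * k * (y : ℂ)) +
        Complex.I * k * (g y * Complex.exp (Complex.I * k * (y : ℂ))))
      (Continuous.continuousWithinAt (by
        have := hgc.continuous
        fun_prop)) (fun y _ => by
        have := (hgc.differentiable (by simp) y).hasDerivAt.mul (hasDerivAt_cexp (Complex.I * k) y)
        exact this.congr_deriv (by ring))
      ((integrableOn_mul_cexp hd.integrableOn hk).add
        ((integrableOn_mul_cexp hgi.integrableOn hk).const_mul _)) (by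
        refine tendsto_const_nhds.congr' ?_
        have h3 : ∀ᶠ x : ℝ in atTop, g x = 0 :=
          (hasCompactSupport_iff_eventuallyEq.1 hgs).filter_mono
            (atTop_le_cocompact.trans_eq Filter.coclosedCompact_eq_cocompact.symm)
        filter_upwards [h3] with x hx
        rw [hx, zero_mul])
    rw [integral_add (integrableOn_mul_cexp hd.integrableOn hk)
      ((integrableOn_mul_cexp hgi.integrableOn hk).const_mul _), integral_const_mul] at h2
    simp only [Complex.ofReal_zero, mul_zero, Complex.exp_zero, mul_one, zero_sub] at h2
    rw [lap, lap, ← h2]; ring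
  have h4 : ‖lap g k‖ ≤ ε / 2 := by
    have h5 : ‖k‖ * ‖lap g k‖ ≤ C := by
      have : ‖Complex.I * k * lap g k‖ = ‖k‖ * ‖lap g k‖ := by simp
      rw [← this, h1]
      refine (norm_sub_le _ _).trans ?_
      rw [norm_neg]
      exact add_le_add le_rfl (norm_lap_le hd.integrableOn hk)
    have h6 : C ≤ ‖k‖ * (ε / 2) := by
      have : 2 * C / ε * (ε / 2) = C := by field_simp
      nlinarith
    exact le_of_mul_le_mul_left (h5.trans h6) hkpos
  have h7 : lap m k = lap (fun y => m y - g y) k + lap g k := by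
    rw [lap, lap, lap, ← integral_add]
    · refine setIntegral_congr_fun measurableSet_Ioi fun y _ => ?_
      ring
    · exact integrableOn_mul_cexp (hm.sub hgi.integrableOn) hk
    · exact integrableOn_mul_cexp hgi.integrableOn hk
  have h8 : ‖lap (fun y => m y - g y) k‖ ≤ ε / 2 := by
    refine (norm_lap_le (hm.sub hgi.integrableOn) hk).trans (le_trans ?_ hnorm)
    have h9 : ∫ y in Ioi (0 : ℝ), ‖m y - g y‖
        = ∫ y in Ioi (0 : ℝ), ‖indicator (Ioi 0) m y - g y‖ :=
      setIntegral_congr_fun measurableSet_Ioi fun y hy => by simp [indicator_of_mem hy]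
    refine h9.le.trans ?_
    exact setIntegral_le_integral hdiff.norm (ae_of_all _ fun _ => norm_nonneg _)
  rw [h7]
  calc _ ≤ _ := norm_add_le _ _
    _ ≤ ε := by linarith

end lap

/-! ### Solutions near the singular endpoint 0 -/

section nearZero
variable {q : ℝ → ℝ} (hq : IsL11 q) {E : ℂ} {u v : ℝ → ℂ}

/-- The potential of the equation, cut off at `1`. -/
noncomputable def cutoff (q : ℝ → ℝ) (E : ℂ) : ℝ → ℝ :=
  indicator (Iic 1) fun t => ‖(q t : ℂ) - E‖

theorem cutoff_nonneg (t : ℝ) : 0 ≤ cutoff q E t := indicator_nonneg (fun _ _ => norm_nonneg _) t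

include hq

theorem isL11_cutoff : IsL11 (cutoff q E) := by
  have h1 : IntegrableOn (fun t => ((t * q t : ℝ) : ℂ) - t * E) (Ioc 0 1) := by
    refine (IntegrableOn.mono_set (Integrable.ofReal hq) Ioc_subset_Ioi_self).sub ?_
    exact (Continuous.integrableOn_Icc (by fun_prop : Continuous fun t : ℝ => (t : ℂ) * E)).mono_set
      Ioc_subset_Icc_self
  have h2 := (integrable_indicator_iff measurableSet_Ioc).2 h1.norm
  refine h2.integrableOn.congr ((ae_restrict_iff' measurableSet_Ioi).2 (ae_of_all _ fun t ht => ?_))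
  rw [mem_Ioi] at ht
  change _ = t * indicator (Iic 1) (fun t => ‖(q t : ℂ) - E‖) t
  by_cases h : t ≤ 1
  · rw [indicator_of_mem (show t ∈ Ioc (0 : ℝ) 1 from ⟨ht, h⟩),
      indicator_of_mem (show t ∈ Iic (1 : ℝ) from h), Complex.ofReal_mul, ← mul_sub, norm_mul,
      Complex.norm_real, Real.norm_of_nonneg ht.le]
  · rw [indicator_of_notMem (fun h' : t ∈ Ioc (0 : ℝ) 1 => h h'.2),
      indicator_of_notMem (show t ∉ Iic (1 : ℝ) from h), mul_zero]

omit hq in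
theorem Sol.norm_deriv_sub_le (h : Sol q E u v) {x a : ℝ} (hx : 0 < x) (hxa : x ≤ a) (ha : a ≤ 1)
    {w : ℝ → ℝ} (hw : ∀ t ∈ Ioc x a, ‖u t‖ ≤ w t)
    (hi : IntegrableOn (fun t => cutoff q E t * w t) (Ioc x a)) :
    ‖v x - v a‖ ≤ ∫ t in Ioc x a, cutoff q E t * w t := by
  rw [norm_sub_rev, h.eq x a hx hxa, intervalIntegral.integral_of_le hxa]
  refine norm_integral_le_of_norm_le (f := fun t => ((q t : ℂ) - E) * u t)
    hi ((ae_restrict_iff' measurableSet_Ioc).2 (ae_of_all _ fun t ht => ?_))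
  rw [norm_mul, cutoff, indicator_of_mem (show t ∈ Iic (1 : ℝ) from ht.2.trans ha)]
  exact mul_le_mul_of_nonneg_left (hw t ht) (norm_nonneg _)

omit hq in
theorem sig_of_nonneg {Q : ℝ → ℝ} (hQ : ∀ t, 0 ≤ Q t) (x : ℝ) : sig Q x = ∫ s in Ioi x, Q s := by
  rw [sig]; simp only [abs_of_nonneg (hQ _)]

theorem tendsto_integral_sig_zero :
    Tendsto (fun x => ∫ t in Ioc 0 x, sig q t) (𝓝[>] 0) (𝓝 0) := by
  have h1 := intervalIntegral.continuousOn_primitive_interval' (μ := volume)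
    (intervalIntegrable_of_Ioi (sig_tail hq le_rfl).1 le_rfl (zero_le_one' ℝ)) left_mem_uIcc
  rw [uIcc_of_le zero_le_one] at h1
  have h2 := (h1 0 (left_mem_Icc.2 zero_le_one)).tendsto
  rw [intervalIntegral.integral_same] at h2
  have h3 : 𝓝[>] (0 : ℝ) ≤ 𝓝[Icc 0 1] 0 := by
    rw [← nhdsWithin_Ioc_eq_nhdsGT zero_lt_one]
    exact nhdsWithin_mono _ Ioc_subset_Icc_self
  refine (h2.mono_left h3).congr' ?_
  filter_upwards [self_mem_nhdsWithin] with x hx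
  rw [intervalIntegral.integral_of_le (le_of_lt hx)]

/-- As `sig q` decreases, x · sig q x is at most its integral over (0, x). -/
theorem tendsto_mul_sig_zero : Tendsto (fun x => x * sig q x) (𝓝[>] 0) (𝓝 0) := by
  refine squeeze_zero' ?_ ?_ (tendsto_integral_sig_zero hq)
  · filter_upwards [self_mem_nhdsWithin] with x hx using mul_nonneg (le_of_lt hx) (sig_nonneg x)
  · filter_upwards [self_mem_nhdsWithin] with x hx
    rw [mem_Ioi] at hx
    have h1 : ∫ t in Ioc 0 x, sig q x ≤ ∫ t in Ioc 0 x, sig q t :=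
      setIntegral_mono_on (by simp) ((sig_tail hq le_rfl).1.mono_set Ioc_subset_Ioi_self)
        measurableSet_Ioc fun t ht => sig_anti hq ht.1 ht.2
    simpa [hx.le] using h1

/-- `∫_0^x ∫_t^∞ Q(s) ds dt = ∫_0^∞ min(x, s) Q(s) ds` for `Q ≥ 0` -/
theorem integral_sig_eq (hnn : ∀ t, 0 ≤ q t) {x : ℝ} (hx : 0 < x) :
    ∫ t in Ioc 0 x, sig q t = ∫ s in Ioi (0 : ℝ), min x s * q s := by
  have hmm : AEStronglyMeasurable q (volume.restrict (Ioi 0)) := aestronglyMeasurable_q hq le_rfl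
  have hval : ∀ s, 0 < s → ∫ t in Ioo 0 s, indicator (Iic x) (fun _ => q s) t = min x s * q s := by
    intro s hs
    rw [integral_Ioc_eq_integral_Ioo.symm, setIntegral_indicator measurableSet_Iic,
      Ioc_inter_Iic, setIntegral_const, Measure.real, Real.volume_Ioc, sub_zero,
      ENNReal.toReal_ofReal (le_min hs.le hx.le), smul_eq_mul, min_comm]
  have hint : IntegrableOn (fun s => min x s * q s) (Ioi 0) := by
    refine Integrable.mono' (Integrable.abs hq) ?_ ((ae_restrict_iff' measurableSet_Ioi).2
      (ae_of_all _ fun s hs => ?_))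
    · exact (by fun_prop : Continuous fun s : ℝ => min x s).aestronglyMeasurable.mul hmm
    · rw [mem_Ioi] at hs
      rw [Real.norm_of_nonneg (mul_nonneg (le_min hx.le hs.le) (hnn s)), abs_mul, abs_of_pos hs,
        abs_of_nonneg (hnn s)]
      exact mul_le_mul_of_nonneg_right (min_le_right _ _) (hnn s)
  have h := integral_triangle_swap (a := 0) (G := fun t s => indicator (Iic x) (fun _ => q s) t)
    ?_ hint ?_
  · rw [setIntegral_congr_fun measurableSet_Ioi (fun s hs => hval s hs)] at h
    rw [← h, ← Ioi_inter_Iic, ← setIntegral_indicator measurableSet_Iic]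
    refine setIntegral_congr_fun measurableSet_Ioi fun t _ => ?_
    by_cases ht : t ∈ Iic x
    · simp only [indicator_of_mem ht]; rw [sig_of_nonneg hnn]
    · simp only [indicator_of_notMem ht]; simp
  · have h1 : AEStronglyMeasurable (fun p : ℝ × ℝ => indicator (Iic x) (fun _ => (1 : ℝ)) p.1 * q p.2)
        ((volume.restrict (Ioi 0)).prod (volume.restrict (Ioi 0))) :=
      ((measurable_const.indicator measurableSet_Iic).comp measurable_fst).aestronglyMeasurable.mul
        hmm.comp_snd
    refine h1.congr (ae_of_all _ fun p => ?_)
    by_cases hp : p.1 ∈ Iic x <;> simp [Function.uncurry, hp, indicator]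
  · refine (ae_restrict_iff' measurableSet_Ioi).2 (ae_of_all _ fun s hs => ⟨?_, ?_⟩)
    · exact IntegrableOn.indicator (by simp) measurableSet_Iic
    · rw [← hval s hs]
      refine le_of_eq (setIntegral_congr_fun measurableSet_Ioo fun t _ => ?_)
      exact Real.norm_of_nonneg (indicator_nonneg (fun _ _ => hnn s) t)

/-- The derivative of a bounded solution may blow up at 0, but not faster than the tail of the
potential, and x times this tail tends to 0. -/
theorem Sol.tendsto_mul_deriv (h : Sol q E u v) :
    Tendsto (fun x : ℝ => (x : ℂ) * v x) (𝓝[>] 0) (𝓝 0) := by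
  obtain ⟨C, hC⟩ := isCompact_Icc.exists_bound_of_continuousOn
    (h.cont.mono (Icc_subset_Ici_self : Icc 0 1 ⊆ Ici (0 : ℝ)))
  have hC0 : 0 ≤ C := (norm_nonneg _).trans (hC 0 (by simp))
  have h0 : Tendsto (fun x : ℝ => x * ‖v 1‖ + C * (x * sig (cutoff q E) x)) (𝓝[>] 0) (𝓝 0) := by
    have h1 : Tendsto (fun x : ℝ => x * ‖v 1‖) (𝓝[>] 0) (𝓝 0) := by
      have := (by fun_prop : Continuous fun x : ℝ => x * ‖v 1‖).tendsto 0
      rw [zero_mul] at this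
      exact this.mono_left nhdsWithin_le_nhds
    simpa using h1.add ((tendsto_mul_sig_zero (isL11_cutoff hq)).const_mul C)
  refine squeeze_zero_norm' ?_ h0
  filter_upwards [Ioc_mem_nhdsGT zero_lt_one] with x hx
  have hi : IntegrableOn (cutoff q E) (Ioi x) := integrableOn_q (isL11_cutoff hq) hx.1
  have h1 := h.norm_deriv_sub_le hx.1 hx.2 le_rfl (w := fun _ => C)
    (fun t ht => hC t ⟨hx.1.le.trans ht.1.le, ht.2⟩)
    ((hi.mono_set Ioc_subset_Ioi_self).mul_const C)
  have h2 : ∫ t in Ioc x 1, cutoff q E t * C ≤ C * sig (cutoff q E) x := by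
    rw [integral_mul_const, mul_comm, sig_of_nonneg cutoff_nonneg]
    exact mul_le_mul_of_nonneg_left (setIntegral_mono_set hi (ae_of_all _ cutoff_nonneg)
      Ioc_subset_Ioi_self.eventuallyLE) hC0
  rw [norm_mul, Complex.norm_real, Real.norm_of_nonneg hx.1.le]
  have h3 : ‖v x‖ ≤ ‖v 1‖ + C * sig (cutoff q E) x := by
    have := norm_add_le (v 1) (v x - v 1)
    rw [add_sub_cancel] at this
    linarith
  nlinarith [mul_le_mul_of_nonneg_left h3 hx.1.le]

/-- A solution vanishing at `0` is `O(x)` there. -/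
theorem Sol.exists_norm_le (h : Sol q E u v) (h0 : u 0 = 0) :
    ∃ a, 0 < a ∧ a ≤ 1 ∧ ∃ C, 0 ≤ C ∧ ∀ x ∈ Ioc 0 a, ‖u x‖ ≤ C * x := by
  have hL := isL11_cutoff hq (E := E)
  obtain ⟨a, ha, ha1, hhalf⟩ : ∃ a, 0 < a ∧ a ≤ 1 ∧ ∫ s in Ioc 0 a, s * cutoff q E s ≤ 1 / 2 := by
    have h1 := intervalIntegral.continuousOn_primitive_interval' (μ := volume)
      (intervalIntegrable_of_Ioi hL le_rfl (zero_le_one' ℝ)) left_mem_uIcc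
    rw [uIcc_of_le zero_le_one] at h1
    have h2 := (h1 0 (left_mem_Icc.2 zero_le_one)).tendsto
    rw [intervalIntegral.integral_same] at h2
    have h3 : 𝓝[>] (0 : ℝ) ≤ 𝓝[Icc 0 1] 0 := by
      rw [← nhdsWithin_Ioc_eq_nhdsGT zero_lt_one]
      exact nhdsWithin_mono _ Ioc_subset_Icc_self
    obtain ⟨a, h4, h5⟩ := (((h2.mono_left h3).eventually (Iic_mem_nhds one_half_pos)).and
      (Ioc_mem_nhdsGT zero_lt_one)).exists
    refine ⟨a, h5.1, h5.2, ?_⟩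
    rw [← intervalIntegral.integral_of_le h5.1.le]
    exact h4
  refine ⟨a, ha, ha1, 2 * ‖v a‖, by positivity, ?_⟩
  have hcont : ContinuousOn u (Icc 0 a) := h.cont.mono Icc_subset_Ici_self
  -- Boundedness of u/x is not known beforehand, so the maximum M of |u|/(x + η) is estimated
  -- instead. Since a was chosen with ∫_0^a s|q - E| ≤ 1/2, integrating the equation twice from a to
  -- the maximum point gives M ≤ |v(a)| + M/2. The resulting bound is independent of η, which then
  -- tends to 0.
  have key : ∀ η, 0 < η → ∀ x ∈ Icc 0 a, ‖u x‖ ≤ 2 * ‖v a‖ * (x + η) := by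
    intro η hη
    obtain ⟨x₀, hx₀, hmax⟩ := isCompact_Icc.exists_isMaxOn (nonempty_Icc.2 ha.le)
      (hcont.norm.div (by fun_prop : ContinuousOn (fun x => x + η) (Icc 0 a))
        fun x hx => by have := hx.1; positivity)
    set M := ‖u x₀‖ / (x₀ + η) with hM
    have hx₀η : 0 < x₀ + η := by have := hx₀.1; positivity
    have hM0 : 0 ≤ M := by positivity
    have hle : ∀ x ∈ Icc 0 a, ‖u x‖ ≤ M * (x + η) := fun x hx => by
      have := hmax hx
      exact (div_le_iff₀ (by have := hx.1; positivity)).1 this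
    suffices hM2 : M ≤ 2 * ‖v a‖ from fun x hx => (hle x hx).trans
      (mul_le_mul_of_nonneg_right hM2 (by have := hx.1; positivity))
    rcases hx₀.1.eq_or_lt with hx0 | hx0
    · rw [hM, ← hx0, h0]; simp
    set Q : ℝ → ℝ := indicator (Iic a) fun t => cutoff q E t * (|t| + η) with hQ
    have hQnn : ∀ t, 0 ≤ Q t := fun t =>
      indicator_nonneg (fun t _ => mul_nonneg (cutoff_nonneg t) (by positivity)) t
    have hQle : ∀ t, t ≤ a → Q t = cutoff q E t * (|t| + η) := fun t ht =>
      indicator_of_mem (show t ∈ Iic a from ht) _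
    have hQL : IsL11 Q := by
      have h1 : IntegrableOn (fun t => t * cutoff q E t * indicator (Iic a) (fun t => |t| + η) t)
          (Ioi 0) := by
        refine Integrable.mul_bdd (c := a + η) hL
          (((by fun_prop : Continuous fun t : ℝ => |t| + η).measurable.indicator
            measurableSet_Iic).aestronglyMeasurable) ((ae_restrict_iff' measurableSet_Ioi).2
            (ae_of_all _ fun t ht => ?_))
        rw [mem_Ioi] at ht
        by_cases hta : t ∈ Iic a
        · rw [indicator_of_mem hta, abs_of_pos ht, Real.norm_of_nonneg (by positivity)]
          exact add_le_add hta le_rfl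
        · rw [indicator_of_notMem hta, norm_zero]; positivity
      refine h1.congr (ae_of_all _ fun t => ?_)
      by_cases hta : t ∈ Iic a
      · simp only [hQ, indicator_of_mem hta]; ring
      · simp only [hQ, indicator_of_notMem hta, mul_zero]
    have hv : ∀ x, 0 < x → x ≤ a → ‖v x‖ ≤ ‖v a‖ + M * sig Q x := by
      intro x hx hxa
      have hQi := integrableOn_q hQL hx
      have hcongr : ∀ t ∈ Ioc x a, M * Q t = cutoff q E t * (M * (t + η)) := fun t ht => by
        rw [hQle t ht.2, abs_of_pos (hx.trans ht.1)]; ring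
      have h1 := h.norm_deriv_sub_le hx hxa ha1 (w := fun t => M * (t + η))
        (fun t ht => hle t ⟨hx.le.trans ht.1.le, ht.2⟩)
        (IntegrableOn.congr_fun ((hQi.mono_set Ioc_subset_Ioi_self).const_mul M) hcongr
          measurableSet_Ioc)
      rw [← setIntegral_congr_fun measurableSet_Ioc hcongr, integral_const_mul] at h1
      have h2 : ∫ t in Ioc x a, Q t ≤ sig Q x := by
        rw [sig_of_nonneg hQnn]
        exact setIntegral_mono_set hQi (ae_of_all _ hQnn) Ioc_subset_Ioi_self.eventuallyLE
      have h3 := norm_add_le (v a) (v x - v a)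
      rw [add_sub_cancel] at h3
      nlinarith [mul_le_mul_of_nonneg_left h2 hM0]
    have hsig := (sig_tail hQL le_rfl).1.mono_set (Ioc_subset_Ioi_self : Ioc 0 x₀ ⊆ Ioi 0)
    have hb : ∫ t in Ioc 0 x₀, (‖v a‖ + M * sig Q t) ≤ (x₀ + η) * (‖v a‖ + M / 2) := by
      rw [integral_add (by simp) (hsig.const_mul M), integral_const_mul, integral_sig_eq hQL hQnn hx0]
      have h1 : ∫ s in Ioi (0 : ℝ), min x₀ s * Q s ≤ (x₀ + η) * (1 / 2) := by
        have h2 : ∫ s in Ioi (0 : ℝ), min x₀ s * Q s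
            ≤ ∫ s in Ioi (0 : ℝ), indicator (Iic a) (fun s => (x₀ + η) * (s * cutoff q E s)) s := by
          refine integral_mono_of_nonneg ((ae_restrict_iff' measurableSet_Ioi).2
            (ae_of_all _ fun s hs => mul_nonneg (le_min hx0.le (le_of_lt hs)) (hQnn s)))
            ((hL.const_mul _).indicator measurableSet_Iic)
            ((ae_restrict_iff' measurableSet_Ioi).2 (ae_of_all _ fun s hs => ?_))
          rw [mem_Ioi] at hs
          by_cases hsa : s ∈ Iic a
          · simp only [hQ, indicator_of_mem hsa]
            rw [abs_of_pos hs]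
            have h3 : min x₀ s * (s + η) ≤ s * (x₀ + η) := by
              rcases le_total x₀ s with h | h
              · rw [min_eq_left h]; nlinarith
              · rw [min_eq_right h]; nlinarith
            nlinarith [mul_le_mul_of_nonneg_left h3 (cutoff_nonneg (q := q) (E := E) s)]
          · simp only [hQ, indicator_of_notMem hsa, mul_zero, le_refl]
        refine h2.trans ?_
        rw [setIntegral_indicator measurableSet_Iic, Ioi_inter_Iic, integral_const_mul]
        exact mul_le_mul_of_nonneg_left hhalf hx₀η.le
      rw [setIntegral_const, Measure.real, Real.volume_Ioc, sub_zero, ENNReal.toReal_ofReal hx0.le,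
        smul_eq_mul]
      nlinarith [mul_le_mul_of_nonneg_left h1 hM0, mul_nonneg hη.le (norm_nonneg (v a))]
    have hu : ‖u x₀‖ ≤ (x₀ + η) * (‖v a‖ + M / 2) := by
      have h1 : Tendsto (fun ε => ‖u x₀ - u ε‖) (𝓝[>] 0) (𝓝 ‖u x₀ - u 0‖) :=
        (tendsto_const_nhds.sub ((h.cont 0 self_mem_Ici).tendsto.mono_left
          (nhdsWithin_mono _ Ioi_subset_Ici_self))).norm
      rw [h0, sub_zero] at h1
      refine le_of_tendsto h1 ?_
      filter_upwards [Ioc_mem_nhdsGT hx0] with ε hε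
      rw [h.sub_eq hq hε.1 hε.2, intervalIntegral.integral_of_le hε.2]
      have hsub : Ioc ε x₀ ⊆ Ioc 0 x₀ := Ioc_subset_Ioc_left hε.1.le
      have hint : IntegrableOn (fun t => ‖v a‖ + M * sig Q t) (Ioc 0 x₀) :=
        Integrable.add (by simp) (hsig.const_mul M)
      refine (norm_integral_le_of_norm_le (f := v) (hint.mono_set hsub)
        ((ae_restrict_iff' measurableSet_Ioc).2 (ae_of_all _ fun t ht =>
          hv t (hε.1.trans ht.1) (ht.2.trans hx₀.2)))).trans (le_trans ?_ hb)
      exact setIntegral_mono_set hint (ae_of_all _ fun t =>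
        add_nonneg (norm_nonneg _) (mul_nonneg hM0 (sig_nonneg t))) hsub.eventuallyLE
    have h5 : M * (x₀ + η) = ‖u x₀‖ := div_mul_cancel₀ _ hx₀η.ne'
    have h6 : M ≤ ‖v a‖ + M / 2 := le_of_mul_le_mul_right (by linarith) hx₀η
    linarith
  intro x hx
  refine ge_of_tendsto (x := 𝓝[>] (0 : ℝ)) (f := fun η => 2 * ‖v a‖ * (x + η)) ?_ ?_
  · have := (by fun_prop : Continuous fun η : ℝ => 2 * ‖v a‖ * (x + η)).tendsto 0
    rw [add_zero] at this
    exact this.mono_left nhdsWithin_le_nhds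
  · filter_upwards [self_mem_nhdsWithin] with η hη using key η hη x ⟨hx.1.le, hx.2⟩

/-- With u = O(x) the right-hand side (q - E) u of the equation is integrable up to 0. -/
theorem Sol.exists_tendsto_deriv (h : Sol q E u v) (h0 : u 0 = 0) :
    ∃ v0, Tendsto v (𝓝[>] 0) (𝓝 v0) := by
  obtain ⟨a, ha, ha1, C, hC, hu⟩ := h.exists_norm_le hq h0
  have hi : IntegrableOn (fun t => ((q t : ℂ) - E) * u t) (Ioc 0 a) := by
    refine Integrable.mono' (g := fun t => C * (t * cutoff q E t))
      (((isL11_cutoff hq).mono_set Ioc_subset_Ioi_self).const_mul C) ?_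
      ((ae_restrict_iff' measurableSet_Ioc).2 (ae_of_all _ fun t ht => ?_))
    · refine AEStronglyMeasurable.mul ((Complex.continuous_ofReal.comp_aestronglyMeasurable
        ((aestronglyMeasurable_q hq le_rfl).mono_measure
          (Measure.restrict_mono Ioc_subset_Ioi_self le_rfl))).sub aestronglyMeasurable_const) ?_
      exact (h.cont.mono fun t ht => le_of_lt ht.1).aestronglyMeasurable measurableSet_Ioc
    · rw [norm_mul, cutoff, indicator_of_mem (show t ∈ Iic (1 : ℝ) from ht.2.trans ha1)]
      nlinarith [mul_le_mul_of_nonneg_left (hu t ht) (norm_nonneg ((q t : ℂ) - E))]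
  have hii : IntervalIntegrable (fun t => ((q t : ℂ) - E) * u t) volume 0 a :=
    (intervalIntegrable_iff_integrableOn_Ioc_of_le ha.le).2 hi
  have h1 := intervalIntegral.continuousOn_primitive_interval' hii left_mem_uIcc
  rw [uIcc_of_le ha.le] at h1
  have h2 := (h1 0 (left_mem_Icc.2 ha.le)).tendsto
  rw [intervalIntegral.integral_same] at h2
  have h3 : 𝓝[>] (0 : ℝ) ≤ 𝓝[Icc 0 a] 0 := by
    rw [← nhdsWithin_Ioc_eq_nhdsGT ha]
    exact nhdsWithin_mono _ Ioc_subset_Icc_self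
  refine ⟨v a - (∫ t in (0 : ℝ)..a, ((q t : ℂ) - E) * u t) + 0,
    ((tendsto_const_nhds (x := v a - ∫ t in (0 : ℝ)..a, ((q t : ℂ) - E) * u t)).add
      (h2.mono_left h3)).congr' ?_⟩
  filter_upwards [Ioc_mem_nhdsGT ha] with x hx
  have h4 := h.eq x a hx.1 hx.2
  have h5 := intervalIntegral.integral_add_adjacent_intervals
    (hii.mono_set (by rw [uIcc_of_le hx.1.le, uIcc_of_le ha.le]; exact Icc_subset_Icc_right hx.2))
    (hii.mono_set (by rw [uIcc_of_le hx.2, uIcc_of_le ha.le]; exact Icc_subset_Icc_left hx.1.le))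
  rw [← h5, ← h4]; ring

/-- The derivative of the second solution may be unbounded at 0, but it is o(1/x) while u is O(x),
so that product disappears in the limit. -/
theorem Sol.tendsto_wronskian_zero (h : Sol q E u v) (h0 : u 0 = 0) {v0 : ℂ}
    (hv : Tendsto v (𝓝[>] 0) (𝓝 v0)) {E' : ℂ} {u' v' : ℝ → ℂ} (h' : Sol q E' u' v') :
    Tendsto (fun x => u x * v' x - v x * u' x) (𝓝[>] 0) (𝓝 (-(v0 * u' 0))) := by
  obtain ⟨a, ha, ha1, C, hC, hu⟩ := h.exists_norm_le hq h0
  have h1 : Tendsto (fun x => u x * v' x) (𝓝[>] 0) (𝓝 0) := by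
    have h2 := (h'.tendsto_mul_deriv hq).norm.const_mul C
    rw [norm_zero, mul_zero] at h2
    refine squeeze_zero_norm' ?_ h2
    filter_upwards [Ioc_mem_nhdsGT ha] with x hx
    rw [norm_mul, norm_mul, Complex.norm_real, Real.norm_of_nonneg hx.1.le, ← mul_assoc]
    exact mul_le_mul_of_nonneg_right (hu x hx) (norm_nonneg _)
  have h3 := h1.sub (hv.mul ((h'.cont 0 self_mem_Ici).tendsto.mono_left
    (nhdsWithin_mono _ Ioi_subset_Ici_self)))
  rwa [zero_sub] at h3

end nearZero
end HalfLine
-- The Jost function and its zeros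
namespace HalfLine

/-- The Jost function `f(k) = f(0, k)`. -/
noncomputable def jostFun (q : ℝ → ℝ) (k : ℂ) : ℂ := kernelJost (kern q) 0 k

/-- The Jost solution at `k = iκ`, a real function. -/
noncomputable def decaying (q : ℝ → ℝ) (κ x : ℝ) : ℝ :=
  (kernelJost (kern q) x (Complex.I * κ)).re

/-- The function whose half-line Fourier transform is `∫_0^∞ f(x, iκ) f(x, k) dx`. -/
noncomputable def overlap (q : ℝ → ℝ) (κ y : ℝ) : ℝ :=
  decaying q κ y + ∫ x in Ioi (0 : ℝ), kern q x y * decaying q κ x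

theorem jostFun_eq (q : ℝ → ℝ) (k : ℂ) :
    jostFun q k = 1 + lap (fun y => (kern q 0 y : ℂ)) k := by
  simp [jostFun, kernelJost, lap]

theorem conj_kernelJost (A : ℝ → ℝ → ℝ) (x : ℝ) (k : ℂ) :
    starRingEnd ℂ (kernelJost A x k) = kernelJost A x (-starRingEnd ℂ k) := by
  have h : ∀ y : ℝ, starRingEnd ℂ (Complex.exp (Complex.I * k * y))
      = Complex.exp (Complex.I * -starRingEnd ℂ k * y) := fun y => by
    rw [← Complex.exp_conj]; congr 1; simp
  rw [kernelJost, kernelJost, map_add, h, ← integral_conj]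
  congr 1
  refine integral_congr_ae (ae_of_all _ fun y => ?_)
  simp only [map_mul, h, Complex.conj_ofReal]

theorem kernelJost_I_mul (q : ℝ → ℝ) (κ x : ℝ) :
    kernelJost (kern q) x (Complex.I * κ) = (decaying q κ x : ℂ) := by
  refine (Complex.conj_eq_iff_re.1 ?_).symm
  rw [conj_kernelJost]
  congr 1
  simp

section
variable {q : ℝ → ℝ} (hq : IsL11 q)
include hq

theorem integrableOn_kern_complex : IntegrableOn (fun y => (kern q 0 y : ℂ)) (Ioi 0) :=
  (integrableOn_kern hq le_rfl).1.ofReal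

theorem continuousOn_jostFun : ContinuousOn (jostFun q) {k : ℂ | 0 ≤ k.im} :=
  (continuousOn_const.add (continuousOn_lap (integrableOn_kern_complex hq))).congr
    fun k _ => jostFun_eq q k

theorem differentiableAt_jostFun {k : ℂ} (hk : 0 < k.im) : DifferentiableAt ℂ (jostFun q) k := by
  rw [show jostFun q = fun k => 1 + lap (fun y => (kern q 0 y : ℂ)) k from funext (jostFun_eq q)]
  exact (differentiableAt_lap (integrableOn_kern_complex hq) hk).const_add 1

omit hq in
/-- The Wronskian of two Jost solutions. -/
theorem wronskian_jost_eq (k k' : ℂ) (x : ℝ) :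
    kernelJost (kern q) x k * jostDeriv q k' x - jostDeriv q k x * kernelJost (kern q) x k'
      = Complex.exp (Complex.I * (k + k') * x) *
        (reduced q k x * (Complex.I * k' * reduced q k' x
          - Complex.exp (-(2 * Complex.I * k' * x)) * reducedAux q k' x)
        - (Complex.I * k * reduced q k x
          - Complex.exp (-(2 * Complex.I * k * x)) * reducedAux q k x) * reduced q k' x) := by
  have h1 : ∀ k : ℂ, jostDeriv q k x = Complex.exp (Complex.I * k * x) *
      (Complex.I * k * reduced q k x
        - Complex.exp (-(2 * Complex.I * k * x)) * reducedAux q k x) := fun k => by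
    rw [jostDeriv, kernelJost_eq_exp_mul, mul_sub, ← mul_assoc (Complex.exp _) (Complex.exp _),
      ← Complex.exp_add, show Complex.I * k * x + -(2 * Complex.I * k * x) = -(Complex.I * k * x) by
        ring]
    ring
  rw [h1, h1, kernelJost_eq_exp_mul, kernelJost_eq_exp_mul,
    show Complex.I * (k + k') * x = Complex.I * k * x + Complex.I * k' * x by ring, Complex.exp_add]
  ring

theorem tendsto_wronskian_aux {k k' : ℂ} (hk : 0 ≤ k.im) (hk' : 0 ≤ k'.im) :
    Tendsto (fun x : ℝ => reduced q k x * (Complex.I * k' * reduced q k' x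
          - Complex.exp (-(2 * Complex.I * k' * x)) * reducedAux q k' x)
        - (Complex.I * k * reduced q k x
          - Complex.exp (-(2 * Complex.I * k * x)) * reducedAux q k x) * reduced q k' x) atTop
      (𝓝 (Complex.I * (k' - k))) := by
  have hsig : Tendsto (sig q) atTop (𝓝 0) := tendsto_tail (integrableOn_q hq one_pos).abs
  have haux : ∀ {k : ℂ}, 0 ≤ k.im →
      Tendsto (fun x : ℝ => Complex.exp (-(2 * Complex.I * k * x)) * reducedAux q k x) atTop
        (𝓝 0) := fun hk => by
    have h := hsig.const_mul (1 + mass q)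
    rw [mul_zero] at h
    refine squeeze_zero_norm' ?_ h
    filter_upwards [eventually_gt_atTop 0] with x hx using norm_mul_reducedAux_le hq hk hx
  have hr := tendsto_reduced hq hk
  have hr' := tendsto_reduced hq hk'
  have h := (hr.mul ((hr'.const_mul (Complex.I * k')).sub (haux hk'))).sub
    (((hr.const_mul (Complex.I * k)).sub (haux hk)).mul hr')
  rwa [show (1 : ℂ) * (Complex.I * k' * 1 - 0) - (Complex.I * k * 1 - 0) * 1
    = Complex.I * (k' - k) by ring] at h

theorem tendsto_wronskian_atTop {k k' : ℂ} (hk : 0 ≤ k.im) (hk' : 0 ≤ k'.im)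
    (hkk : 0 < k.im + k'.im) :
    Tendsto (fun x : ℝ => kernelJost (kern q) x k * jostDeriv q k' x
      - jostDeriv q k x * kernelJost (kern q) x k') atTop (𝓝 0) := by
  simp only [wronskian_jost_eq]
  have h0 : Tendsto (fun x : ℝ => Complex.exp (Complex.I * (k + k') * x)) atTop (𝓝 0) := by
    rw [tendsto_zero_iff_norm_tendsto_zero]
    simp only [norm_cexp_I_mul]
    exact Real.tendsto_exp_neg_atTop_nhds_zero.comp (tendsto_id.const_mul_atTop (by simpa using hkk))
  simpa using h0.mul (tendsto_wronskian_aux hq hk hk')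

theorem tendsto_wronskian_neg (k : ℝ) :
    Tendsto (fun x : ℝ => kernelJost (kern q) x k * jostDeriv q (-(k : ℂ)) x
      - jostDeriv q k x * kernelJost (kern q) x (-(k : ℂ))) atTop (𝓝 (-2 * Complex.I * k)) := by
  simp only [wronskian_jost_eq]
  have h := tendsto_wronskian_aux hq (k := k) (k' := -(k : ℂ)) (by simp) (by simp)
  rw [show Complex.I * (-(k : ℂ) - k) = -2 * Complex.I * k by ring] at h
  simpa using h

/-- The Wronskian of f(·, k) and f(·, -k) is constant and equals -2ik at infinity. If f(k) = 0, then
f(-k) = 0 by conjugation, and the Wronskian would tend to 0 at the origin. -/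
theorem jostFun_ne_zero {k : ℝ} (hk : k ≠ 0) : jostFun q k ≠ 0 := by
  intro h0
  have hs := sol_kernelJost hq (k := k) (by simp)
  have hs' := sol_kernelJost hq (k := -(k : ℂ)) (by simp)
  obtain ⟨v0, hv⟩ := hs.exists_tendsto_deriv hq h0
  have h0' : kernelJost (kern q) 0 (-(k : ℂ)) = 0 := by
    have := conj_kernelJost (kern q) 0 k
    rw [Complex.conj_ofReal] at this
    rw [← this, show kernelJost (kern q) 0 k = 0 from h0, map_zero]
  have h1 := hs.tendsto_wronskian_zero hq h0 hv hs'
  beta_reduce at h1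
  rw [h0', mul_zero, neg_zero] at h1
  have hconst : ∀ a b, 0 < a → a ≤ b →
      kernelJost (kern q) b k * jostDeriv q (-(k : ℂ)) b
        - jostDeriv q k b * kernelJost (kern q) b (-(k : ℂ))
      = kernelJost (kern q) a k * jostDeriv q (-(k : ℂ)) a
        - jostDeriv q k a * kernelJost (kern q) a (-(k : ℂ)) := fun a b ha hab => by
    have := hs.wronskian hq hs' ha hab
    rw [show (k : ℂ) ^ 2 - (-(k : ℂ)) ^ 2 = 0 by ring, zero_mul, sub_eq_zero] at this
    exact this
  have h2 : Tendsto (fun x : ℝ => kernelJost (kern q) x k * jostDeriv q (-(k : ℂ)) x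
      - jostDeriv q k x * kernelJost (kern q) x (-(k : ℂ))) atTop
      (𝓝 (kernelJost (kern q) 1 k * jostDeriv q (-(k : ℂ)) 1
        - jostDeriv q k 1 * kernelJost (kern q) 1 (-(k : ℂ)))) := by
    refine tendsto_const_nhds.congr' ?_
    filter_upwards [eventually_ge_atTop 1] with x hx using (hconst 1 x one_pos hx).symm
  have h3 := tendsto_nhds_unique h2 (tendsto_wronskian_neg hq k)
  have h4 : Tendsto (fun x : ℝ => kernelJost (kern q) x k * jostDeriv q (-(k : ℂ)) x
      - jostDeriv q k x * kernelJost (kern q) x (-(k : ℂ))) (𝓝[>] 0)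
      (𝓝 (-2 * Complex.I * k)) := by
    refine tendsto_const_nhds.congr' ?_
    filter_upwards [Ioc_mem_nhdsGT one_pos] with x hx
    rw [← h3, hconst x 1 hx.1 hx.2]
  have h5 := tendsto_nhds_unique h1 h4
  simp [hk] at h5

theorem integrableOn_mul_jost {k k' : ℂ} (hk : 0 ≤ k.im) (hk' : 0 ≤ k'.im)
    (hkk : 0 < k.im + k'.im) :
    IntegrableOn (fun x => kernelJost (kern q) x k * kernelJost (kern q) x k') (Ioi 0) := by
  refine Integrable.mono' (g := fun x => (1 + mass q) ^ 2 * Real.exp (-(k.im + k'.im) * x))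
    ((integrableOn_exp_mul_Ioi (neg_lt_zero.2 hkk) 0).const_mul _)
    ((stronglyMeasurable_kernelJost hq k).mul
      (stronglyMeasurable_kernelJost hq k')).aestronglyMeasurable
    ((ae_restrict_iff' measurableSet_Ioi).2 (ae_of_all _ fun x hx => ?_))
  have h1 := norm_kernelJost_le hq hk (le_of_lt hx)
  have h2 := norm_kernelJost_le hq hk' (le_of_lt hx)
  rw [norm_mul]
  calc _ ≤ ((1 + mass q) * Real.exp (-(k.im * x))) * ((1 + mass q) * Real.exp (-(k'.im * x))) := by
        gcongr; exact (norm_nonneg _).trans h1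
    _ = _ := by
      rw [show -(k.im + k'.im) * x = -(k.im * x) + -(k'.im * x) by ring, Real.exp_add]; ring

/-- The Wronskian identity between 0 and ∞. All information on the zeros comes from it, with
suitable k': that they are imaginary and simple, and how the norming constants enter the derivative
of f. -/
theorem wronskian_identity {k k' : ℂ} (hk : 0 ≤ k.im) (hk' : 0 ≤ k'.im)
    (hkk : 0 < k.im + k'.im) (h0 : jostFun q k = 0) {v0 : ℂ}
    (hv : Tendsto (jostDeriv q k) (𝓝[>] 0) (𝓝 v0)) :
    v0 * jostFun q k' = (k ^ 2 - k' ^ 2) *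
      ∫ x in Ioi (0 : ℝ), kernelJost (kern q) x k * kernelJost (kern q) x k' := by
  have hs := sol_kernelJost hq hk
  have hs' := sol_kernelJost hq hk'
  have hi := integrableOn_mul_jost hq hk hk' hkk
  have h1 : ∀ a, 0 < a → -(kernelJost (kern q) a k * jostDeriv q k' a
      - jostDeriv q k a * kernelJost (kern q) a k') = (k ^ 2 - k' ^ 2) *
      ∫ x in Ioi a, kernelJost (kern q) x k * kernelJost (kern q) x k' := fun a ha => by
    have h2 := (intervalIntegral_tendsto_integral_Ioi a (hi.mono_set (Ioi_subset_Ioi ha.le))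
      tendsto_id).const_mul (k ^ 2 - k' ^ 2)
    have h3 := (tendsto_wronskian_atTop hq hk hk' hkk).sub_const
      (kernelJost (kern q) a k * jostDeriv q k' a - jostDeriv q k a * kernelJost (kern q) a k')
    rw [zero_sub] at h3
    refine tendsto_nhds_unique (h3.congr' ?_) h2
    filter_upwards [eventually_ge_atTop a] with b hb using hs.wronskian hq hs' ha hb
  have h4 := (hs.tendsto_wronskian_zero hq h0 hv hs').neg
  rw [neg_neg] at h4
  refine tendsto_nhds_unique h4 (Tendsto.congr' ?_ ((((continuousOn_tail hi) 0
    self_mem_Ici).tendsto.mono_left (nhdsWithin_mono _ Ioi_subset_Ici_self)).const_mul _))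
  filter_upwards [self_mem_nhdsWithin] with a ha using (h1 a ha).symm

theorem integral_norm_sq_jost_pos {k : ℂ} (hk : 0 < k.im) :
    0 < ∫ x in Ioi (0 : ℝ), ‖kernelJost (kern q) x k‖ ^ 2 := by
  have hi : IntegrableOn (fun x => ‖kernelJost (kern q) x k‖ ^ 2) (Ioi 0) := by
    refine (integrableOn_mul_jost hq hk.le hk.le (by linarith)).norm.congr (ae_of_all _ fun x => ?_)
    simp only [norm_mul]; ring
  rw [setIntegral_pos_iff_support_of_nonneg_ae (ae_of_all _ fun x => by positivity) hi]
  obtain ⟨X, hX⟩ := eventually_atTop.1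
    ((tendsto_reduced hq hk.le).eventually_ne (one_ne_zero' ℂ))
  have hsub : Ioi (max X 0) ⊆ (Function.support fun x => ‖kernelJost (kern q) x k‖ ^ 2) ∩ Ioi 0 := by
    intro x hx
    refine ⟨?_, lt_of_le_of_lt (le_max_right _ _) (mem_Ioi.1 hx)⟩
    rw [Function.mem_support, kernelJost_eq_exp_mul]
    exact pow_ne_zero 2 (norm_ne_zero_iff.2 (mul_ne_zero (Complex.exp_ne_zero _)
      (hX x ((le_max_left _ _).trans (le_of_lt hx)))))
  exact lt_of_lt_of_le (by simp) (measure_mono hsub)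

/-- The argument behind real eigenvalues: for k' = -conj k, also a zero, the integral is that of
|f|² and positive, so k² is real. -/
theorem re_eq_zero_of_jostFun_eq_zero {k : ℂ} (hk : 0 < k.im) (h0 : jostFun q k = 0) :
    k.re = 0 := by
  obtain ⟨v0, hv⟩ := (sol_kernelJost hq hk.le).exists_tendsto_deriv hq h0
  have hk' : 0 < (-starRingEnd ℂ k).im := by simpa using hk
  have h0' : jostFun q (-starRingEnd ℂ k) = 0 := by
    have : starRingEnd ℂ (jostFun q k) = _ := conj_kernelJost (kern q) 0 k
    rw [jostFun, ← this, h0, map_zero]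
  have h1 := wronskian_identity hq hk.le hk'.le (add_pos hk hk') h0 hv
  rw [h0', mul_zero, zero_eq_mul] at h1
  rcases h1 with h1 | h1
  · have h2 := congrArg Complex.im h1
    simp [sq] at h2
    have : 4 * (k.re * k.im) = 0 := by linarith
    have := hk.ne'
    simp_all
  · exfalso
    have h3 := integral_norm_sq_jost_pos hq hk
    have h4 : ∫ x in Ioi (0 : ℝ), kernelJost (kern q) x k * kernelJost (kern q) x (-starRingEnd ℂ k)
        = ((∫ x in Ioi (0 : ℝ), ‖kernelJost (kern q) x k‖ ^ 2 : ℝ) : ℂ) := by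
      have h5 := integral_ofReal (𝕜 := ℂ) (μ := volume.restrict (Ioi (0 : ℝ)))
        (f := fun x => ‖kernelJost (kern q) x k‖ ^ 2)
      refine Eq.trans (integral_congr_ae (ae_of_all _ fun x => ?_)) h5
      beta_reduce
      rw [← conj_kernelJost, Complex.mul_conj']
      simp
    rw [h4] at h1
    exact h3.ne' (by exact_mod_cast h1)

theorem abs_decaying_le {κ : ℝ} (hκ : 0 < κ) {x : ℝ} (hx : 0 ≤ x) :
    |decaying q κ x| ≤ (1 + mass q) * Real.exp (-(κ * x)) := by
  have h := norm_kernelJost_le hq (k := Complex.I * κ) (by simpa using hκ.le) hx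
  rw [kernelJost_I_mul, Complex.norm_real] at h
  simpa using h

theorem measurable_decaying (κ : ℝ) : Measurable (decaying q κ) :=
  Complex.measurable_re.comp (stronglyMeasurable_kernelJost hq (Complex.I * κ)).measurable

theorem integrableOn_decaying {κ : ℝ} (hκ : 0 < κ) : IntegrableOn (decaying q κ) (Ioi 0) := by
  refine Integrable.mono' (g := fun x => (1 + mass q) * Real.exp (-κ * x))
    ((integrableOn_exp_mul_Ioi (neg_lt_zero.2 hκ) 0).const_mul _)
    (measurable_decaying hq κ).aestronglyMeasurable
    ((ae_restrict_iff' measurableSet_Ioi).2 (ae_of_all _ fun x hx => ?_))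
  rw [neg_mul]
  exact abs_decaying_le hq hκ (le_of_lt hx)

/-- `A(x, y) g(x)` is integrable on the quadrant if `g` is integrable. -/
theorem integrable_kern_mul {g : ℝ → ℝ} (hg : IntegrableOn g (Ioi 0)) :
    Integrable (fun p : ℝ × ℝ => kern q p.1 p.2 * g p.1)
      ((volume.restrict (Ioi 0)).prod (volume.restrict (Ioi 0))) := by
  have hm : AEStronglyMeasurable (fun p : ℝ × ℝ => kern q p.1 p.2 * g p.1)
      ((volume.restrict (Ioi 0)).prod (volume.restrict (Ioi 0))) :=
    (measurable_kern hq).aestronglyMeasurable.mul hg.aestronglyMeasurable.comp_fst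
  refine (integrable_prod_iff hm).2 ⟨?_, ?_⟩
  · exact (ae_restrict_iff' measurableSet_Ioi).2 (ae_of_all _ fun x hx =>
      (integrable_kern hq (le_of_lt hx)).restrict.mul_const (g x))
  · refine Integrable.mono' (hg.abs.const_mul (mass q)) hm.norm.integral_prod_right'
      ((ae_restrict_iff' measurableSet_Ioi).2 (ae_of_all _ fun x hx => ?_))
    rw [Real.norm_of_nonneg (integral_nonneg fun _ => norm_nonneg _)]
    simp only [norm_mul, Real.norm_eq_abs, integral_mul_const]
    refine mul_le_mul_of_nonneg_right (le_trans ?_ (integral_abs_kern_le_mass hq (le_of_lt hx)))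
      (abs_nonneg _)
    exact setIntegral_le_integral (integrable_kern hq (le_of_lt hx)).abs
      (ae_of_all _ fun _ => abs_nonneg _)

theorem integrableOn_overlap {κ : ℝ} (hκ : 0 < κ) : IntegrableOn (overlap q κ) (Ioi 0) :=
  Integrable.add (integrableOn_decaying hq hκ)
    (integrable_kern_mul hq (integrableOn_decaying hq hκ)).integral_prod_right

theorem lap_overlap {κ : ℝ} (hκ : 0 < κ) {k : ℂ} (hk : 0 ≤ k.im) :
    lap (fun y => (overlap q κ y : ℂ)) k
      = ∫ x in Ioi (0 : ℝ), kernelJost (kern q) x (Complex.I * κ) * kernelJost (kern q) x k := by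
  have hd := integrableOn_decaying hq hκ
  have hdc : IntegrableOn (fun y => (decaying q κ y : ℂ)) (Ioi 0) := hd.ofReal
  have hprod := integrable_kern_mul hq hd
  have hprod' : Integrable (fun p : ℝ × ℝ => ((kern q p.1 p.2 * decaying q κ p.1 : ℝ) : ℂ) *
      Complex.exp (Complex.I * k * (p.2 : ℂ)))
      ((volume.restrict (Ioi 0)).prod (volume.restrict (Ioi 0))) := by
    refine Integrable.mul_bdd (c := 1) hprod.ofReal
      (by fun_prop : Continuous fun p : ℝ × ℝ =>
        Complex.exp (Complex.I * k * (p.2 : ℂ))).aestronglyMeasurable ?_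
    rw [Measure.prod_restrict]
    exact (ae_restrict_iff' (measurableSet_Ioi.prod measurableSet_Ioi)).2
      (ae_of_all _ fun p hp => norm_cexp_le_one hk (le_of_lt hp.2))
  have hk1 : ∀ x ∈ Ioi (0 : ℝ), kernelJost (kern q) x (Complex.I * κ) * kernelJost (kern q) x k
      = decaying q κ x * Complex.exp (Complex.I * k * x) +
        ∫ y in Ioi (0 : ℝ), ((kern q x y * decaying q κ x : ℝ) : ℂ) *
          Complex.exp (Complex.I * k * (y : ℂ)) := by
    intro x hx
    rw [kernelJost_I_mul, kernelJost, mul_add, ← integral_const_mul]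
    congr 1
    rw [← integral_Ici_eq_integral_Ioi, ← setIntegral_eq_of_subset_of_forall_sdiff_eq_zero
      measurableSet_Ioi (Ici_subset_Ioi.2 hx) (fun y hy => ?_)]
    · refine integral_congr_ae (ae_of_all _ fun y => ?_)
      push_cast; ring
    · rw [kern_eq_zero_of_lt hq (not_le.1 hy.2)]; simp
  have h1 := integral_add (integrableOn_mul_cexp hdc hk)
    hprod'.integral_prod_left
  have h2 := integral_add (integrableOn_mul_cexp hdc hk)
    hprod'.integral_prod_right
  rw [setIntegral_congr_fun measurableSet_Ioi hk1]
  refine Eq.trans (Eq.trans (integral_congr_ae (ae_of_all _ fun y => ?_)) h2) (Eq.trans ?_ h1.symm)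
  · simp only [overlap]
    have h5 : ∫ x in Ioi (0 : ℝ), ((kern q x y * decaying q κ x : ℝ) : ℂ)
        = ((∫ x in Ioi (0 : ℝ), kern q x y * decaying q κ x : ℝ) : ℂ) :=
      integral_ofReal (𝕜 := ℂ)
    rw [integral_mul_const, h5]
    push_cast; ring
  · exact congrArg _ (integral_integral_swap hprod').symm

/-- At a zero `iκ` of the Jost function, with `v0` the derivative of `f(·, iκ)` at `0`. -/
theorem mul_jostFun_eq_overlap {κ : ℝ} (hκ : 0 < κ) (h0 : jostFun q (Complex.I * κ) = 0) {v0 : ℂ}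
    (hv : Tendsto (jostDeriv q (Complex.I * κ)) (𝓝[>] 0) (𝓝 v0)) {k : ℂ} (hk : 0 ≤ k.im) :
    v0 * jostFun q k = -(k ^ 2 + κ ^ 2) * lap (fun y => (overlap q κ y : ℂ)) k := by
  rw [wronskian_identity hq (by simpa using hκ.le) hk (by simp; linarith) h0 hv, lap_overlap hq hκ hk,
    mul_pow, Complex.I_sq]
  ring

theorem lap_overlap_self {κ : ℝ} (hκ : 0 < κ) :
    lap (fun y => (overlap q κ y : ℂ)) (Complex.I * κ)
      = ((∫ x in Ioi (0 : ℝ), ‖kernelJost (kern q) x (Complex.I * κ)‖ ^ 2 : ℝ) : ℂ) := by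
  rw [lap_overlap hq hκ (by simpa using hκ.le)]
  refine Eq.trans (integral_congr_ae (ae_of_all _ fun x => ?_)) (integral_ofReal (𝕜 := ℂ))
  simp [kernelJost_I_mul, sq]

/-- If the derivative at 0 vanished, the transform of `overlap` would be zero at all k with k² ≠
-κ², hence at iκ by continuity; but there it is the positive integral of |f|². -/
theorem exists_deriv_ne_zero {κ : ℝ} (hκ : 0 < κ) (h0 : jostFun q (Complex.I * κ) = 0) :
    ∃ v0 : ℂ, v0 ≠ 0 ∧ Tendsto (jostDeriv q (Complex.I * κ)) (𝓝[>] 0) (𝓝 v0) := by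
  have him : 0 < (Complex.I * κ).im := by simpa using hκ
  obtain ⟨v0, hv⟩ := (sol_kernelJost hq him.le).exists_tendsto_deriv hq h0
  refine ⟨v0, ?_, hv⟩
  rintro rfl
  have h1 : ∀ k : ℂ, 0 ≤ k.im → k ^ 2 + κ ^ 2 ≠ 0 → lap (fun y => (overlap q κ y : ℂ)) k = 0 := by
    intro k hk hne
    have := mul_jostFun_eq_overlap hq hκ h0 hv hk
    rw [zero_mul, zero_eq_mul, neg_eq_zero] at this
    exact this.resolve_left hne
  have hc : ContinuousAt (lap fun y => (overlap q κ y : ℂ)) (Complex.I * κ) :=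
    (differentiableAt_lap (integrableOn_overlap hq hκ).ofReal him).continuousAt
  have h2 : Tendsto (fun t : ℝ => Complex.I * κ + t) (𝓝[≠] 0) (𝓝 (Complex.I * κ)) := by
    have := (by fun_prop : Continuous fun t : ℝ => Complex.I * κ + (t : ℂ)).tendsto 0
    rw [Complex.ofReal_zero, add_zero] at this
    exact this.mono_left nhdsWithin_le_nhds
  have h3 := hc.tendsto.comp h2
  have h4 : Tendsto ((lap fun y => (overlap q κ y : ℂ)) ∘ fun t : ℝ => Complex.I * κ + t) (𝓝[≠] 0)
      (𝓝 0) := by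
    refine tendsto_const_nhds.congr' ?_
    filter_upwards [self_mem_nhdsWithin] with t ht
    refine (h1 _ (by simpa using hκ.le) ?_).symm
    intro h5
    have h6 := congrArg Complex.im h5
    simp [sq] at h6
    have h7 : t * κ = 0 := by linarith
    exact (mul_ne_zero ht hκ.ne') h7
  have h5 := tendsto_nhds_unique h3 h4
  rw [lap_overlap_self hq hκ] at h5
  exact (integral_norm_sq_jost_pos hq him).ne' (by exact_mod_cast h5)

/-- Near iκ, f is the product of -(k² + κ²)/v0, which has a simple zero, and the transform of
`overlap`, which equals the integral of |f|² at iκ. -/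
theorem hasDerivAt_jostFun {κ : ℝ} (hκ : 0 < κ) (h0 : jostFun q (Complex.I * κ) = 0) {v0 : ℂ}
    (hv0 : v0 ≠ 0) (hv : Tendsto (jostDeriv q (Complex.I * κ)) (𝓝[>] 0) (𝓝 v0)) :
    HasDerivAt (jostFun q) (-(2 * Complex.I * κ) *
      ((∫ x in Ioi (0 : ℝ), ‖kernelJost (kern q) x (Complex.I * κ)‖ ^ 2 : ℝ) : ℂ) / v0)
      (Complex.I * κ) := by
  have him : 0 < (Complex.I * κ).im := by simpa using hκ
  have h1 : HasDerivAt (lap fun y => (overlap q κ y : ℂ)) _ _ :=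
    (differentiableAt_lap (integrableOn_overlap hq hκ).ofReal him).hasDerivAt
  have h2 := ((((hasDerivAt_id (Complex.I * κ : ℂ)).pow 2).add_const ((κ : ℂ) ^ 2)).neg.mul h1).div_const v0
  refine (h2.congr_deriv ?_).congr_of_eventuallyEq ?_
  · have h3 : (Complex.I * κ : ℂ) ^ 2 + κ ^ 2 = 0 := by rw [mul_pow, Complex.I_sq]; ring
    simp only [id, Pi.neg_apply, Pi.pow_apply]
    rw [lap_overlap_self hq hκ, h3]
    push_cast
    ring
  · filter_upwards [(isOpen_lt continuous_const Complex.continuous_im).mem_nhds him] with k hk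
    have := mul_jostFun_eq_overlap hq hκ h0 hv (le_of_lt hk)
    simp only [Pi.mul_apply, Pi.neg_apply, Pi.pow_apply, id]
    rw [← this, mul_div_cancel_left₀ _ hv0]

end
end HalfLine
-- Behaviour of the Jost function at 0 and finiteness of its zeros
namespace HalfLine

/-- Integration by parts: the transform of a function in terms of that of its tail. -/
theorem lap_eq_mul_lap_tail {a : ℝ → ℝ} (ha : IntegrableOn a (Ioi 0)) (hac : ContinuousOn a (Ioi 0))
    (hK : IntegrableOn (tail a) (Ioi 0)) {k : ℂ} (hk : 0 ≤ k.im) :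
    lap (fun y => (a y : ℂ)) k = tail a 0 + Complex.I * k * lap (fun y => (tail a y : ℂ)) k := by
  have hKc : IntegrableOn (fun y => (tail a y : ℂ)) (Ioi 0) := hK.ofReal
  have haC : IntegrableOn (fun y => (a y : ℂ)) (Ioi 0) := ha.ofReal
  have hcont : ContinuousOn (fun y => (a y : ℂ)) (Ioi 0) :=
    Complex.continuous_ofReal.comp_continuousOn hac
  have hof : ∀ y, (tail a y : ℂ) = ∫ s in Ioi y, (a s : ℂ) := fun y =>
    (integral_ofReal (𝕜 := ℂ)).symm
  have h1 := integral_Ioi_of_hasDerivAt_of_tendsto (a := (0 : ℝ)) (m := (0 : ℂ))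
      (f := fun y : ℝ => (tail a y : ℂ) * Complex.exp (Complex.I * k * (y : ℂ)))
      (f' := fun y : ℝ => -((a y : ℂ) * Complex.exp (Complex.I * k * (y : ℂ))) +
        Complex.I * k * ((tail a y : ℂ) * Complex.exp (Complex.I * k * (y : ℂ))))
      (((Complex.continuous_ofReal.comp_continuousOn (continuousOn_tail ha)) 0 self_mem_Ici).mul
        (continuous_cexp_I_mul k).continuousWithinAt) (fun y hy => by
        have h2 := (hasDerivAt_tail haC hcont hy).mul (hasDerivAt_cexp (Complex.I * k) y)
        refine (h2.congr_of_eventuallyEq (Eventually.of_forall fun t => ?_)).congr_deriv ?_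
        · simp only [hof, Pi.mul_apply]
        · simp only [hof]; ring)
      ((integrableOn_mul_cexp haC hk).neg.add
        ((integrableOn_mul_cexp hKc hk).const_mul _)) (by
        have h3 := (tendsto_tail haC).norm
        rw [norm_zero] at h3
        refine squeeze_zero_norm' ?_ h3
        filter_upwards [eventually_ge_atTop 0] with y hy
        rw [norm_mul, hof]
        exact mul_le_of_le_one_right (norm_nonneg _) (norm_cexp_le_one hk hy))
  rw [integral_add (integrableOn_mul_cexp haC hk).fun_neg
    ((integrableOn_mul_cexp hKc hk).const_mul _), integral_const_mul, integral_neg] at h1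
  simp only [Complex.ofReal_zero, mul_zero, Complex.exp_zero, mul_one, zero_sub] at h1
  rw [lap, lap]
  linear_combination -h1

theorem jostFun_zero (q : ℝ → ℝ) : jostFun q 0 = ((1 + tail (kern q 0) 0 : ℝ) : ℂ) := by
  rw [jostFun_eq, lap, tail]
  simp only [mul_zero, zero_mul, Complex.exp_zero, mul_one]
  push_cast
  congr 1
  exact integral_ofReal (𝕜 := ℂ)

section
variable {q : ℝ → ℝ} (hq : IsL11 q)
include hq

theorem continuousOn_kern_zero : ContinuousOn (kern q 0) (Ioi 0) := by
  have h : ContinuousOn (fun y : ℝ => Function.uncurry (kern q) ((0 : ℝ), y)) (Ioi 0) :=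
    ContinuousOn.comp (g := Function.uncurry (kern q)) (f := fun y : ℝ => ((0 : ℝ), y))
      (continuousOn_kern hq) (by fun_prop) fun y hy => ⟨le_rfl, le_of_lt hy, hy⟩
  simpa only [Function.uncurry_apply_pair] using h

/-- The Jost function in the exceptional case `f(0) = 0`. -/
theorem jostFun_eq_mul_lap (h0 : tail (kern q 0) 0 = -1) {k : ℂ} (hk : 0 ≤ k.im) :
    jostFun q k = Complex.I * k * lap (fun y => (tail (kern q 0) y : ℂ)) k := by
  rw [jostFun_eq, lap_eq_mul_lap_tail (integrableOn_kern hq le_rfl).1 (continuousOn_kern_zero hq)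
    (exceptional hq h0).1 hk, h0]
  push_cast
  ring

theorem lap_tail_kern_zero_ne_zero (h0 : tail (kern q 0) 0 = -1) :
    lap (fun y => (tail (kern q 0) y : ℂ)) 0 ≠ 0 := by
  rw [lap]
  simp only [mul_zero, zero_mul, Complex.exp_zero, mul_one]
  have h2 : ∫ y in Ioi (0 : ℝ), (tail (kern q 0) y : ℂ) = _ := integral_ofReal (𝕜 := ℂ)
  rw [h2]
  exact Complex.ofReal_ne_zero.2 (exceptional hq h0).2.1

/-- If f(0) = 0, then f(k) = ik K^(k) with K^(0) ≠ 0; otherwise continuity suffices. Without this,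
zeros iκ could accumulate at 0, where f need not be holomorphic. -/
theorem exists_ne_zero_near_zero :
    ∃ r > 0, ∀ k : ℂ, 0 ≤ k.im → k ≠ 0 → ‖k‖ < r → jostFun q k ≠ 0 := by
  have hmem : (0 : ℂ) ∈ {k : ℂ | 0 ≤ k.im} := by simp
  by_cases h0 : tail (kern q 0) 0 = -1
  · have hK := exceptional hq h0
    have hKc : IntegrableOn (fun y => (tail (kern q 0) y : ℂ)) (Ioi 0) := hK.1.ofReal
    have h1 := lap_tail_kern_zero_ne_zero hq h0
    have h3 := ((continuousOn_lap hKc) 0 hmem).eventually_ne h1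
    obtain ⟨r, hr, h4⟩ := Metric.mem_nhdsWithin_iff.1 h3
    refine ⟨r, hr, fun k hk hk0 hkr => ?_⟩
    rw [jostFun_eq_mul_lap hq h0 hk]
    exact mul_ne_zero (mul_ne_zero Complex.I_ne_zero hk0)
      (h4 ⟨by rwa [mem_ball_zero_iff], hk⟩)
  · have h1 : jostFun q 0 ≠ 0 := by
      rw [jostFun_zero]
      exact_mod_cast fun h => h0 (by linarith)
    obtain ⟨r, hr, h4⟩ := Metric.mem_nhdsWithin_iff.1
      (((continuousOn_jostFun hq) 0 hmem).eventually_ne h1)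
    exact ⟨r, hr, fun k hk _ hkr => h4 ⟨by rwa [mem_ball_zero_iff], hk⟩⟩

/-- The Riemann-Lebesgue lemma excludes large κ and the previous lemma small ones. Infinitely many
zeros would accumulate at a point of a compact interval in (0, ∞); it would be a zero with
nonvanishing derivative, and such zeros are isolated. -/
theorem finite_zeros : {κ : ℝ | 0 < κ ∧ jostFun q (Complex.I * κ) = 0}.Finite := by
  obtain ⟨r, hr, hr'⟩ := exists_ne_zero_near_zero hq
  obtain ⟨R, hR⟩ := exists_norm_lap_le (integrableOn_kern_complex hq) one_half_pos
  have hn : ∀ κ : ℝ, 0 < κ → ‖Complex.I * (κ : ℂ)‖ = κ := fun κ hκ => by simp [abs_of_pos hκ]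
  have him : ∀ κ : ℝ, 0 < κ → 0 < (Complex.I * (κ : ℂ)).im := fun κ hκ => by simpa using hκ
  have hsub : {κ : ℝ | 0 < κ ∧ jostFun q (Complex.I * κ) = 0} ⊆ Icc r R := by
    rintro κ ⟨hκ, h0⟩
    refine ⟨not_lt.1 fun h => ?_, not_lt.1 fun h => ?_⟩
    · exact hr' _ (him κ hκ).le (norm_pos_iff.1 ((hn κ hκ).symm ▸ hκ)) (by rwa [hn κ hκ]) h0
    · have h1 := hR _ (him κ hκ).le (by rw [hn κ hκ]; exact h.le)
      rw [jostFun_eq, add_eq_zero_iff_neg_eq] at h0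
      rw [← h0] at h1
      norm_num at h1
  by_contra hinf
  obtain ⟨x, hx, hacc⟩ := Set.Infinite.exists_accPt_of_subset_isCompact hinf isCompact_Icc hsub
  have hx0 : 0 < x := hr.trans_le hx.1
  have hfreq := accPt_iff_frequently.1 hacc
  have hcont : ContinuousAt (fun κ : ℝ => jostFun q (Complex.I * κ)) x :=
    ContinuousAt.comp (f := fun κ : ℝ => Complex.I * (κ : ℂ))
      (differentiableAt_jostFun hq (him x hx0)).continuousAt (by fun_prop)
  have hzero : jostFun q (Complex.I * x) = 0 := by
    by_contra hne
    refine hfreq ?_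
    filter_upwards [hcont.eventually_ne hne] with κ hκ h using hκ h.2.2
  obtain ⟨v0, hv0, hv⟩ := exists_deriv_ne_zero hq hx0 hzero
  have hd := hasDerivAt_jostFun hq hx0 hzero hv0 hv
  have hne := hd.eventually_ne (c := 0) (by
    refine div_ne_zero (mul_ne_zero ?_ ?_) hv0
    · simp [hx0.ne']
    · exact_mod_cast (integral_norm_sq_jost_pos hq (him x hx0)).ne')
  rw [eventually_nhdsWithin_iff] at hne
  refine hfreq ?_
  have hc : Tendsto (fun κ : ℝ => Complex.I * (κ : ℂ)) (𝓝 x) (𝓝 (Complex.I * x)) :=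
    (by fun_prop : Continuous fun κ : ℝ => Complex.I * (κ : ℂ)).tendsto x
  filter_upwards [hc.eventually hne] with κ hκ h
  exact hκ (by simpa using h.1) h.2.2

end
end HalfLine
-- S is one plus a Fourier transform
namespace HalfLine

/-- `g` is a constant plus a Fourier transform, and so is `k g'(k)` with constant zero. -/
def IsScaled (c : ℂ) (g : ℝ → ℂ) : Prop :=
  ∃ l h : ℝ → ℂ, Integrable l ∧ Integrable h ∧ (∀ k, g k = c + ft l k) ∧
    ∀ k : ℝ, k ≠ 0 → HasDerivAt g (ft h k / k) k

namespace IsScaled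
variable {c c' : ℂ} {g g' : ℝ → ℂ}

theorem add (hg : IsScaled c g) (hg' : IsScaled c' g') :
    IsScaled (c + c') (fun k => g k + g' k) := by
  obtain ⟨l, h, hl, hh, h1, h2⟩ := hg
  obtain ⟨l', h', hl', hh', h1', h2'⟩ := hg'
  refine ⟨fun x => l x + l' x, fun x => h x + h' x, hl.add hl', hh.add hh', fun k => ?_,
    fun k hk => ?_⟩
  · beta_reduce; rw [ft_add hl hl', h1, h1']; ring
  · rw [ft_add hh hh', add_div]; exact (h2 k hk).add (h2' k hk)

theorem const_mul (hg : IsScaled c g) (a : ℂ) : IsScaled (a * c) (fun k => a * g k) := by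
  obtain ⟨l, h, hl, hh, h1, h2⟩ := hg
  refine ⟨fun x => a * l x, fun x => a * h x, hl.const_mul a, hh.const_mul a, fun k => ?_,
    fun k hk => ?_⟩
  · beta_reduce; rw [ft_const_mul, h1]; ring
  · rw [ft_const_mul, mul_div_assoc]; exact (h2 k hk).const_mul a

theorem comp_neg (hg : IsScaled c g) : IsScaled c (fun k => g (-k)) := by
  obtain ⟨l, h, hl, hh, h1, h2⟩ := hg
  refine ⟨fun x => l (-x), fun x => h (-x), hl.comp_neg, hh.comp_neg, fun k => ?_, fun k hk => ?_⟩
  · beta_reduce; rw [ft_comp_neg, h1]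
  · rw [ft_comp_neg]
    refine ((h2 (-k) (neg_ne_zero.2 hk)).scomp k (hasDerivAt_neg k)).congr_deriv ?_
    rw [Complex.ofReal_neg, div_neg, smul_neg, neg_one_smul, neg_neg]

theorem mul (hg : IsScaled c g) (hg' : IsScaled c' g') :
    IsScaled (c * c') (fun k => g k * g' k) := by
  obtain ⟨l, h, hl, hh, h1, h2⟩ := hg
  obtain ⟨l', h', hl', hh', h1', h2'⟩ := hg'
  obtain ⟨m, hm, hm'⟩ := exists_ft_mul hl hl'
  obtain ⟨n, hn, hn'⟩ := exists_ft_mul hl hh'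
  obtain ⟨n', hp, hp'⟩ := exists_ft_mul hh hl'
  refine ⟨fun x => m x + (c * l' x + c' * l x), fun x => n x + n' x + (c * h' x + c' * h x),
    hm.add ((hl'.const_mul c).add (hl.const_mul c')),
    (hn.add hp).add ((hh'.const_mul c).add (hh.const_mul c')), fun k => ?_, fun k hk => ?_⟩
  · beta_reduce
    rw [ft_add hm ((hl'.const_mul c).fun_add (hl.const_mul c')),
      ft_add (hl'.const_mul c) (hl.const_mul c'), ft_const_mul, ft_const_mul, hm', h1, h1']
    ring
  · rw [ft_add (hn.fun_add hp) ((hh'.const_mul c).fun_add (hh.const_mul c')), ft_add hn hp,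
      ft_add (hh'.const_mul c) (hh.const_mul c'), ft_const_mul, ft_const_mul, hn', hp']
    refine ((h2 k hk).mul (h2' k hk)).congr_deriv ?_
    rw [h1, h1']
    ring

theorem continuous (hg : IsScaled c g) : Continuous g := by
  obtain ⟨l, h, hl, hh, h1, h2⟩ := hg
  rw [show g = fun k => c + ft l k from funext h1]
  exact continuous_const.add (continuous_ft hl)

theorem exists_le_norm (hg : IsScaled 1 g) (h0 : ∀ k, g k ≠ 0) : ∃ m > 0, ∀ k, m ≤ ‖g k‖ := by
  have hc := hg.continuous
  obtain ⟨l, h, hl, hh, h1, h2⟩ := hg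
  have h3 : ∀ᶠ k in cocompact ℝ, 1 / 2 ≤ ‖g k‖ := by
    have := ((tendsto_ft_cocompact l).const_add 1).norm
    rw [add_zero, norm_one] at this
    filter_upwards [this.eventually (Ici_mem_nhds (by norm_num : (1 / 2 : ℝ) < 1))] with k hk
    rw [h1]; exact hk
  obtain ⟨K, hK, hKc⟩ := mem_cocompact.1 h3
  rcases K.eq_empty_or_nonempty with rfl | hne
  · exact ⟨1 / 2, by norm_num, fun k => hKc (by simp)⟩
  · obtain ⟨k₀, hk₀, hmin⟩ := hK.exists_isMinOn hne hc.norm.continuousOn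
    refine ⟨min (1 / 2) ‖g k₀‖, lt_min (by norm_num) (norm_pos_iff.2 (h0 k₀)), fun k => ?_⟩
    by_cases hk : k ∈ K
    · exact (min_le_right _ _).trans (hmin hk)
    · exact (min_le_left _ _).trans (hKc hk)

/-- Wiener's lemma gives 1/g = 1 + n^, and then -k g'/g² = -h^ (1 + n^)² is again a transform. -/
theorem inv (hg : IsScaled 1 g) (h0 : ∀ k, g k ≠ 0) : IsScaled 1 (fun k => (g k)⁻¹) := by
  obtain ⟨m, hm, hmg⟩ := hg.exists_le_norm h0
  obtain ⟨l, h, hl, hh, h1, h2⟩ := hg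
  obtain ⟨n, hn, hn'⟩ := exists_ft_inverse hl hm fun k => by rw [← h1]; exact hmg k
  have hinv : ∀ k, (g k)⁻¹ = 1 + ft n k := fun k => by rw [h1, hn']
  obtain ⟨p, hp, hp'⟩ := exists_ft_mul hh hn
  obtain ⟨r, hr, hr'⟩ := exists_ft_mul hp hn
  refine ⟨n, fun x => -1 * (h x + (2 * p x + r x)), hn,
    (hh.add ((hp.const_mul 2).add hr)).const_mul _, hinv, fun k hk => ?_⟩
  rw [ft_const_mul, ft_add hh ((hp.const_mul 2).fun_add hr), ft_add (hp.const_mul 2) hr, ft_const_mul,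
    hr', hp']
  refine ((h2 k hk).fun_inv (h0 k)).congr_deriv ?_
  rw [div_eq_mul_inv _ (g k ^ 2), ← inv_pow, hinv]
  ring

end IsScaled

theorem norm_cexp_sub_one_le (k r : ℝ) :
    ‖Complex.exp (Complex.I * k * (r : ℂ)) - 1‖ ≤ |k| * |r| := by
  have h := Real.norm_exp_I_mul_ofReal_sub_one_le (x := k * r)
  rw [Real.norm_eq_abs, abs_mul] at h
  refine le_of_eq_of_le ?_ h
  push_cast
  rw [mul_assoc]

/-- `k ∫_0^∞ a(y) e^{iky} dy = -i ∫_0^∞ α(r) (e^{ikr} - 1) dr` if `a` is the tail of `α`. -/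
theorem mul_lap_tail {α : ℝ → ℝ} (hα : IsL11 α) (k : ℝ) :
    k * lap (fun y => (tail α y : ℂ)) k
      = -Complex.I * ∫ r in Ioi (0 : ℝ), (α r : ℂ) * (Complex.exp (Complex.I * k * (r : ℂ)) - 1) := by
  have hmm : AEStronglyMeasurable (fun r => (α r : ℂ)) (volume.restrict (Ioi 0)) :=
    Complex.continuous_ofReal.comp_aestronglyMeasurable (aestronglyMeasurable_q hα le_rfl)
  have hswap := integral_triangle_swap (a := 0) (b := fun s => |s * α s|)
    (G := fun t s => (α s : ℂ) * Complex.exp (Complex.I * k * (t : ℂ)))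
    (hmm.comp_snd.mul (by fun_prop : Continuous fun p : ℝ × ℝ =>
      Complex.exp (Complex.I * k * (p.1 : ℂ))).aestronglyMeasurable) (Integrable.abs hα)
    ((ae_restrict_iff' measurableSet_Ioi).2 (ae_of_all _ fun s hs => ?_))
  · rw [lap, ← integral_const_mul, ← integral_const_mul]
    have h1 : ∀ y : ℝ, (tail α y : ℂ) * Complex.exp (Complex.I * k * (y : ℂ))
        = ∫ s in Ioi y, (α s : ℂ) * Complex.exp (Complex.I * k * (y : ℂ)) := fun y => by
      rw [integral_mul_const]
      congr 1
      exact (integral_ofReal (𝕜 := ℂ)).symm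
    simp only [h1]
    rw [integral_const_mul, hswap, ← integral_const_mul]
    refine setIntegral_congr_fun measurableSet_Ioi fun s hs => ?_
    rw [mem_Ioi] at hs
    rw [integral_const_mul, ← integral_Ioc_eq_integral_Ioo, ← intervalIntegral.integral_of_le hs.le]
    rcases eq_or_ne k 0 with rfl | hk
    · simp
    · rw [integral_exp_mul_complex (mul_ne_zero Complex.I_ne_zero (Complex.ofReal_ne_zero.2 hk))]
      have : (k : ℂ) ≠ 0 := Complex.ofReal_ne_zero.2 hk
      simp only [Complex.ofReal_zero, mul_zero, Complex.exp_zero]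
      rw [div_eq_mul_inv, mul_inv, Complex.inv_I]
      linear_combination (-Complex.I * (α s : ℂ) * (Complex.exp (Complex.I * k * s) - 1)) *
        mul_inv_cancel₀ this
  · rw [mem_Ioi] at hs
    have hn : ∀ t : ℝ, ‖(α s : ℂ) * Complex.exp (Complex.I * k * (t : ℂ))‖ = |α s| := fun t => by
      rw [norm_mul, norm_cexp_I_mul]; simp
    refine ⟨?_, ?_⟩
    · exact (Continuous.integrableOn_Icc (by fun_prop)).mono_set Ioo_subset_Icc_self
    · simp only [hn]
      rw [setIntegral_const, Measure.real, Real.volume_Ioo, sub_zero, ENNReal.toReal_ofReal hs.le,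
        smul_eq_mul, abs_mul, abs_of_pos hs]

/-- With a the tail of α, k a^(k) is an integral of α(r)(e^{ikr} - 1), which may be differentiated
under the integral sign with majorant |r α(r)|. Hence k times the derivative of a^ is the transform
of r α(r) - a(r). -/
theorem isScaled_lap_tail {α : ℝ → ℝ} (hα : IsL11 α) (ha : IntegrableOn (tail α) (Ioi 0)) :
    IsScaled 0 (fun k : ℝ => lap (fun y => (tail α y : ℂ)) k) := by
  have haC : IntegrableOn (fun y => (tail α y : ℂ)) (Ioi 0) := ha.ofReal
  have hαC : IntegrableOn (fun r => ((r * α r : ℝ) : ℂ)) (Ioi 0) := Integrable.ofReal hα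
  have hmm : AEStronglyMeasurable (fun r => (α r : ℂ)) (volume.restrict (Ioi 0)) :=
    Complex.continuous_ofReal.comp_aestronglyMeasurable (aestronglyMeasurable_q hα le_rfl)
  have ha' := (integrable_indicator_iff measurableSet_Ioi).2 haC
  have hα' := (integrable_indicator_iff measurableSet_Ioi).2 hαC
  refine ⟨_, _, ha', hα'.sub ha', fun k => by beta_reduce; rw [lap_ofReal, zero_add], fun k hk => ?_⟩
  have hkC : (k : ℂ) ≠ 0 := Complex.ofReal_ne_zero.2 hk
  have hF : ∀ k : ℝ, AEStronglyMeasurable (fun r : ℝ => (α r : ℂ) *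
      (Complex.exp (Complex.I * k * (r : ℂ)) - 1)) (volume.restrict (Ioi 0)) := fun k =>
    hmm.mul (by fun_prop : Continuous fun r : ℝ =>
      Complex.exp (Complex.I * k * (r : ℂ)) - 1).aestronglyMeasurable
  have hderiv := (hasDerivAt_integral_of_dominated_loc_of_deriv_le (μ := volume.restrict (Ioi 0))
    (F := fun (z : ℝ) (r : ℝ) => (α r : ℂ) * (Complex.exp (Complex.I * z * (r : ℂ)) - 1))
    (F' := fun (z : ℝ) (r : ℝ) => (α r : ℂ) * (Complex.I * r *
      Complex.exp (Complex.I * z * (r : ℂ))))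
    (bound := fun r => |r * α r|) (x₀ := k) univ_mem (Eventually.of_forall fun z => hF z) ?_ ?_ ?_
    (Integrable.abs hα) ?_).2
  · have h1 := (hasDerivAt_id k).ofReal_comp.inv hkC |>.mul (hderiv.const_mul (-Complex.I))
    have h2 : (∫ r in Ioi (0 : ℝ), (α r : ℂ) * (Complex.I * r *
        Complex.exp (Complex.I * k * (r : ℂ)))) = Complex.I * lap (fun r => ((r * α r : ℝ) : ℂ)) k := by
      rw [lap, ← integral_const_mul]
      refine integral_congr_ae (ae_of_all _ fun r => ?_)
      push_cast; ring
    have h3 := mul_lap_tail hα k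
    refine (h1.congr_of_eventuallyEq ?_).congr_deriv ?_
    · filter_upwards [isOpen_ne.mem_nhds hk] with z hz
      have hzC : (z : ℂ) ≠ 0 := Complex.ofReal_ne_zero.2 hz
      simp only [Pi.mul_apply, Pi.inv_apply, id]
      rw [← mul_lap_tail hα z, inv_mul_cancel_left₀ hzC]
    · have h4 := ft_sub hα' ha' k
      rw [show ((Ioi (0 : ℝ)).indicator (fun r => ((r * α r : ℝ) : ℂ)) -
        (Ioi (0 : ℝ)).indicator fun y => (tail α y : ℂ)) = fun x =>
        (Ioi (0 : ℝ)).indicator (fun r => ((r * α r : ℝ) : ℂ)) x -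
        (Ioi (0 : ℝ)).indicator (fun y => (tail α y : ℂ)) x from rfl, h4, ← lap_ofReal,
        ← lap_ofReal, ← h3, h2]
      simp only [id, Complex.ofReal_one, Pi.inv_apply]
      field_simp
      linear_combination (-(lap (fun r => ((r * α r : ℝ) : ℂ)) k)) * Complex.I_sq
  · refine Integrable.mono' ((Integrable.abs hα).const_mul |k|) (hF k)
      (ae_of_all _ fun r => ?_)
    rw [norm_mul, Complex.norm_real, Real.norm_eq_abs, abs_mul]
    nlinarith [mul_le_mul_of_nonneg_left (norm_cexp_sub_one_le k r) (abs_nonneg (α r))]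
  · exact hmm.mul (by fun_prop : Continuous fun r : ℝ =>
      Complex.I * r * Complex.exp (Complex.I * k * (r : ℂ))).aestronglyMeasurable
  · refine ae_of_all _ fun r z _ => ?_
    rw [norm_mul, norm_mul, norm_mul, norm_cexp_I_mul]
    simp [abs_mul, mul_comm]
  · refine ae_of_all _ fun r z _ => HasDerivAt.const_mul _ ?_
    have h1 := (((((hasDerivAt_id z).ofReal_comp).const_mul Complex.I).mul_const (r : ℂ)).cexp).sub_const 1
    refine h1.congr_deriv ?_
    simp only [id, Complex.ofReal_one]; ring

section
variable {q : ℝ → ℝ} (hq : IsL11 q)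
include hq

theorem isScaled_jostFun : IsScaled 1 (fun k : ℝ => jostFun q k) := by
  obtain ⟨α, hα, h⟩ := exists_tail_kern hq
  have hint : IntegrableOn (tail α) (Ioi 0) :=
    (integrableOn_kern hq le_rfl).1.congr_fun (fun y hy => h y hy) measurableSet_Ioi
  obtain ⟨l, m, hl, hm, h1, h2⟩ := isScaled_lap_tail hα hint
  have h3 : ∀ k : ℂ, jostFun q k = 1 + lap (fun y => (tail α y : ℂ)) k := fun k => by
    rw [jostFun_eq]
    congr 1
    exact setIntegral_congr_fun measurableSet_Ioi fun y hy => by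
      beta_reduce; rw [h y hy]
  refine ⟨l, m, hl, hm, fun k => ?_, fun k hk => ?_⟩
  · have := h1 k
    beta_reduce at this ⊢
    rw [h3, this, zero_add]
  · simp only [h3]; exact (h2 k hk).const_add 1

omit hq in
theorem conj_jostFun (k : ℝ) : starRingEnd ℂ (jostFun q k) = jostFun q (-(k : ℂ)) := by
  rw [jostFun, conj_kernelJost, Complex.conj_ofReal, jostFun]

/-- `S(-k)` is, up to the value at `0`, one plus a Fourier transform of the class above. -/
theorem exists_isScaled_scattering : ∃ G : ℝ → ℂ, IsScaled 1 G ∧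
    ∀ k : ℝ, k ≠ 0 → G k = jostFun q k / jostFun q (-(k : ℂ)) := by
  have hf := isScaled_jostFun hq
  by_cases h0 : tail (kern q 0) 0 = -1
  · obtain ⟨hK, -, α, hα, h⟩ := exceptional hq h0
    have hKs : IsScaled 0 (fun k : ℝ => lap (fun y => (tail (kern q 0) y : ℂ)) k) := by
      have hint : IntegrableOn (tail α) (Ioi 0) :=
        hK.congr_fun (fun y hy => h y hy) measurableSet_Ioi
      have h3 : ∀ k : ℂ, lap (fun y => (tail (kern q 0) y : ℂ)) k
          = lap (fun y => (tail α y : ℂ)) k := fun k =>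
        setIntegral_congr_fun measurableSet_Ioi fun y hy => by
          beta_reduce; rw [h y hy]
      simp only [h3]
      exact isScaled_lap_tail hα hint
    have hE : IsScaled 0 (fun k : ℝ => 1 / (1 - Complex.I * k)) := by
      have hE1 : ∀ y : ℝ, tail (fun r => Real.exp (-r)) y = Real.exp (-y) := fun y =>
        integral_exp_neg_Ioi y
      have hE2 : IsL11 (fun r => Real.exp (-r)) := by
        have := Real.GammaIntegral_convergent (s := 2) two_pos
        refine this.congr_fun (fun x hx => ?_) measurableSet_Ioi
        norm_num [mul_comm]
      have hE3 : IntegrableOn (tail fun r => Real.exp (-r)) (Ioi 0) := by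
        rw [show (tail fun r => Real.exp (-r)) = fun y => Real.exp (-y) from funext hE1]
        exact integrableOn_exp_neg_Ioi 0
      have hE4 := isScaled_lap_tail hE2 hE3
      convert hE4 using 2 with k
      symm
      simp only [hE1, lap]
      have h5 : ∀ y : ℝ, ((Real.exp (-y) : ℝ) : ℂ) * Complex.exp (Complex.I * k * (y : ℂ))
          = Complex.exp ((-1 + Complex.I * k) * y) := fun y => by
        rw [Complex.ofReal_exp, ← Complex.exp_add]; congr 1; push_cast; ring
      simp only [h5]
      rw [integral_exp_mul_complex_Ioi (by simp)]
      simp only [Complex.ofReal_zero, mul_zero, Complex.exp_zero]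
      rw [← neg_div_neg_eq]
      congr 1 <;> ring
    -- In the exceptional case f = ik K^ vanishes at 0 and cannot be inverted. The function v = f -
    -- K^ = (ik - 1) K^ has no real zero and the same constant term 1. The quotient is f(k)/f(-k) =
    -- -K^(k)/K^(-k) = (1 - 2/(1 - ik)) v(k)/v(-k), and 1/(1 - ik) is the transform of e^{-y}.
    have hv := hf.add (hKs.const_mul (-1))
    rw [mul_zero, add_zero] at hv
    have hvk : ∀ k : ℝ, jostFun q k + -1 * lap (fun y => (tail (kern q 0) y : ℂ)) k
        = (Complex.I * k - 1) * lap (fun y => (tail (kern q 0) y : ℂ)) k := fun k => by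
      rw [jostFun_eq_mul_lap hq h0 (by simp)]; ring
    have hlap0 : ∀ k : ℝ, lap (fun y => (tail (kern q 0) y : ℂ)) k ≠ 0 := fun k => by
      rcases eq_or_ne k 0 with rfl | hk
      · rw [Complex.ofReal_zero]; exact lap_tail_kern_zero_ne_zero hq h0
      · have := jostFun_ne_zero hq hk
        rw [jostFun_eq_mul_lap hq h0 (by simp)] at this
        exact right_ne_zero_of_mul this
    have hne : ∀ k : ℝ, Complex.I * k - 1 ≠ 0 := fun k hk => by
      have := congrArg Complex.re hk
      simp at this
    have hinv := hv.comp_neg.inv fun k => by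
      rw [hvk]; exact mul_ne_zero (hne _) (hlap0 _)
    have hΦ : IsScaled 1 (fun k : ℝ => 1 + (-2) * (1 / (1 - Complex.I * k))) := by
      have h1 : IsScaled 1 (fun _ : ℝ => (1 : ℂ)) :=
        ⟨0, 0, integrable_zero _ _ _, integrable_zero _ _ _, fun k => by simp [ft],
          fun k _ => by simpa [ft] using hasDerivAt_const k (1 : ℂ)⟩
      simpa using h1.add (hE.const_mul (-2))
    have hres := (hΦ.mul hv).mul hinv
    rw [one_mul, one_mul] at hres
    refine ⟨_, hres, fun k hk => ?_⟩
    have hk' : (k : ℂ) ≠ 0 := Complex.ofReal_ne_zero.2 hk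
    have h4 : 1 - Complex.I * (k : ℂ) ≠ 0 := fun h => hne k (by linear_combination -h)
    have h1 := hvk (-k)
    have h2 := hlap0 (-k)
    have h3 := hne (-k)
    have h6 := jostFun_eq_mul_lap hq h0 (k := -(k : ℂ)) (by simp)
    rw [hvk, h1]
    push_cast at h2 h3 ⊢
    rw [h6, jostFun_eq_mul_lap hq h0 (by simp)]
    generalize lap (fun y => (tail (kern q 0) y : ℂ)) k = L at *
    generalize lap (fun y => (tail (kern q 0) y : ℂ)) (-(k : ℂ)) = L' at *
    rw [mul_neg] at h3 ⊢
    have hw : Complex.I * (k : ℂ) ≠ 0 := mul_ne_zero Complex.I_ne_zero hk'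
    generalize Complex.I * (k : ℂ) = w at *
    rw [show (1 : ℂ) + -2 * (1 / (1 - w)) = (-w - 1) / (1 - w) by field_simp; ring, div_mul_eq_mul_div,
      ← div_eq_mul_inv, div_div, div_eq_div_iff (mul_ne_zero h4 (mul_ne_zero h3 h2))
      (mul_ne_zero (neg_ne_zero.2 hw) h2)]
    ring
  · have hinv := hf.comp_neg.inv fun k => by
      rcases eq_or_ne k 0 with rfl | hk
      · rw [neg_zero, Complex.ofReal_zero, jostFun_zero]
        exact_mod_cast fun h => h0 (by linarith)
      · exact jostFun_ne_zero hq (neg_ne_zero.2 hk)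
    refine ⟨_, by simpa using hf.mul hinv, fun k hk => ?_⟩
    simp [div_eq_mul_inv]

end
end HalfLine
-- Pointwise Fourier inversion by improper integrals
namespace HalfLine

/-- The sine integral. -/
noncomputable def sineIntegral (x : ℝ) : ℝ := ∫ t in (0 : ℝ)..x, Real.sinc t

theorem hasDerivAt_sineIntegral (x : ℝ) : HasDerivAt sineIntegral (Real.sinc x) x :=
  intervalIntegral.integral_hasDerivAt_right (Real.continuous_sinc.intervalIntegrable _ _)
    (Real.continuous_sinc.stronglyMeasurableAtFilter _ _) Real.continuous_sinc.continuousAt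

theorem continuous_sineIntegral : Continuous sineIntegral :=
  continuous_iff_continuousAt.2 fun x => (hasDerivAt_sineIntegral x).continuousAt

theorem sineIntegral_neg (x : ℝ) : sineIntegral (-x) = -sineIntegral x := by
  have h := intervalIntegral.integral_comp_neg (a := 0) (b := x) Real.sinc
  simp only [Real.sinc_neg, neg_zero] at h
  rw [sineIntegral, sineIntegral, h, intervalIntegral.integral_symm]

/-- Si(t) + cos t / t has the integrable derivative -cos t / t². The value of the limit is never
needed. -/
theorem exists_tendsto_sineIntegral : ∃ L : ℝ, Tendsto sineIntegral atTop (𝓝 L) := by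
  have hint : IntegrableOn (fun t : ℝ => Real.cos t * t ^ (-2 : ℝ)) (Ioi 1) :=
    Integrable.bdd_mul (c := 1) (integrableOn_Ioi_rpow_of_lt (by norm_num : (-2 : ℝ) < -1) one_pos)
      Real.continuous_cos.aestronglyMeasurable (ae_of_all _ fun t => Real.abs_cos_le_one t)
  have h1 : ∀ x, 1 ≤ x → sineIntegral x = sineIntegral 1 + Real.cos 1 - Real.cos x / x
      - ∫ t in (1 : ℝ)..x, Real.cos t * t ^ (-2 : ℝ) := by
    intro x hx
    have hI := intervalIntegral.integral_eq_sub_of_hasDerivAt (a := 1) (b := x)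
      (f := fun t => sineIntegral t + Real.cos t / t)
      (f' := fun t => -(Real.cos t * t ^ (-2 : ℝ))) (fun t ht => ?_)
      (intervalIntegrable_of_Ioi hint le_rfl hx).neg
    · rw [intervalIntegral.integral_neg, div_one] at hI
      linarith
    · rw [uIcc_of_le hx] at ht
      have ht0 : 0 < t := one_pos.trans_le ht.1
      refine ((hasDerivAt_sineIntegral t).add
        ((Real.hasDerivAt_cos t).div (hasDerivAt_id t) ht0.ne')).congr_deriv ?_
      rw [Real.sinc_of_ne_zero ht0.ne', Real.rpow_neg ht0.le, Real.rpow_two]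
      simp only [id]
      field_simp
      ring
  have h2 : Tendsto (fun x : ℝ => Real.cos x / x) atTop (𝓝 0) := by
    refine squeeze_zero_norm' ?_ tendsto_inv_atTop_zero
    filter_upwards [eventually_gt_atTop 0] with x hx
    rw [norm_div, Real.norm_of_nonneg hx.le, Real.norm_eq_abs, div_eq_mul_inv]
    exact mul_le_of_le_one_left (by positivity) (Real.abs_cos_le_one x)
  refine ⟨_, (((tendsto_const_nhds (x := sineIntegral 1 + Real.cos 1)).sub h2).sub
    (intervalIntegral_tendsto_integral_Ioi 1 hint tendsto_id)).congr' ?_⟩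
  filter_upwards [eventually_ge_atTop 1] with x hx using (h1 x hx).symm

theorem exists_abs_sineIntegral_le : ∃ M : ℝ, 0 ≤ M ∧ ∀ x, |sineIntegral x| ≤ M := by
  obtain ⟨L, hL⟩ := exists_tendsto_sineIntegral
  obtain ⟨X, hX⟩ := eventually_atTop.1 (hL.abs.eventually (Iic_mem_nhds (lt_add_one |L|)))
  obtain ⟨C, hC⟩ := isCompact_Icc.exists_bound_of_continuousOn
    (continuous_sineIntegral.continuousOn (s := Icc 0 (max X 0)))
  refine ⟨max (|L| + 1) C, le_max_of_le_left (by positivity), ?_⟩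
  have h : ∀ x, 0 ≤ x → |sineIntegral x| ≤ max (|L| + 1) C := fun x hx => by
    rcases le_total x (max X 0) with h | h
    · exact (hC x ⟨hx, h⟩).trans (le_max_right _ _)
    · exact (hX x ((le_max_left _ _).trans h)).trans (le_max_left _ _)
  intro x
  rcases le_total 0 x with hx | hx
  · exact h x hx
  · have := h (-x) (by linarith)
    rwa [sineIntegral_neg, abs_neg] at this

theorem exists_tendsto_sineIntegral_mul :
    ∃ L : ℝ, ∀ y : ℝ, Tendsto (fun R => sineIntegral (R * y)) atTop (𝓝 (L * SignType.sign y)) := by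
  obtain ⟨L, hL⟩ := exists_tendsto_sineIntegral
  refine ⟨L, fun y => ?_⟩
  rcases lt_trichotomy y 0 with hy | rfl | hy
  · have h1 := (hL.comp (tendsto_id.atTop_mul_const (neg_pos.2 hy))).neg
    rw [sign_neg hy]
    simp only [SignType.coe_neg_one, mul_neg, mul_one]
    refine h1.congr fun R => ?_
    simp only [Function.comp, id]
    rw [← sineIntegral_neg, mul_neg, neg_neg]
  · simp [sineIntegral]
  · rw [sign_pos hy]
    simpa [Function.comp_def] using hL.comp (tendsto_id.atTop_mul_const hy)

/-- The truncated inverse Fourier integral, up to the factor `2π`. -/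
noncomputable def truncInt (g : ℝ → ℂ) (x R : ℝ) : ℂ :=
  ∫ k in (-R)..R, ft g k * Complex.exp (-(Complex.I * k * x))

section inversion
variable {g h : ℝ → ℂ} (hg : Integrable g) (hh : Integrable h)
  (hd : ∀ k : ℝ, k ≠ 0 → HasDerivAt (ft g) (ft h k / k) k)
include hg hh hd

omit hg hd in
theorem integrable_mul_sineIntegral (x R : ℝ) :
    Integrable fun t => h t * (sineIntegral (R * (t - x)) : ℂ) := by
  obtain ⟨M, -, hM⟩ := exists_abs_sineIntegral_le
  have := continuous_sineIntegral
  exact Integrable.mul_bdd (c := M) hh (by fun_prop : Continuous fun t : ℝ =>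
    (sineIntegral (R * (t - x)) : ℂ)).aestronglyMeasurable (ae_of_all _ fun t => by
      rw [Complex.norm_real]; exact hM _)

/-- Formally an integration by parts in k: k times the derivative of g^ is the transform of h, and
integrating sin(k(t - x))/k in k gives the sine integral. The factor 1/x is the reason for excluding
x = 0. -/
theorem truncInt_eq {x : ℝ} (hx : x ≠ 0) {R : ℝ} (hR : 0 < R) :
    truncInt g x R = (2 / x) * (∫ t, h t * (sineIntegral (R * (t - x)) : ℂ))
      + (Complex.I / x) * (ft g R * Complex.exp (-(Complex.I * R * x))
        - ft g (-R) * Complex.exp (Complex.I * R * x)) := by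
  have hxC : (x : ℂ) ≠ 0 := Complex.ofReal_ne_zero.2 hx
  have hgc := continuous_ft hg
  have hu : Continuous fun k : ℝ => ft g k * Complex.exp (-(Complex.I * k * x)) := by fun_prop
  obtain ⟨M, hM0, hM⟩ := exists_abs_sineIntegral_le
  have hsi := continuous_sineIntegral
  have hQc : Continuous fun R : ℝ => ∫ t, h t * (sineIntegral (R * (t - x)) : ℂ) := by
    refine continuous_of_dominated (bound := fun t => ‖h t‖ * M)
      (fun R => (integrable_mul_sineIntegral hh x R).aestronglyMeasurable)
      (fun R => ae_of_all _ fun t => ?_) (hh.norm.mul_const M) (ae_of_all _ fun t => by fun_prop)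
    rw [norm_mul, Complex.norm_real]
    exact mul_le_mul_of_nonneg_left (hM _) (norm_nonneg _)
  have htr : ∀ R : ℝ, HasDerivAt (truncInt g x) (ft g R * Complex.exp (-(Complex.I * R * x)) +
      ft g (-R) * Complex.exp (Complex.I * R * x)) R := by
    intro R
    have h1 : ∀ R : ℝ, HasDerivAt (fun R => ∫ k in (0 : ℝ)..R,
        ft g k * Complex.exp (-(Complex.I * k * x))) _ R := fun R =>
      intervalIntegral.integral_hasDerivAt_right (hu.intervalIntegrable _ _)
        (hu.stronglyMeasurableAtFilter _ _) hu.continuousAt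
    have h2 := (h1 R).sub ((h1 (-R)).scomp R (hasDerivAt_neg R))
    refine (h2.congr_of_eventuallyEq (Eventually.of_forall fun R => ?_)).congr_deriv ?_
    · simp only [Pi.sub_apply, Function.comp]
      exact (intervalIntegral.integral_interval_sub_left (hu.intervalIntegrable _ _)
        (hu.intervalIntegrable _ _)).symm
    · rw [neg_one_smul, sub_neg_eq_add]
      congr 3
      push_cast; ring
  -- The difference of the two sides. It vanishes at R = 0 and is continuous there, and its
  -- derivative is zero for R > 0; the derivative of g^ is not available at k = 0.
  set P : ℝ → ℂ := fun R => truncInt g x R - (2 / x) * (∫ t, h t * (sineIntegral (R * (t - x)) : ℂ))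
      - (Complex.I / x) * (ft g R * Complex.exp (-(Complex.I * R * x))
        - ft g (-R) * Complex.exp (Complex.I * R * x)) with hP
  have hPc : Continuous P := by
    have h1 : Continuous (truncInt g x) := continuous_iff_continuousAt.2 fun R =>
      (htr R).continuousAt
    fun_prop
  have hP0 : P 0 = 0 := by simp [hP, truncInt, sineIntegral]
  have hPd : ∀ R, 0 < R → HasDerivAt P 0 R := by
    intro R hR
    have hRC : (R : ℂ) ≠ 0 := Complex.ofReal_ne_zero.2 hR.ne'
    have hQ := (hasDerivAt_integral_of_dominated_loc_of_deriv_le (μ := volume)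
      (F := fun (R t : ℝ) => h t * (sineIntegral (R * (t - x)) : ℂ))
      (F' := fun (R t : ℝ) => h t * ((Real.sinc (R * (t - x)) * (t - x) : ℝ) : ℂ))
      (bound := fun t => ‖h t‖ * (2 / R)) (x₀ := R) (s := Ioi (R / 2))
      (Ioi_mem_nhds (by linarith))
      (Eventually.of_forall fun R => (integrable_mul_sineIntegral hh x R).aestronglyMeasurable)
      (integrable_mul_sineIntegral hh x R) ?_ ?_ (hh.norm.mul_const _) ?_).2
    · have hfg := hd R hR.ne'
      have hfg' := (hd (-R) (neg_ne_zero.2 hR.ne')).scomp R (hasDerivAt_neg R)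
      have he : HasDerivAt (fun R : ℝ => Complex.exp (-(Complex.I * R * x)))
          (-(Complex.I * x) * Complex.exp (-(Complex.I * R * x))) R := by
        have := hasDerivAt_cexp (-(Complex.I * x)) R
        have hc : ∀ R : ℝ, -(Complex.I * x) * (R : ℂ) = -(Complex.I * R * x) := fun R => by ring
        simpa only [hc] using this
      have he' : HasDerivAt (fun R : ℝ => Complex.exp (Complex.I * R * x))
          (Complex.I * x * Complex.exp (Complex.I * R * x)) R := by
        have := hasDerivAt_cexp (Complex.I * x) R
        have hc : ∀ R : ℝ, Complex.I * x * (R : ℂ) = Complex.I * R * x := fun R => by ring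
        simpa only [hc] using this
      have hall := ((htr R).sub (hQ.const_mul (2 / (x : ℂ)))).sub
        (((hfg.mul he).sub (hfg'.mul he')).const_mul (Complex.I / (x : ℂ)))
      refine hall.congr_deriv ?_
      have hI : ∫ t, h t * ((Real.sinc (R * (t - x)) * (t - x) : ℝ) : ℂ)
          = (ft h R * Complex.exp (-(Complex.I * R * x))
            - ft h (-R) * Complex.exp (Complex.I * R * x)) / (2 * Complex.I * R) := by
        have h1 : ∀ t : ℝ, h t * ((Real.sinc (R * (t - x)) * (t - x) : ℝ) : ℂ)
            = (Complex.exp (Complex.I * R * t) * h t * Complex.exp (-(Complex.I * R * x))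
              - Complex.exp (Complex.I * (-R : ℝ) * t) * h t * Complex.exp (Complex.I * R * x))
              / (2 * Complex.I * R) := by
          intro t
          have h2 : ((Real.sinc (R * (t - x)) * (t - x) : ℝ) : ℂ)
              = ((Real.sin (R * (t - x)) : ℝ) : ℂ) / R := by
            rw [← Complex.ofReal_div]
            congr 1
            rcases eq_or_ne (t - x) 0 with h0 | h0
            · simp [h0]
            · rw [Real.sinc_of_ne_zero (mul_ne_zero hR.ne' h0)]
              field_simp
          rw [h2, mul_right_comm, ← Complex.exp_add, mul_right_comm _ (h t), ← Complex.exp_add,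
            Complex.ofReal_sin, Complex.sin]
          have e1 : Complex.I * R * t + -(Complex.I * R * x) = ((R * (t - x) : ℝ) : ℂ) * Complex.I := by
            push_cast; ring
          have e2 : Complex.I * ((-R : ℝ) : ℂ) * t + Complex.I * R * x
              = -(((R * (t - x) : ℝ) : ℂ) * Complex.I) := by push_cast; ring
          rw [e1, e2, neg_mul]
          field_simp
          linear_combination (h t * (Complex.exp (-(((R * (t - x) : ℝ) : ℂ) * Complex.I))
            - Complex.exp (((R * (t - x) : ℝ) : ℂ) * Complex.I))) * Complex.I_sq
        simp only [h1]
        rw [integral_div, integral_sub ((integrable_cexp_mul hh R).mul_const _)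
          ((integrable_cexp_mul hh (-R)).mul_const _), integral_mul_const, integral_mul_const, ft, ft]
      rw [hI]
      simp only [Function.comp, neg_smul, one_smul]
      push_cast
      field_simp
      linear_combination (Complex.I * R * x * (ft g R * Complex.exp (-(Complex.I * R * x))
        + ft g (-R) * Complex.exp (Complex.I * R * x)) - ft h R * Complex.exp (-(Complex.I * R * x))
        + ft h (-R) * Complex.exp (Complex.I * R * x)) * Complex.I_sq
    · have := Real.continuous_sinc
      exact hh.aestronglyMeasurable.mul (by fun_prop : Continuous fun t : ℝ =>
        ((Real.sinc (R * (t - x)) * (t - x) : ℝ) : ℂ)).aestronglyMeasurable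
    · refine ae_of_all _ fun t z hz => ?_
      have hz0 : 0 < z := (half_pos hR).trans hz
      rw [norm_mul, Complex.norm_real]
      refine mul_le_mul_of_nonneg_left ?_ (norm_nonneg _)
      rcases eq_or_ne (t - x) 0 with h0 | h0
      · rw [h0]; simp; positivity
      · rw [Real.sinc_of_ne_zero (mul_ne_zero hz0.ne' h0),
          show Real.sin (z * (t - x)) / (z * (t - x)) * (t - x) = Real.sin (z * (t - x)) / z by
            field_simp, norm_div, Real.norm_of_nonneg hz0.le, div_le_div_iff₀ hz0 hR]
        have h1 : ‖Real.sin (z * (t - x))‖ ≤ 1 := Real.abs_sin_le_one _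
        have h2 : R / 2 < z := hz
        nlinarith
    · refine ae_of_all _ fun t z _ => HasDerivAt.const_mul _ ?_
      have h1 := ((hasDerivAt_sineIntegral (z * (t - x))).comp z
        ((hasDerivAt_id z).mul_const (t - x))).ofReal_comp
      simpa using h1
  have hPR : P R = P 0 := by
    have h1 : Tendsto P (𝓝[>] 0) (𝓝 (P 0)) := (hPc.tendsto 0).mono_left nhdsWithin_le_nhds
    refine tendsto_nhds_unique (tendsto_const_nhds.congr' ?_) h1
    filter_upwards [Ioc_mem_nhdsGT hR] with ε hε
    exact constant_of_has_deriv_right_zero hPc.continuousOn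
      (fun y hy => (hPd y (hε.1.trans_le hy.1)).hasDerivWithinAt) R ⟨hε.2, le_rfl⟩
  rw [hP0] at hPR
  simp only [hP] at hPR
  linear_combination hPR

omit hh hd in
theorem continuous_truncInt (R : ℝ) : Continuous fun x => truncInt g x R := by
  have := continuous_ft hg
  exact intervalIntegral.continuous_parametric_intervalIntegral_of_continuous'
    (f := fun x k : ℝ => ft g k * Complex.exp (-(Complex.I * k * x))) (by fun_prop) _ _

-- Inversion in the weak sense: Fubini moves the truncation to a test function, whose transform is
-- integrable. It serves to recognise the pointwise limit as g.
omit hh hd in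
open FourierTransform in
theorem tendsto_integral_smul_truncInt {ψ : ℝ → ℝ} (hψ : ContDiff ℝ (⊤ : ℕ∞) ψ)
    (hψc : HasCompactSupport ψ) :
    Tendsto (fun n : ℕ => ∫ x, ψ x • truncInt g x ((n : ℝ) + 1)) atTop
      (𝓝 (2 * Real.pi * ∫ x, ψ x • g x)) := by
  have hgc := continuous_ft hg
  have hψi : Integrable ψ := hψ.continuous.integrable_of_hasCompactSupport hψc
  set p : ℝ → ℂ := fun x => (ψ x : ℂ) with hp
  have hpd : ContDiff ℝ (⊤ : ℕ∞) p := Complex.ofRealCLM.contDiff.comp hψ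
  have hpc : HasCompactSupport p := hψc.comp_left Complex.ofReal_zero
  set P : SchwartzMap ℝ ℂ := hpc.toSchwartzMap hpd with hP
  have hPp : (P : ℝ → ℂ) = p := rfl
  have hpi : Integrable p := P.integrable
  have hFi : Integrable (𝓕 p) := by
    have := (𝓕 P).integrable (μ := volume)
    rwa [SchwartzMap.fourier_coe, hPp] at this
  have hπ : (2 * Real.pi) ≠ 0 := by positivity
  set φ : ℝ → ℂ := fun k => ft p (-k) with hφ
  have hφF : ∀ k, φ k = 𝓕 p (k / (2 * Real.pi)) := fun k => by
    rw [hφ]; beta_reduce; rw [ft_eq_fourier, neg_div, neg_neg]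
  have hφi : Integrable φ := by
    rw [show φ = fun k => 𝓕 p (k / (2 * Real.pi)) from funext hφF]
    exact hFi.comp_div hπ
  have hftφ : ∀ t, ft φ t = 2 * Real.pi * p t := fun t => by
    have h1 := Measure.integral_comp_div
      (fun w : ℝ => Complex.exp ((2 * Real.pi * (w * t) : ℝ) * Complex.I) * 𝓕 p w) (2 * Real.pi)
    have h2 : 𝓕⁻ (𝓕 p) t = p t := congrFun (hpd.continuous.fourierInv_fourier_eq hpi hFi) t
    rw [Real.fourierInv_eq'] at h2
    simp only [smul_eq_mul] at h2
    have h3 : ∀ w : ℝ, inner ℝ w t = w * t := fun w => by simp [mul_comm]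
    simp only [h3] at h2
    rw [h2, abs_of_pos (by positivity), Complex.real_smul] at h1
    rw [ft, ← Complex.ofReal_ofNat, ← Complex.ofReal_mul, ← h1]
    refine integral_congr_ae (ae_of_all _ fun k => ?_)
    beta_reduce
    rw [hφF]
    congr 2
    rw [show 2 * Real.pi * (k / (2 * Real.pi) * t) = k * t by field_simp]
    push_cast; ring
  have hdual : ∫ k, ft g k * φ k = 2 * Real.pi * ∫ x, ψ x • g x := by
    have hprod : Integrable (fun z : ℝ × ℝ => Complex.exp (Complex.I * z.1 * z.2) * (φ z.1 * g z.2))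
        (volume.prod volume) := by
      refine Integrable.bdd_mul (c := 1) (hφi.mul_prod hg)
        (by fun_prop : Continuous fun z : ℝ × ℝ =>
          Complex.exp (Complex.I * z.1 * z.2)).aestronglyMeasurable (ae_of_all _ fun z => ?_)
      rw [norm_cexp_I_mul]; simp
    have h1 := integral_integral_swap
      (f := fun k t : ℝ => Complex.exp (Complex.I * k * t) * (φ k * g t)) hprod
    rw [← integral_const_mul]
    refine Eq.trans (integral_congr_ae (ae_of_all _ fun k => ?_)) (h1.trans
      (integral_congr_ae (ae_of_all _ fun t => ?_)))
    · beta_reduce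
      rw [ft, ← integral_mul_const]
      refine integral_congr_ae (ae_of_all _ fun t => ?_)
      ring
    · beta_reduce
      rw [Complex.real_smul, ← mul_assoc, ← hftφ, ft, ← integral_mul_const]
      refine integral_congr_ae (ae_of_all _ fun k => ?_)
      beta_reduce
      rw [mul_right_comm Complex.I (k : ℂ)]
      ring
  have hswap : ∀ R : ℝ, 0 ≤ R → ∫ x, ψ x • truncInt g x R = ∫ k in (-R)..R, ft g k * φ k := by
    intro R hR
    have hprod : Integrable (fun z : ℝ × ℝ => Complex.exp (-(Complex.I * z.2 * z.1)) *
        (p z.1 * ft g z.2)) (volume.prod (volume.restrict (Ioc (-R) R))) := by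
      refine Integrable.bdd_mul (c := 1) (hpi.mul_prod
        (hgc.integrableOn_Icc.mono_set Ioc_subset_Icc_self))
        (by fun_prop : Continuous fun z : ℝ × ℝ =>
          Complex.exp (-(Complex.I * z.2 * z.1))).aestronglyMeasurable (ae_of_all _ fun z => ?_)
      rw [show -(Complex.I * z.2 * z.1) = Complex.I * ((-z.2 : ℝ) : ℂ) * z.1 by push_cast; ring,
        norm_cexp_I_mul]; simp
    have h1 := integral_integral_swap (f := fun x k : ℝ => Complex.exp (-(Complex.I * k * x)) *
        (p x * ft g k)) hprod
    rw [intervalIntegral.integral_of_le (by linarith)]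
    refine Eq.trans (integral_congr_ae (ae_of_all _ fun x => ?_)) (h1.trans
      (integral_congr_ae (ae_of_all _ fun k => ?_)))
    · beta_reduce
      rw [truncInt, intervalIntegral.integral_of_le (by linarith), Complex.real_smul,
        ← integral_const_mul]
      refine integral_congr_ae (ae_of_all _ fun k => ?_)
      simp only [hp]; ring
    · simp only [hφ, ft]
      rw [← integral_const_mul]
      refine integral_congr_ae (ae_of_all _ fun x => ?_)
      beta_reduce
      rw [show Complex.I * ((-k : ℝ) : ℂ) * x = -(Complex.I * k * x) by push_cast; ring]
      ring
  have hugi : Integrable fun k => ft g k * φ k :=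
    Integrable.bdd_mul (c := ∫ t, ‖g t‖) hφi hgc.aestronglyMeasurable
      (ae_of_all _ fun k => norm_ft_le g k)
  have h1 : Tendsto (fun n : ℕ => (n : ℝ) + 1) atTop atTop :=
    tendsto_natCast_atTop_atTop.atTop_add tendsto_const_nhds
  rw [← hdual]
  refine (intervalIntegral_tendsto_integral hugi (tendsto_neg_atTop_atBot.comp h1) h1).congr fun n => ?_
  exact (hswap _ (by positivity)).symm

theorem exists_norm_truncInt_le : ∃ C, 0 ≤ C ∧ ∀ x ≠ 0, ∀ R > 0, ‖truncInt g x R‖ ≤ C * |x|⁻¹ := by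
  obtain ⟨M, hM0, hM⟩ := exists_abs_sineIntegral_le
  refine ⟨2 * (∫ t, ‖h t‖ * M) + 2 * ∫ t, ‖g t‖, by positivity, fun x hx R hR => ?_⟩
  have h1 : ‖∫ t, h t * (sineIntegral (R * (t - x)) : ℂ)‖ ≤ ∫ t, ‖h t‖ * M :=
    norm_integral_le_of_norm_le (f := fun t => h t * (sineIntegral (R * (t - x)) : ℂ))
      (hh.norm.mul_const M) (ae_of_all _ fun t => by
        rw [norm_mul, Complex.norm_real]
        exact mul_le_mul_of_nonneg_left (hM _) (norm_nonneg _))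
  have h2 : ‖ft g R * Complex.exp (-(Complex.I * R * x))
      - ft g (-R) * Complex.exp (Complex.I * R * x)‖ ≤ 2 * ∫ t, ‖g t‖ := by
    have e1 : ‖Complex.exp (-(Complex.I * R * x))‖ = 1 := by
      rw [show -(Complex.I * R * x) = Complex.I * ((-R : ℝ) : ℂ) * x by push_cast; ring,
        norm_cexp_I_mul]; simp
    have e2 : ‖Complex.exp (Complex.I * R * x)‖ = 1 := by rw [norm_cexp_I_mul]; simp
    refine (norm_sub_le _ _).trans ?_
    rw [norm_mul, norm_mul, e1, e2, mul_one, mul_one, two_mul]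
    exact add_le_add (norm_ft_le g R) (norm_ft_le g (-R))
  have h3 : 0 ≤ |x|⁻¹ := by positivity
  rw [truncInt_eq hg hh hd hx hR]
  refine (norm_add_le _ _).trans ?_
  rw [norm_mul, norm_mul, norm_div, norm_div, Complex.norm_I, Complex.norm_real, Complex.norm_two,
    Real.norm_eq_abs, div_eq_mul_inv, one_div]
  nlinarith [mul_le_mul_of_nonneg_left h1 h3, mul_le_mul_of_nonneg_left h2 h3]

theorem tendsto_truncInt {L : ℝ}
    (hL : ∀ y : ℝ, Tendsto (fun R => sineIntegral (R * y)) atTop (𝓝 (L * SignType.sign y)))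
    {x : ℝ} (hx : x ≠ 0) : Tendsto (truncInt g x) atTop
      (𝓝 ((2 / x) * ∫ t, h t * ((L * SignType.sign (t - x) : ℝ) : ℂ))) := by
  obtain ⟨M, hM0, hM⟩ := exists_abs_sineIntegral_le
  have h1 : Tendsto (fun R : ℝ => ∫ t, h t * (sineIntegral (R * (t - x)) : ℂ)) atTop
      (𝓝 (∫ t, h t * ((L * SignType.sign (t - x) : ℝ) : ℂ))) := by
    refine tendsto_integral_filter_of_dominated_convergence (fun t => ‖h t‖ * M)
      (Eventually.of_forall fun R => (integrable_mul_sineIntegral hh x R).aestronglyMeasurable)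
      (Eventually.of_forall fun R => ae_of_all _ fun t => ?_) (hh.norm.mul_const M)
      (ae_of_all _ fun t => ?_)
    · rw [norm_mul, Complex.norm_real]
      exact mul_le_mul_of_nonneg_left (hM _) (norm_nonneg _)
    · exact ((Complex.continuous_ofReal.tendsto _).comp (hL (t - x))).const_mul _
  have hz : ∀ {φ : ℝ → ℝ} {s : ℂ}, Tendsto φ atTop (cocompact ℝ) →
      Tendsto (fun R : ℝ => ft g (φ R) * Complex.exp (s * (Complex.I * R * x))) atTop (𝓝 0) ∨
      s ≠ 1 ∧ s ≠ -1 := by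
    intro φ s hφ
    by_cases hs : s = 1 ∨ s = -1
    · left
      have h2 := ((tendsto_ft_cocompact g).comp hφ).norm
      rw [norm_zero] at h2
      refine squeeze_zero_norm (fun R => ?_) h2
      have e2 : ‖Complex.exp (s * (Complex.I * R * x))‖ = 1 := by
        rcases hs with rfl | rfl <;> rw [Complex.norm_exp] <;> simp
      rw [norm_mul, e2, mul_one, Function.comp]
    · right; push Not at hs; exact hs
  have h2 := (hz (φ := fun R => R) (s := -1) atTop_le_cocompact).resolve_right (by simp)
  have h3 := (hz (φ := fun R => -R) (s := 1)
    (tendsto_neg_atTop_atBot.mono_right atBot_le_cocompact)).resolve_right (by simp)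
  have h4 := (h1.const_mul (2 / (x : ℂ))).add ((h2.sub h3).const_mul (Complex.I / (x : ℂ)))
  rw [sub_zero, mul_zero, add_zero] at h4
  refine h4.congr' ?_
  filter_upwards [eventually_gt_atTop 0] with R hR
  rw [truncInt_eq hg hh hd hx hR]
  simp only [neg_mul, one_mul]

/-- Fourier inversion for an improper integral. -/
theorem exists_inversion : ∃ Φ : ℝ → ℂ,
    (∀ x ≠ 0, Tendsto (truncInt g x) atTop (𝓝 (2 * Real.pi * Φ x))) ∧
    ContinuousOn Φ {0}ᶜ ∧ Tendsto Φ atBot (𝓝 0) ∧ Φ =ᵐ[volume] g := by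
  obtain ⟨L, hL⟩ := exists_tendsto_sineIntegral_mul
  -- The limit of the sine integrals, a bounded function of x; up to a constant the inverse
  -- transform is I(x)/x, so it is continuous off 0 and tends to 0 at -∞.
  set I : ℝ → ℂ := fun x => ∫ t, h t * ((L * SignType.sign (t - x) : ℝ) : ℂ) with hI
  have hπ : (Real.pi : ℂ) ≠ 0 := Complex.ofReal_ne_zero.2 Real.pi_ne_zero
  have hsign : Measurable fun t : ℝ => ((SignType.sign t : SignType) : ℝ) := by
    have : (fun t : ℝ => ((SignType.sign t : SignType) : ℝ))
        = fun t => if 0 < t then 1 else if t < 0 then -1 else 0 := by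
      funext t; rw [sign_apply]; split_ifs <;> simp
    rw [this]
    exact Measurable.ite measurableSet_Ioi measurable_const
      (Measurable.ite measurableSet_Iio measurable_const measurable_const)
  have hsm : ∀ x : ℝ, Measurable fun t : ℝ => ((L * SignType.sign (t - x) : ℝ) : ℂ) := fun x =>
    Complex.measurable_ofReal.comp (measurable_const.mul (hsign.comp (measurable_id.sub_const x)))
  have hsb : ∀ x t : ℝ, ‖((L * SignType.sign (t - x) : ℝ) : ℂ)‖ ≤ |L| := fun x t => by
    rw [Complex.norm_real, Real.norm_eq_abs, abs_mul]
    refine mul_le_of_le_one_right (abs_nonneg _) ?_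
    rcases SignType.sign (t - x) with _ | _ | _ <;> simp
  have hIb : ∀ x, ‖I x‖ ≤ ∫ t, ‖h t‖ * |L| := fun x =>
    norm_integral_le_of_norm_le (f := fun t => h t * ((L * SignType.sign (t - x) : ℝ) : ℂ))
      (hh.norm.mul_const _) (ae_of_all _ fun t => by
        rw [norm_mul]; exact mul_le_mul_of_nonneg_left (hsb x t) (norm_nonneg _))
  have hIc : Continuous I := by
    refine continuous_iff_continuousAt.2 fun x => continuousAt_of_dominated
      (bound := fun t => ‖h t‖ * |L|)
      (Eventually.of_forall fun y => hh.aestronglyMeasurable.mul (hsm y).aestronglyMeasurable)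
      (Eventually.of_forall fun y => ae_of_all _ fun t => by
        rw [norm_mul]; exact mul_le_mul_of_nonneg_left (hsb y t) (norm_nonneg _))
      (hh.norm.mul_const _) ?_
    filter_upwards [compl_mem_ae_iff.2 (measure_singleton x)] with t ht
    have ht' : t - x ≠ 0 := sub_ne_zero.2 ht
    have h1 : ∀ᶠ y in 𝓝 x, SignType.sign (t - y) = SignType.sign (t - x) := by
      have hc : Tendsto (fun y => t - y) (𝓝 x) (𝓝 (t - x)) :=
        (continuous_const.sub continuous_id).tendsto x
      exact ((continuousAt_sign_of_ne_zero ht').tendsto.comp hc).eventually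
        (p := fun s => s = SignType.sign (t - x)) (by rw [nhds_discrete]; exact mem_pure.2 rfl)
    refine (continuousAt_const (y := h t * ((L * SignType.sign (t - x) : ℝ) : ℂ))).congr ?_
    filter_upwards [h1] with y hy
    rw [hy]
  have hΦ : ∀ x ≠ 0, Tendsto (truncInt g x) atTop
      (𝓝 (2 * Real.pi * ((Real.pi : ℂ)⁻¹ * ((x : ℂ)⁻¹ * I x)))) := fun x hx => by
    have := tendsto_truncInt hg hh hd hL hx
    rwa [show (2 / x : ℂ) * (∫ t, h t * ((L * SignType.sign (t - x) : ℝ) : ℂ))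
      = 2 * Real.pi * ((Real.pi : ℂ)⁻¹ * ((x : ℂ)⁻¹ * I x)) by
        rw [hI]; field_simp] at this
  have hΦc : ContinuousOn (fun x : ℝ => (Real.pi : ℂ)⁻¹ * ((x : ℂ)⁻¹ * I x)) {0}ᶜ := by
    refine continuousOn_const.mul (ContinuousOn.mul (ContinuousOn.inv₀ (by fun_prop) ?_)
      hIc.continuousOn)
    exact fun x hx => Complex.ofReal_ne_zero.2 hx
  refine ⟨fun x => (Real.pi : ℂ)⁻¹ * ((x : ℂ)⁻¹ * I x), hΦ, hΦc, ?_, ?_⟩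
  · have h1 : Tendsto (fun x : ℝ => ((x : ℂ)⁻¹ * I x)) atBot (𝓝 0) := by
      have h2 := (tendsto_inv_atBot_zero (𝕜 := ℝ)).norm.mul_const (∫ t, ‖h t‖ * |L|)
      rw [norm_zero, zero_mul] at h2
      refine squeeze_zero_norm (fun x => ?_) h2
      rw [norm_mul, ← Complex.ofReal_inv, Complex.norm_real]
      exact mul_le_mul_of_nonneg_left (hIb x) (norm_nonneg _)
    simpa using h1.const_mul (Real.pi : ℂ)⁻¹
  -- The pointwise limit agrees with g almost everywhere, since both arise as weak limits of the
  -- same truncations against test functions supported off 0. The bound C/|x| supplies dominated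
  -- convergence there. This bypasses the evaluation of L.
  · have hint : LocallyIntegrableOn (fun x : ℝ => (Real.pi : ℂ)⁻¹ * ((x : ℂ)⁻¹ * I x) - g x) {0}ᶜ :=
      (hΦc.locallyIntegrableOn isOpen_compl_singleton.measurableSet).sub
        (hg.locallyIntegrable.locallyIntegrableOn _)
    have h0 := isOpen_compl_singleton.ae_eq_zero_of_integral_contDiff_smul_eq_zero hint
      fun ψ hψ hψc hψ0 => ?_
    · filter_upwards [h0, compl_mem_ae_iff.2 (measure_singleton (0 : ℝ))] with x hx hx0
      exact sub_eq_zero.1 (hx hx0)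
    obtain ⟨C, hC, hCb⟩ := exists_norm_truncInt_le hg hh hd
    obtain ⟨K, hK⟩ := hψc.isCompact.exists_bound_of_continuousOn
      (continuousOn_inv₀.mono hψ0 : ContinuousOn (fun x : ℝ => x⁻¹) (tsupport ψ))
    have hψi : Integrable ψ := hψ.continuous.integrable_of_hasCompactSupport hψc
    have hb : ∀ x, ∀ R > 0, ‖ψ x • truncInt g x R‖ ≤ ‖ψ x‖ * (C * K) := fun x R hR => by
      rw [norm_smul]
      by_cases hx : x ∈ tsupport ψ
      · refine mul_le_mul_of_nonneg_left ((hCb x (hψ0 hx) R hR).trans ?_) (norm_nonneg _)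
        rw [← abs_inv]
        exact mul_le_mul_of_nonneg_left (hK x hx) hC
      · rw [image_eq_zero_of_notMem_tsupport hx]; simp
    have hlim : Tendsto (fun n : ℕ => ∫ x, ψ x • truncInt g x ((n : ℝ) + 1)) atTop
        (𝓝 (∫ x, ψ x • (2 * Real.pi * ((Real.pi : ℂ)⁻¹ * ((x : ℂ)⁻¹ * I x))))) := by
      refine tendsto_integral_of_dominated_convergence (fun x => ‖ψ x‖ * (C * K)) (fun n => ?_)
        (hψi.norm.mul_const _) (fun n => ae_of_all _ fun x => hb x _ (by positivity))
        (ae_of_all _ fun x => ?_)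
      · exact hψ.continuous.aestronglyMeasurable.smul
          (continuous_truncInt hg _).aestronglyMeasurable
      · by_cases hx : x ∈ tsupport ψ
        · exact ((hΦ x (hψ0 hx)).comp (tendsto_natCast_atTop_atTop.atTop_add
            tendsto_const_nhds)).const_smul (ψ x)
        · simp [image_eq_zero_of_notMem_tsupport hx]
    have h1 := tendsto_nhds_unique hlim (tendsto_integral_smul_truncInt hg hψ hψc)
    have hΦi : Integrable fun x : ℝ => ψ x • ((Real.pi : ℂ)⁻¹ * ((x : ℂ)⁻¹ * I x)) := by
      refine Integrable.mono' (g := fun x => ‖ψ x‖ * (‖(Real.pi : ℂ)⁻¹‖ * (K * ∫ t, ‖h t‖ * |L|)))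
        (hψi.norm.mul_const _) ?_ (ae_of_all _ fun x => ?_)
      · exact hψ.continuous.aestronglyMeasurable.smul (((by fun_prop : Measurable fun x : ℝ =>
          (x : ℂ)⁻¹).aestronglyMeasurable.mul hIc.aestronglyMeasurable).const_mul _)
      · rw [norm_smul]
        by_cases hx : x ∈ tsupport ψ
        · rw [norm_mul, norm_mul, ← Complex.ofReal_inv x, Complex.norm_real]
          have := hK x hx
          have := hIb x
          gcongr
          exact (norm_nonneg _).trans (hK x hx)
        · rw [image_eq_zero_of_notMem_tsupport hx]; simp
    have hgi : Integrable fun x : ℝ => ψ x • g x := by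
      obtain ⟨B, hB⟩ := hψ.continuous.bounded_above_of_compact_support hψc
      exact hg.bdd_smul B hψ.continuous.aestronglyMeasurable (ae_of_all _ hB)
    simp only [smul_sub]
    rw [integral_sub hΦi hgi, sub_eq_zero]
    have h2 : ∀ f : ℝ → ℂ, ∫ x, ψ x • (2 * Real.pi * f x) = 2 * Real.pi * ∫ x, ψ x • f x := fun f => by
      rw [← integral_const_mul]
      refine integral_congr_ae (ae_of_all _ fun x => ?_)
      simp only [Complex.real_smul]; ring
    rw [h2] at h1
    exact mul_left_cancel₀ (mul_ne_zero two_ne_zero hπ) h1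

end inversion
end HalfLine
-- The scattering part of F
namespace HalfLine

/-- `Φ` is the inverse Fourier transform of `1 - S`. -/
structure IsScattering (q : ℝ → ℝ) (Φ : ℝ → ℝ) : Prop where
  integrable : Integrable Φ
  continuousOn : ContinuousOn Φ {0}ᶜ
  tendsto_atBot : Tendsto Φ atBot (𝓝 0)
  eq : ∀ k : ℝ, k ≠ 0 → jostFun q (-(k : ℂ)) = (1 - ft (fun x : ℝ => (Φ x : ℂ)) (-k)) * jostFun q k
  tendsto : ∀ x : ℝ, x ≠ 0 → Tendsto (fun R : ℝ => (1 / (2 * (Real.pi : ℂ))) *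
    ∫ k in (-R)..R, ft (fun x : ℝ => (Φ x : ℂ)) (-k) * Complex.exp (Complex.I * (k : ℂ) * (x : ℂ)))
      atTop (𝓝 (Φ x : ℂ))

theorem conj_intervalIntegral_symm {f : ℝ → ℂ} (R : ℝ) :
    starRingEnd ℂ (∫ k in (-R)..R, f k) = ∫ k in (-R)..R, starRingEnd ℂ (f (-k)) := by
  have h := intervalIntegral.integral_comp_neg (a := -R) (b := R) fun k => starRingEnd ℂ (f k)
  rw [neg_neg] at h
  rw [h, ← intervalIntegral.intervalIntegral_conj]

/-- The function G provided by `exists_isScaled_scattering` is S(-k), so inversion applies to 1 - G.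
Realness follows from f(-k) = conj f(k) on the real line, which makes every truncated integral real.
-/
theorem exists_isScattering {q : ℝ → ℝ} (hq : IsL11 q) : ∃ Φ, IsScattering q Φ := by
  obtain ⟨G, ⟨l, h, hl, hh, h1, h2⟩, hG⟩ := exists_isScaled_scattering hq
  set g : ℝ → ℂ := fun x => -l x with hg
  have hgi : Integrable g := hl.neg
  have hgk : ∀ k, ft g k = 1 - G k := fun k => by rw [hg, ft_neg, h1]; ring
  have hd : ∀ k : ℝ, k ≠ 0 → HasDerivAt (ft g) (ft (fun x => -h x) k / k) k := fun k hk => by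
    rw [ft_neg, neg_div, show ft g = fun k => 1 - G k from funext hgk]
    exact (h2 k hk).const_sub 1
  obtain ⟨Ψ, hΨ1, hΨ2, hΨ3, hΨ4⟩ := exists_inversion hgi hh.neg hd
  have hconj : ∀ k, starRingEnd ℂ (ft g k) = ft g (-k) := by
    have hc := continuous_ft hgi
    refine congrFun (Continuous.ext_on (dense_compl_singleton (0 : ℝ))
      (Complex.continuous_conj.comp hc) (hc.comp continuous_neg) fun k hk => ?_)
    rw [hgk, hgk, hG k hk, hG (-k) (neg_ne_zero.2 hk), map_sub, map_div₀, map_one, conj_jostFun,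
      Complex.ofReal_neg, neg_neg, ← conj_jostFun, Complex.conj_conj]
  have hreal : ∀ x : ℝ, x ≠ 0 → (Ψ x).im = 0 := fun x hx => by
    have h3 : ∀ R, starRingEnd ℂ (truncInt g x R) = truncInt g x R := fun R => by
      rw [truncInt, conj_intervalIntegral_symm]
      refine intervalIntegral.integral_congr fun k _ => ?_
      rw [map_mul, hconj, neg_neg, ← Complex.exp_conj]
      congr 2
      simp
    have h4 := ((Complex.continuous_conj.tendsto _).comp (hΨ1 x hx)).congr h3
    have h5 := tendsto_nhds_unique h4 (hΨ1 x hx)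
    rw [map_mul, map_mul, Complex.conj_ofReal, Complex.conj_ofNat] at h5
    exact Complex.conj_eq_iff_im.1 (mul_left_cancel₀ (mul_ne_zero two_ne_zero
      (Complex.ofReal_ne_zero.2 Real.pi_ne_zero)) h5)
  have hre : ∀ x : ℝ, x ≠ 0 → ((Ψ x).re : ℂ) = Ψ x := fun x hx =>
    Complex.ext (by simp) (by simp [hreal x hx])
  have hae : (fun x : ℝ => ((Ψ x).re : ℂ)) =ᵐ[volume] g := by
    filter_upwards [hΨ4, compl_mem_ae_iff.2 (measure_singleton (0 : ℝ))] with x hx hx0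
    rw [hre x hx0, hx]
  have hft : ft (fun x : ℝ => ((Ψ x).re : ℂ)) = ft g := by
    funext k
    refine integral_congr_ae ?_
    filter_upwards [hae] with x hx
    rw [hx]
  refine ⟨fun x => (Ψ x).re, (hgi.congr hΨ4.symm).re, Complex.continuous_re.comp_continuousOn hΨ2,
    by simpa [Function.comp_def] using (Complex.continuous_re.tendsto _).comp hΨ3, fun k hk => ?_, fun x hx => ?_⟩
  · rw [hft, hgk, hG (-k) (neg_ne_zero.2 hk), sub_sub_cancel, Complex.ofReal_neg, neg_neg,
      div_mul_cancel₀ _ (jostFun_ne_zero hq hk)]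
  · rw [hft, hre x hx]
    have h3 := (hΨ1 x hx).const_mul (1 / (2 * (Real.pi : ℂ)))
    have hπ : (Real.pi : ℂ) ≠ 0 := Complex.ofReal_ne_zero.2 Real.pi_ne_zero
    rw [← mul_assoc, one_div_mul_cancel (mul_ne_zero two_ne_zero hπ), one_mul] at h3
    refine h3.congr fun R => ?_
    have h6 := intervalIntegral.integral_comp_neg (a := -R) (b := R) fun k : ℝ =>
      ft g (-k) * Complex.exp (Complex.I * k * x)
    rw [neg_neg] at h6
    rw [truncInt, ← h6]
    congr 1
    refine intervalIntegral.integral_congr fun k _ => ?_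
    rw [neg_neg]
    congr 2
    push_cast; ring

/-- The transform of a correlation over the half-line. -/
theorem ft_correlation {f g : ℝ → ℝ} (hf : IntegrableOn f (Ioi 0)) (hg : Integrable g) :
    Integrable (fun y => ∫ s in Ioi (0 : ℝ), f s * g (s + y)) ∧ ∀ k : ℝ,
      ft (fun y => ((∫ s in Ioi (0 : ℝ), f s * g (s + y) : ℝ) : ℂ)) k
        = lap (fun s => (f s : ℂ)) (-(k : ℂ)) * ft (fun x => (g x : ℂ)) k := by
  have hi : Integrable (fun p : ℝ × ℝ => f p.1 * g (p.1 + p.2))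
      ((volume.restrict (Ioi 0)).prod volume) := by
    have hmg : AEStronglyMeasurable (fun p : ℝ × ℝ => g (p.1 + p.2))
        ((volume.restrict (Ioi 0)).prod volume) := by
      have h0 : AEStronglyMeasurable (fun p : ℝ × ℝ => g (p.1 + p.2)) (volume.prod volume) :=
        hg.aestronglyMeasurable.comp_quasiMeasurePreserving
          (quasiMeasurePreserving_add volume volume)
      exact h0.mono_measure (Measure.prod_mono Measure.restrict_le_self le_rfl)
    have hm := (hf.aestronglyMeasurable.comp_fst (ν := volume)).mul hmg
    refine (integrable_prod_iff hm).2 ⟨ae_of_all _ fun s => (hg.comp_add_left s).const_mul (f s), ?_⟩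
    refine (hf.norm.mul_const (∫ x, ‖g x‖)).congr (ae_of_all _ fun s => ?_)
    simp only [Pi.mul_apply, norm_mul, integral_const_mul]
    rw [integral_add_left_eq_self (fun x => ‖g x‖) s]
  refine ⟨hi.integral_prod_right, fun k => ?_⟩
  have hi' : Integrable (fun p : ℝ × ℝ => Complex.exp (Complex.I * k * p.2) *
      ((f p.1 * g (p.1 + p.2) : ℝ) : ℂ)) ((volume.restrict (Ioi 0)).prod volume) := by
    refine Integrable.bdd_mul (c := 1) hi.ofReal (by fun_prop : Continuous fun p : ℝ × ℝ =>
      Complex.exp (Complex.I * k * p.2)).aestronglyMeasurable (ae_of_all _ fun p => ?_)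
    rw [norm_cexp_I_mul]; simp
  have h1 := integral_integral_swap (f := fun s y : ℝ => Complex.exp (Complex.I * k * y) *
      ((f s * g (s + y) : ℝ) : ℂ)) hi'
  rw [lap, ← integral_mul_const]
  refine Eq.trans (integral_congr_ae (ae_of_all _ fun y => ?_)) (h1.symm.trans
    (integral_congr_ae (ae_of_all _ fun s => ?_)))
  · beta_reduce
    rw [integral_const_mul]
    congr 1
    exact (integral_ofReal (𝕜 := ℂ)).symm
  · beta_reduce
    rw [ft, ← integral_add_left_eq_self (fun x : ℝ => Complex.exp (Complex.I * k * x) * (g x : ℂ)) s,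
      ← integral_const_mul]
    refine integral_congr_ae (ae_of_all _ fun y => ?_)
    beta_reduce
    have : Complex.exp (Complex.I * k * y) = Complex.exp (Complex.I * -(k : ℂ) * s) *
        Complex.exp (Complex.I * k * ((s + y : ℝ) : ℂ)) := by
      rw [← Complex.exp_add]; congr 1; push_cast; ring
    rw [this]
    push_cast; ring

/-- The Marchenko-type equation for the scattering part of `F`. -/
theorem IsScattering.convolution_eq {q Φ : ℝ → ℝ} (hΦ : IsScattering q Φ) {l : ℝ → ℝ}
    (hl : IntegrableOn l (Ioi 0)) {c : ℝ}
    (h : ∀ k : ℝ, k ≠ 0 → (c + lap (fun y => (l y : ℂ)) (-(k : ℂ)))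
      = (1 - ft (fun x : ℝ => (Φ x : ℂ)) (-k)) * (c + lap (fun y => (l y : ℂ)) k)) :
    ∀ᵐ y ∂(volume.restrict (Ioi (0 : ℝ))),
      l y + c * Φ y + ∫ s in Ioi (0 : ℝ), l s * Φ (s + y) = 0 := by
  obtain ⟨hci, hcf⟩ := ft_correlation hl hΦ.integrable
  set lp : ℝ → ℂ := indicator (Ioi 0) fun y => (l y : ℂ) with hlp
  have hlC : IntegrableOn (fun y => (l y : ℂ)) (Ioi 0) := hl.ofReal
  have hlpi : Integrable lp := (integrable_indicator_iff measurableSet_Ioi).2 hlC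
  have hcc : Integrable fun y => ((∫ s in Ioi (0 : ℝ), l s * Φ (s + y) : ℝ) : ℂ) := hci.ofReal
  have hΦc : Integrable fun y => (Φ y : ℂ) := hΦ.integrable.ofReal
  have hI1 : Integrable fun y => lp y - lp (-y) := hlpi.sub hlpi.comp_neg
  have hI2 : Integrable fun y => (c : ℂ) * Φ y +
      ((∫ s in Ioi (0 : ℝ), l s * Φ (s + y) : ℝ) : ℂ) := (hΦc.const_mul (c : ℂ)).add hcc
  have hlapneg : ∀ k : ℝ, lap (fun y => (l y : ℂ)) (-(k : ℂ)) = ft lp (-k) := fun k => by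
    rw [← Complex.ofReal_neg, lap_ofReal]
  -- The hypothesis, read at -k, says that l₊ - l₊(-·) + c Φ + (correlation of l and Φ) has zero
  -- transform for k ≠ 0, hence for all k by continuity; l₊ is l extended by zero. For y > 0 the
  -- reflected term drops out.
  have h0 := ae_eq_zero_of_ft_eq_zero (hI1.fun_add hI2) (congrFun (Continuous.ext_on
    (dense_compl_singleton (0 : ℝ)) (continuous_ft (hI1.fun_add hI2)) continuous_const
    fun k hk => by
      have h1 := h (-k) (neg_ne_zero.2 hk)
      rw [neg_neg, Complex.ofReal_neg, neg_neg, hlapneg, lap_ofReal] at h1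
      rw [ft_add hI1 hI2, ft_sub hlpi hlpi.comp_neg, ft_comp_neg, ft_add (hΦc.const_mul _) hcc,
        ft_const_mul, hcf, hlapneg]
      linear_combination h1))
  rw [Filter.EventuallyEq] at h0
  refine (ae_restrict_iff' measurableSet_Ioi).2 ?_
  filter_upwards [h0] with y hy hy0
  rw [mem_Ioi] at hy0
  rw [hlp, indicator_of_mem (show y ∈ Ioi (0 : ℝ) from hy0),
    indicator_of_notMem (show -y ∉ Ioi (0 : ℝ) by simp [hy0.le])] at hy
  simp only [Pi.zero_apply] at hy
  have : ((l y + c * Φ y + ∫ s in Ioi (0 : ℝ), l s * Φ (s + y) : ℝ) : ℂ) = 0 := by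
    push_cast
    linear_combination hy
  exact_mod_cast this

end HalfLine
-- Analytic continuation and division by the Jost function
namespace HalfLine

/-- A continuous function that is holomorphic off the real line is entire. -/
theorem differentiable_of_im_ne_zero {H : ℂ → ℂ} (hc : Continuous H)
    (hd : ∀ k : ℂ, k.im ≠ 0 → DifferentiableAt ℂ H k) : Differentiable ℂ H := by
  rw [← differentiableOn_univ]
  refine (Complex.isConservativeOn_and_continuousOn_iff_isDifferentiableOn isOpen_univ).1
    ⟨fun z w _ => ?_, hc.continuousOn⟩
  -- For a rectangle with a side on the real axis Cauchy's theorem needs only continuity on the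
  -- boundary. A general rectangle is cut along the real axis, and Morera's theorem concludes.
  have key : ∀ z w : ℂ, z.im = 0 ∨ w.im = 0 →
      (((∫ x : ℝ in z.re..w.re, H (x + z.im * Complex.I)) -
        ∫ x : ℝ in z.re..w.re, H (x + w.im * Complex.I)) +
        Complex.I • ∫ y : ℝ in z.im..w.im, H (w.re + y * Complex.I)) -
          Complex.I • ∫ y : ℝ in z.im..w.im, H (z.re + y * Complex.I) = 0 := fun z w h => by
    refine Complex.integral_boundary_rect_eq_zero_of_continuousOn_of_differentiableOn H z w
      hc.continuousOn fun k hk => (hd k fun h0 => ?_).differentiableWithinAt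
    have h1 := hk.2.1
    have h2 := hk.2.2
    rw [h0] at h1 h2
    rcases h with h | h <;> rw [h] at h1 h2 <;> simp at h1 h2 <;> linarith
  have k1 := key z ⟨w.re, 0⟩ (Or.inr rfl)
  have k2 := key ⟨z.re, 0⟩ w (Or.inl rfl)
  have hi : ∀ a b c : ℝ, IntervalIntegrable (fun y : ℝ => H (c + y * Complex.I)) volume a b :=
    fun a b c => Continuous.intervalIntegrable (by fun_prop) _ _
  have s1 := intervalIntegral.integral_add_adjacent_intervals (hi z.im 0 w.re) (hi 0 w.im w.re)
  have s2 := intervalIntegral.integral_add_adjacent_intervals (hi z.im 0 z.re) (hi 0 w.im z.re)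
  rw [Complex.wedgeIntegral, Complex.wedgeIntegral, intervalIntegral.integral_symm z.re w.re,
    intervalIntegral.integral_symm z.im w.im, ← s1, ← s2]
  simp only [smul_eq_mul] at *
  linear_combination k1 + k2

/-- Infinity in the closed upper half-plane. -/
noncomputable def upper : Filter ℂ := cocompact ℂ ⊓ 𝓟 {k | 0 ≤ k.im}

theorem tendsto_lap {m : ℝ → ℂ} (hm : IntegrableOn m (Ioi 0)) : Tendsto (lap m) upper (𝓝 0) := by
  refine Metric.tendsto_nhds.2 fun ε hε => ?_
  obtain ⟨R, hR⟩ := exists_norm_lap_le hm (half_pos hε)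
  refine eventually_inf_principal.2 ?_
  filter_upwards [(tendsto_norm_cocompact_atTop (E := ℂ)).eventually_ge_atTop R] with k hk him
  rw [dist_zero_right]
  linarith [hR k him hk]

/-- A half-line transform whose boundary values continue to the other half-plane vanishes. -/
theorem ae_eq_zero_of_continuation {m : ℝ → ℂ} (hm : IntegrableOn m (Ioi 0)) {H : ℂ → ℂ}
    (hc : ContinuousOn H {k | 0 ≤ k.im}) (hd : ∀ k : ℂ, 0 < k.im → DifferentiableAt ℂ H k)
    (hH : Tendsto (fun k => k⁻¹ * H k) upper (𝓝 0)) (heq : ∀ k : ℝ, H k = k * lap m (-(k : ℂ))) :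
    ∀ᵐ y ∂(volume.restrict (Ioi (0 : ℝ))), m y = 0 := by
  set G : ℂ → ℂ := fun k => if 0 ≤ k.im then H k else k * lap m (-k) with hG
  have hGc : Continuous G := by
    refine continuous_if_le continuous_const Complex.continuous_im hc ?_ fun k hk => ?_
    · refine continuousOn_id.mul ((continuousOn_lap hm).comp continuousOn_neg fun k hk => ?_)
      have h : k.im ≤ 0 := hk
      simpa using h
    · have : k = (k.re : ℂ) := Complex.ext rfl hk.symm
      rw [this, heq]
  have hGd : Differentiable ℂ G := differentiable_of_im_ne_zero hGc fun k hk => by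
    rcases lt_or_gt_of_ne hk with h | h
    · have h1 : DifferentiableAt ℂ (fun k => k * lap m (-k)) k :=
        differentiableAt_id.mul (DifferentiableAt.comp (g := lap m) (f := fun k : ℂ => -k) k
          (differentiableAt_lap hm (by simpa using h)) differentiableAt_id.neg)
      refine h1.congr_of_eventuallyEq ?_
      filter_upwards [(isOpen_lt Complex.continuous_im continuous_const).mem_nhds h] with w hw
      exact if_neg (not_le.2 hw)
    · refine (hd k h).congr_of_eventuallyEq ?_
      filter_upwards [(isOpen_lt continuous_const Complex.continuous_im).mem_nhds h] with w hw
      exact if_pos (le_of_lt hw)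
  have hG0 : G 0 = 0 := by
    have := heq 0
    simp only [Complex.ofReal_zero, zero_mul] at this
    rw [hG]
    simp [this]
  have hne : ∀ᶠ k in cocompact ℂ, k ≠ (0 : ℂ) := by
    filter_upwards [(tendsto_norm_cocompact_atTop (E := ℂ)).eventually_gt_atTop 0] with k hk
    exact norm_pos_iff.1 hk
  -- The glued function G is entire, vanishes at 0, and G(k)/k tends to 0 in both half-planes.
  -- Liouville's theorem for G(k)/k gives G = 0.
  have hlim : Tendsto (dslope G 0) (cocompact ℂ) (𝓝 0) := by
    have h1 : Tendsto (fun k : ℂ => if 0 ≤ k.im then k⁻¹ * H k else lap m (-k))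
        (cocompact ℂ) (𝓝 0) := by
      refine Tendsto.if hH ((tendsto_lap hm).comp ?_)
      refine tendsto_inf.2 ⟨((Homeomorph.neg ℂ).isClosedEmbedding.tendsto_cocompact).mono_left
        inf_le_left, tendsto_principal.2 (eventually_inf_principal.2 (Eventually.of_forall
        fun k hk => ?_))⟩
      simpa using (not_le.1 hk).le
    refine h1.congr' ?_
    filter_upwards [hne] with k hk
    rw [dslope_of_ne _ hk, slope_def_field, hG0, sub_zero, sub_zero, div_eq_inv_mul, hG]
    beta_reduce
    split_ifs
    · rfl
    · rw [inv_mul_cancel_left₀ hk]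
  have hGz : ∀ k, G k = 0 := fun k => by
    have h1 := ((differentiableOn_univ.1 ((Complex.differentiableOn_dslope univ_mem).2
      hGd.differentiableOn))).apply_eq_of_tendsto_cocompact k hlim
    have h2 := sub_smul_dslope G 0 k
    rw [h1, smul_zero, hG0, sub_zero] at h2
    exact h2.symm
  have hz : ∀ k : ℝ, k ≠ 0 → lap m (-(k : ℂ)) = 0 := fun k hk => by
    have h1 := hGz k
    rw [hG] at h1
    simp only [Complex.ofReal_im, le_refl, if_true] at h1
    rw [heq] at h1
    exact (mul_eq_zero.1 h1).resolve_left (Complex.ofReal_ne_zero.2 hk)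
  have hmi : Integrable (indicator (Ioi 0) m) := (integrable_indicator_iff measurableSet_Ioi).2 hm
  have h0 := ae_eq_zero_of_ft_eq_zero hmi (congrFun (Continuous.ext_on
    (dense_compl_singleton (0 : ℝ)) (continuous_ft hmi) continuous_const fun k hk => by
      rw [← lap_ofReal]
      have := hz (-k) (neg_ne_zero.2 hk)
      rwa [Complex.ofReal_neg, neg_neg] at this))
  refine (ae_restrict_iff' measurableSet_Ioi).2 ?_
  filter_upwards [h0] with y hy hy0
  rwa [indicator_of_mem hy0] at hy

variable {q : ℝ → ℝ} (hq : IsL11 q)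
include hq

theorem deriv_jostFun_ne_zero {κ : ℝ} (hκ : 0 < κ) (h0 : jostFun q (Complex.I * κ) = 0) :
    deriv (jostFun q) (Complex.I * κ) ≠ 0 := by
  obtain ⟨v0, hv0, hv⟩ := exists_deriv_ne_zero hq hκ h0
  rw [(hasDerivAt_jostFun hq hκ h0 hv0 hv).deriv]
  have hi : 0 < (Complex.I * (κ : ℂ)).im := by simpa using hκ
  refine div_ne_zero (mul_ne_zero (neg_ne_zero.2 (mul_ne_zero (mul_ne_zero two_ne_zero
    Complex.I_ne_zero) (Complex.ofReal_ne_zero.2 hκ.ne'))) (Complex.ofReal_ne_zero.2 ?_)) hv0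
  exact (integral_norm_sq_jost_pos hq hi).ne'

theorem eq_I_mul_of_jostFun_eq_zero {k : ℂ} (hk : 0 < k.im) (h0 : jostFun q k = 0) :
    k = Complex.I * (k.im : ℂ) :=
  Complex.ext (by simpa using re_eq_zero_of_jostFun_eq_zero hq hk h0) (by simp)

theorem tendsto_jostFun_upper : Tendsto (jostFun q) upper (𝓝 1) := by
  have h := (tendsto_lap (integrableOn_kern_complex hq)).const_add 1
  rw [add_zero] at h
  exact h.congr fun k => (jostFun_eq q k).symm

open Classical in
/-- `k N(k) / f(k)`, when the zeros of `f` are cancelled by those of `N`. -/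
theorem exists_quotient {N : ℂ → ℂ} (hc : ContinuousOn N {k | 0 ≤ k.im})
    (hd : ∀ k : ℂ, 0 < k.im → DifferentiableAt ℂ N k) (hN : Tendsto N upper (𝓝 0))
    (h0 : jostFun q 0 = 0 → N 0 = 0)
    (hz : ∀ κ : ℝ, 0 < κ → jostFun q (Complex.I * κ) = 0 → N (Complex.I * κ) = 0) :
    ∃ H : ℂ → ℂ, ContinuousOn H {k | 0 ≤ k.im} ∧ (∀ k : ℂ, 0 < k.im → DifferentiableAt ℂ H k) ∧
      Tendsto (fun k => k⁻¹ * H k) upper (𝓝 0) ∧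
      ∀ k : ℝ, H k * jostFun q k = k * N k ∧ (k = 0 → H k = 0) := by
  -- At a zero of f, which is simple and shared by N, the quotient takes the value N'/f'. Nearby it
  -- is the ratio of the slopes of N and f, so it is holomorphic.
  set g : ℂ → ℂ := fun k =>
    if jostFun q k = 0 then deriv N k / deriv (jostFun q) k else N k / jostFun q k with hg
  have hgne : ∀ k, jostFun q k ≠ 0 → g k = N k / jostFun q k := fun k hk => if_neg hk
  have hgd : ∀ k : ℂ, 0 < k.im → DifferentiableAt ℂ g k := fun k hk => by
    by_cases hf : jostFun q k = 0
    · have hU : {w : ℂ | 0 < w.im} ∈ 𝓝 k :=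
        (isOpen_lt continuous_const Complex.continuous_im).mem_nhds hk
      have hds : ∀ F : ℂ → ℂ, (∀ w : ℂ, 0 < w.im → DifferentiableAt ℂ F w) →
          DifferentiableAt ℂ (dslope F k) k := fun F hF =>
        ((Complex.differentiableOn_dslope hU).2 fun w hw =>
          (hF w hw).differentiableWithinAt).differentiableAt hU
      have hfd := hds _ fun w hw => differentiableAt_jostFun hq hw
      have hkI := eq_I_mul_of_jostFun_eq_zero hq hk hf
      have hf' : dslope (jostFun q) k k ≠ 0 := by
        rw [dslope_same, hkI]
        exact deriv_jostFun_ne_zero hq hk (hkI ▸ hf)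
      have hNk : N k = 0 := by
        rw [hkI]; exact hz _ hk (hkI ▸ hf)
      refine ((hds N hd).div hfd hf').congr_of_eventuallyEq ?_
      filter_upwards [hfd.continuousAt.eventually_ne hf'] with w hw
      rcases eq_or_ne w k with rfl | hwk
      · rw [hg, Pi.div_apply, dslope_same, dslope_same]; exact if_pos hf
      · rw [dslope_of_ne _ hwk, slope_def_field, hf, sub_zero] at hw
        rw [Pi.div_apply, dslope_of_ne _ hwk, dslope_of_ne _ hwk, slope_def_field, slope_def_field,
          hf, hNk, sub_zero, sub_zero, hgne w fun h => hw (by rw [h, zero_div]),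
          div_div_div_cancel_right₀ (sub_ne_zero.2 hwk)]
    · refine ((hd k hk).div (differentiableAt_jostFun hq hk) hf).congr_of_eventuallyEq ?_
      filter_upwards [(differentiableAt_jostFun hq hk).continuousAt.eventually_ne hf] with w hw
      exact hgne w hw
  refine ⟨fun k => k * g k, fun k hk => ?_, fun k hk => differentiableAt_id.mul (hgd k hk), ?_,
    fun k => ⟨?_, fun hk => by simp [hk]⟩⟩
  · have him : 0 ≤ k.im := hk
    rcases him.lt_or_eq with hk' | hk'
    · exact (differentiableAt_id.mul (hgd k hk')).continuousAt.continuousWithinAt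
    · by_cases hf : jostFun q k = 0
      · have hk0 : k = 0 := by
          by_contra h
          have h1 : k = (k.re : ℂ) := Complex.ext rfl hk'.symm
          exact jostFun_ne_zero hq (k := k.re) (fun h2 => h (by rw [h1, h2, Complex.ofReal_zero]))
            (h1 ▸ hf)
        subst hk0
        -- Here the factor k is needed: in the exceptional case k N/f = N/(i K^) extends
        -- continuously to 0, with value 0 because N(0) = 0.
        have ht : tail (kern q 0) 0 = -1 := by
          rw [jostFun_zero, Complex.ofReal_eq_zero] at hf
          linarith
        have hKc : IntegrableOn (fun y => (tail (kern q 0) y : ℂ)) (Ioi 0) :=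
          (exceptional hq ht).1.ofReal
        have h1 := ((hc 0 hk).div (continuousWithinAt_const.mul (continuousOn_lap hKc 0 hk))
          (mul_ne_zero Complex.I_ne_zero (lap_tail_kern_zero_ne_zero hq ht)))
        obtain ⟨r, hr, hr'⟩ := exists_ne_zero_near_zero hq
        refine h1.congr_of_eventuallyEq ?_ (by simp [h0 hf])
        filter_upwards [self_mem_nhdsWithin, mem_nhdsWithin_of_mem_nhds (Metric.ball_mem_nhds 0 hr)]
          with w hw hwr
        rcases eq_or_ne w 0 with rfl | hw0
        · simp [h0 hf]
        · rw [hgne w (hr' w hw hw0 (by simpa using hwr)), jostFun_eq_mul_lap hq ht hw,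
            mul_comm Complex.I w, mul_assoc, ← mul_div_assoc, mul_div_mul_left _ _ hw0]
          rfl
      · have h1 := continuousWithinAt_id.mul ((hc k hk).div (continuousOn_jostFun hq k hk) hf)
        refine h1.congr_of_eventuallyEq ?_ (by rw [hgne k hf]; rfl)
        filter_upwards [(continuousOn_jostFun hq k hk).eventually_ne hf] with w hw
        rw [hgne w hw]; rfl
  · have h1 := hN.div (tendsto_jostFun_upper hq) one_ne_zero
    rw [zero_div] at h1
    have hne : ∀ᶠ k in upper, k ≠ (0 : ℂ) := by
      refine Eventually.filter_mono inf_le_left ?_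
      filter_upwards [(tendsto_norm_cocompact_atTop (E := ℂ)).eventually_gt_atTop 0] with k hk
      exact norm_pos_iff.1 hk
    refine h1.congr' ?_
    filter_upwards [hne, (tendsto_jostFun_upper hq).eventually_ne one_ne_zero] with k hk hf
    rw [inv_mul_cancel_left₀ hk, hgne k hf]
    rfl
  · beta_reduce
    rcases eq_or_ne k 0 with rfl | hk
    · simp
    · have := jostFun_ne_zero hq hk
      rw [hgne _ this, mul_assoc, div_mul_cancel₀ _ this]

end HalfLine
-- The difference of F_s and the Marchenko function is a sum of exponentials
namespace HalfLine

theorem integrableOn_exp_neg_mul {κ : ℝ} (hκ : 0 < κ) :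
    IntegrableOn (fun y : ℝ => Complex.exp (-(κ * y : ℂ))) (Ioi 0) := by
  have h := integrableOn_exp_mul_complex_Ioi (a := -(κ : ℂ)) (by simpa using hκ) 0
  simpa only [neg_mul] using h

theorem lap_exp_neg_mul {κ : ℝ} (hκ : 0 < κ) {k : ℂ} (hk : 0 ≤ k.im) :
    lap (fun y : ℝ => Complex.exp (-(κ * y : ℂ))) k = ((κ : ℂ) - Complex.I * k)⁻¹ := by
  have h := integral_exp_mul_complex_Ioi (a := Complex.I * k - κ) (by simp; linarith) 0
  rw [Complex.ofReal_zero, mul_zero, Complex.exp_zero, neg_div, ← div_neg, neg_sub, one_div] at h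
  rw [← h]
  refine integral_congr_ae (ae_of_all _ fun y => ?_)
  beta_reduce
  rw [← Complex.exp_add]
  congr 1
  ring

variable {q : ℝ → ℝ} (hq : IsL11 q)
include hq

/-- A solution of the homogeneous correlation equation, multiplied by `f`. -/
theorem exists_lap_mul_jostFun {D : ℝ → ℝ} (hD : IntegrableOn D (Ioi 0))
    (H : ∀ᵐ y ∂(volume.restrict (Ioi (0 : ℝ))),
      D y + ∫ s in Ioi (0 : ℝ), kern q 0 s * D (s + y) = 0) :
    ∃ e : ℝ → ℂ, IntegrableOn e (Ioi 0) ∧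
      ∀ k : ℝ, lap (fun y => (D y : ℂ)) (-(k : ℂ)) * jostFun q k = lap e k := by
  set Dp : ℝ → ℝ := indicator (Ioi 0) D with hDp
  have hDpi : Integrable Dp := (integrable_indicator_iff measurableSet_Ioi).2 hD
  obtain ⟨hci, hcf⟩ := ft_correlation (integrableOn_kern hq le_rfl).1 hDpi
  set c : ℝ → ℝ := fun y => ∫ s in Ioi (0 : ℝ), kern q 0 s * Dp (s + y) with hc
  have hcC : Integrable fun y => (c y : ℂ) := hci.ofReal
  have hDC : Integrable fun y => (Dp y : ℂ) := hDpi.ofReal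
  have hlapD : ∀ k : ℝ, ft (fun y => (Dp y : ℂ)) k = lap (fun y => (D y : ℂ)) k := fun k => by
    rw [lap_ofReal]
    congr 1
    funext y
    rw [hDp]
    by_cases hy : y ∈ Ioi (0 : ℝ)
    · rw [indicator_of_mem hy, indicator_of_mem hy]
    · rw [indicator_of_notMem hy, indicator_of_notMem hy, Complex.ofReal_zero]
  -- With D extended by zero, the sum of D and its correlation is defined on the whole line and
  -- vanishes for y > 0. So its transform at -k is the half-line transform, at k, of its reflection,
  -- where only the correlation contributes.
  have hE : ∀ᵐ y : ℝ, 0 < y → (Dp y : ℂ) + c y = 0 := by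
    filter_upwards [(ae_restrict_iff' measurableSet_Ioi).1 H] with y hy hy0
    have h1 : Dp y = D y := indicator_of_mem (show y ∈ Ioi (0 : ℝ) from hy0) D
    have h2 : c y = ∫ s in Ioi (0 : ℝ), kern q 0 s * D (s + y) :=
      setIntegral_congr_fun measurableSet_Ioi fun s hs => by
        rw [mem_Ioi] at hs
        simp only [hDp, indicator_of_mem (show s + y ∈ Ioi (0 : ℝ) from add_pos hs hy0)]
    rw [h1, h2, ← Complex.ofReal_add, hy hy0, Complex.ofReal_zero]
  refine ⟨fun z => (c (-z) : ℂ), hcC.comp_neg.integrableOn, fun k => ?_⟩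
  have h1 : ft (fun y => (Dp y : ℂ) + c y) (-k) = lap (fun z => (c (-z) : ℂ)) k := by
    rw [lap_ofReal, ← ft_comp_neg]
    refine integral_congr_ae ?_
    filter_upwards [(Measure.measurePreserving_neg (volume : Measure ℝ)).quasiMeasurePreserving.ae
      hE, compl_mem_ae_iff.2 (measure_singleton (0 : ℝ))] with z hz hz0
    rcases lt_or_gt_of_ne hz0 with h | h
    · rw [hz (neg_pos.2 h), indicator_of_notMem (by simpa using h.le)]
    · rw [indicator_of_mem (show z ∈ Ioi (0 : ℝ) from h), hDp,
        indicator_of_notMem (by simpa using h.le), Complex.ofReal_zero, zero_add]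
  rw [← h1, ft_add hDC hcC, hcf, hlapD, jostFun_eq, Complex.ofReal_neg, neg_neg]
  ring

/-- The transform of D at -k equals e^(k)/f(k), which continues to the upper half-plane with at most
simple poles, located at the zeros of f. Exponentials with matching poles are subtracted, and
`ae_eq_zero_of_continuation` annihilates the rest. -/
theorem exists_sum_of_homogeneous {D : ℝ → ℝ} (hD : IntegrableOn D (Ioi 0))
    (H : ∀ᵐ y ∂(volume.restrict (Ioi (0 : ℝ))),
      D y + ∫ s in Ioi (0 : ℝ), kern q 0 s * D (s + y) = 0) :
    ∃ d : ℝ → ℂ, ∀ᵐ y ∂(volume.restrict (Ioi (0 : ℝ))),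
      (D y : ℂ) = ∑ κ ∈ (finite_zeros hq).toFinset, d κ * Complex.exp (-(κ * y : ℂ)) := by
  obtain ⟨e, he, hek⟩ := exists_lap_mul_jostFun hq hD H
  set Z := (finite_zeros hq).toFinset with hZ
  have hZ0 : ∀ κ ∈ Z, 0 < κ := fun κ h => ((finite_zeros hq).mem_toFinset.1 h).1
  have hZf : ∀ κ ∈ Z, jostFun q (Complex.I * κ) = 0 := fun κ h =>
    ((finite_zeros hq).mem_toFinset.1 h).2
  -- At -k the transform of e^{-κy} is 1/(κ + ik) = -i/(k - iκ). Equating -i d_κ with the residue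
  -- e^(iκ)/f'(iκ) gives this coefficient.
  set d : ℝ → ℂ := fun κ =>
    Complex.I * lap e (Complex.I * κ) / deriv (jostFun q) (Complex.I * κ) with hd
  -- The numerator over the common denominator f. As f(iκ) = 0, the quotient f(k)/(k - iκ) is the
  -- slope of f, holomorphic in the upper half-plane.
  set N : ℂ → ℂ := fun k => lap e k -
    ∑ κ ∈ Z, d κ * (-Complex.I * dslope (jostFun q) (Complex.I * κ) k) with hN
  have him : ∀ κ : ℝ, 0 < κ → 0 < (Complex.I * (κ : ℂ)).im := fun κ hκ => by simpa using hκ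
  have hU : ∀ k : ℂ, 0 < k.im → {w : ℂ | 0 < w.im} ∈ 𝓝 k := fun k hk =>
    (isOpen_lt continuous_const Complex.continuous_im).mem_nhds hk
  have hU' : ∀ k : ℂ, 0 < k.im → {w : ℂ | 0 ≤ w.im} ∈ 𝓝 k := fun k hk =>
    mem_of_superset (hU k hk) fun w (hw : 0 < w.im) => hw.le
  have hsl : ∀ κ ∈ Z, ∀ k : ℂ, k ≠ Complex.I * κ →
      dslope (jostFun q) (Complex.I * κ) k = (k - Complex.I * κ)⁻¹ * jostFun q k :=
    fun κ hκ k hk => by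
      rw [dslope_of_ne _ hk, slope_def_field, hZf κ hκ, sub_zero, div_eq_inv_mul]
  have hne0 : ∀ κ ∈ Z, ∀ k : ℝ, (k : ℂ) ≠ Complex.I * κ := fun κ hκ k h => by
    have := congrArg Complex.im h
    simp at this
    exact (hZ0 κ hκ).ne this
  refine Exists.elim (exists_quotient hq (N := N) ?_ ?_ ?_ ?_ ?_) fun G ⟨hGc, hGd, hGt, hG⟩ => ?_
  · refine (continuousOn_lap he).sub (continuousOn_finsetSum _ fun κ hκ => ?_)
    exact continuousOn_const.mul (continuousOn_const.mul
      ((continuousOn_dslope (hU' _ (him κ (hZ0 κ hκ)))).2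
        ⟨continuousOn_jostFun hq, differentiableAt_jostFun hq (him κ (hZ0 κ hκ))⟩))
  · intro k hk
    refine (differentiableAt_lap he hk).sub (DifferentiableAt.fun_sum fun κ hκ => ?_)
    exact (((((Complex.differentiableOn_dslope (hU _ (him κ (hZ0 κ hκ)))).2 fun w hw =>
      (differentiableAt_jostFun hq hw).differentiableWithinAt).differentiableAt
        (hU k hk)).const_mul _).const_mul _)
  · have h1 : ∀ κ ∈ Z, Tendsto (fun k => d κ * (-Complex.I *
        dslope (jostFun q) (Complex.I * κ) k)) upper (𝓝 0) := fun κ hκ => by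
      have hcc : Tendsto (fun k : ℂ => k - Complex.I * κ) upper (cocompact ℂ) :=
        ((Homeomorph.subRight (Complex.I * (κ : ℂ))).isClosedEmbedding.tendsto_cocompact).mono_left
          inf_le_left
      have h2 : Tendsto (fun k : ℂ => (k - Complex.I * κ)⁻¹ * jostFun q k) upper (𝓝 0) := by
        rw [← Metric.cobounded_eq_cocompact] at hcc
        have := (tendsto_inv₀_cobounded.comp hcc).mul (tendsto_jostFun_upper hq)
        rwa [zero_mul] at this
      have hne : ∀ᶠ k in upper, k ≠ Complex.I * κ := by
        filter_upwards [hcc.eventually ((tendsto_norm_cocompact_atTop (E := ℂ)).eventually_gt_atTop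
          0)] with k hk
        exact sub_ne_zero.1 (norm_pos_iff.1 hk)
      have h3 := h2.congr' (f₂ := dslope (jostFun q) (Complex.I * κ)) (by
        filter_upwards [hne] with k hk
        exact (hsl κ hκ k hk).symm)
      simpa using (h3.const_mul (-Complex.I)).const_mul (d κ)
    have h4 := (tendsto_lap he).sub (tendsto_finsetSum _ h1)
    rwa [Finset.sum_const_zero, sub_zero] at h4
  · intro h0
    have h1 := hek 0
    rw [Complex.ofReal_zero, h0, mul_zero] at h1
    rw [hN]
    beta_reduce
    rw [← h1, zero_sub, neg_eq_zero]
    refine Finset.sum_eq_zero fun κ hκ => ?_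
    have := hne0 κ hκ 0
    rw [Complex.ofReal_zero] at this
    rw [hsl κ hκ 0 this, h0, mul_zero, mul_zero, mul_zero]
  · intro κ hκ h0
    have hκZ : κ ∈ Z := (finite_zeros hq).mem_toFinset.2 ⟨hκ, h0⟩
    rw [hN]
    beta_reduce
    rw [Finset.sum_eq_single_of_mem κ hκZ, dslope_same, hd]
    · have := deriv_jostFun_ne_zero hq hκ h0
      field_simp
      linear_combination lap e (Complex.I * κ) * Complex.I_sq
    · intro b hb hbκ
      rw [hsl b hb _ fun h => hbκ (Complex.ofReal_injective
        (mul_left_cancel₀ Complex.I_ne_zero h)).symm, h0, mul_zero, mul_zero, mul_zero]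
  · refine ⟨d, ?_⟩
    have hDC : IntegrableOn (fun y => (D y : ℂ)) (Ioi 0) := hD.ofReal
    have hexp : ∀ κ ∈ Z, IntegrableOn (fun y : ℝ => d κ * Complex.exp (-(κ * y : ℂ))) (Ioi 0) :=
      fun κ hκ => (integrableOn_exp_neg_mul (hZ0 κ hκ)).const_mul _
    have hm : IntegrableOn (fun y : ℝ => (D y : ℂ) - ∑ κ ∈ Z, d κ * Complex.exp (-(κ * y : ℂ)))
        (Ioi 0) := hDC.sub (integrable_finsetSum _ hexp)
    have h0 := ae_eq_zero_of_continuation hm hGc hGd hGt fun k => ?_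
    · filter_upwards [h0] with y hy
      exact sub_eq_zero.1 hy
    rcases eq_or_ne k 0 with rfl | hk
    · rw [(hG 0).2 rfl, Complex.ofReal_zero, zero_mul]
    have hf := jostFun_ne_zero hq hk
    refine mul_right_cancel₀ hf ((hG k).1.trans ?_)
    rw [mul_assoc]
    congr 1
    have hki : 0 ≤ (-(k : ℂ)).im := by simp
    have h1 : lap (fun y : ℝ => (D y : ℂ) - ∑ κ ∈ Z, d κ * Complex.exp (-(κ * y : ℂ))) (-(k : ℂ))
        = lap (fun y => (D y : ℂ)) (-(k : ℂ)) - ∑ κ ∈ Z, d κ * ((κ : ℂ) - Complex.I * -k)⁻¹ := by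
      have h2 : ∀ κ ∈ Z, Integrable (fun y : ℝ => d κ * (Complex.exp (-(κ * y : ℂ)) *
          Complex.exp (Complex.I * -(k : ℂ) * y))) (volume.restrict (Ioi 0)) := fun κ hκ =>
        (integrableOn_mul_cexp (integrableOn_exp_neg_mul (hZ0 κ hκ)) hki).const_mul _
      rw [lap, lap]
      simp_rw [sub_mul, Finset.sum_mul, mul_assoc (d _)]
      rw [integral_sub (integrableOn_mul_cexp hDC hki) (integrable_finsetSum _ h2),
        integral_finsetSum _ h2]
      congr 1
      refine Finset.sum_congr rfl fun κ hκ => ?_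
      rw [integral_const_mul, ← lap_exp_neg_mul (hZ0 κ hκ) hki, lap]
    rw [h1, sub_mul, hek, Finset.sum_mul, hN]
    beta_reduce
    congr 1
    refine Finset.sum_congr rfl fun κ hκ => ?_
    rw [hsl κ hκ k (hne0 κ hκ k), mul_assoc (d κ), ← mul_assoc (-Complex.I)]
    congr 2
    rw [← Complex.inv_I, ← mul_inv]
    congr 1
    linear_combination -(κ : ℂ) * Complex.I_sq

end HalfLine
-- The coefficients of the exponentials
namespace HalfLine

/-- `∫_0^∞ |f(x, iκ)|² dx`. -/
noncomputable def normSq (q : ℝ → ℝ) (κ : ℝ) : ℝ :=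
  ∫ x in Ioi (0 : ℝ), ‖kernelJost (kern q) x (Complex.I * κ)‖ ^ 2

variable {q : ℝ → ℝ} (hq : IsL11 q)
include hq

theorem normSq_pos {κ : ℝ} (hκ : 0 < κ) : 0 < normSq q κ :=
  integral_norm_sq_jost_pos hq (by simpa using hκ)

/-- `overlap` is the transpose of I + A applied to f(·, iκ), so its integral against F(· + y) is
that of f(x, iκ) against `transm (marF q) x y`. For x < y the latter is -A(x, y) and cancels the
second term of `overlap`. -/
theorem overlap_add_integral {κ : ℝ} (hκ : 0 < κ) {y : ℝ} (hy : 0 < y) :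
    overlap q κ y + ∫ s in Ioi (0 : ℝ), overlap q κ s * marF q (s + y)
      = decaying q κ y + ∫ x in Ioi y, decaying q κ x * transm q (marF q) x y := by
  set f := decaying q κ with hf
  have hfi : IntegrableOn f (Ioi 0) := integrableOn_decaying hq hκ
  set m : ℝ → ℝ := fun s => marF q (s + y) with hm
  have hmm : StronglyMeasurable m :=
    (stronglyMeasurable_marF hq).comp_measurable (measurable_id.add_const y)
  have hmb : ∀ s : ℝ, 0 < s → ‖m s‖ ≤ marConst q * sig q (y / 2) := fun s hs =>
    abs_marF_le_of_le hq hy (by linarith)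
  have hp := integrable_kern_mul hq hfi
  have hpm : Integrable (fun p : ℝ × ℝ => kern q p.1 p.2 * f p.1 * m p.2)
      ((volume.restrict (Ioi 0)).prod (volume.restrict (Ioi 0))) := by
    refine Integrable.mul_bdd (c := marConst q * sig q (y / 2)) hp
      (hmm.comp_measurable measurable_snd).aestronglyMeasurable ?_
    rw [Measure.prod_restrict]
    exact (ae_restrict_iff' (measurableSet_Ioi.prod measurableSet_Ioi)).2
      (ae_of_all _ fun p hp => hmb p.2 hp.2)
  have hmul : ∀ g : ℝ → ℝ, IntegrableOn g (Ioi 0) → IntegrableOn (fun s => g s * m s) (Ioi 0) :=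
    fun g hg => Integrable.mul_bdd (c := marConst q * sig q (y / 2)) hg hmm.aestronglyMeasurable
      ((ae_restrict_iff' measurableSet_Ioi).2 (ae_of_all _ hmb))
  have hin : ∀ x : ℝ, 0 < x → ∫ s in Ioi (0 : ℝ), kern q x s * f x * m s
      = f x * transm q (marF q) x y - f x * m x := fun x hx => by
    have h1 : ∫ s in Ioi (0 : ℝ), kern q x s * f x * m s
        = ∫ s in Ioi x, kern q x s * f x * m s := by
      refine setIntegral_eq_of_subset_of_ae_sdiff_eq_zero measurableSet_Ioi.nullMeasurableSet
        (Ioi_subset_Ioi hx.le) ?_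
      filter_upwards [compl_mem_ae_iff.2 (measure_singleton x)] with s hs hs'
      rw [kern_eq_zero_of_lt hq ((not_lt.1 hs'.2).lt_of_ne hs), zero_mul, zero_mul]
    rw [h1, transm, mul_add, add_sub_cancel_left, ← integral_const_mul]
    refine integral_congr_ae (ae_of_all _ fun s => ?_)
    simp only [smul_eq_mul, hm]
    ring
  have hfm := hmul f hfi
  have hft : IntegrableOn (fun x => f x * transm q (marF q) x y) (Ioi 0) := by
    refine ((hpm.integral_prod_left.add hfm).congr ?_)
    refine (ae_restrict_iff' measurableSet_Ioi).2 (ae_of_all _ fun x hx => ?_)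
    rw [Pi.add_apply, hin x hx, sub_add_cancel]
  have hk : IntegrableOn (fun x => kern q x y * f x) (Ioi 0) :=
    Integrable.bdd_mul (c := kernConst q * sig q (y / 2)) hfi
      ((measurable_kern hq).comp (measurable_id.prodMk measurable_const)).aestronglyMeasurable
      (ae_of_all _ fun x => abs_kern_le_of_le hq hy le_rfl)
  have h2 : ∫ s in Ioi (0 : ℝ), overlap q κ s * m s
      = ∫ x in Ioi (0 : ℝ), f x * transm q (marF q) x y := by
    have h3 : ∀ s, overlap q κ s * m s
        = f s * m s + ∫ x in Ioi (0 : ℝ), kern q x s * f x * m s := fun s => by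
      rw [overlap, add_mul, integral_mul_const]
    simp_rw [h3]
    rw [integral_add hfm hpm.integral_prod_right,
      ← integral_integral_swap (f := fun x s : ℝ => kern q x s * f x * m s) hpm,
      setIntegral_congr_fun measurableSet_Ioi hin, integral_sub hft hfm]
    ring
  rw [h2, overlap, add_assoc, ← integral_add hk hft, add_right_inj]
  rw [setIntegral_eq_of_subset_of_forall_sdiff_eq_zero measurableSet_Ioi (Ioi_subset_Ioi hy.le)]
  · refine setIntegral_congr_fun measurableSet_Ioi fun x hx => ?_
    rw [kern_eq_zero_of_lt hq hx, zero_mul, zero_add]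
  · intro x hx
    rw [transm_marF hq ⟨le_of_lt hx.1, not_lt.1 hx.2, hy⟩]
    ring

/-- The integral is negligible: f(x, iκ) is O(e^{-κx}) and `transm` is bounded by a constant times
`sig q (y / 2)`, which tends to 0. -/
theorem tendsto_exp_mul_decaying {κ : ℝ} (hκ : 0 < κ) :
    Tendsto (fun y => Real.exp (κ * y) * (decaying q κ y +
      ∫ x in Ioi y, decaying q κ x * transm q (marF q) x y)) atTop (𝓝 1) := by
  have h1 : Tendsto (fun y => Real.exp (κ * y) * decaying q κ y) atTop (𝓝 1) := by
    have h := (Complex.continuous_re.tendsto _).comp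
      (tendsto_reduced hq (k := Complex.I * κ) (by simpa using hκ.le))
    rw [Complex.one_re] at h
    refine h.congr fun y => ?_
    have h2 : -(Complex.I * (Complex.I * κ) * y) = ((κ * y : ℝ) : ℂ) := by
      push_cast
      linear_combination -(κ : ℂ) * y * Complex.I_sq
    rw [Function.comp_apply, reduced, kernelJost_I_mul, h2, ← Complex.ofReal_exp,
      ← Complex.ofReal_mul, Complex.ofReal_re]
  have h2 : Tendsto (fun y => Real.exp (κ * y) *
      ∫ x in Ioi y, decaying q κ x * transm q (marF q) x y) atTop (𝓝 0) := by
    have hs : Tendsto (fun y : ℝ => (1 + mass q) * (marConst q * sig q (y / 2) * (1 + mass q)) / κ)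
        atTop (𝓝 0) := by
      have h3 : Tendsto (sig q) atTop (𝓝 0) := tendsto_tail (integrableOn_q hq one_pos).abs
      have h4 := h3.comp (tendsto_id.atTop_div_const (two_pos (α := ℝ)))
      simpa using ((((h4.const_mul (marConst q)).mul_const (1 + mass q)).const_mul
        (1 + mass q)).div_const κ)
    refine squeeze_zero_norm' ?_ hs
    filter_upwards [eventually_gt_atTop 0] with y hy
    have hneg : -κ < 0 := neg_neg_of_pos hκ
    have h5 : ‖∫ x in Ioi y, decaying q κ x * transm q (marF q) x y‖
        ≤ ∫ x in Ioi y, (1 + mass q) * (marConst q * sig q (y / 2) * (1 + mass q)) *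
          Real.exp (-κ * x) := by
      refine norm_integral_le_of_norm_le ((integrableOn_exp_mul_Ioi hneg y).const_mul _)
        ((ae_restrict_iff' measurableSet_Ioi).2 (ae_of_all _ fun x hx => ?_))
      have hx0 : 0 < x := hy.trans hx
      rw [norm_mul, Real.norm_eq_abs, Real.norm_eq_abs, neg_mul]
      refine (mul_le_mul (abs_decaying_le hq hκ hx0.le) (abs_transm_marF_le hq hx0.le hy
        (le_add_of_nonneg_left hx0.le)) (abs_nonneg _) ?_).trans_eq (by ring)
      exact mul_nonneg (by linarith [mass_nonneg (q := q)]) (Real.exp_nonneg _)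
    rw [integral_const_mul, integral_exp_mul_Ioi hneg, neg_div_neg_eq] at h5
    rw [norm_mul, Real.norm_of_nonneg (Real.exp_nonneg _)]
    refine (mul_le_mul_of_nonneg_left h5 (Real.exp_nonneg _)).trans_eq ?_
    rw [neg_mul, Real.exp_neg]
    have := (Real.exp_pos (κ * y)).ne'
    field_simp
  have := h1.add h2
  rw [add_zero] at this
  exact this.congr fun y => (mul_add _ _ _).symm

/-- For c = 1 and l = A(0, ·), `IsScattering.convolution_eq` is Marchenko's equation at x = 0 for Φ.
`marF` satisfies the same equation, and the difference is homogeneous. -/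
theorem IsScattering.homogeneous {Φ : ℝ → ℝ} (hΦ : IsScattering q Φ) :
    ∀ᵐ y ∂(volume.restrict (Ioi (0 : ℝ))), (Φ y - marF q y) +
      ∫ s in Ioi (0 : ℝ), kern q 0 s * (Φ (s + y) - marF q (s + y)) = 0 := by
  have hk := (integrableOn_kern hq le_rfl).1
  have h0 := hΦ.convolution_eq (c := 1) hk fun k hk => by
    have := hΦ.eq k hk
    rw [jostFun_eq, jostFun_eq] at this
    rwa [Complex.ofReal_one]
  filter_upwards [h0,
    (integrable_correlation_Ioi (c := 0) hk hΦ.integrable.integrableOn (by simp)).prod_right_ae,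
    (integrable_correlation_Ioi (c := 0) hk (integrableOn_marF hq) (by simp)).prod_right_ae,
    ae_restrict_mem measurableSet_Ioi] with y h1 h2 h3 hy
  have h4 := transm_marF hq (x := 0) (y := y) ⟨le_rfl, le_of_lt hy, hy⟩
  rw [transm, zero_add] at h4
  simp only [smul_eq_mul] at h4
  simp_rw [mul_sub]
  rw [integral_sub h2 h3]
  linarith

/-- Orthogonality of eigenfunctions to different eigenvalues. -/
theorem lap_overlap_of_ne {κ κ' : ℝ} (hκ : 0 < κ) (hκ' : 0 < κ') (hne : κ' ≠ κ)
    (h0 : jostFun q (Complex.I * κ) = 0) (h0' : jostFun q (Complex.I * κ') = 0) :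
    lap (fun y => (overlap q κ y : ℂ)) (Complex.I * κ') = 0 := by
  obtain ⟨v0, -, hv⟩ := exists_deriv_ne_zero hq hκ h0
  have h1 := mul_jostFun_eq_overlap hq hκ h0 hv (k := Complex.I * κ') (by simpa using hκ'.le)
  rw [h0', mul_zero] at h1
  refine (mul_eq_zero.1 h1.symm).resolve_left (neg_ne_zero.2 ?_)
  rw [mul_pow, Complex.I_sq]
  have h2 : κ ^ 2 - κ' ^ 2 ≠ 0 := by
    rw [sq_sub_sq]
    exact mul_ne_zero (by positivity) (sub_ne_zero.2 hne.symm)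
  have h3 : (-1 * (κ' : ℂ) ^ 2 + (κ : ℂ) ^ 2) = ((κ ^ 2 - κ' ^ 2 : ℝ) : ℂ) := by push_cast; ring
  rw [h3]
  exact Complex.ofReal_ne_zero.2 h2

/-- The transform of `overlap` is f up to a factor even in k, so its values at -k and k also have
the ratio S(k). This is the case c = 0 of `IsScattering.convolution_eq`. -/
theorem IsScattering.overlap_eq {Φ : ℝ → ℝ} (hΦ : IsScattering q Φ) {κ : ℝ} (hκ : 0 < κ)
    (h0 : jostFun q (Complex.I * κ) = 0) :
    ∀ᵐ y ∂(volume.restrict (Ioi (0 : ℝ))),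
      overlap q κ y + ∫ s in Ioi (0 : ℝ), overlap q κ s * Φ (s + y) = 0 := by
  obtain ⟨v0, hv0, hv⟩ := exists_deriv_ne_zero hq hκ h0
  have h1 := hΦ.convolution_eq (c := 0) (integrableOn_overlap hq hκ) fun k hk => by
    have h2 := mul_jostFun_eq_overlap hq hκ h0 hv (k := k) (by simp)
    have h3 := mul_jostFun_eq_overlap hq hκ h0 hv (k := -(k : ℂ)) (by simp)
    have h4 : (k : ℂ) ^ 2 + (κ : ℂ) ^ 2 ≠ 0 := by
      have : k ^ 2 + κ ^ 2 ≠ 0 := by positivity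
      exact_mod_cast this
    rw [neg_sq, hΦ.eq k hk] at h3
    rw [Complex.ofReal_zero, zero_add, zero_add]
    refine mul_left_cancel₀ (neg_ne_zero.2 h4) ?_
    linear_combination (1 - ft (fun x : ℝ => (Φ x : ℂ)) (-k)) * h2 - h3
  filter_upwards [h1] with y hy
  simpa using hy

/-- Pairing Φ - `marF` with `overlap` isolates one exponential by orthogonality and gives d_κ
e^{-κy} times the norming integral. The pairing can also be computed from the equations for Φ and
for `marF` separately: it is minus a quantity asymptotic to e^{-κy}. -/
theorem IsScattering.coeff_eq {Φ : ℝ → ℝ} (hΦ : IsScattering q Φ) {d : ℝ → ℂ}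
    (hd : ∀ᵐ y ∂(volume.restrict (Ioi (0 : ℝ))), ((Φ y - marF q y : ℝ) : ℂ)
      = ∑ κ ∈ (finite_zeros hq).toFinset, d κ * Complex.exp (-(κ * y : ℂ)))
    {κ : ℝ} (hκ : 0 < κ) (h0 : jostFun q (Complex.I * κ) = 0) : d κ * normSq q κ = -1 := by
  set Z := (finite_zeros hq).toFinset with hZ
  have hZ' : ∀ κ' ∈ Z, 0 < κ' ∧ jostFun q (Complex.I * κ') = 0 := fun κ' h =>
    (finite_zeros hq).mem_toFinset.1 h
  have hκZ : κ ∈ Z := (finite_zeros hq).mem_toFinset.2 ⟨hκ, h0⟩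
  have hθ := integrableOn_overlap hq hκ
  have hθC : IntegrableOn (fun y => (overlap q κ y : ℂ)) (Ioi 0) := hθ.ofReal
  have hG : ∀ᵐ y ∂(volume.restrict (Ioi (0 : ℝ))), ((Real.exp (κ * y) * (decaying q κ y +
      ∫ x in Ioi y, decaying q κ x * transm q (marF q) x y) : ℝ) : ℂ) = -(d κ * normSq q κ) := by
    filter_upwards [hΦ.overlap_eq hq hκ h0,
      (integrable_correlation_Ioi (c := 0) hθ hΦ.integrable.integrableOn (by simp)).prod_right_ae,
      (integrable_correlation_Ioi (c := 0) hθ (integrableOn_marF hq) (by simp)).prod_right_ae,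
      ae_restrict_mem measurableSet_Ioi] with y h1 h2 h3 hy
    rw [mem_Ioi] at hy
    have hdy : ∀ᵐ s ∂(volume.restrict (Ioi (0 : ℝ))), ((Φ (s + y) - marF q (s + y) : ℝ) : ℂ)
        = ∑ κ ∈ Z, d κ * Complex.exp (-(κ * (s + y : ℝ) : ℂ)) := by
      refine (ae_restrict_iff' measurableSet_Ioi).2 ?_
      filter_upwards [(measurePreserving_add_right volume y).quasiMeasurePreserving.ae
        ((ae_restrict_iff' measurableSet_Ioi).1 hd)] with s hs hs0
      exact hs (add_pos (mem_Ioi.1 hs0) hy)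
    have h4 : ∫ s in Ioi (0 : ℝ), ((overlap q κ s * (Φ (s + y) - marF q (s + y)) : ℝ) : ℂ)
        = d κ * Complex.exp (-(κ * y : ℂ)) * normSq q κ := by
      have h5 : ∀ κ' ∈ Z, Integrable (fun s : ℝ => d κ' * Complex.exp (-(κ' * y : ℂ)) *
          ((overlap q κ s : ℂ) * Complex.exp (Complex.I * (Complex.I * κ') * s)))
          (volume.restrict (Ioi 0)) := fun κ' hκ' =>
        (integrableOn_mul_cexp hθC (by simpa using (hZ' κ' hκ').1.le)).const_mul _
      have h6 : ∫ s in Ioi (0 : ℝ), ((overlap q κ s * (Φ (s + y) - marF q (s + y)) : ℝ) : ℂ)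
          = ∫ s in Ioi (0 : ℝ), ∑ κ' ∈ Z, d κ' * Complex.exp (-(κ' * y : ℂ)) *
          ((overlap q κ s : ℂ) * Complex.exp (Complex.I * (Complex.I * κ') * s)) := by
        refine integral_congr_ae ?_
        filter_upwards [hdy] with s hs
        rw [Complex.ofReal_mul, hs, Finset.mul_sum]
        refine Finset.sum_congr rfl fun κ' _ => ?_
        have : Complex.exp (-(κ' * (s + y : ℝ) : ℂ)) = Complex.exp (-(κ' * y : ℂ)) *
            Complex.exp (Complex.I * (Complex.I * κ') * s) := by
          rw [← Complex.exp_add]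
          congr 1
          push_cast
          linear_combination -(κ' : ℂ) * s * Complex.I_sq
        rw [this]
        ring
      rw [h6, integral_finsetSum _ h5]
      simp_rw [integral_const_mul]
      rw [Finset.sum_eq_single_of_mem κ hκZ fun κ' hκ' hne => ?_]
      · congr 1
        exact lap_overlap_self hq hκ
      · rw [← lap, lap_overlap_of_ne hq hκ (hZ' κ' hκ').1 hne h0 (hZ' κ' hκ').2, mul_zero]
    have h7 : ∫ s in Ioi (0 : ℝ), ((overlap q κ s * (Φ (s + y) - marF q (s + y)) : ℝ) : ℂ)
        = (((∫ s in Ioi (0 : ℝ), overlap q κ s * Φ (s + y)) -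
          ∫ s in Ioi (0 : ℝ), overlap q κ s * marF q (s + y) : ℝ) : ℂ) := by
      rw [← integral_sub h2 h3]
      simp_rw [← mul_sub]
      exact integral_ofReal (𝕜 := ℂ)
    have h8 := overlap_add_integral hq hκ hy
    rw [← h8]
    have h9 : overlap q κ y + ∫ s in Ioi (0 : ℝ), overlap q κ s * marF q (s + y)
        = -((∫ s in Ioi (0 : ℝ), overlap q κ s * Φ (s + y)) -
          ∫ s in Ioi (0 : ℝ), overlap q κ s * marF q (s + y)) := by linarith
    have h10 : Complex.exp (κ * y : ℂ) * Complex.exp (-(κ * y : ℂ)) = 1 := by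
      rw [← Complex.exp_add, add_neg_cancel, Complex.exp_zero]
    rw [h9, Complex.ofReal_mul, Complex.ofReal_neg, Complex.ofReal_exp, Complex.ofReal_mul]
    rw [← h7, h4]
    linear_combination -(d κ * normSq q κ) * h10
  have hlim := (Complex.continuous_ofReal.tendsto _).comp (tendsto_exp_mul_decaying hq hκ)
  rw [Complex.ofReal_one] at hlim
  -- The identity for a constant holds almost everywhere, the limit along all y; the two meet at
  -- some point of a far half-line, which has positive measure.
  by_contra hne
  have hne' : (1 : ℂ) ≠ -(d κ * normSq q κ) := fun h => hne (by rw [h, neg_neg])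
  obtain ⟨R, hR⟩ := eventually_atTop.1 (hlim.eventually_ne hne')
  have h1 := ae_restrict_of_ae_restrict_of_subset (Ioi_subset_Ioi (le_max_right R 0)) hG
  have hnb : (ae (volume.restrict (Ioi (max R 0)))).NeBot := by
    rw [ae_neBot, Ne, Measure.restrict_eq_zero, Real.volume_Ioi]
    simp
  obtain ⟨y, hy, hyR⟩ := (h1.and (ae_restrict_mem measurableSet_Ioi)).exists
  exact hR y ((le_max_left _ _).trans (le_of_lt hyR)) hy

/-- On the half-line the scattering and bound state parts add up to the kernel determined by the
transformation operator. -/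
theorem IsScattering.add_sum_eq {Φ : ℝ → ℝ} (hΦ : IsScattering q Φ) {y : ℝ} (hy : 0 < y) :
    Φ y + ∑ κ ∈ (finite_zeros hq).toFinset, (normSq q κ)⁻¹ * Real.exp (-(κ * y)) = marF q y := by
  obtain ⟨d, hd⟩ := exists_sum_of_homogeneous hq
    (D := fun y => Φ y - marF q y) (hΦ.integrable.integrableOn.sub (integrableOn_marF hq))
    (hΦ.homogeneous hq)
  have hae : (fun y => Φ y + ∑ κ ∈ (finite_zeros hq).toFinset,
      (normSq q κ)⁻¹ * Real.exp (-(κ * y))) =ᵐ[volume.restrict (Ioi 0)] marF q := by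
    filter_upwards [hd] with y hy
    have h1 : ((Φ y - marF q y : ℝ) : ℂ) = ((-∑ κ ∈ (finite_zeros hq).toFinset,
        (normSq q κ)⁻¹ * Real.exp (-(κ * y)) : ℝ) : ℂ) := by
      rw [hy, ← Finset.sum_neg_distrib, Complex.ofReal_sum]
      refine Finset.sum_congr rfl fun κ hκ => ?_
      have h2 := (finite_zeros hq).mem_toFinset.1 hκ
      have h3 := hΦ.coeff_eq hq hd h2.1 h2.2
      have h4 : (normSq q κ : ℂ) ≠ 0 := Complex.ofReal_ne_zero.2 (normSq_pos hq h2.1).ne'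
      have h5 : d κ = -(normSq q κ : ℂ)⁻¹ := by
        rw [← neg_one_mul, ← h3, mul_inv_cancel_right₀ h4]
      rw [h5]
      push_cast
      ring
    linarith [Complex.ofReal_injective h1]
  have hcont : ContinuousOn (fun y => Φ y + ∑ κ ∈ (finite_zeros hq).toFinset,
      (normSq q κ)⁻¹ * Real.exp (-(κ * y))) (Ioi 0) :=
    (hΦ.continuousOn.mono fun x hx => ne_of_gt hx).add (by fun_prop)
  exact Measure.eqOn_open_of_ae_eq hae isOpen_Ioi hcont (continuousOn_marF hq) hy

end HalfLine
-- Scattering data: existence, uniqueness, reconstruction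
namespace HalfLine

theorem _root_.IsDataOf.congr {f g : ℝ → ℂ → ℂ} {D : ScatteringData} (hD : IsDataOf f D)
    (h : ∀ (k : ℂ) (x : ℝ), 0 ≤ k.im → 0 ≤ x → f x k = g x k) : IsDataOf g D := by
  have h1 : ∀ k : ℝ, f 0 (-(k : ℂ)) / f 0 k = g 0 (-(k : ℂ)) / g 0 k := fun k => by
    rw [h _ 0 (by simp) le_rfl, h _ 0 (by simp) le_rfl]
  refine ⟨fun k hk => (hD.S_eq k hk).trans (h1 k), hD.S_zero.congr h1, hD.k_pos, hD.k_strictMono,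
    ?_, hD.s_pos, fun j => (hD.s_eq j).trans ?_⟩
  · rw [← hD.zeros_eq]
    ext z
    exact and_congr_right fun hz => by rw [h z 0 (le_of_lt hz) le_rfl]
  · congr 1
    refine setIntegral_congr_fun measurableSet_Ioi fun x hx => ?_
    rw [h _ x (by simpa using (hD.k_pos j).le) (le_of_lt hx)]

theorem _root_.IsDataOf.range_eq {f : ℝ → ℂ → ℂ} {D : ScatteringData} (hD : IsDataOf f D) :
    range D.k = {κ : ℝ | 0 < κ ∧ f 0 (Complex.I * κ) = 0} := by
  ext κ
  have h1 : (0 < (Complex.I * (κ : ℂ)).im ∧ f 0 (Complex.I * κ) = 0) ↔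
      Complex.I * (κ : ℂ) ∈ range fun j => Complex.I * (D.k j : ℂ) := by
    rw [← hD.zeros_eq]; rfl
  have h2 : (0 < κ ∧ f 0 (Complex.I * κ) = 0) ↔
      (0 < (Complex.I * (κ : ℂ)).im ∧ f 0 (Complex.I * κ) = 0) := by simp
  refine Iff.trans ?_ (h2.trans h1).symm
  refine exists_congr fun j => ⟨fun h => by beta_reduce; rw [h], fun h => ?_⟩
  exact Complex.ofReal_injective (mul_left_cancel₀ Complex.I_ne_zero h)

theorem _root_.IsDataOf.unique {f : ℝ → ℂ → ℂ} {D D' : ScatteringData} (hD : IsDataOf f D)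
    (hD' : IsDataOf f D') : D = D' := by
  have hr := hD.range_eq.trans hD'.range_eq.symm
  have hJ : D.J = D'.J := by
    have h1 := Nat.card_range_of_injective hD.k_strictMono.injective
    have h2 := Nat.card_range_of_injective hD'.k_strictMono.injective
    rw [hr, h2] at h1
    simpa using h1.symm
  have hS : D.S = D'.S := funext fun k => by
    rcases eq_or_ne k 0 with rfl | hk
    · exact tendsto_nhds_unique hD.S_zero hD'.S_zero
    · rw [hD.S_eq k hk, hD'.S_eq k hk]
  obtain ⟨S, J, k, s⟩ := D
  obtain ⟨S', J', k', s'⟩ := D'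
  simp only at hJ hS hr
  subst hJ hS
  have hk : k = k' := (hD.k_strictMono.range_inj hD'.k_strictMono).1 hr
  subst hk
  have hs : s = s' := funext fun j => (hD.s_eq j).trans (hD'.s_eq j).symm
  rw [hs]

variable {q : ℝ → ℝ} (hq : IsL11 q)

include hq in
theorem IsScattering.div_eq {Φ : ℝ → ℝ} (hΦ : IsScattering q Φ) {k : ℝ} (hk : k ≠ 0) :
    kernelJost (kern q) 0 (-(k : ℂ)) / kernelJost (kern q) 0 k
      = 1 - ft (fun x : ℝ => (Φ x : ℂ)) (-k) :=
  (div_eq_iff (jostFun_ne_zero hq hk)).2 (hΦ.eq k hk)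

theorem IsScattering.continuous_symbol {Φ : ℝ → ℝ} (hΦ : IsScattering q Φ) :
    Continuous fun k : ℝ => 1 - ft (fun x : ℝ => (Φ x : ℂ)) (-k) := by
  have hi : Integrable fun x : ℝ => (Φ x : ℂ) := hΦ.integrable.ofReal
  exact continuous_const.sub ((continuous_ft hi).comp continuous_neg)

include hq in
theorem IsScattering.tendsto_div {Φ : ℝ → ℝ} (hΦ : IsScattering q Φ) :
    Tendsto (fun k : ℝ => kernelJost (kern q) 0 (-(k : ℂ)) / kernelJost (kern q) 0 k) (𝓝[≠] 0)
      (𝓝 (1 - ft (fun x : ℝ => (Φ x : ℂ)) (-0))) := by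
  refine ((hΦ.continuous_symbol.tendsto 0).mono_left nhdsWithin_le_nhds).congr' ?_
  filter_upwards [self_mem_nhdsWithin] with k hk using (hΦ.div_eq hq hk).symm

include hq

theorem exists_isDataOf : ∃ D, IsDataOf (kernelJost (kern q)) D := by
  obtain ⟨Φ, hΦ⟩ := exists_isScattering hq
  set Z := (finite_zeros hq).toFinset with hZ
  set e := Z.orderEmbOfFin rfl with he
  have hmem : ∀ j, 0 < e j ∧ jostFun q (Complex.I * e j) = 0 := fun j =>
    (finite_zeros hq).mem_toFinset.1 (Z.orderEmbOfFin_mem rfl j)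
  refine ⟨⟨fun k => 1 - ft (fun x : ℝ => (Φ x : ℂ)) (-k), Z.card, e, fun j => (normSq q (e j))⁻¹⟩,
    fun k hk => (hΦ.div_eq hq hk).symm, hΦ.tendsto_div hq, fun j => (hmem j).1, e.strictMono,
    ?_, fun j => inv_pos.2 (normSq_pos hq (hmem j).1), fun j => rfl⟩
  ext z
  constructor
  · rintro ⟨hz, hz0⟩
    have h1 := eq_I_mul_of_jostFun_eq_zero hq hz hz0
    have h2 : z.im ∈ range e := by
      rw [he, Finset.range_orderEmbOfFin]
      exact (finite_zeros hq).mem_toFinset.2 ⟨hz, h1 ▸ hz0⟩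
    obtain ⟨j, hj⟩ := h2
    refine ⟨j, Eq.trans ?_ h1.symm⟩
    rw [← hj]
  · rintro ⟨j, rfl⟩
    exact ⟨by simpa using (hmem j).1, (hmem j).2⟩

section data
variable {D : ScatteringData} (hD : IsDataOf (kernelJost (kern q)) D) {Φ : ℝ → ℝ}
  (hΦ : IsScattering q Φ)
include hD hΦ

theorem _root_.IsDataOf.S_eq_sub (k : ℝ) : D.S k = 1 - ft (fun x : ℝ => (Φ x : ℂ)) (-k) := by
  rcases eq_or_ne k 0 with rfl | hk
  · exact tendsto_nhds_unique hD.S_zero (hΦ.tendsto_div hq)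
  · rw [hD.S_eq k hk, hΦ.div_eq hq hk]

theorem _root_.IsDataOf.tendsto_truncatedFs {x : ℝ} (hx : x ≠ 0) :
    Tendsto (D.truncatedFs x) atTop (𝓝 (Φ x : ℂ)) := by
  refine (hΦ.tendsto x hx).congr fun R => ?_
  rw [ScatteringData.truncatedFs]
  simp_rw [hD.S_eq_sub hq hΦ, sub_sub_cancel]

theorem _root_.IsDataOf.Fs_eq {x : ℝ} (hx : x ≠ 0) : D.Fs x = Φ x := by
  rw [ScatteringData.Fs, (hD.tendsto_truncatedFs hq hΦ hx).limUnder_eq, Complex.ofReal_re]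

omit hΦ in
theorem _root_.IsDataOf.Fd_eq (x : ℝ) : D.Fd x
    = ∑ κ ∈ (finite_zeros hq).toFinset, (normSq q κ)⁻¹ * Real.exp (-(κ * x)) := by
  have h1 : (finite_zeros hq).toFinset = Finset.univ.image D.k := by
    ext κ
    rw [(finite_zeros hq).mem_toFinset, ← Finset.mem_coe, Finset.coe_image, Finset.coe_univ,
      image_univ, hD.range_eq]
    rfl
  rw [h1, Finset.sum_image hD.k_strictMono.injective.injOn]
  exact Finset.sum_congr rfl fun j _ => by rw [hD.s_eq]; rfl

-- The link between the two halves of the proof: everything shown for `marF` through the Volterra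
-- equations now holds for the F of the scattering data.
omit hΦ in
theorem _root_.IsDataOf.F_eq_marF {x : ℝ} (hx : 0 < x) : D.F x = marF q x := by
  obtain ⟨Φ, hΦ⟩ := exists_isScattering hq
  rw [ScatteringData.F, hD.Fs_eq hq hΦ hx.ne', hD.Fd_eq hq, hΦ.add_sum_eq hq hx]

theorem _root_.IsDataOf.F_sub_ae : (fun x => D.F x - D.Fd x) =ᵐ[volume] Φ := by
  filter_upwards [compl_mem_ae_iff.2 (measure_singleton (0 : ℝ))] with x hx
  rw [ScatteringData.F, add_sub_cancel_right, hD.Fs_eq hq hΦ hx]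

theorem _root_.IsDataOf.tendsto_Fs : Tendsto D.Fs atBot (𝓝 0) := by
  refine hΦ.tendsto_atBot.congr' ?_
  filter_upwards [eventually_lt_atBot 0] with x hx
  rw [hD.Fs_eq hq hΦ hx.ne]

theorem _root_.IsDataOf.one_sub_S_eq (k : ℝ) : 1 - D.S k =
    ∫ x : ℝ, ((D.F x - D.Fd x : ℝ) : ℂ) * Complex.exp (-(Complex.I * (k : ℂ) * (x : ℂ))) := by
  rw [hD.S_eq_sub hq hΦ, sub_sub_cancel, ft]
  refine integral_congr_ae ?_
  filter_upwards [hD.F_sub_ae hq hΦ] with x hx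
  rw [hx, mul_comm]
  congr 2
  push_cast
  ring

end data

omit hq in
/-- The leading term of a sum of exponentials at `-∞`. -/
theorem _root_.ScatteringData.tendsto_remainder {D : ScatteringData} (hk : StrictMono D.k)
    (hk0 : ∀ j, 0 < D.k j) (hF : Tendsto D.Fs atBot (𝓝 0)) (m : Fin D.J) :
    Tendsto (fun x : ℝ => D.remainder m x * Real.exp (D.k m * x)) atBot (𝓝 (D.s m)) := by
  have hexp : ∀ κ : ℝ, 0 < κ → Tendsto (fun x : ℝ => Real.exp (κ * x)) atBot (𝓝 0) := fun κ hκ =>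
    Real.tendsto_exp_atBot.comp (tendsto_id.const_mul_atBot hκ)
  have hsum : ∀ x, D.remainder m x * Real.exp (D.k m * x) = D.Fs x * Real.exp (D.k m * x) +
      ∑ j ∈ Finset.Iic m, D.s j * Real.exp ((D.k m - D.k j) * x) := fun x => by
    have h1 : D.Fd x = ∑ j ∈ Finset.Iic m, D.s j * Real.exp (-(D.k j * x)) +
        ∑ j ∈ Finset.Ioi m, D.s j * Real.exp (-(D.k j * x)) := by
      have hd : Disjoint (Finset.Iic m) (Finset.Ioi m) := Finset.disjoint_left.2 fun j h h' =>
        not_lt.2 (Finset.mem_Iic.1 h) (Finset.mem_Ioi.1 h')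
      rw [← Finset.sum_union hd, ScatteringData.Fd]
      refine Finset.sum_congr ?_ fun _ _ => rfl
      ext j
      simp [le_or_gt]
    rw [ScatteringData.remainder, ScatteringData.F, h1, ← add_assoc, add_sub_cancel_right, add_mul,
      Finset.sum_mul]
    congr 1
    refine Finset.sum_congr rfl fun j _ => ?_
    rw [mul_assoc, ← Real.exp_add]
    congr 2
    ring
  have h2 : ∀ j ∈ Finset.Iic m, Tendsto (fun x : ℝ => D.s j * Real.exp ((D.k m - D.k j) * x)) atBot
      (𝓝 (if j = m then D.s m else 0)) := fun j hj => by
    split_ifs with h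
    · simp [h]
    · have h3 := hexp _ (sub_pos.2 (hk ((Finset.mem_Iic.1 hj).lt_of_ne h)))
      simpa using h3.const_mul (D.s j)
  have h4 := (hF.mul (hexp _ (hk0 m))).add (tendsto_finsetSum _ h2)
  rw [Finset.sum_ite_eq' (Finset.Iic m) m, if_pos (Finset.mem_Iic.2 le_rfl), zero_mul,
    zero_add] at h4
  exact h4.congr fun x => (hsum x).symm

-- The logarithm of R(x) e^{κx} converges because s > 0, so it is negligible after division by -x.
omit hq in
theorem tendsto_log_div {R : ℝ → ℝ} {κ s : ℝ} (hs : 0 < s)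
    (h : Tendsto (fun x => R x * Real.exp (κ * x)) atBot (𝓝 s)) :
    Tendsto (fun x => Real.log (R x) / (-x)) atBot (𝓝 κ) := by
  have h1 := (((Real.continuousAt_log hs.ne').tendsto.comp h).div_atTop
    tendsto_neg_atBot_atTop).add_const κ
  rw [zero_add] at h1
  refine h1.congr' ?_
  filter_upwards [h.eventually_ne hs.ne', eventually_lt_atBot 0] with x hx hx0
  have h2 : R x ≠ 0 := left_ne_zero_of_mul hx
  rw [Function.comp_apply, Real.log_mul h2 (Real.exp_ne_zero _), Real.log_exp]
  have := hx0.ne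
  field_simp
  ring

omit hq in
/-- Kernels that agree almost everywhere on every section agree. -/
theorem eq_of_ae_eq_section {A A' : ℝ → ℝ → ℝ} (h0 : ∀ x y : ℝ, (x, y) ∉ kernelDomain → A x y = 0)
    (h0' : ∀ x y : ℝ, (x, y) ∉ kernelDomain → A' x y = 0)
    (hc : ContinuousOn (Function.uncurry A) kernelDomain)
    (hc' : ContinuousOn (Function.uncurry A') kernelDomain)
    (h : ∀ x : ℝ, 0 ≤ x → A x =ᵐ[volume.restrict (Ioi x)] A' x) : A = A' := by
  funext x y
  by_cases hxy : (x, y) ∈ kernelDomain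
  · have hsec : ∀ B : ℝ → ℝ → ℝ, ContinuousOn (Function.uncurry B) kernelDomain →
        ContinuousOn (B x) {y | (x, y) ∈ kernelDomain} := fun B hB =>
      ContinuousOn.comp (g := Function.uncurry B) (f := fun y : ℝ => (x, y)) hB (by fun_prop)
        fun y hy => hy
    have hsub : Ioi x ⊆ {y | (x, y) ∈ kernelDomain} := fun y hy =>
      ⟨hxy.1, le_of_lt hy, lt_of_le_of_lt hxy.1 hy⟩
    have h1 : EqOn (A x) (A' x) (Ioi x) := Measure.eqOn_open_of_ae_eq (h x hxy.1) isOpen_Ioi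
      ((hsec A hc).mono hsub) ((hsec A' hc').mono hsub)
    -- The a.e. equality only sees y > x; continuity extends it to the diagonal.
    refine h1.of_subset_closure (hsec A hc) (hsec A' hc') hsub ?_ hxy
    rw [closure_Ioi]
    exact fun y hy => hy.2.1
  · rw [h0 x y hxy, h0' x y hxy]

theorem isTransformationKernel_unique {A : ℝ → ℝ → ℝ} (hA : IsTransformationKernel q A) :
    A = kern q := by
  have hK := isTransformationKernel_kern hq
  refine eq_of_ae_eq_section hA.eq_zero hK.eq_zero hA.continuousOn hK.continuousOn fun x hx => ?_
  have hi : IntegrableOn (fun y => A x y - kern q x y) (Ioi x) :=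
    (hA.integrableOn x hx).sub (hK.integrableOn x hx)
  have hiC : IntegrableOn (fun y => ((A x y - kern q x y : ℝ) : ℂ)) (Ioi x) := hi.ofReal
  have hcoe : ∀ {B : ℝ → ℝ → ℝ}, IntegrableOn (B x) (Ioi x) → ∀ k : ℝ, IntegrableOn
      (fun y => (B x y : ℂ) * Complex.exp (Complex.I * k * y)) (Ioi x) := fun {B} hB k => by
    have hBC : IntegrableOn (fun y => (B x y : ℂ)) (Ioi x) := hB.ofReal
    refine Integrable.mul_bdd (c := 1) hBC
      (continuous_cexp_I_mul _).aestronglyMeasurable (ae_of_all _ fun y => ?_)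
    rw [norm_cexp_I_mul]; simp
  have h0 := ae_eq_zero_of_ft_eq_zero ((integrable_indicator_iff measurableSet_Ioi).2 hiC)
    fun k => by
      have h1 := (hA.jost_eq x k hx (by simp)).symm.trans (hK.jost_eq x k hx (by simp))
      rw [kernelJost, kernelJost, add_right_inj, ← sub_eq_zero,
        ← integral_sub (hcoe (hA.integrableOn x hx) k) (hcoe (hK.integrableOn x hx) k)] at h1
      rw [ft, ← h1, ← integral_indicator measurableSet_Ioi]
      congr 1
      funext y
      by_cases hy : y ∈ Ioi x
      · rw [indicator_of_mem hy, indicator_of_mem hy]; push_cast; ring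
      · rw [indicator_of_notMem hy, indicator_of_notMem hy, mul_zero]
  refine (ae_restrict_iff' measurableSet_Ioi).2 ?_
  filter_upwards [h0] with y hy hyx
  rw [indicator_of_mem hyx] at hy
  exact sub_eq_zero.1 (Complex.ofReal_injective (hy.trans Complex.ofReal_zero.symm))

omit hq in
theorem marchenko_congr {F G a : ℝ → ℝ} (h : ∀ z, 0 < z → F z = G z) {x y : ℝ} (hx : 0 ≤ x)
    (hy : 0 < y) : marchenko F x a y = marchenko G x a y := by
  rw [marchenko, marchenko, h _ (by linarith)]
  congr 1
  refine setIntegral_congr_fun measurableSet_Ioi fun s hs => ?_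
  rw [h _ (by linarith [mem_Ioi.1 hs])]

theorem marchenko_kern {x y : ℝ} (h : (x, y) ∈ kernelDomain) :
    marchenko (marF q) x (kern q x) y = 0 := by
  have h1 := transm_marF hq h
  rw [transm] at h1
  simp only [smul_eq_mul] at h1
  rw [marchenko]
  linarith

theorem marchenko_unique {x : ℝ} {a : ℝ → ℝ} (hx : 0 ≤ x) (ha : IntegrableOn a (Ioi x))
    (h : ∀ᵐ y ∂(volume.restrict (Ioi x)), marchenko (marF q) x a y = 0) :
    a =ᵐ[volume.restrict (Ioi x)] kern q x := by
  have hk := (integrableOn_kern hq hx).1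
  have h0 := marchenko_homogeneous hq hx (h := fun y => a y - kern q x y) (ha.sub hk) (by
    filter_upwards [h, ae_restrict_mem measurableSet_Ioi] with y hy hyx
    have hy0 : 0 < y := lt_of_le_of_lt hx hyx
    have h2 := marchenko_kern hq (x := x) (y := y) ⟨hx, le_of_lt hyx, hy0⟩
    rw [marchenko] at hy h2
    simp_rw [sub_mul]
    rw [integral_sub (integrableOn_mul_marF hq hx ha hy0) (integrableOn_mul_marF hq hx hk hy0)]
    linarith)
  filter_upwards [h0] with y hy
  exact sub_eq_zero.1 hy

/-- Lebesgue differentiation of A(x, x) = (1/2) ∫_x^∞ q. As q need not be integrable at 0, it is cut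
off at 1/(n + 1), and countably many null sets are collected. -/
theorem hasDerivAt_kern_diag :
    ∀ᵐ x ∂(volume.restrict (Ioi (0 : ℝ))), HasDerivAt (fun t : ℝ => kern q t t) (-(q x) / 2) x := by
  have hpos : ∀ n : ℕ, (0 : ℝ) < 1 / (n + 1) := fun n => by positivity
  have hint : ∀ n : ℕ, Integrable (indicator (Ioi (1 / (n + 1) : ℝ)) q) := fun n =>
    (integrable_indicator_iff measurableSet_Ioi).2 (integrableOn_q hq (hpos n))
  have hae := ae_all_iff.2 fun n => LocallyIntegrable.ae_hasDerivAt_integral (hint n).locallyIntegrable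
  refine (ae_restrict_iff' measurableSet_Ioi).2 ?_
  filter_upwards [hae] with x hx hx0
  obtain ⟨n, hn⟩ := exists_nat_one_div_lt (mem_Ioi.1 hx0)
  have h1 := (((hx n 0).const_sub (∫ t in Ioi (0 : ℝ),
    indicator (Ioi (1 / (n + 1) : ℝ)) q t)).const_mul (1 / 2))
  rw [indicator_of_mem (show x ∈ Ioi (1 / (n + 1) : ℝ) from hn)] at h1
  refine (h1.congr_of_eventuallyEq ?_).congr_deriv (by ring)
  filter_upwards [isOpen_Ioi.mem_nhds (show x ∈ Ioi (1 / (n + 1) : ℝ) from hn)] with t ht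
  have ht0 : 0 < t := (hpos n).trans ht
  have h2 : ∫ s in Ioi t, q s = ∫ s in Ioi t, indicator (Ioi (1 / (n + 1) : ℝ)) q s :=
    setIntegral_congr_fun measurableSet_Ioi fun s hs =>
      (indicator_of_mem (Ioi_subset_Ioi (le_of_lt ht) hs) q).symm
  rw [kern_diag hq ht0, h2, tail_eq_sub (hint n).integrableOn ht0.le]

omit hq in
theorem _root_.IsJostSolution.congr {q' : ℝ → ℝ} (h : q =ᵐ[volume.restrict (Ioi 0)] q') {k : ℂ} {u : ℝ → ℂ}
    (hu : IsJostSolution q k u) : IsJostSolution q' k u := by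
  obtain ⟨v, hv, hvi⟩ := hu.equation
  refine ⟨hu.continuousOn, ⟨v, hv, fun a b ha hab => (hvi a b ha hab).trans ?_⟩, hu.asymptotics⟩
  refine intervalIntegral.integral_congr_ae ?_
  filter_upwards [(ae_restrict_iff' measurableSet_Ioi).1 h] with t ht htm
  rw [uIoc_of_le hab] at htm
  rw [ht (ha.trans htm.1)]

-- Only integrals of q enter the definition of a Jost solution, so potentials equal a.e. define the
-- same predicate and the choice operator returns the same function.
omit hq in
theorem jost_congr {q' : ℝ → ℝ} (h : q =ᵐ[volume.restrict (Ioi 0)] q') : jost q = jost q' := by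
  have h1 : ∀ k, IsJostSolution q k = IsJostSolution q' k := fun k =>
    funext fun u => propext ⟨fun hu => hu.congr h, fun hu => hu.congr h.symm⟩
  funext x k
  rw [jost, jost, h1]

theorem isDataOf_jost_iff {D : ScatteringData} :
    IsDataOf (jost q) D ↔ IsDataOf (kernelJost (kern q)) D :=
  ⟨fun h => h.congr fun _ _ hk hx => jost_eq_kernelJost hq hk hx,
    fun h => h.congr fun _ _ hk hx => (jost_eq_kernelJost hq hk hx).symm⟩

/-- The two F agree everywhere on (0, ∞) by continuity, so the kernel of q solves the Marchenko
equation of q', whose integrable solution is unique. -/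
theorem kern_eq_of_F_ae_eq {q' : ℝ → ℝ} (hq' : IsL11 q') {D D' : ScatteringData}
    (hD : IsDataOf (kernelJost (kern q)) D) (hD' : IsDataOf (kernelJost (kern q')) D')
    (h : D.F =ᵐ[volume] D'.F) : kern q = kern q' := by
  have h1 : marF q =ᵐ[volume.restrict (Ioi 0)] marF q' := by
    filter_upwards [ae_restrict_of_ae h, ae_restrict_mem measurableSet_Ioi] with z hz hz0
    rw [← hD.F_eq_marF hq hz0, ← hD'.F_eq_marF hq' hz0, hz]
  have h2 : EqOn (marF q) (marF q') (Ioi 0) :=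
    Measure.eqOn_open_of_ae_eq h1 isOpen_Ioi (continuousOn_marF hq) (continuousOn_marF hq')
  have hK := isTransformationKernel_kern hq
  have hK' := isTransformationKernel_kern hq'
  refine eq_of_ae_eq_section hK.eq_zero hK'.eq_zero hK.continuousOn hK'.continuousOn fun x hx =>
    marchenko_unique hq' hx (hK.integrableOn x hx) ?_
  refine (ae_restrict_iff' measurableSet_Ioi).2 (ae_of_all _ fun y hy => ?_)
  have hy0 : 0 < y := lt_of_le_of_lt hx hy
  rw [← marchenko_congr (fun z hz => h2 hz) hx hy0, marchenko_kern hq ⟨hx, le_of_lt hy, hy0⟩]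

theorem ae_eq_of_kern_eq {q' : ℝ → ℝ} (hq' : IsL11 q') (h : kern q = kern q') :
    q =ᵐ[volume.restrict (Ioi 0)] q' := by
  filter_upwards [hasDerivAt_kern_diag hq, hasDerivAt_kern_diag hq'] with x h1 h2
  rw [← h] at h2
  linarith [h1.unique h2]

end HalfLine

/-! ### The theorem -/

open HalfLine

theorem theorem1p1 (q : ℝ → ℝ) (hq : IsL11 q) :
    -- the objects attached to `q`: Jost solutions, scattering data, transformation kernel
    (∀ k : ℂ, 0 ≤ k.im → IsJostSolution q k (fun x => jost q x k) ∧
      ∀ u : ℝ → ℂ, IsJostSolution q k u → EqOn u (fun x => jost q x k) (Ici 0)) ∧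
    (∃! D : ScatteringData, IsDataOf (jost q) D) ∧
    (∃! A : ℝ → ℝ → ℝ, IsTransformationKernel q A) ∧
    ∀ (D : ScatteringData) (A : ℝ → ℝ → ℝ),
      IsDataOf (jost q) D → IsTransformationKernel q A →
      -- step 1: the improper integral that defines `F` converges
      (∀ x : ℝ, x ≠ 0 → Tendsto (D.truncatedFs x) atTop (𝓝 ((D.Fs x : ℝ) : ℂ))) ∧
      -- step 1 reversed: asymptotics of `F` at `-∞`, then a Fourier transform
      (∀ m : Fin D.J,
        Tendsto (fun x : ℝ => Real.log (D.remainder m x) / (-x)) atBot (𝓝 (D.k m)) ∧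
        Tendsto (fun x : ℝ => D.remainder m x * Real.exp (D.k m * x)) atBot (𝓝 (D.s m))) ∧
      Tendsto (fun x : ℝ => D.F x - D.Fd x) atBot (𝓝 0) ∧
      Integrable (fun x : ℝ => D.F x - D.Fd x) ∧
      (∀ k : ℝ, 1 - D.S k =
        ∫ x : ℝ, ((D.F x - D.Fd x : ℝ) : ℂ) * Complex.exp (-(Complex.I * (k : ℂ) * (x : ℂ)))) ∧
      -- step 2: `A(x, ·)` is the unique integrable solution of Marchenko's equation
      (∀ x y : ℝ, (x, y) ∈ kernelDomain → marchenko D.F x (A x) y = 0) ∧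
      (∀ (x : ℝ) (a : ℝ → ℝ), 0 ≤ x → IntegrableOn a (Ioi x) →
        (∀ᵐ y ∂(volume.restrict (Ioi x)), marchenko D.F x a y = 0) →
        a =ᵐ[volume.restrict (Ioi x)] A x) ∧
      -- step 2 reversed: `F` is the unique integrable solution of the same equation, given `A`
      IntegrableOn D.F (Ioi 0) ∧
      (∀ G : ℝ → ℝ, IntegrableOn G (Ioi 0) →
        (∀ x : ℝ, 0 ≤ x → ∀ᵐ y ∂(volume.restrict (Ioi x)), marchenko G x (A x) y = 0) →
        G =ᵐ[volume.restrict (Ioi 0)] D.F) ∧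
      -- step 2 reversed, second way: all data (hence `F` on the whole line) from `f` built from `A`
      (∀ D' : ScatteringData, IsDataOf (kernelJost A) D' ↔ D' = D) ∧
      -- step 3: `q = -2 dA(x, x)/dx`
      (∀ᵐ x ∂(volume.restrict (Ioi (0 : ℝ))), HasDerivAt (fun t : ℝ => A t t) (-(q x) / 2) x) ∧
      -- step 3 reversed: `A` is the unique solution of the Volterra-type equation, given `q`,
      -- and the limit of the successive approximations
      volterraStep q A = A ∧
      (∀ δ : ℝ, 0 < δ → ∃ C : ℝ, ∀ x y : ℝ, δ ≤ y → |A x y| ≤ C) ∧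
      (∀ B : ℝ → ℝ → ℝ, Measurable (Function.uncurry B) →
        (∀ δ : ℝ, 0 < δ → ∃ C : ℝ, ∀ x y : ℝ, δ ≤ y → |B x y| ≤ C) →
        volterraStep q B = B → B = A) ∧
      (∀ δ : ℝ, 0 < δ → TendstoUniformlyOn
        (fun (n : ℕ) (p : ℝ × ℝ) => ((volterraStep q)^[n] (fun _ _ => 0)) p.1 p.2)
        (Function.uncurry A) atTop {p : ℝ × ℝ | δ ≤ p.2}) ∧
      -- each of the four objects determines the three others
      (∀ (q' : ℝ → ℝ) (D' : ScatteringData) (A' : ℝ → ℝ → ℝ), IsL11 q' →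
        IsDataOf (jost q') D' → IsTransformationKernel q' A' →
        List.TFAE [D = D', D.F =ᵐ[volume] D'.F, A = A', q =ᵐ[volume.restrict (Ioi 0)] q']) := by
  have hK := isTransformationKernel_kern hq
  obtain ⟨D₀, hD₀⟩ := exists_isDataOf hq
  obtain ⟨Φ, hΦ⟩ := exists_isScattering hq
  refine ⟨fun k hk => ⟨isJostSolution_jost hq hk, fun u hu =>
    isJostSolution_unique hq hk hu (isJostSolution_jost hq hk)⟩,
    ⟨D₀, (isDataOf_jost_iff hq).2 hD₀, fun D hD =>
      IsDataOf.unique ((isDataOf_jost_iff hq).1 hD) hD₀⟩,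
    ⟨kern q, hK, fun A hA => isTransformationKernel_unique hq hA⟩, fun D A hD hA => ?_⟩
  rw [isDataOf_jost_iff hq] at hD
  obtain rfl := isTransformationKernel_unique hq hA
  have hFs := IsDataOf.tendsto_Fs hq hD hΦ
  have hmar : ∀ (G : ℝ → ℝ) (a : ℝ → ℝ) (x : ℝ), 0 ≤ x → (∀ z, 0 < z → G z = marF q z) →
      (∀ᵐ y ∂(volume.restrict (Ioi x)), marchenko G x a y = 0) →
      ∀ᵐ y ∂(volume.restrict (Ioi x)), marchenko (marF q) x a y = 0 := fun G a x hx hG h => by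
    filter_upwards [h, ae_restrict_mem measurableSet_Ioi] with y hy hyx
    rwa [← marchenko_congr hG hx (lt_of_le_of_lt hx hyx)]
  have hF : ∀ z, 0 < z → D.F z = marF q z := fun z hz => IsDataOf.F_eq_marF hq hD hz
  have hFae : D.F =ᵐ[volume.restrict (Ioi 0)] marF q :=
    (ae_restrict_iff' measurableSet_Ioi).2 (ae_of_all _ hF)
  refine ⟨fun x hx => ?_, fun m => ?_, ?_, ?_, IsDataOf.one_sub_S_eq hq hD hΦ, fun x y h => ?_,
    fun x a hx ha h => marchenko_unique hq hx ha (hmar _ _ x hx hF h), ?_, fun G hG h => ?_,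
    fun D' => ⟨fun h => IsDataOf.unique h hD, fun h => h ▸ hD⟩, hasDerivAt_kern_diag hq,
    volterraStep_kern hq, fun δ hδ => ⟨_, fun x y h => abs_kern_le_of_le hq hδ h⟩,
    fun B hm hb h => kern_unique hq hm hb h, fun δ hδ => tendstoUniformlyOn_iterate hq hδ,
    fun q' D' A' hq' hD' hA' => ?_⟩
  · rw [IsDataOf.Fs_eq hq hD hΦ hx]
    exact IsDataOf.tendsto_truncatedFs hq hD hΦ hx
  · have h := ScatteringData.tendsto_remainder hD.k_strictMono hD.k_pos hFs m
    exact ⟨tendsto_log_div (hD.s_pos m) h, h⟩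
  · exact hFs.congr fun x => (add_sub_cancel_right _ _).symm
  · exact hΦ.integrable.congr (IsDataOf.F_sub_ae hq hD hΦ).symm
  · rw [marchenko_congr hF h.1 h.2.2]
    exact marchenko_kern hq h
  · exact (integrableOn_marF hq).congr hFae.symm
  · exact (marF_unique hq hG fun x hx => h x hx.le).trans hFae.symm
  · have hDq' := (isDataOf_jost_iff hq').1 hD'
    obtain rfl := isTransformationKernel_unique hq' hA'
    -- The cycle S, F, A, q, S; its last arrow is the uniqueness of the scattering data of given
    -- Jost solutions.
    tfae_have 1 → 2 := fun h => h ▸ ae_eq_refl _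
    tfae_have 2 → 3 := fun h => kern_eq_of_F_ae_eq hq hq' hD hDq' h
    tfae_have 3 → 4 := fun h => ae_eq_of_kern_eq hq hq' h
    tfae_have 4 → 1 := fun h =>
      IsDataOf.unique (jost_congr h ▸ (isDataOf_jost_iff hq).2 hD) hD'
    tfae_finish
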